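/- **Conventions.** A *groupoid opfibration* is a functor $p:A\to B$ such that every morphism of $A$ is opcartesian for $p$ and, for all $x\in A$ and $\phi:px\to b$ in $B$, there are a morphism $\kappa:x\to z$ in $A$ and an isomorphism $pz\cong b$ whose composite with $p\kappa$ is $\phi$. A morphism $p:A\to B$ of a bicategory $\mathscr C$ is a groupoid opfibration when the functor $\mathscr C(U,p):\mathscr C(U,A)\to\mathscr C(U,B)$ is one for every object $U$. A *protocalibration* of a bicategory $\mathscr C$ is a class $\mathscr R$ of morphisms that contains all equivalences, is closed under isomorphism of morphisms and under composition, consists of groupoid opfibrations, and is such that for all $f:U\to W$ in $\mathscr R$ and all $g:V\to W$ the bicategorical pullback (bipullback) $P\to V$ of $f$ along $g$ exists and is in $\mathscr R$. For a category with pullbacks (a locally discrete bicategory), a protocalibration is thus a class of morphisms containing the isomorphisms, closed under composition and stable under pullback. *$\mathscr R$-spans.* For a protocalibration $\mathscr R$ of $\mathscr C$, $\mathrm{Spn}_{\mathscr R}\mathscr C$ has the objects of $\mathscr C$; its morphisms $U\to V$ are the spans $U\xleftarrow{u}S\xrightarrow{v}V$ with $u\in\mathscr R$; its 2-morphisms $(u,S,v)\Rightarrow(u',S',v')$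 are isomorphism classes of triples consisting of $f:S\to S'$, an invertible 2-morphism $u'f\cong u$ and a 2-morphism $\sigma:v\Rightarrow v'f$. Vertical composition is by pasting, and spans compose by bipullback. For $[f,\sigma]:(u,S,v)\Rightarrow(u',S',v')$ from $U$ to $V$ and $[g,\tau]:(r,T,s)\Rightarrow(r',T',s')$ from $V$ to $W$, let $P$ and $P'$ be the vertices of the composite spans, with projections $a:P\to S$, $b:P\to T$, $a':P'\to S'$, $b':P'\to T'$. As $r'$ is a groupoid opfibration, there are $\kappa:gb\Rightarrow k$ and $r'k\cong v'fa$ such that $r'\kappa$ followed by this isomorphism is $r'gb\cong rb\cong va\xrightarrow{\sigma a}v'fa$. The bipullback $P'$ gives $h:P\to P'$ with $a'h\cong fa$ and $b'h\cong k$. The horizontal composite is represented by $h$, the isomorphism $u'a'h\cong u'fa\cong ua$ and the 2-morphism $sb\xrightarrow{\tau b}s'gb\xrightarrow{s'\kappa}s'k\cong s'b'h$. The identities are $(1_U,U,1_U)$, and the constraints are those induced by the universal properties of bipullbacks. Let $\mathscr E$ be a category with pullbacks. A morphism $u:S\to U$ of $\mathscr E$ is *powerful* when the pullback functor $\Delta_u:\mathscr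 E/U\to\mathscr E/S$ has a right adjoint $\Pi_u$. A pair $(\mathscr L,\mathscr R)$ of protocalibrations of $\mathscr E$ is *compatible* when every morphism in $\mathscr L$ is powerful and in $\mathscr R$, and $\Pi_u a\in\mathscr R$ whenever $u\in\mathscr L$ and $a\in\mathscr R$. *Spans in $\mathscr E$.* ${}_{\mathscr L}\mathrm{Spn}\,\mathscr E$ is the bicategory with the objects of $\mathscr E$, with morphisms $X\to Y$ the spans $X\xleftarrow{l}A\xrightarrow{r}Y$, written $(l,A,r)$, with $l\in\mathscr L$, and with 2-morphisms $(l,A,r)\Rightarrow(l',A',r')$ the morphisms $h:A'\to A$ of $\mathscr E$ with $lh=l'$ and $rh=r'$; spans compose by pullback. $\mathscr R_*$ is the class of its morphisms with invertible left leg and with right leg in $\mathscr R$. *Polynomials.* ${}_{\mathscr L}\mathrm{Ply}_{\mathscr R}\mathscr E$ has the objects of $\mathscr E$. Its morphisms $X\to Y$ are the polynomials $p=(X\xleftarrow{r}A\xrightarrow{n}B\xrightarrow{t}Y)$ with $n\in\mathscr L$ and $t\in\mathscr R$. Its 2-morphisms $p\Rightarrow p'=(r',n',t')$ are the isomorphism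 classes of diagrams consisting of $g:B\to B'$ with $t'g=t$, a pullback $P$ of $n'$ along $g$, with projections $m:P\to B$ and $h:P\to A'$, and a morphism $\ell:P\to A$ with $n\ell=m$ and $r\ell=r'h$; they compose vertically by pasting pullbacks. The composite of $p:X\to Y$ with $q=(Y\xleftarrow{s}C\xrightarrow{k}D\xrightarrow{w}Z)$ is formed from $F=B\times_YC\to C$: put $d=\Pi_k(F\to C):Q\to D$, let $P$ be the pullback of $k$ along $d$, let $e:P\to F$ be the counit of $\Delta_k\dashv\Pi_k$, and let $A'$ be the pullback of $n$ along $P\xrightarrow{e}F\to B$; the composite is $X\leftarrow A\leftarrow A'\to P\to Q\xrightarrow{d}D\xrightarrow{w}Z$, with middle leg $A'\to P\to Q$. The identities are the polynomials with all three legs identities; horizontal composition of 2-morphisms and the constraints are those induced by the universal properties of $\Pi$ and of pullbacks. **Theorem.** Let $(\mathscr L,\mathscr R)$ be a compatible pair of protocalibrations on a category $\mathscr E$ with pullbacks. Then $\mathscr R_*$ is a protocalibration of the bicategory ${}_{\mathscr L}\mathrm{Spn}\,\mathscr E$, the data above make ${}_{\mathscr L}\mathrm{Ply}_{\mathscr R}\mathscr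 E$ and $\mathrm{Spn}_{\mathscr R_*}({}_{\mathscr L}\mathrm{Spn}\,\mathscr E)$ bicategories, and $$({}_{\mathscr L}\mathrm{Ply}_{\mathscr R}\mathscr E)^{\mathrm{op}}=\mathrm{Spn}_{\mathscr R_*}({}_{\mathscr L}\mathrm{Spn}\,\mathscr E)$$ in the following sense. There is a pseudofunctor from the left-hand side (1-cells reversed, 2-cells not) to the right-hand side which is the identity on objects, sends a polynomial $p=(X\xleftarrow{r}A\xrightarrow{n}B\xrightarrow{t}Y)$ to the $\mathscr R_*$-span $$Y\xleftarrow{(1_B,B,t)}B\xrightarrow{(n,A,r)}X,$$ sends the 2-morphism represented by $(g,P,m,h,\ell)$ to the class of the diagram consisting of the morphism $(1_B,B,g):B\to B'$, the canonical isomorphism $(1_{B'},B',t')\circ(1_B,B,g)\cong(1_B,B,t)$, and the 2-morphism $(n,A,r)\Rightarrow(n',A',r')\circ(1_B,B,g)$ which, as a morphism of spans in the opposite direction, is $\ell:P\to A$; and which is an equivalence of categories on every hom-category. -/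

import Mathlib

open CategoryTheory CategoryTheory.Limits CategoryTheory.Bicategory Opposite

universe w v u

set_option linter.unusedSimpArgs false
set_option linter.unusedSectionVars false

namespace SpanPoly

section CategoryLevel

variable {E : Type u} [Category.{v} E]

/-- A protocalibration of a category with pullbacks: a class of morphisms that contains the
isomorphisms, is closed under composition and is stable under pullback. (For a category, regarded
as a locally discrete bicategory, bipullbacks are pullbacks, isomorphic morphisms are equal, and
every morphism is a groupoid opfibration.) -/
class IsProtocalibration (W : MorphismProperty E) : Prop where
  iso_mem : ∀ {X Y : E} (f : X ⟶ Y) [IsIso f], W f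
  comp_mem : ∀ {X Y Z : E} (f : X ⟶ Y) (g : Y ⟶ Z), W f → W g → W (f ≫ g)
  pullback_mem : ∀ {P U V Z : E} {g' : P ⟶ U} {f' : P ⟶ V} {f : U ⟶ Z} {g : V ⟶ Z},
    IsPullback g' f' f g → W f → W f'

instance (W : MorphismProperty E) [h : IsProtocalibration W] : W.IsMultiplicative where
  id_mem X := h.iso_mem (𝟙 X)
  comp_mem f g hf hg := h.comp_mem f g hf hg

instance (W : MorphismProperty E) [h : IsProtocalibration W] : W.IsStableUnderBaseChange where
  of_isPullback sq hg := h.pullback_mem sq hg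

end CategoryLevel

section Spans

variable {E : Type u} [Category.{v} E] {L : MorphismProperty E} [HasPullbacks E]
  [IsProtocalibration L]

/-- The first projection of a composite span. -/
noncomputable def spanFst {X Y Z : E} (S : Span L ⊤ X Y) (T : Span L ⊤ Y Z) :
    (S.comp T).apex ⟶ S.apex := pullback.fst S.r T.l

/-- The second projection of a composite span. -/
noncomputable def spanSnd {X Y Z : E} (S : Span L ⊤ X Y) (T : Span L ⊤ Y Z) :
    (S.comp T).apex ⟶ T.apex := pullback.snd S.r T.l

theorem spanCond {X Y Z : E} (S : Span L ⊤ X Y) (T : Span L ⊤ Y Z) :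
    spanFst S T ≫ S.r = spanSnd S T ≫ T.l := pullback.condition

theorem spanCond_assoc {X Y Z W : E} (S : Span L ⊤ X Y) (T : Span L ⊤ Y Z) (h : Y ⟶ W) :
    spanFst S T ≫ S.r ≫ h = spanSnd S T ≫ T.l ≫ h := pullback.condition_assoc h

theorem spanComp_l {X Y Z : E} (S : Span L ⊤ X Y) (T : Span L ⊤ Y Z) :
    (S.comp T).l = spanFst S T ≫ S.l := rfl

theorem spanComp_r {X Y Z : E} (S : Span L ⊤ X Y) (T : Span L ⊤ Y Z) :
    (S.comp T).r = spanSnd S T ≫ T.r := rfl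

/-- The map into a composite span given by the universal property of the pullback. -/
noncomputable def spanLift {X Y Z : E} (S : Span L ⊤ X Y) (T : Span L ⊤ Y Z) {Q : E}
    (a : Q ⟶ S.apex) (b : Q ⟶ T.apex) (h : a ≫ S.r = b ≫ T.l) : Q ⟶ (S.comp T).apex :=
  pullback.lift a b h

theorem spanLift_fst {X Y Z : E} (S : Span L ⊤ X Y) (T : Span L ⊤ Y Z) {Q : E}
    (a : Q ⟶ S.apex) (b : Q ⟶ T.apex) (h : a ≫ S.r = b ≫ T.l) :
    spanLift S T a b h ≫ spanFst S T = a := pullback.lift_fst _ _ _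

theorem spanLift_snd {X Y Z : E} (S : Span L ⊤ X Y) (T : Span L ⊤ Y Z) {Q : E}
    (a : Q ⟶ S.apex) (b : Q ⟶ T.apex) (h : a ≫ S.r = b ≫ T.l) :
    spanLift S T a b h ≫ spanSnd S T = b := pullback.lift_snd _ _ _

theorem spanLift_fst_assoc {X Y Z : E} (S : Span L ⊤ X Y) (T : Span L ⊤ Y Z) {Q W : E}
    (a : Q ⟶ S.apex) (b : Q ⟶ T.apex) (h : a ≫ S.r = b ≫ T.l) (k : S.apex ⟶ W) :
    spanLift S T a b h ≫ spanFst S T ≫ k = a ≫ k := pullback.lift_fst_assoc _ _ _ _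

theorem spanLift_snd_assoc {X Y Z : E} (S : Span L ⊤ X Y) (T : Span L ⊤ Y Z) {Q W : E}
    (a : Q ⟶ S.apex) (b : Q ⟶ T.apex) (h : a ≫ S.r = b ≫ T.l) (k : T.apex ⟶ W) :
    spanLift S T a b h ≫ spanSnd S T ≫ k = b ≫ k := pullback.lift_snd_assoc _ _ _ _

theorem spanHomExt {X Y Z : E} {S : Span L ⊤ X Y} {T : Span L ⊤ Y Z} {Q : E}
    {a b : Q ⟶ (S.comp T).apex} (h₁ : a ≫ spanFst S T = b ≫ spanFst S T)
    (h₂ : a ≫ spanSnd S T = b ≫ spanSnd S T) : a = b := pullback.hom_ext h₁ h₂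

/-- Whiskering of a morphism of spans by a span on the left. -/
noncomputable def spanWhiskerLeft {X Y Z : E} (S : Span L ⊤ X Y) {T T' : Span L ⊤ Y Z}
    (η : T ⟶ T') : S.comp T ⟶ S.comp T' where
  hom := spanLift S T' (spanFst S T) (spanSnd S T ≫ η.hom)
    (by rw [spanCond, Category.assoc, Span.Hom.hom_l])
  hom_l := by rw [spanComp_l, spanComp_l, spanLift_fst_assoc]
  hom_r := by rw [spanComp_r, spanComp_r, spanLift_snd_assoc, Category.assoc, Span.Hom.hom_r]

/-- Whiskering of a morphism of spans by a span on the right. -/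
noncomputable def spanWhiskerRight {X Y Z : E} {S S' : Span L ⊤ X Y} (η : S ⟶ S')
    (T : Span L ⊤ Y Z) : S.comp T ⟶ S'.comp T where
  hom := spanLift S' T (spanFst S T ≫ η.hom) (spanSnd S T)
    (by rw [Category.assoc, Span.Hom.hom_r, spanCond])
  hom_l := by rw [spanComp_l, spanComp_l, spanLift_fst_assoc, Category.assoc, Span.Hom.hom_l]
  hom_r := by rw [spanComp_r, spanComp_r, spanLift_snd_assoc]

/-- The canonical associativity isomorphism for composition of spans. -/
noncomputable def spanAssociator {X Y Z W : E} (S : Span L ⊤ X Y) (T : Span L ⊤ Y Z)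
    (U : Span L ⊤ Z W) : (S.comp T).comp U ≅ S.comp (T.comp U) where
  hom :=
    { hom := spanLift S (T.comp U) (spanFst (S.comp T) U ≫ spanFst S T)
        (spanLift T U (spanFst (S.comp T) U ≫ spanSnd S T) (spanSnd (S.comp T) U)
          (by rw [Category.assoc, ← spanComp_r, spanCond]))
        (by rw [spanComp_l, spanLift_fst_assoc, Category.assoc, Category.assoc, spanCond])
      hom_l := by simp only [spanComp_l, spanLift_fst_assoc, Category.assoc]
      hom_r := by simp only [spanComp_r, spanLift_snd_assoc] }
  inv :=
    { hom := spanLift (S.comp T) U (spanLift S T (spanFst S (T.comp U))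
          (spanSnd S (T.comp U) ≫ spanFst T U)
          (by rw [Category.assoc, ← spanComp_l, spanCond]))
        (spanSnd S (T.comp U) ≫ spanSnd T U)
        (by rw [spanComp_r, spanLift_snd_assoc, Category.assoc, Category.assoc, spanCond])
      hom_l := by simp only [spanComp_l, spanLift_fst_assoc]
      hom_r := by simp only [spanComp_r, spanLift_snd_assoc, Category.assoc] }
  hom_inv_id := by
    ext
    simp only [Span.comp_hom, Span.id_hom]
    apply spanHomExt
    · apply spanHomExt <;> simp only [Category.assoc, Category.id_comp, spanLift_fst,
        spanLift_snd, spanLift_fst_assoc, spanLift_snd_assoc]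
    · simp only [Category.assoc, Category.id_comp, spanLift_snd, spanLift_snd_assoc]
  inv_hom_id := by
    ext
    simp only [Span.comp_hom, Span.id_hom]
    apply spanHomExt
    · simp only [Category.assoc, Category.id_comp, spanLift_fst, spanLift_fst_assoc]
    · apply spanHomExt <;> simp only [Category.assoc, Category.id_comp, spanLift_fst,
        spanLift_snd, spanLift_fst_assoc, spanLift_snd_assoc]

/-- The identity map of `X`, as a map into the apex of the identity span. -/
def spanIdIn (X : E) : X ⟶ (Span.id (Wₗ := L) (Wᵣ := ⊤) X).apex := 𝟙 X

theorem spanId_r (X : E) :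
    (Span.id (Wₗ := L) (Wᵣ := ⊤) X).r = (Span.id (Wₗ := L) (Wᵣ := ⊤) X).l := rfl

theorem spanIdIn_l (X : E) : spanIdIn X ≫ (Span.id (Wₗ := L) (Wᵣ := ⊤) X).l = 𝟙 X :=
  Category.comp_id _

theorem spanId_l_in (X : E) :
    (Span.id (Wₗ := L) (Wᵣ := ⊤) X).l ≫ spanIdIn X = 𝟙 _ :=
  Category.comp_id _

/-- The canonical left unit isomorphism for composition of spans. -/
noncomputable def spanLeftUnitor {X Y : E} (S : Span L ⊤ X Y) : (Span.id X).comp S ≅ S where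
  hom :=
    { hom := spanSnd (Span.id X) S
      hom_l := by rw [spanComp_l, ← spanId_r, spanCond]
      hom_r := by rw [spanComp_r] }
  inv :=
    { hom := spanLift (Span.id X) S (S.l ≫ spanIdIn X) (𝟙 S.apex)
        (by rw [Category.assoc, spanId_r, spanIdIn_l, Category.comp_id, Category.id_comp])
      hom_l := by
        rw [spanComp_l, spanLift_fst_assoc, Category.assoc, spanIdIn_l, Category.comp_id]
      hom_r := by rw [spanComp_r, spanLift_snd_assoc, Category.id_comp] }
  hom_inv_id := by
    ext
    apply spanHomExt
    · rw [Span.comp_hom, Category.assoc, spanLift_fst, Span.id_hom, Category.id_comp,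
        ← Category.assoc, ← spanCond, spanId_r, Category.assoc, spanId_l_in, Category.comp_id]
    · rw [Span.comp_hom, Category.assoc, spanLift_snd, Span.id_hom, Category.id_comp,
        Category.comp_id]
  inv_hom_id := by
    ext
    exact spanLift_snd _ _ _ _ _

/-- The canonical right unit isomorphism for composition of spans. -/
noncomputable def spanRightUnitor {X Y : E} (S : Span L ⊤ X Y) : S.comp (Span.id Y) ≅ S where
  hom :=
    { hom := spanFst S (Span.id Y)
      hom_l := by rw [spanComp_l]
      hom_r := by rw [spanComp_r, spanId_r, spanCond] }
  inv :=
    { hom := spanLift S (Span.id Y) (𝟙 S.apex) (S.r ≫ spanIdIn Y)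
        (by rw [Category.assoc, spanIdIn_l, Category.comp_id, Category.id_comp])
      hom_l := by rw [spanComp_l, spanLift_fst_assoc, Category.id_comp]
      hom_r := by
        rw [spanComp_r, spanLift_snd_assoc, spanId_r, Category.assoc, spanIdIn_l,
          Category.comp_id] }
  hom_inv_id := by
    ext
    apply spanHomExt
    · rw [Span.comp_hom, Category.assoc, spanLift_fst, Span.id_hom, Category.id_comp,
        Category.comp_id]
    · rw [Span.comp_hom, Category.assoc, spanLift_snd, Span.id_hom, Category.id_comp,
        ← Category.assoc, spanCond, Category.assoc, spanId_l_in, Category.comp_id]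
  inv_hom_id := by
    ext
    exact spanLift_fst _ _ _ _ _

theorem span_whiskerLeft_id {X Y Z : E} (S : Span L ⊤ X Y) (T : Span L ⊤ Y Z) :
    spanWhiskerLeft S (𝟙 T) = 𝟙 _ := by
  ext
  apply spanHomExt <;> simp only [spanWhiskerLeft, spanWhiskerRight, spanAssociator, spanLeftUnitor, spanRightUnitor,
      Span.comp_hom, Span.id_hom, Category.assoc, Category.id_comp, Category.comp_id, spanLift_fst,
      spanLift_snd, spanLift_fst_assoc, spanLift_snd_assoc]

theorem span_whiskerLeft_comp {X Y Z : E} (S : Span L ⊤ X Y) {T T' T'' : Span L ⊤ Y Z} (η : T ⟶ T') (θ : T' ⟶ T'') :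
    spanWhiskerLeft S (η ≫ θ) = spanWhiskerLeft S η ≫ spanWhiskerLeft S θ := by
  ext
  apply spanHomExt <;> simp only [spanWhiskerLeft, spanWhiskerRight, spanAssociator, spanLeftUnitor, spanRightUnitor,
      Span.comp_hom, Span.id_hom, Category.assoc, Category.id_comp, Category.comp_id, spanLift_fst,
      spanLift_snd, spanLift_fst_assoc, spanLift_snd_assoc]

theorem span_id_whiskerLeft {X Y : E} {S T : Span L ⊤ X Y} (η : S ⟶ T) :
    spanWhiskerLeft (Span.id X) η = (spanLeftUnitor S).hom ≫ η ≫ (spanLeftUnitor T).inv := by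
  ext
  apply spanHomExt
  · simp only [spanWhiskerLeft, spanWhiskerRight, spanAssociator, spanLeftUnitor, spanRightUnitor,
      Span.comp_hom, Span.id_hom, Category.assoc, Category.id_comp, Category.comp_id, spanLift_fst,
      spanLift_snd, spanLift_fst_assoc, spanLift_snd_assoc]
    rw [Span.Hom.hom_l_assoc, ← spanCond_assoc, spanId_r, spanId_l_in, Category.comp_id]
  · simp only [spanWhiskerLeft, spanWhiskerRight, spanAssociator, spanLeftUnitor, spanRightUnitor,
      Span.comp_hom, Span.id_hom, Category.assoc, Category.id_comp, Category.comp_id, spanLift_fst,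
      spanLift_snd, spanLift_fst_assoc, spanLift_snd_assoc]

theorem span_comp_whiskerLeft {X Y Z W : E} (S : Span L ⊤ X Y) (T : Span L ⊤ Y Z) {U U' : Span L ⊤ Z W} (η : U ⟶ U') :
    spanWhiskerLeft (S.comp T) η = (spanAssociator S T U).hom ≫
      spanWhiskerLeft S (spanWhiskerLeft T η) ≫ (spanAssociator S T U').inv := by
  ext
  apply spanHomExt
  · apply spanHomExt <;> simp only [spanWhiskerLeft, spanWhiskerRight, spanAssociator, spanLeftUnitor, spanRightUnitor,
      Span.comp_hom, Span.id_hom, Category.assoc, Category.id_comp, Category.comp_id, spanLift_fst,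
      spanLift_snd, spanLift_fst_assoc, spanLift_snd_assoc]
  · simp only [spanWhiskerLeft, spanWhiskerRight, spanAssociator, spanLeftUnitor, spanRightUnitor,
      Span.comp_hom, Span.id_hom, Category.assoc, Category.id_comp, Category.comp_id, spanLift_fst,
      spanLift_snd, spanLift_fst_assoc, spanLift_snd_assoc]

theorem span_id_whiskerRight {X Y Z : E} (S : Span L ⊤ X Y) (T : Span L ⊤ Y Z) :
    spanWhiskerRight (𝟙 S) T = 𝟙 _ := by
  ext
  apply spanHomExt <;> simp only [spanWhiskerLeft, spanWhiskerRight, spanAssociator, spanLeftUnitor, spanRightUnitor,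
      Span.comp_hom, Span.id_hom, Category.assoc, Category.id_comp, Category.comp_id, spanLift_fst,
      spanLift_snd, spanLift_fst_assoc, spanLift_snd_assoc]

theorem span_comp_whiskerRight {X Y Z : E} {S S' S'' : Span L ⊤ X Y} (η : S ⟶ S') (θ : S' ⟶ S'') (T : Span L ⊤ Y Z) :
    spanWhiskerRight (η ≫ θ) T = spanWhiskerRight η T ≫ spanWhiskerRight θ T := by
  ext
  apply spanHomExt <;> simp only [spanWhiskerLeft, spanWhiskerRight, spanAssociator, spanLeftUnitor, spanRightUnitor,
      Span.comp_hom, Span.id_hom, Category.assoc, Category.id_comp, Category.comp_id, spanLift_fst,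
      spanLift_snd, spanLift_fst_assoc, spanLift_snd_assoc]

theorem span_whiskerRight_id {X Y : E} {S T : Span L ⊤ X Y} (η : S ⟶ T) :
    spanWhiskerRight η (Span.id Y) = (spanRightUnitor S).hom ≫ η ≫ (spanRightUnitor T).inv := by
  ext
  apply spanHomExt
  · simp only [spanWhiskerLeft, spanWhiskerRight, spanAssociator, spanLeftUnitor, spanRightUnitor,
      Span.comp_hom, Span.id_hom, Category.assoc, Category.id_comp, Category.comp_id, spanLift_fst,
      spanLift_snd, spanLift_fst_assoc, spanLift_snd_assoc]
  · simp only [spanWhiskerLeft, spanWhiskerRight, spanAssociator, spanLeftUnitor, spanRightUnitor,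
      Span.comp_hom, Span.id_hom, Category.assoc, Category.id_comp, Category.comp_id, spanLift_fst,
      spanLift_snd, spanLift_fst_assoc, spanLift_snd_assoc]
    rw [Span.Hom.hom_r_assoc, spanCond_assoc, spanId_l_in, Category.comp_id]

theorem span_whiskerRight_comp {X Y Z W : E} {S S' : Span L ⊤ X Y} (η : S ⟶ S') (T : Span L ⊤ Y Z) (U : Span L ⊤ Z W) :
    spanWhiskerRight η (T.comp U) = (spanAssociator S T U).inv ≫
      spanWhiskerRight (spanWhiskerRight η T) U ≫ (spanAssociator S' T U).hom := by
  ext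
  apply spanHomExt
  · simp only [spanWhiskerLeft, spanWhiskerRight, spanAssociator, spanLeftUnitor, spanRightUnitor,
      Span.comp_hom, Span.id_hom, Category.assoc, Category.id_comp, Category.comp_id, spanLift_fst,
      spanLift_snd, spanLift_fst_assoc, spanLift_snd_assoc]
  · apply spanHomExt <;> simp only [spanWhiskerLeft, spanWhiskerRight, spanAssociator, spanLeftUnitor, spanRightUnitor,
      Span.comp_hom, Span.id_hom, Category.assoc, Category.id_comp, Category.comp_id, spanLift_fst,
      spanLift_snd, spanLift_fst_assoc, spanLift_snd_assoc]

theorem span_whisker_assoc {X Y Z W : E} (S : Span L ⊤ X Y) {T T' : Span L ⊤ Y Z} (η : T ⟶ T') (U : Span L ⊤ Z W) :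
    spanWhiskerRight (spanWhiskerLeft S η) U = (spanAssociator S T U).hom ≫
      spanWhiskerLeft S (spanWhiskerRight η U) ≫ (spanAssociator S T' U).inv := by
  ext
  apply spanHomExt
  · apply spanHomExt <;> simp only [spanWhiskerLeft, spanWhiskerRight, spanAssociator, spanLeftUnitor, spanRightUnitor,
      Span.comp_hom, Span.id_hom, Category.assoc, Category.id_comp, Category.comp_id, spanLift_fst,
      spanLift_snd, spanLift_fst_assoc, spanLift_snd_assoc]
  · simp only [spanWhiskerLeft, spanWhiskerRight, spanAssociator, spanLeftUnitor, spanRightUnitor,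
      Span.comp_hom, Span.id_hom, Category.assoc, Category.id_comp, Category.comp_id, spanLift_fst,
      spanLift_snd, spanLift_fst_assoc, spanLift_snd_assoc]

theorem span_whisker_exchange {X Y Z : E} {S S' : Span L ⊤ X Y} {T T' : Span L ⊤ Y Z} (η : S ⟶ S') (θ : T ⟶ T') :
    spanWhiskerLeft S θ ≫ spanWhiskerRight η T' = spanWhiskerRight η T ≫ spanWhiskerLeft S' θ := by
  ext
  apply spanHomExt <;> simp only [spanWhiskerLeft, spanWhiskerRight, spanAssociator, spanLeftUnitor, spanRightUnitor,
      Span.comp_hom, Span.id_hom, Category.assoc, Category.id_comp, Category.comp_id, spanLift_fst,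
      spanLift_snd, spanLift_fst_assoc, spanLift_snd_assoc]

theorem span_pentagon {X Y Z W V : E} (S : Span L ⊤ X Y) (T : Span L ⊤ Y Z) (U : Span L ⊤ Z W) (K : Span L ⊤ W V) :
    spanWhiskerRight (spanAssociator S T U).hom K ≫ (spanAssociator S (T.comp U) K).hom ≫
      spanWhiskerLeft S (spanAssociator T U K).hom =
    (spanAssociator (S.comp T) U K).hom ≫ (spanAssociator S T (U.comp K)).hom := by
  ext
  apply spanHomExt
  · simp only [spanWhiskerLeft, spanWhiskerRight, spanAssociator, spanLeftUnitor, spanRightUnitor,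
      Span.comp_hom, Span.id_hom, Category.assoc, Category.id_comp, Category.comp_id, spanLift_fst,
      spanLift_snd, spanLift_fst_assoc, spanLift_snd_assoc]
  · apply spanHomExt
    · simp only [spanWhiskerLeft, spanWhiskerRight, spanAssociator, spanLeftUnitor, spanRightUnitor,
      Span.comp_hom, Span.id_hom, Category.assoc, Category.id_comp, Category.comp_id, spanLift_fst,
      spanLift_snd, spanLift_fst_assoc, spanLift_snd_assoc]
    · apply spanHomExt <;> simp only [spanWhiskerLeft, spanWhiskerRight, spanAssociator, spanLeftUnitor, spanRightUnitor,
      Span.comp_hom, Span.id_hom, Category.assoc, Category.id_comp, Category.comp_id, spanLift_fst,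
      spanLift_snd, spanLift_fst_assoc, spanLift_snd_assoc]

theorem span_triangle {X Y Z : E} (S : Span L ⊤ X Y) (T : Span L ⊤ Y Z) :
    (spanAssociator S (Span.id Y) T).hom ≫ spanWhiskerLeft S (spanLeftUnitor T).hom =
    spanWhiskerRight (spanRightUnitor S).hom T := by
  ext
  apply spanHomExt <;> simp only [spanWhiskerLeft, spanWhiskerRight, spanAssociator, spanLeftUnitor, spanRightUnitor,
      Span.comp_hom, Span.id_hom, Category.assoc, Category.id_comp, Category.comp_id, spanLift_fst,
      spanLift_snd, spanLift_fst_assoc, spanLift_snd_assoc]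

/-- The objects of the bicategory of spans in `E` with left leg in `L`: those of `E`. -/
structure LeftSpan (L : MorphismProperty E) where
  /-- the underlying object of `E` -/
  as : E

/-- The bicategory of spans `X ⟵ A ⟶ Y` in `E` with left leg in `L`; the 2-cells are the morphisms
of spans, and composition is by pullback. -/
noncomputable instance : Bicategory (LeftSpan L) where
  Hom X Y := Span L ⊤ X.as Y.as
  id X := Span.id X.as
  comp S T := Span.comp S T
  homCategory X Y := inferInstanceAs (Category (Span L ⊤ X.as Y.as))
  whiskerLeft S _ _ η := spanWhiskerLeft S η
  whiskerRight η T := spanWhiskerRight η T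
  associator S T U := spanAssociator S T U
  leftUnitor S := spanLeftUnitor S
  rightUnitor S := spanRightUnitor S
  whiskerLeft_id S T := span_whiskerLeft_id S T
  whiskerLeft_comp S _ _ _ η θ := span_whiskerLeft_comp S η θ
  id_whiskerLeft η := span_id_whiskerLeft η
  comp_whiskerLeft S T _ _ η := span_comp_whiskerLeft S T η
  id_whiskerRight S T := span_id_whiskerRight S T
  comp_whiskerRight η θ T := span_comp_whiskerRight η θ T
  whiskerRight_id η := span_whiskerRight_id η
  whiskerRight_comp η T U := span_whiskerRight_comp η T U
  whisker_assoc S _ _ η U := span_whisker_assoc S η U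
  whisker_exchange η θ := span_whisker_exchange η θ
  pentagon S T U K := span_pentagon S T U K
  triangle S T := span_triangle S T

end Spans
section Dual

/-- The 2-cell dual `B^co` of a bicategory `B`: same objects and 1-cells, reversed 2-cells. -/
structure Co (B : Type u) where
  /-- the underlying object of `B` -/
  as : B

variable {B : Type u} [Bicategory.{w, v} B]

/-- 1-cells of `B^co` are 1-cells of `B`. -/
structure Co.Hom (X Y : Co B) where
  /-- the underlying 1-cell of `B` -/
  as : X.as ⟶ Y.as

/-- 2-cells `f ⟶ g` of `B^co` are 2-cells `g ⟶ f` of `B`. -/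
structure Co.Hom₂ {X Y : Co B} (f g : Co.Hom X Y) where
  /-- the underlying 2-cell of `B` -/
  as : g.as ⟶ f.as

instance : CategoryStruct (Co B) where
  Hom X Y := Co.Hom X Y
  id X := ⟨𝟙 X.as⟩
  comp f g := ⟨f.as ≫ g.as⟩

instance (X Y : Co B) : Category (X ⟶ Y) where
  Hom f g := Co.Hom₂ f g
  id f := ⟨𝟙 f.as⟩
  comp η θ := ⟨θ.as ≫ η.as⟩
  id_comp _ := congrArg Co.Hom₂.mk (Category.comp_id _)
  comp_id _ := congrArg Co.Hom₂.mk (Category.id_comp _)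
  assoc _ _ _ := congrArg Co.Hom₂.mk (Category.assoc _ _ _).symm

/-- An invertible 2-cell of `B` gives an invertible 2-cell of `B^co` in the same direction. -/
def coIso {X Y : B} {f g : X ⟶ Y} (e : f ≅ g) :
    (show (Co.mk X ⟶ Co.mk Y) from ⟨f⟩) ≅ (show (Co.mk X ⟶ Co.mk Y) from ⟨g⟩) where
  hom := ⟨e.inv⟩
  inv := ⟨e.hom⟩
  hom_inv_id := congrArg Co.Hom₂.mk e.hom_inv_id
  inv_hom_id := congrArg Co.Hom₂.mk e.inv_hom_id

instance : Bicategory (Co B) where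
  whiskerLeft f _ _ η := Co.Hom₂.mk (f.as ◁ Co.Hom₂.as η)
  whiskerRight η h := Co.Hom₂.mk (Co.Hom₂.as η ▷ h.as)
  associator f g h := coIso (α_ f.as g.as h.as)
  leftUnitor f := coIso (λ_ f.as)
  rightUnitor f := coIso (ρ_ f.as)
  whiskerLeft_id _ _ := congrArg Co.Hom₂.mk (Bicategory.whiskerLeft_id _ _)
  whiskerLeft_comp _ _ _ _ _ _ := congrArg Co.Hom₂.mk (Bicategory.whiskerLeft_comp _ _ _)
  id_whiskerLeft _ := congrArg Co.Hom₂.mk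
    ((Bicategory.id_whiskerLeft _).trans (Category.assoc _ _ _).symm)
  comp_whiskerLeft _ _ _ _ _ := congrArg Co.Hom₂.mk
    ((Bicategory.comp_whiskerLeft _ _ _).trans (Category.assoc _ _ _).symm)
  id_whiskerRight _ _ := congrArg Co.Hom₂.mk (Bicategory.id_whiskerRight _ _)
  comp_whiskerRight _ _ _ := congrArg Co.Hom₂.mk (Bicategory.comp_whiskerRight _ _ _)
  whiskerRight_id _ := congrArg Co.Hom₂.mk
    ((Bicategory.whiskerRight_id _).trans (Category.assoc _ _ _).symm)
  whiskerRight_comp _ _ _ := congrArg Co.Hom₂.mk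
    ((Bicategory.whiskerRight_comp _ _ _).trans (Category.assoc _ _ _).symm)
  whisker_assoc _ _ _ _ _ := congrArg Co.Hom₂.mk
    ((Bicategory.whisker_assoc _ _ _).trans (Category.assoc _ _ _).symm)
  whisker_exchange _ _ := congrArg Co.Hom₂.mk (Bicategory.whisker_exchange _ _).symm
  pentagon f g h i := congrArg Co.Hom₂.mk
    ((Category.assoc _ _ _).trans (pentagon_inv f.as g.as h.as i.as))
  triangle f g := congrArg Co.Hom₂.mk (triangle_assoc_comp_left_inv f.as g.as)

end Dual

section BicategoricalNotions

variable {C : Type u} [Bicategory.{w, v} C]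

/-- A functor `p : A ⥤ B` is a groupoid opfibration when every morphism `κ : x ⟶ z` of `A` is
opcartesian for `p`, and every `φ : p x ⟶ b` is, up to an isomorphism `p z ≅ b`, the image of some
morphism `x ⟶ z`. -/
structure IsGroupoidOpfibration {A : Type*} {B : Type*} [Category* A] [Category* B]
    (p : A ⥤ B) : Prop where
  opcartesian : ∀ {x z k : A} (κ : x ⟶ z) (a : x ⟶ k) (b : p.obj z ⟶ p.obj k),
    p.map κ ≫ b = p.map a → ∃! c : z ⟶ k, p.map c = b ∧ κ ≫ c = a
  exists_lift : ∀ (x : A) {b : B} (φ : p.obj x ⟶ b),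
    ∃ (z : A) (κ : x ⟶ z) (e : p.obj z ≅ b), p.map κ ≫ e.hom = φ

/-- A 1-cell `p : A ⟶ B` of a bicategory is a groupoid opfibration when composition with `p` is a
groupoid opfibration `C(U, A) ⥤ C(U, B)` for every object `U`. -/
def IsGroupoidOpfibrationCell {A B : C} (p : A ⟶ B) : Prop :=
  ∀ U : C, IsGroupoidOpfibration (Bicategory.postcomp U p)

/-- A square over a cospan `U ⟶ W ⟵ V` commuting up to a specified isomorphism. -/
structure IsoSquare {U V W : C} (f : U ⟶ W) (g : V ⟶ W) where
  /-- the vertex -/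
  pt : C
  /-- the projection to `U` -/
  fst : pt ⟶ U
  /-- the projection to `V` -/
  snd : pt ⟶ V
  /-- the filling isomorphism -/
  iso : fst ≫ f ≅ snd ≫ g

/-- A square is a bipullback when, for each `X`, the comparison functor from `C(X, P)` to the
category of pairs `a : X ⟶ U`, `b : X ⟶ V` with an isomorphism `a ≫ f ≅ b ≫ g` is essentially
surjective, full and faithful. -/
structure IsBipullback {U V W : C} {f : U ⟶ W} {g : V ⟶ W} (c : IsoSquare f g) : Prop where
  exists_lift : ∀ {X : C} (a : X ⟶ U) (b : X ⟶ V) (δ : a ≫ f ≅ b ≫ g),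
    ∃ (h : X ⟶ c.pt) (α : h ≫ c.fst ≅ a) (β : h ≫ c.snd ≅ b),
      α.hom ▷ f ≫ δ.hom =
        (α_ h c.fst f).hom ≫ h ◁ c.iso.hom ≫ (α_ h c.snd g).inv ≫ β.hom ▷ g
  existsUnique_cell : ∀ {X : C} (h k : X ⟶ c.pt) (α : h ≫ c.fst ⟶ k ≫ c.fst)
    (β : h ≫ c.snd ⟶ k ≫ c.snd),
    α ▷ f ≫ (α_ k c.fst f).hom ≫ k ◁ c.iso.hom ≫ (α_ k c.snd g).inv =
      (α_ h c.fst f).hom ≫ h ◁ c.iso.hom ≫ (α_ h c.snd g).inv ≫ β ▷ g →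
    ∃! χ : h ⟶ k, χ ▷ c.fst = α ∧ χ ▷ c.snd = β

/-- A protocalibration of a bicategory: a class `R` of 1-cells which contains the equivalences, is
closed under isomorphism, composition and bipullback along arbitrary 1-cells (these bipullbacks
being required to exist), and consists of groupoid opfibrations. -/
class IsBiProtocalibration (R : MorphismProperty C) : Prop where
  equivalence_mem : ∀ {U V : C} (e : U ≌ V), R e.hom
  iso_mem : ∀ {U V : C} {f g : U ⟶ V}, (f ≅ g) → R f → R g
  comp_mem : ∀ {U V W : C} (f : U ⟶ V) (g : V ⟶ W), R f → R g → R (f ≫ g)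
  exists_bipullback : ∀ {U V W : C} (f : U ⟶ W) (g : V ⟶ W), R f →
    ∃ c : IsoSquare f g, IsBipullback c ∧ R c.snd
  opfibration : ∀ {U V : C} (f : U ⟶ V), R f → IsGroupoidOpfibrationCell f

end BicategoricalNotions

section Lawful

/-- The data of a bicategory, without any laws. -/
class BicategoryStruct (B : Type u) extends CategoryStruct.{v} B where
  /-- 2-cells with their identities and vertical composition -/
  homStruct : ∀ a b : B, CategoryStruct.{w} (a ⟶ b)
  /-- whiskering on the left -/
  whiskerLeft {a b c : B} (f : a ⟶ b) {g h : b ⟶ c} (η : g ⟶ h) : f ≫ g ⟶ f ≫ h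
  /-- whiskering on the right -/
  whiskerRight {a b c : B} {f g : a ⟶ b} (η : f ⟶ g) (h : b ⟶ c) : f ≫ h ⟶ g ≫ h
  /-- the associativity constraint -/
  associator {a b c d : B} (f : a ⟶ b) (g : b ⟶ c) (h : c ⟶ d) : (f ≫ g) ≫ h ⟶ f ≫ g ≫ h
  /-- the left unit constraint -/
  leftUnitor {a b : B} (f : a ⟶ b) : 𝟙 a ≫ f ⟶ f
  /-- the right unit constraint -/
  rightUnitor {a b : B} (f : a ⟶ b) : f ≫ 𝟙 b ⟶ f

namespace BicategoryStruct

attribute [reducible, instance] homStruct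

/-- The laws of a bicategory: 1-cells and 2-cells between two objects form a category, horizontal
composition is functorial, the constraints are invertible and natural, and the pentagon and
triangle identities hold. -/
class IsLawful (B : Type u) [BicategoryStruct.{w, v} B] : Prop where
  id_comp : ∀ {a b : B} {f g : a ⟶ b} (η : f ⟶ g), 𝟙 f ≫ η = η
  comp_id : ∀ {a b : B} {f g : a ⟶ b} (η : f ⟶ g), η ≫ 𝟙 g = η
  assoc : ∀ {a b : B} {f g h i : a ⟶ b} (η : f ⟶ g) (θ : g ⟶ h) (ζ : h ⟶ i),
    (η ≫ θ) ≫ ζ = η ≫ θ ≫ ζ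
  whiskerLeft_id : ∀ {a b c : B} (f : a ⟶ b) (g : b ⟶ c), whiskerLeft f (𝟙 g) = 𝟙 (f ≫ g)
  whiskerLeft_comp : ∀ {a b c : B} (f : a ⟶ b) {g h i : b ⟶ c} (η : g ⟶ h) (θ : h ⟶ i),
    whiskerLeft f (η ≫ θ) = whiskerLeft f η ≫ whiskerLeft f θ
  id_whiskerRight : ∀ {a b c : B} (f : a ⟶ b) (g : b ⟶ c), whiskerRight (𝟙 f) g = 𝟙 (f ≫ g)
  comp_whiskerRight : ∀ {a b c : B} {f g h : a ⟶ b} (η : f ⟶ g) (θ : g ⟶ h) (i : b ⟶ c),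
    whiskerRight (η ≫ θ) i = whiskerRight η i ≫ whiskerRight θ i
  whisker_exchange : ∀ {a b c : B} {f g : a ⟶ b} {h i : b ⟶ c} (η : f ⟶ g) (θ : h ⟶ i),
    whiskerLeft f θ ≫ whiskerRight η i = whiskerRight η h ≫ whiskerLeft g θ
  associator_invertible : ∀ {a b c d : B} (f : a ⟶ b) (g : b ⟶ c) (h : c ⟶ d),
    ∃ ζ : f ≫ g ≫ h ⟶ (f ≫ g) ≫ h, associator f g h ≫ ζ = 𝟙 _ ∧ ζ ≫ associator f g h = 𝟙 _
  leftUnitor_invertible : ∀ {a b : B} (f : a ⟶ b),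
    ∃ ζ : f ⟶ 𝟙 a ≫ f, leftUnitor f ≫ ζ = 𝟙 _ ∧ ζ ≫ leftUnitor f = 𝟙 _
  rightUnitor_invertible : ∀ {a b : B} (f : a ⟶ b),
    ∃ ζ : f ⟶ f ≫ 𝟙 b, rightUnitor f ≫ ζ = 𝟙 _ ∧ ζ ≫ rightUnitor f = 𝟙 _
  associator_naturality_left : ∀ {a b c d : B} {f f' : a ⟶ b} (η : f ⟶ f') (g : b ⟶ c)
    (h : c ⟶ d), whiskerRight (whiskerRight η g) h ≫ associator f' g h =
      associator f g h ≫ whiskerRight η (g ≫ h)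
  associator_naturality_middle : ∀ {a b c d : B} (f : a ⟶ b) {g g' : b ⟶ c} (η : g ⟶ g')
    (h : c ⟶ d), whiskerRight (whiskerLeft f η) h ≫ associator f g' h =
      associator f g h ≫ whiskerLeft f (whiskerRight η h)
  associator_naturality_right : ∀ {a b c d : B} (f : a ⟶ b) (g : b ⟶ c) {h h' : c ⟶ d}
    (η : h ⟶ h'), whiskerLeft (f ≫ g) η ≫ associator f g h' =
      associator f g h ≫ whiskerLeft f (whiskerLeft g η)
  leftUnitor_naturality : ∀ {a b : B} {f g : a ⟶ b} (η : f ⟶ g),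
    whiskerLeft (𝟙 a) η ≫ leftUnitor g = leftUnitor f ≫ η
  rightUnitor_naturality : ∀ {a b : B} {f g : a ⟶ b} (η : f ⟶ g),
    whiskerRight η (𝟙 b) ≫ rightUnitor g = rightUnitor f ≫ η
  pentagon : ∀ {a b c d e : B} (f : a ⟶ b) (g : b ⟶ c) (h : c ⟶ d) (i : d ⟶ e),
    whiskerRight (associator f g h) i ≫ associator f (g ≫ h) i ≫ whiskerLeft f (associator g h i) =
      associator (f ≫ g) h i ≫ associator f g (h ≫ i)
  triangle : ∀ {a b c : B} (f : a ⟶ b) (g : b ⟶ c),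
    associator f (𝟙 b) g ≫ whiskerLeft f (leftUnitor g) = whiskerRight (rightUnitor f) g

/-- The bicategory given by lawful data. -/
noncomputable instance toBicategory (B : Type u) [BicategoryStruct.{w, v} B] [h : IsLawful B] :
    Bicategory.{w, v} B :=
  letI (a b : B) : Category (a ⟶ b) :=
    { id_comp := h.id_comp, comp_id := h.comp_id, assoc := h.assoc }
  { homCategory := inferInstance
    whiskerLeft := whiskerLeft
    whiskerRight := whiskerRight
    associator f g k :=
      { hom := associator f g k
        inv := (h.associator_invertible f g k).choose
        hom_inv_id := (h.associator_invertible f g k).choose_spec.1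
        inv_hom_id := (h.associator_invertible f g k).choose_spec.2 }
    leftUnitor f :=
      { hom := leftUnitor f
        inv := (h.leftUnitor_invertible f).choose
        hom_inv_id := (h.leftUnitor_invertible f).choose_spec.1
        inv_hom_id := (h.leftUnitor_invertible f).choose_spec.2 }
    rightUnitor f :=
      { hom := rightUnitor f
        inv := (h.rightUnitor_invertible f).choose
        hom_inv_id := (h.rightUnitor_invertible f).choose_spec.1
        inv_hom_id := (h.rightUnitor_invertible f).choose_spec.2 }
    whiskerLeft_id := h.whiskerLeft_id
    whiskerLeft_comp := h.whiskerLeft_comp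
    id_whiskerLeft η := by rw [← Category.assoc, Iso.eq_comp_inv]; exact h.leftUnitor_naturality η
    comp_whiskerLeft f g _ _ η := by
      rw [← Category.assoc, Iso.eq_comp_inv]; exact h.associator_naturality_right f g η
    id_whiskerRight := h.id_whiskerRight
    comp_whiskerRight := h.comp_whiskerRight
    whiskerRight_id η := by rw [← Category.assoc, Iso.eq_comp_inv]; exact h.rightUnitor_naturality η
    whiskerRight_comp η g k := by
      rw [Iso.eq_inv_comp]; exact (h.associator_naturality_left η g k).symm
    whisker_assoc f _ _ η k := by
      rw [← Category.assoc, Iso.eq_comp_inv]; exact h.associator_naturality_middle f η k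
    whisker_exchange := h.whisker_exchange
    pentagon := h.pentagon
    triangle := h.triangle }

end BicategoryStruct
end Lawful

section BicategoricalSpans

variable {C : Type u} [Bicategory.{w, v} C]

/-- An `R`-span from `U` to `V` in a bicategory: `U ⟵ S ⟶ V` with the left leg in `R`. -/
structure BiSpan (R : MorphismProperty C) (U V : C) where
  /-- the vertex -/
  apex : C
  /-- the left leg -/
  left : apex ⟶ U
  /-- the right leg -/
  right : apex ⟶ V
  left_mem : R left

/-- A diagram representing a 2-cell of `R`-spans: a 1-cell `f` between the vertices, an isomorphism
`f ≫ S'.left ≅ S.left` and a 2-cell `S.right ⟶ f ≫ S'.right`. -/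
structure BiSpan.Diagram {R : MorphismProperty C} {U V : C} (S S' : BiSpan R U V) where
  /-- the 1-cell between the vertices -/
  mid : S.apex ⟶ S'.apex
  /-- the invertible 2-cell on the left -/
  left : mid ≫ S'.left ≅ S.left
  /-- the 2-cell on the right -/
  right : S.right ⟶ mid ≫ S'.right

/-- Two diagrams are isomorphic when their 1-cells are isomorphic compatibly with the 2-cells. -/
instance BiSpan.diagramSetoid {R : MorphismProperty C} {U V : C} (S S' : BiSpan R U V) :
    Setoid (BiSpan.Diagram S S') where
  r a b := ∃ χ : a.mid ≅ b.mid,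
    χ.hom ▷ S'.left ≫ b.left.hom = a.left.hom ∧ a.right ≫ χ.hom ▷ S'.right = b.right
  iseqv :=
    { refl := fun a => ⟨Iso.refl _, by simp, by simp⟩
      symm := by
        rintro a b ⟨χ, h₁, h₂⟩
        exact ⟨χ.symm, by simp [← h₁], by simp [← h₂]⟩
      trans := by
        rintro a b c ⟨χ, h₁, h₂⟩ ⟨ψ, h₃, h₄⟩
        exact ⟨χ ≪≫ ψ, by simp [h₁, h₃], by simp [← h₄, ← h₂]⟩ }

/-- The 2-cells of `R`-spans: isomorphism classes of diagrams. -/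
def BiSpan.Cell {R : MorphismProperty C} {U V : C} (S S' : BiSpan R U V) :=
  Quotient (BiSpan.diagramSetoid S S')

/-- The vertical composite of two diagrams, by pasting. -/
def BiSpan.Diagram.vcomp {R : MorphismProperty C} {U V : C} {S S' S'' : BiSpan R U V}
    (a : Diagram S S') (b : Diagram S' S'') : Diagram S S'' where
  mid := a.mid ≫ b.mid
  left := α_ _ _ _ ≪≫ whiskerLeftIso a.mid b.left ≪≫ a.left
  right := a.right ≫ a.mid ◁ b.right ≫ (α_ _ _ _).inv

/-- Vertical composition of 2-cells. -/
def BiSpan.Cell.vcomp {R : MorphismProperty C} {U V : C} {S S' S'' : BiSpan R U V} :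
    Cell S S' → Cell S' S'' → Cell S S'' :=
  Quotient.map₂ Diagram.vcomp (by
    rintro a a' ⟨χ, h₁, h₂⟩ b b' ⟨ψ, h₃, h₄⟩
    refine ⟨whiskerRightIso χ b.mid ≪≫ whiskerLeftIso a'.mid ψ, ?_, ?_⟩
    · simp only [Diagram.vcomp, ← h₁, ← h₃, Iso.trans_hom, whiskerRightIso_hom,
        whiskerLeftIso_hom, comp_whiskerRight, whiskerLeft_comp, Category.assoc]
      rw [associator_naturality_middle_assoc, associator_naturality_left_assoc,
        ← whisker_exchange_assoc, ← whisker_exchange_assoc]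
    · simp only [Diagram.vcomp, ← h₂, ← h₄, Iso.trans_hom, whiskerRightIso_hom,
        whiskerLeftIso_hom, comp_whiskerRight, whiskerLeft_comp, Category.assoc]
      rw [← associator_inv_naturality_left_assoc, ← associator_inv_naturality_middle,
        whisker_exchange_assoc])

variable {R : MorphismProperty C} [hR : IsBiProtocalibration R]

namespace BiSpan

section Composition

variable {U V W : C} (S : BiSpan R U V) (T : BiSpan R V W)

/-- A chosen bipullback of the left leg of `T` along the right leg of `S`. -/
noncomputable def bipullback : IsoSquare T.left S.right :=
  (hR.exists_bipullback T.left S.right T.left_mem).choose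

theorem bipullback_isBipullback : IsBipullback (bipullback S T) :=
  (hR.exists_bipullback T.left S.right T.left_mem).choose_spec.1

theorem bipullback_mem : R (bipullback S T).snd :=
  (hR.exists_bipullback T.left S.right T.left_mem).choose_spec.2

/-- The vertex of the composite span. -/
noncomputable def vertex : C := (bipullback S T).pt

/-- The projection of the composite span to the first span. -/
noncomputable def proj₁ : vertex S T ⟶ S.apex := (bipullback S T).snd

/-- The projection of the composite span to the second span. -/
noncomputable def proj₂ : vertex S T ⟶ T.apex := (bipullback S T).fst

/-- The isomorphism filling the bipullback square. -/
noncomputable def square : proj₂ S T ≫ T.left ≅ proj₁ S T ≫ S.right := (bipullback S T).iso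

/-- Composition of spans, by bipullback. -/
noncomputable def comp : BiSpan R U W where
  apex := vertex S T
  left := proj₁ S T ≫ S.left
  right := proj₂ S T ≫ T.right
  left_mem := hR.comp_mem _ _ (bipullback_mem S T) S.left_mem

variable {X : C} (b : X ⟶ T.apex) (a : X ⟶ S.apex) (δ : b ≫ T.left ≅ a ≫ S.right)

/-- The 1-cell into the vertex of a composite span given by the bipullback property. -/
noncomputable def lift : X ⟶ vertex S T :=
  ((bipullback_isBipullback S T).exists_lift b a δ).choose

/-- The second projection of `lift`. -/
noncomputable def liftProj₂ : lift S T b a δ ≫ proj₂ S T ≅ b :=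
  ((bipullback_isBipullback S T).exists_lift b a δ).choose_spec.choose

/-- The first projection of `lift`. -/
noncomputable def liftProj₁ : lift S T b a δ ≫ proj₁ S T ≅ a :=
  ((bipullback_isBipullback S T).exists_lift b a δ).choose_spec.choose_spec.choose

theorem lift_square :
    (liftProj₂ S T b a δ).hom ▷ T.left ≫ δ.hom =
      (α_ _ _ _).hom ≫ lift S T b a δ ◁ (square S T).hom ≫ (α_ _ _ _).inv ≫
        (liftProj₁ S T b a δ).hom ▷ S.right :=
  ((bipullback_isBipullback S T).exists_lift b a δ).choose_spec.choose_spec.choose_spec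

end Composition

/-- The identity span. -/
def id (U : C) : BiSpan R U U := ⟨U, 𝟙 U, 𝟙 U, hR.equivalence_mem (Equivalence.id U)⟩

/-- The 2-cell obtained from `a.right` by pasting with `b.left` and the bipullback square lifts along
the groupoid opfibration `T'.left` to a 2-cell `κ : proj₂ ≫ b.mid ⟶ k`. -/
theorem exists_opcartesian {U V W : C} {S S' : BiSpan R U V} {T T' : BiSpan R V W}
    (a : Diagram S S') (b : Diagram T T') :
    ∃ (k : vertex S T ⟶ T'.apex) (κ : proj₂ S T ≫ b.mid ⟶ k)
      (e : k ≫ T'.left ≅ (proj₁ S T ≫ a.mid) ≫ S'.right),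
      κ ▷ T'.left ≫ e.hom = (α_ _ _ _).hom ≫ proj₂ S T ◁ b.left.hom ≫ (square S T).hom ≫
        proj₁ S T ◁ a.right ≫ (α_ _ _ _).inv :=
  (hR.opfibration T'.left T'.left_mem (vertex S T)).exists_lift (proj₂ S T ≫ b.mid) _

/-- The horizontal composite of two diagrams: the 1-cell between the vertices is induced by the
bipullback property from the lift `k` and from `proj₁ ≫ a.mid`. -/
noncomputable def Diagram.hcomp {U V W : C} {S S' : BiSpan R U V} {T T' : BiSpan R V W}
    (a : Diagram S S') (b : Diagram T T') : Diagram (comp S T) (comp S' T') :=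
  let k := (exists_opcartesian a b).choose
  let κ : proj₂ S T ≫ b.mid ⟶ k := (exists_opcartesian a b).choose_spec.choose
  let e : k ≫ T'.left ≅ (proj₁ S T ≫ a.mid) ≫ S'.right :=
    (exists_opcartesian a b).choose_spec.choose_spec.choose
  { mid := lift S' T' k (proj₁ S T ≫ a.mid) e
    left := (α_ _ _ _).symm ≪≫ whiskerRightIso (liftProj₁ S' T' k _ e) S'.left ≪≫ α_ _ _ _ ≪≫
      whiskerLeftIso (proj₁ S T) a.left
    right := proj₂ S T ◁ b.right ≫ (α_ _ _ _).inv ≫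
      (κ ≫ (liftProj₂ S' T' k _ e).inv) ▷ T'.right ≫ (α_ _ _ _).hom }

/-- Horizontal composition of 2-cells; the class of the composite does not depend on the
representing diagrams. -/
noncomputable def Cell.hcomp {U V W : C} {S S' : BiSpan R U V} {T T' : BiSpan R V W}
    (a : Cell S S') (b : Cell T T') : Cell (comp S T) (comp S' T') :=
  Quotient.mk _ (Diagram.hcomp (Quotient.out a) (Quotient.out b))

/-- The identity 2-cell. -/
def Cell.id {U V : C} (S : BiSpan R U V) : Cell S S :=
  Quotient.mk _ ⟨𝟙 _, λ_ _, (λ_ _).inv⟩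

/-- The associativity constraint, induced by the projections. -/
noncomputable def associatorDiagram {U V W Z : C} (S : BiSpan R U V) (T : BiSpan R V W)
    (Y : BiSpan R W Z) : Diagram (comp (comp S T) Y) (comp S (comp T Y)) :=
  let q₁ : vertex (comp S T) Y ⟶ vertex S T := proj₁ (comp S T) Y
  let q₂ := proj₂ (comp S T) Y
  let δ : q₂ ≫ Y.left ≅ (q₁ ≫ proj₂ S T) ≫ T.right := square (comp S T) Y ≪≫ (α_ _ _ _).symm
  let h := lift T Y q₂ (q₁ ≫ proj₂ S T) δ
  let θ : h ≫ proj₁ T Y ≫ T.left ≅ (q₁ ≫ proj₁ S T) ≫ S.right :=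
    (α_ _ _ _).symm ≪≫ whiskerRightIso (liftProj₁ T Y q₂ (q₁ ≫ proj₂ S T) δ) T.left ≪≫
      α_ _ _ _ ≪≫ whiskerLeftIso q₁ (square S T) ≪≫ (α_ _ _ _).symm
  { mid := lift S (comp T Y) h (q₁ ≫ proj₁ S T) θ
    left := (α_ _ _ _).symm ≪≫
      whiskerRightIso (liftProj₁ S (comp T Y) h (q₁ ≫ proj₁ S T) θ) S.left ≪≫ α_ _ _ _
    right := (liftProj₂ T Y q₂ (q₁ ≫ proj₂ S T) δ).inv ▷ Y.right ≫ (α_ _ _ _).hom ≫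
      (liftProj₂ S (comp T Y) h (q₁ ≫ proj₁ S T) θ).inv ▷ (proj₂ T Y ≫ Y.right) ≫ (α_ _ _ _).hom }

/-- The left unit constraint, given by the second projection. -/
noncomputable def leftUnitorDiagram {U V : C} (S : BiSpan R U V) : Diagram (comp (id U) S) S where
  mid := proj₂ (id U) S
  left := square (id U) S
  right := 𝟙 _

/-- The right unit constraint, given by the first projection. -/
noncomputable def rightUnitorDiagram {U V : C} (S : BiSpan R U V) : Diagram (comp S (id V)) S where
  mid := proj₁ S (id V)
  left := Iso.refl _
  right := (square S (id V)).hom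

end BiSpan

/-- The objects of the bicategory of `R`-spans in `C`: those of `C`. -/
structure Spn (R : MorphismProperty C) where
  /-- the underlying object of `C` -/
  as : C

/-- The bicategory `Spn_R C` of `R`-spans in the bicategory `C`. -/
noncomputable instance : BicategoryStruct (Spn R) where
  Hom X Y := BiSpan R X.as Y.as
  id X := BiSpan.id X.as
  comp S T := BiSpan.comp S T
  homStruct _ _ :=
    { Hom := fun S S' => BiSpan.Cell S S'
      id := fun S => BiSpan.Cell.id S
      comp := fun a b => BiSpan.Cell.vcomp a b }
  whiskerLeft S _ _ b := BiSpan.Cell.hcomp (BiSpan.Cell.id S) b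
  whiskerRight a T := BiSpan.Cell.hcomp a (BiSpan.Cell.id T)
  associator S T Y := Quotient.mk _ (BiSpan.associatorDiagram S T Y)
  leftUnitor S := Quotient.mk _ (BiSpan.leftUnitorDiagram S)
  rightUnitor S := Quotient.mk _ (BiSpan.rightUnitorDiagram S)

end BicategoricalSpans

section Polynomials

variable {E : Type u} [Category.{v} E] [HasPullbacks E]

/-- A morphism `u : S ⟶ U` is powerful when the functor `Δ_u` pulling back along `u` has a right
adjoint `Π_u`. -/
def powerful (E : Type u) [Category.{v} E] [HasPullbacks E] : MorphismProperty E :=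
  fun _ _ u => (Over.pullback u).IsLeftAdjoint

section Distributivity

variable {A S U : E} (a : A ⟶ S) (u : S ⟶ U) (hu : powerful E u)

/-- The object `Π_u a` of the category of objects over `U`. -/
noncomputable def piOver : Over U :=
  haveI : (Over.pullback u).IsLeftAdjoint := hu
  (Over.pullback u).rightAdjoint.obj (Over.mk a)

/-- The domain of `Π_u a`. -/
noncomputable def piObj : E := (piOver a u hu).left

/-- `Π_u a` as a morphism of `E`. -/
noncomputable def piMap : piObj a u hu ⟶ U := (piOver a u hu).hom

/-- The underlying morphism of the counit `Δ_u Π_u a ⟶ a`. -/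
noncomputable def piEval : pullback (piMap a u hu) u ⟶ A :=
  haveI : (Over.pullback u).IsLeftAdjoint := hu
  ((Adjunction.ofIsLeftAdjoint (Over.pullback u)).counit.app (Over.mk a)).left

theorem piEval_comp : piEval a u hu ≫ a = pullback.snd (piMap a u hu) u :=
  haveI : (Over.pullback u).IsLeftAdjoint := hu
  Over.w ((Adjunction.ofIsLeftAdjoint (Over.pullback u)).counit.app (Over.mk a))

variable {Q : E} (y : Q ⟶ U) (x : pullback y u ⟶ A) (hx : x ≫ a = pullback.snd y u)

/-- The morphism `Q ⟶ Π_u a` over `U` that corresponds to `x : Δ_u y ⟶ a` under the adjunction. -/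
noncomputable def piLift : Q ⟶ piObj a u hu :=
  haveI : (Over.pullback u).IsLeftAdjoint := hu
  ((Adjunction.ofIsLeftAdjoint (Over.pullback u)).homEquiv (Over.mk y) (Over.mk a)
    (Over.homMk x hx : (Over.pullback u).obj (Over.mk y) ⟶ Over.mk a)).left

theorem piLift_comp : piLift a u hu y x hx ≫ piMap a u hu = y :=
  haveI : (Over.pullback u).IsLeftAdjoint := hu
  Over.w ((Adjunction.ofIsLeftAdjoint (Over.pullback u)).homEquiv (Over.mk y) (Over.mk a)
    (Over.homMk x hx : (Over.pullback u).obj (Over.mk y) ⟶ Over.mk a))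

theorem piLift_eval :
    pullback.lift (pullback.fst y u ≫ piLift a u hu y x hx) (pullback.snd y u)
      (by rw [Category.assoc, piLift_comp, pullback.condition]) ≫ piEval a u hu = x := by
  haveI : (Over.pullback u).IsLeftAdjoint := hu
  have h := congrArg CommaMorphism.left
    (((Adjunction.ofIsLeftAdjoint (Over.pullback u)).homEquiv_counit
      (g := (Adjunction.ofIsLeftAdjoint (Over.pullback u)).homEquiv (Over.mk y) (Over.mk a)
        (Over.homMk x hx : (Over.pullback u).obj (Over.mk y) ⟶ Over.mk a))).symm.trans
      (Equiv.symm_apply_apply _ _))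
  exact h

end Distributivity

/-- A pair `(L, R)` of protocalibrations is compatible when `L` consists of powerful morphisms
which are in `R`, and `Π_u a` is in `R` whenever `u` is in `L` and `a` is in `R`. -/
class IsCompatible (L R : MorphismProperty E) : Prop where
  le_powerful : L ≤ powerful E
  le_right : L ≤ R
  pi_mem : ∀ {A S U : E} (a : A ⟶ S) (u : S ⟶ U) (hu : L u),
    R a → R (piMap a u (le_powerful u hu))

/-- A polynomial `X ⟵ A ⟶ B ⟶ Y` with middle leg in `L` and right leg in `R`. -/
structure Poly (L R : MorphismProperty E) (X Y : E) where
  /-- the domain of the middle leg -/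
  A : E
  /-- the codomain of the middle leg -/
  B : E
  /-- the left leg -/
  r : A ⟶ X
  /-- the middle leg -/
  n : A ⟶ B
  /-- the right leg -/
  t : B ⟶ Y
  n_mem : L n
  t_mem : R t

namespace Poly

variable {L R : MorphismProperty E} {X Y Z W : E}

/-- A diagram representing a morphism of polynomials `p ⟶ q`: a morphism `g` between the codomains
of the middle legs, a pullback `P` of the middle leg of `q` along `g`, and a morphism `ℓ` from `P`
to the domain of the middle leg of `p`, making everything commute. -/
structure Diagram (p q : Poly L R X Y) where
  /-- the vertex of the pullback -/
  P : E
  /-- the morphism `P ⟶ p.A` -/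
  ℓ : P ⟶ p.A
  /-- the pullback of `q.n` along `g` -/
  m : P ⟶ p.B
  /-- the morphism between the codomains of the middle legs -/
  g : p.B ⟶ q.B
  /-- the pullback of `g` along `q.n` -/
  h : P ⟶ q.A
  isPullback : IsPullback m h g q.n
  ℓ_n : ℓ ≫ p.n = m
  ℓ_r : ℓ ≫ p.r = h ≫ q.r
  g_t : g ≫ q.t = p.t

/-- Two diagrams are isomorphic when their pullback vertices are, compatibly with all morphisms. -/
instance diagramSetoid (p q : Poly L R X Y) : Setoid (Diagram p q) where
  r d d' := d.g = d'.g ∧ ∃ e : d.P ≅ d'.P, e.hom ≫ d'.ℓ = d.ℓ ∧ e.hom ≫ d'.m = d.m ∧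
    e.hom ≫ d'.h = d.h
  iseqv :=
    { refl := fun d => ⟨rfl, Iso.refl _, by simp, by simp, by simp⟩
      symm := by
        rintro d d' ⟨hg, e, h₁, h₂, h₃⟩
        exact ⟨hg.symm, e.symm, by simp [← h₁], by simp [← h₂], by simp [← h₃]⟩
      trans := by
        rintro d d' d'' ⟨hg, e, h₁, h₂, h₃⟩ ⟨hg', e', h₁', h₂', h₃'⟩
        exact ⟨hg.trans hg', e ≪≫ e', by simp [h₁, h₁'], by simp [h₂, h₂'], by simp [h₃, h₃']⟩ }

/-- The morphisms of polynomials: isomorphism classes of diagrams. -/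
def Cell (p q : Poly L R X Y) := Quotient (diagramSetoid p q)

/-- The data of a diagram whose pullback square is the chosen one. -/
structure NormalCell (p q : Poly L R X Y) where
  /-- the morphism between the codomains of the middle legs -/
  g : p.B ⟶ q.B
  /-- the morphism from the chosen pullback -/
  ℓ : pullback g q.n ⟶ p.A
  ℓ_n : ℓ ≫ p.n = pullback.fst g q.n
  ℓ_r : ℓ ≫ p.r = pullback.snd g q.n ≫ q.r
  g_t : g ≫ q.t = p.t

/-- The morphism of polynomials represented by a diagram on the chosen pullback. -/
noncomputable def NormalCell.toCell {p q : Poly L R X Y} (c : NormalCell p q) : Cell p q :=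
  Quotient.mk _
    { P := pullback c.g q.n
      ℓ := c.ℓ
      m := pullback.fst c.g q.n
      g := c.g
      h := pullback.snd c.g q.n
      isPullback := IsPullback.of_hasPullback c.g q.n
      ℓ_n := c.ℓ_n
      ℓ_r := c.ℓ_r
      g_t := c.g_t }

/-- The diagram on the chosen pullback isomorphic to a given diagram. -/
noncomputable def Diagram.normalize {p q : Poly L R X Y} (d : Diagram p q) : NormalCell p q where
  g := d.g
  ℓ := d.isPullback.lift (pullback.fst d.g q.n) (pullback.snd d.g q.n) pullback.condition ≫ d.ℓ
  ℓ_n := by rw [Category.assoc, d.ℓ_n, d.isPullback.lift_fst]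
  ℓ_r := by rw [Category.assoc, d.ℓ_r, d.isPullback.lift_snd_assoc]
  g_t := d.g_t

/-- Every morphism of polynomials has exactly one representative on the chosen pullback. -/
noncomputable def Cell.normal {p q : Poly L R X Y} : Cell p q → NormalCell p q :=
  Quotient.lift Diagram.normalize (by
    rintro ⟨P, ℓ, m, g, h, sq, w₁, w₂, w₃⟩ ⟨P', ℓ', m', g', h', sq', w₁', w₂', w₃'⟩
      ⟨hg, e, h₁, h₂, h₃⟩
    obtain rfl : g = g' := hg
    simp only [Diagram.normalize, NormalCell.mk.injEq, heq_eq_eq, true_and]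
    dsimp only at e h₁ h₂ h₃
    refine (congrArg (_ ≫ ·) h₁.symm).trans ((Category.assoc _ _ _).symm.trans ?_)
    congr 1
    apply sq'.hom_ext
    · rw [sq'.lift_fst, Category.assoc, h₂, sq.lift_fst]
    · rw [sq'.lift_snd, Category.assoc, h₃, sq.lift_snd])

theorem NormalCell.normal_toCell {p q : Poly L R X Y} (c : NormalCell p q) :
    c.toCell.normal = c := by
  obtain ⟨g, ℓ, h₁, h₂, h₃⟩ := c
  simp only [toCell, Cell.normal, Diagram.normalize, Quotient.lift_mk, NormalCell.mk.injEq,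
    heq_eq_eq, true_and]
  convert Category.id_comp ℓ
  apply pullback.hom_ext
  · exact (IsPullback.lift_fst _ _ _ _).trans (Category.id_comp _).symm
  · exact (IsPullback.lift_snd _ _ _ _).trans (Category.id_comp _).symm

theorem Cell.toCell_normal {p q : Poly L R X Y} (c : Cell p q) : c.normal.toCell = c := by
  induction c using Quotient.inductionOn with
  | h d =>
    refine Quotient.sound ⟨rfl, ((IsPullback.of_hasPullback d.g q.n).isoIsPullback _ _
      d.isPullback), ?_, ?_, ?_⟩
    · simp only [Cell.normal, Diagram.normalize, Quotient.lift_mk]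
      congr 1
    · simp [Cell.normal, Diagram.normalize]
    · simp [Cell.normal, Diagram.normalize]

/-- The identity of a polynomial. -/
noncomputable def NormalCell.id (p : Poly L R X Y) : NormalCell p p where
  g := 𝟙 p.B
  ℓ := pullback.snd (𝟙 p.B) p.n
  ℓ_n := by rw [← pullback.condition, Category.comp_id]
  ℓ_r := rfl
  g_t := Category.id_comp _

/-- The vertical composite of morphisms of polynomials, by pasting pullbacks. -/
noncomputable def NormalCell.vcomp {p q s : Poly L R X Y} (c : NormalCell p q)
    (d : NormalCell q s) : NormalCell p s :=
  let k : pullback (c.g ≫ d.g) s.n ⟶ pullback d.g s.n :=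
    pullback.lift (pullback.fst _ _ ≫ c.g) (pullback.snd _ _)
      (by rw [Category.assoc, pullback.condition])
  have hk₁ : k ≫ pullback.fst d.g s.n = pullback.fst _ _ ≫ c.g := pullback.lift_fst _ _ _
  have hk₂ : k ≫ pullback.snd d.g s.n = pullback.snd _ _ := pullback.lift_snd _ _ _
  let j : pullback (c.g ≫ d.g) s.n ⟶ pullback c.g q.n :=
    pullback.lift (pullback.fst _ _) (k ≫ d.ℓ) (by rw [Category.assoc, d.ℓ_n, hk₁])
  have hj₁ : j ≫ pullback.fst c.g q.n = pullback.fst _ _ := pullback.lift_fst _ _ _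
  have hj₂ : j ≫ pullback.snd c.g q.n = k ≫ d.ℓ := pullback.lift_snd _ _ _
  { g := c.g ≫ d.g
    ℓ := j ≫ c.ℓ
    ℓ_n := by rw [Category.assoc, c.ℓ_n, hj₁]
    ℓ_r := by
      rw [Category.assoc, c.ℓ_r, ← Category.assoc, hj₂, Category.assoc, d.ℓ_r, ← Category.assoc,
        hk₂]
    g_t := by rw [Category.assoc, d.g_t, c.g_t] }

section Composition

variable [hL : IsProtocalibration L] [hR : IsProtocalibration R] [hLR : IsCompatible L R]

/-- The identity polynomial. -/
def id (L R : MorphismProperty E) [hL : IsProtocalibration L] [hR : IsProtocalibration R] (X : E) :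
    Poly L R X X := ⟨X, X, 𝟙 X, 𝟙 X, 𝟙 X, hL.iso_mem _, hR.iso_mem _⟩

section Vertices

variable (p : Poly L R X Y) (q : Poly L R Y Z)

/-- `Π_{q.n} (p.B ×_Y q.A ⟶ q.A)` as a morphism of `E`. -/
noncomputable def distr :
    piObj (pullback.snd p.t q.r) q.n (hLR.le_powerful _ q.n_mem) ⟶ q.B :=
  piMap (pullback.snd p.t q.r) q.n (hLR.le_powerful _ q.n_mem)

/-- The counit of `Δ_{q.n} ⊣ Π_{q.n}` followed by the projection to `p.B`. -/
noncomputable def distrEval : pullback (distr p q) q.n ⟶ p.B :=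
  piEval (pullback.snd p.t q.r) q.n (hLR.le_powerful _ q.n_mem) ≫ pullback.fst p.t q.r

/-- Composition of polynomials: for `F = p.B ×_Y q.A`, it is
`X ⟵ A' ⟶ P ⟶ Π_{q.n} F ⟶ q.B ⟶ Z` where `P` is the pullback of `q.n` along `Π_{q.n} F ⟶ q.B` and
`A'` is the pullback of `p.n` along `P ⟶ F ⟶ p.B`. -/
noncomputable def comp : Poly L R X Z where
  A := pullback (distrEval p q) p.n
  B := piObj (pullback.snd p.t q.r) q.n (hLR.le_powerful _ q.n_mem)
  r := pullback.snd (distrEval p q) p.n ≫ p.r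
  n := pullback.fst (distrEval p q) p.n ≫ pullback.fst (distr p q) q.n
  t := distr p q ≫ q.t
  n_mem := hL.comp_mem _ _
    (hL.pullback_mem (IsPullback.of_hasPullback (distrEval p q) p.n).flip p.n_mem)
    (hL.pullback_mem (IsPullback.of_hasPullback (distr p q) q.n).flip q.n_mem)
  t_mem := hR.comp_mem _ _ (hLR.pi_mem _ _ q.n_mem
    (hR.pullback_mem (IsPullback.of_hasPullback p.t q.r) p.t_mem)) q.t_mem

/-- The morphism `Π_{q.n} F ⟶ q.B`. -/
noncomputable def compD : (comp p q).B ⟶ q.B := distr p q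

/-- The pullback `P` of `q.n` along `compD`. -/
noncomputable def compP : E := pullback (compD p q) q.n

/-- The projection `P ⟶ Π_{q.n} F`. -/
noncomputable def compP₁ : compP p q ⟶ (comp p q).B := pullback.fst (compD p q) q.n

/-- The projection `P ⟶ q.A`. -/
noncomputable def compP₂ : compP p q ⟶ q.A := pullback.snd (compD p q) q.n

/-- The morphism `P ⟶ F ⟶ p.B`. -/
noncomputable def compEv : compP p q ⟶ p.B := distrEval p q

/-- The projection `A' ⟶ P`. -/
noncomputable def compA₁ : (comp p q).A ⟶ compP p q := pullback.fst (distrEval p q) p.n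

/-- The projection `A' ⟶ p.A`. -/
noncomputable def compA₂ : (comp p q).A ⟶ p.A := pullback.snd (distrEval p q) p.n

theorem comp_r : (comp p q).r = compA₂ p q ≫ p.r := rfl

theorem comp_n : (comp p q).n = compA₁ p q ≫ compP₁ p q := rfl

theorem comp_t : (comp p q).t = compD p q ≫ q.t := rfl

theorem compP_isPullback : IsPullback (compP₁ p q) (compP₂ p q) (compD p q) q.n :=
  IsPullback.of_hasPullback (compD p q) q.n

theorem compA_isPullback : IsPullback (compA₁ p q) (compA₂ p q) (compEv p q) p.n :=
  IsPullback.of_hasPullback (distrEval p q) p.n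

theorem compEv_t : compEv p q ≫ p.t = compP₂ p q ≫ q.r := by
  have h : distrEval p q ≫ p.t = pullback.snd (distr p q) q.n ≫ q.r := by
    exact (Category.assoc _ _ _).trans ((congrArg (piEval _ _ _ ≫ ·) pullback.condition).trans
      ((Category.assoc _ _ _).symm.trans (congrArg (· ≫ q.r) (piEval_comp _ _ _))))
  exact h

variable {p q} {Q : E} (y : Q ⟶ q.B) (x : pullback y q.n ⟶ p.B)
  (hx : x ≫ p.t = pullback.snd y q.n ≫ q.r)

/-- The morphism into `Π_{q.n} F` given by its universal property. -/
noncomputable def liftB : Q ⟶ (comp p q).B :=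
  piLift _ _ _ y (pullback.lift x (pullback.snd y q.n) hx) (pullback.lift_snd _ _ _)

theorem liftB_D : liftB y x hx ≫ compD p q = y := piLift_comp _ _ _ _ _ _

theorem liftB_ev {T : E} (τ : T ⟶ Q) (z : T ⟶ compP p q)
    (hz : z ≫ compP₁ p q = τ ≫ liftB y x hx) (w : τ ≫ y = (z ≫ compP₂ p q) ≫ q.n) :
    z ≫ compEv p q = pullback.lift τ (z ≫ compP₂ p q) w ≫ x := by
  have hw : (pullback.fst y q.n ≫ liftB y x hx) ≫ compD p q = pullback.snd y q.n ≫ q.n := by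
    rw [Category.assoc, liftB_D, pullback.condition]
  have h : (compP_isPullback p q).lift _ _ hw ≫ compEv p q = x := by
    have h₁ := piLift_eval (pullback.snd p.t q.r) q.n (hLR.le_powerful _ q.n_mem) y
      (pullback.lift x (pullback.snd y q.n) hx) (pullback.lift_snd _ _ _)
    have h₂ := (congrArg (· ≫ pullback.fst p.t q.r) h₁).trans (pullback.lift_fst _ _ _)
    refine Eq.trans ?_ ((Category.assoc _ _ _).symm.trans h₂)
    refine congrArg (· ≫ compEv p q) ?_
    apply (compP_isPullback p q).hom_ext
    · rw [IsPullback.lift_fst]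
      exact (pullback.lift_fst _ _ _).symm
    · rw [IsPullback.lift_snd]
      exact (pullback.lift_snd _ _ _).symm
  have hz' : z = pullback.lift τ (z ≫ compP₂ p q) w ≫ (compP_isPullback p q).lift _ _ hw := by
    apply (compP_isPullback p q).hom_ext
    · rw [Category.assoc, IsPullback.lift_fst, pullback.lift_fst_assoc, hz]
    · rw [Category.assoc, IsPullback.lift_snd, pullback.lift_snd]
  calc z ≫ compEv p q
      = (pullback.lift τ (z ≫ compP₂ p q) w ≫ (compP_isPullback p q).lift _ _ hw) ≫
          compEv p q := congrArg (· ≫ compEv p q) hz'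
    _ = _ := by rw [Category.assoc, h]

end Vertices

section HorizontalComposition

variable {p p' : Poly L R X Y} {q q' : Poly L R Y Z} (c : NormalCell p p') (d : NormalCell q q')

/-- The morphism from the pullback of `q'.n` along `compD ≫ d.g` to `compP p q` induced by `d`. -/
noncomputable def hcompK : pullback (compD p q ≫ d.g) q'.n ⟶ compP p q :=
  (compP_isPullback p q).lift (pullback.fst _ _)
    (pullback.lift (pullback.fst _ _ ≫ compD p q) (pullback.snd _ _)
      (by rw [Category.assoc, pullback.condition]) ≫ d.ℓ)
    (by rw [Category.assoc, d.ℓ_n, pullback.lift_fst])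

theorem hcompK_fst : hcompK (p := p) d ≫ compP₁ p q = pullback.fst (compD p q ≫ d.g) q'.n :=
  (compP_isPullback p q).lift_fst _ _ _

theorem hcompK_r :
    hcompK (p := p) d ≫ compP₂ p q ≫ q.r = pullback.snd (compD p q ≫ d.g) q'.n ≫ q'.r := by
  rw [hcompK, IsPullback.lift_snd_assoc, Category.assoc, d.ℓ_r, pullback.lift_snd_assoc]

/-- The horizontal composite of two morphisms of polynomials, induced by the universal properties
of `Π` and of pullbacks. -/
noncomputable def NormalCell.hcomp : NormalCell (comp p q) (comp p' q') :=
  let G : (comp p q).B ⟶ (comp p' q').B :=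
    liftB (compD p q ≫ d.g) (hcompK d ≫ compEv p q ≫ c.g) (by
      rw [Category.assoc, Category.assoc, c.g_t, compEv_t, hcompK_r])
  have hG : G ≫ compD p' q' = compD p q ≫ d.g := liftB_D _ _ _
  let T := pullback G (comp p' q').n
  let τ : T ⟶ (comp p q).B := pullback.fst _ _
  let z : T ⟶ (comp p' q').A := pullback.snd _ _
  have hT : τ ≫ G = z ≫ compA₁ p' q' ≫ compP₁ p' q' := pullback.condition
  have hw : τ ≫ compD p q ≫ d.g = ((z ≫ compA₁ p' q') ≫ compP₂ p' q') ≫ q'.n := by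
    rw [← hG, ← Category.assoc, hT, Category.assoc, Category.assoc, Category.assoc,
      (compP_isPullback p' q').w, Category.assoc]
  let y : T ⟶ compP p q :=
    pullback.lift (f := compD p q ≫ d.g) (g := q'.n) τ ((z ≫ compA₁ p' q') ≫ compP₂ p' q') hw ≫
      hcompK d
  have hy : y ≫ compP₁ p q = τ := by
    rw [Category.assoc, hcompK_fst, pullback.lift_fst]
  have hyz : (y ≫ compEv p q) ≫ c.g = (z ≫ compA₂ p' q') ≫ p'.n := by
    rw [Category.assoc z, ← (compA_isPullback p' q').w, ← Category.assoc z,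
      liftB_ev _ _ _ τ (z ≫ compA₁ p' q') ((Category.assoc _ _ _).trans hT.symm) hw]
    simp only [y, Category.assoc]
  let b : T ⟶ pullback c.g p'.n := pullback.lift (y ≫ compEv p q) (z ≫ compA₂ p' q') hyz
  have hb₁ : b ≫ pullback.fst c.g p'.n = y ≫ compEv p q := pullback.lift_fst _ _ _
  have hb₂ : b ≫ pullback.snd c.g p'.n = z ≫ compA₂ p' q' := pullback.lift_snd _ _ _
  have hyb : y ≫ compEv p q = (b ≫ c.ℓ) ≫ p.n :=
    hb₁.symm.trans ((congrArg (b ≫ ·) c.ℓ_n.symm).trans (Category.assoc _ _ _).symm)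
  { g := G
    ℓ := (compA_isPullback p q).lift y (b ≫ c.ℓ) hyb
    ℓ_n := by
      rw [comp_n p q, IsPullback.lift_fst_assoc]
      exact hy
    ℓ_r := by
      rw [comp_r p q, comp_r p' q', IsPullback.lift_snd_assoc, Category.assoc, c.ℓ_r, ← Category.assoc, hb₂,
        Category.assoc]
    g_t := by rw [comp_t, comp_t, ← Category.assoc, hG, Category.assoc, d.g_t] }

end HorizontalComposition

section Constraints

/-- The left unit constraint. -/
noncomputable def leftUnitor (q : Poly L R X Y) : NormalCell (comp (id L R X) q) q where
  g := compD (id L R X) q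
  ℓ := (compA_isPullback (id L R X) q).lift (𝟙 _) (compEv (id L R X) q)
    ((Category.id_comp _).trans (Category.comp_id _).symm)
  ℓ_n := ((compA_isPullback (id L R X) q).lift_fst_assoc _ _ _ _).trans (Category.id_comp _)
  ℓ_r := ((compA_isPullback (id L R X) q).lift_snd_assoc _ _ _ _).trans
    (compEv_t (id L R X) q)
  g_t := rfl

/-- The right unit constraint. -/
noncomputable def rightUnitor (p : Poly L R X Y) : NormalCell (comp p (id L R Y)) p :=
  let s : (comp p (id L R Y)).B ⟶ compP p (id L R Y) :=
    (compP_isPullback p (id L R Y)).lift (𝟙 _) (compD p (id L R Y))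
      ((Category.id_comp _).trans (Category.comp_id _).symm)
  have hs₁ : s ≫ compP₁ p (id L R Y) = 𝟙 _ := (compP_isPullback p (id L R Y)).lift_fst _ _ _
  have hs₂ : s ≫ compP₂ p (id L R Y) = compD p (id L R Y) :=
    (compP_isPullback p (id L R Y)).lift_snd _ _ _
  let g : (comp p (id L R Y)).B ⟶ p.B := s ≫ compEv p (id L R Y)
  { g := g
    ℓ := (compA_isPullback p (id L R Y)).lift (pullback.fst g p.n ≫ s) (pullback.snd g p.n)
      ((Category.assoc _ _ _).trans pullback.condition)
    ℓ_n := by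
      rw [comp_n, IsPullback.lift_fst_assoc, Category.assoc, hs₁, Category.comp_id]
    ℓ_r := by rw [comp_r, IsPullback.lift_snd_assoc]
    g_t := (Category.assoc _ _ _).trans ((congrArg (s ≫ ·) (compEv_t p (id L R Y))).trans
      ((Category.assoc _ _ _).symm.trans (congrArg (· ≫ (id L R Y).r) hs₂))) }

/-- The associativity constraint, induced by the universal properties of `Π` and of pullbacks. -/
noncomputable def associator (p : Poly L R X Y) (q : Poly L R Y Z) (s : Poly L R Z W) :
    NormalCell (comp (comp p q) s) (comp p (comp q s)) :=
  let e : compP (comp p q) s ⟶ (comp p q).B := compEv (comp p q) s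
  have he : e ≫ compD p q ≫ q.t = compP₂ (comp p q) s ≫ s.r := compEv_t (comp p q) s
  let x : pullback (compD (comp p q) s) s.n ⟶ q.B :=
    (show pullback (compD (comp p q) s) s.n ⟶ (comp p q).B from e) ≫ compD p q
  let α : (comp (comp p q) s).B ⟶ (comp q s).B :=
    liftB (compD (comp p q) s) x ((Category.assoc _ _ _).trans he)
  have hα : α ≫ compD q s = compD (comp p q) s := liftB_D _ _ _
  let J := pullback α (comp q s).n
  let J₁ : J ⟶ (comp (comp p q) s).B := pullback.fst _ _
  let J₂ : J ⟶ (comp q s).A := pullback.snd _ _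
  have hJ : J₁ ≫ α = J₂ ≫ compA₁ q s ≫ compP₁ q s := pullback.condition
  have hJ' : J₁ ≫ compD (comp p q) s = ((J₂ ≫ compA₁ q s) ≫ compP₂ q s) ≫ s.n := by
    rw [← hα, ← Category.assoc, hJ]
    simp only [Category.assoc]
    rw [(compP_isPullback q s).w]
  let j : J ⟶ compP (comp p q) s :=
    (compP_isPullback (comp p q) s).lift J₁ ((J₂ ≫ compA₁ q s) ≫ compP₂ q s) hJ'
  have hj₁ : j ≫ compP₁ (comp p q) s = J₁ := (compP_isPullback (comp p q) s).lift_fst _ _ _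
  have hj₂ : j ≫ compP₂ (comp p q) s = (J₂ ≫ compA₁ q s) ≫ compP₂ q s :=
    (compP_isPullback (comp p q) s).lift_snd _ _ _
  have hj : (j ≫ e) ≫ compD p q = (J₂ ≫ compA₂ q s) ≫ q.n := by
    have hj' : j = pullback.lift J₁ ((J₂ ≫ compA₁ q s) ≫ compP₂ q s) hJ' := by
      apply (compP_isPullback (comp p q) s).hom_ext
      · rw [hj₁]
        exact (pullback.lift_fst _ _ _).symm
      · rw [hj₂]
        exact (pullback.lift_snd _ _ _).symm
    rw [Category.assoc J₂, ← (compA_isPullback q s).w, ← Category.assoc J₂,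
      liftB_ev _ _ _ J₁ (J₂ ≫ compA₁ q s) ((Category.assoc _ _ _).trans hJ.symm) hJ',
      Category.assoc, hj']
    rfl
  let i : J ⟶ compP p q := (compP_isPullback p q).lift (j ≫ e) (J₂ ≫ compA₂ q s) hj
  have hi₁ : i ≫ compP₁ p q = j ≫ e := (compP_isPullback p q).lift_fst _ _ _
  have hi₂ : i ≫ compP₂ p q = J₂ ≫ compA₂ q s := (compP_isPullback p q).lift_snd _ _ _
  let G : (comp (comp p q) s).B ⟶ (comp p (comp q s)).B :=
    liftB (q := comp q s) α (i ≫ compEv p q) (by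
      rw [Category.assoc, compEv_t, ← Category.assoc, hi₂, comp_r, Category.assoc])
  have hG : G ≫ compD p (comp q s) = α := liftB_D _ _ _
  let T := pullback G (comp p (comp q s)).n
  let τ : T ⟶ (comp (comp p q) s).B := pullback.fst _ _
  let z : T ⟶ (comp p (comp q s)).A := pullback.snd _ _
  have hT : τ ≫ G = z ≫ compA₁ p (comp q s) ≫ compP₁ p (comp q s) := pullback.condition
  have hw : τ ≫ α = ((z ≫ compA₁ p (comp q s)) ≫ compP₂ p (comp q s)) ≫ (comp q s).n := by
    rw [← hG, ← Category.assoc, hT, Category.assoc, Category.assoc, Category.assoc, Category.assoc,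
      (compP_isPullback p (comp q s)).w]
  let y : T ⟶ J := pullback.lift τ ((z ≫ compA₁ p (comp q s)) ≫ compP₂ p (comp q s)) hw
  have hy : y ≫ J₁ = τ := pullback.lift_fst _ _ _
  have hyz : (y ≫ i) ≫ compEv p q = (z ≫ compA₂ p (comp q s)) ≫ p.n := by
    rw [Category.assoc z, ← (compA_isPullback p (comp q s)).w, ← Category.assoc z,
      liftB_ev _ _ _ τ (z ≫ compA₁ p (comp q s)) ((Category.assoc _ _ _).trans hT.symm) hw,
      Category.assoc]
  let a : T ⟶ (comp p q).A :=
    (compA_isPullback p q).lift (y ≫ i) (z ≫ compA₂ p (comp q s)) hyz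
  have ha₁ : a ≫ compA₁ p q = y ≫ i := (compA_isPullback p q).lift_fst _ _ _
  have ha₂ : a ≫ compA₂ p q = z ≫ compA₂ p (comp q s) := (compA_isPullback p q).lift_snd _ _ _
  have hya : (y ≫ j) ≫ e = a ≫ (comp p q).n := by
    rw [comp_n, ← Category.assoc a, ha₁, Category.assoc, Category.assoc, hi₁]
  { g := G
    ℓ := (compA_isPullback (comp p q) s).lift (y ≫ j) a hya
    ℓ_n := by
      rw [comp_n (comp p q) s, IsPullback.lift_fst_assoc, Category.assoc, hj₁, hy]
    ℓ_r := by
      rw [comp_r (comp p q) s, IsPullback.lift_snd_assoc, comp_r p q, comp_r p (comp q s),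
        ← Category.assoc, ha₂, Category.assoc]
    g_t := by
      rw [comp_t p (comp q s), comp_t q s, comp_t (comp p q) s, ← Category.assoc, hG,
        ← Category.assoc, hα] }

end Constraints

end Composition

end Poly

/-- The objects of the bicategory of polynomials in `E` with middle leg in `L` and right leg in
`R`: those of `E`. -/
structure Ply (L R : MorphismProperty E) where
  /-- the underlying object of `E` -/
  as : E

/-- The bicategory of polynomials in `E` with middle leg in `L` and right leg in `R`. -/
noncomputable instance (L R : MorphismProperty E) [IsProtocalibration L] [IsProtocalibration R]
    [IsCompatible L R] : BicategoryStruct (Ply L R) where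
  Hom X Y := Poly L R X.as Y.as
  id X := Poly.id L R X.as
  comp p q := Poly.comp p q
  homStruct _ _ :=
    { Hom := fun p q => Poly.Cell p q
      id := fun p => (Poly.NormalCell.id p).toCell
      comp := fun c d => (Poly.NormalCell.vcomp c.normal d.normal).toCell }
  whiskerLeft p _ _ d := (Poly.NormalCell.hcomp (Poly.NormalCell.id p) (Poly.Cell.normal d)).toCell
  whiskerRight c q := (Poly.NormalCell.hcomp (Poly.Cell.normal c) (Poly.NormalCell.id q)).toCell
  associator p q s := (Poly.associator p q s).toCell
  leftUnitor p := (Poly.leftUnitor p).toCell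
  rightUnitor p := (Poly.rightUnitor p).toCell

end Polynomials

section Comparison

variable {E : Type u} [Category.{v} E] [HasPullbacks E] (L R : MorphismProperty E)
  [IsProtocalibration L] [IsProtocalibration R]

/-- The bicategory of spans in `E` with left leg in `L`, in which 2-cells from `S` to `S'` are
morphisms of spans from `S'` to `S`; that is, the 2-cell dual of `LeftSpan L`. -/
abbrev LSpn := Co (LeftSpan L)

/-- The class `R_*` of 1-cells of `LSpn L` with invertible left leg and with right leg in `R`. -/
def lowerStar : MorphismProperty (LSpn L) := fun X Y S =>
  IsIso (Span.l (show Span L ⊤ X.as.as Y.as.as from S.as)) ∧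
    R (Span.r (show Span L ⊤ X.as.as Y.as.as from S.as))

variable {L R}

/-- A span in `E` with left leg in `L`, as a 1-cell of `LSpn L`. -/
def spanCell {X A Y : E} (l : A ⟶ X) (r : A ⟶ Y) (hl : L l) :
    (Co.mk (LeftSpan.mk X) : LSpn L) ⟶ Co.mk (LeftSpan.mk Y) :=
  Co.Hom.mk (X := Co.mk (LeftSpan.mk X)) (Y := Co.mk (LeftSpan.mk Y))
    (show Span L ⊤ X Y from ⟨A, l, r, hl, trivial⟩)

/-- The 1-cell `(1, B, g)` of `LSpn L` for a morphism `g : B ⟶ Y` of `E`. -/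
def starCell {B Y : E} (g : B ⟶ Y) :
    (Co.mk (LeftSpan.mk B) : LSpn L) ⟶ Co.mk (LeftSpan.mk Y) :=
  spanCell (𝟙 B) g (IsProtocalibration.iso_mem _)


/-- The `R_*`-span `Y ⟵ B ⟶ X` in `LSpn L`, with legs `(1, B, t)` and `(n, A, r)`, given by a
polynomial `X ⟵ A ⟶ B ⟶ Y` with legs `r`, `n`, `t`. -/
def polySpan {X Y : E} (p : Poly L R X Y) :
    BiSpan (lowerStar L R) (Co.mk (LeftSpan.mk Y)) (Co.mk (LeftSpan.mk X)) where
  apex := Co.mk (LeftSpan.mk p.B)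
  left := starCell p.t
  right := spanCell p.n p.r p.n_mem
  left_mem := ⟨inferInstanceAs (IsIso (𝟙 p.B)), p.t_mem⟩

/-- The isomorphism `(1, B, g) ≫ (1, B', t') ≅ (1, B, t)` of 1-cells of `LSpn L` for `g ≫ t' = t`. -/
noncomputable def starIso {B B' Y : E} (g : B ⟶ B') (t' : B' ⟶ Y) (t : B ⟶ Y) (h : g ≫ t' = t) :
    (starCell g ≫ starCell t' :
      (Co.mk (LeftSpan.mk B) : LSpn L) ⟶ Co.mk (LeftSpan.mk Y)) ≅ starCell t :=
  coIso (X := LeftSpan.mk B) (Y := LeftSpan.mk Y)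
    (show Span.comp (Wₗ := L) (Wᵣ := ⊤) ⟨B, 𝟙 B, g, IsProtocalibration.iso_mem _, trivial⟩
        ⟨B', 𝟙 B', t', IsProtocalibration.iso_mem _, trivial⟩ ≅
          ⟨B, 𝟙 B, t, IsProtocalibration.iso_mem _, trivial⟩ from
      Span.mkIso (show pullback g (𝟙 B') ≅ B from asIso (pullback.fst g (𝟙 B'))) rfl (by
        have h' : pullback.fst g (𝟙 B') ≫ t = pullback.snd g (𝟙 B') ≫ t' := by
          rw [← h, ← Category.assoc, pullback.condition, Category.comp_id]
        exact h'))

/-- The 2-cell `(n, A, r) ⟶ (1, B, g) ≫ (n', A', r')` of `LSpn L`, a morphism of spans in the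
opposite direction, given by the morphism `ℓ` of a morphism of polynomials. -/
noncomputable def polyTwoCell {X Y : E} {p q : Poly L R X Y} (c : Poly.NormalCell p q) :
    (spanCell p.n p.r p.n_mem : (Co.mk (LeftSpan.mk p.B) : LSpn L) ⟶ Co.mk (LeftSpan.mk X)) ⟶
      starCell c.g ≫ spanCell q.n q.r q.n_mem :=
  Co.Hom₂.mk (show Span.comp (Wₗ := L) (Wᵣ := ⊤)
      ⟨p.B, 𝟙 p.B, c.g, IsProtocalibration.iso_mem _, trivial⟩
      ⟨q.A, q.n, q.r, q.n_mem, trivial⟩ ⟶ ⟨p.A, p.n, p.r, p.n_mem, trivial⟩ from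
    { hom := c.ℓ
      hom_l := c.ℓ_n.trans (Category.comp_id _).symm
      hom_r := c.ℓ_r })

/-- The diagram of `R_*`-spans given by a morphism of polynomials. -/
noncomputable def polyDiagram {X Y : E} {p q : Poly L R X Y} (c : Poly.NormalCell p q) :
    BiSpan.Diagram (polySpan p) (polySpan q) where
  mid := starCell c.g
  left := starIso c.g q.t p.t c.g_t
  right := polyTwoCell c

variable (L R)

/-- The comparison on objects, 1-cells and 2-cells: the identity on objects, a polynomial goes to
the corresponding span of spans, and a morphism of polynomials to the class of the corresponding
diagram. -/
noncomputable def comparison [IsCompatible L R] [IsBiProtocalibration (lowerStar L R)]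
    [BicategoryStruct.IsLawful (Ply L R)] :
    PrelaxFunctorStruct (Ply L R)ᵒᵖ (Spn (lowerStar L R)) where
  obj X := Spn.mk (Co.mk (LeftSpan.mk X.unop.as))
  map p := polySpan p.unop
  map₂ c := Quotient.mk _ (polyDiagram (Poly.Cell.normal c.unop2))

end Comparison

end SpanPoly

/-! A span with invertible left leg is, up to a unique invertible 2-cell, a morphism of `E`. An
`R_*`-span `Y ⟵ B ⟶ X` therefore amounts to a morphism `t : B ⟶ Y` in `R` together with a span `B ⟵
A ⟶ X` whose left leg is in `L`, which is a polynomial from `X` to `Y`. In a diagram between two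
such spans the isomorphism on the left forces the 1-cell between the vertices to have an invertible
left leg, so this 1-cell is `(1, B, g)` up to a unique isomorphism, the isomorphism on the left
carries no further information, and the 2-cell on the right is a morphism from the pullback of `n'`
along `g` to `A`. So 2-cells of spans of spans are exactly morphisms of polynomials (`phi_eq_iff`,
`Phi_surjective`).

The composites agree because of what a bipullback in `LSpn L` is. Let `f : U ⟶ W` have invertible
left leg and let `g : V ⟶ W` be any span. A square on `f` and `g` is a bipullback exactly when a
generalized element of its vertex is an element of `V` together with a family of elements of `U`,
compatible over `W`, indexed by the fibre of the left leg of `g` (`IsRepresenting.isBipullback` and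
`isRepresenting_of_isBipullback`, for squares whose second projection has invertible left leg). This
is the universal property of `Π` along the left leg of `g`, applied to `U ×_W ap g`, hence of the
vertex in the composition of polynomials. It gives the existence of bipullbacks, and compatibility
of the pair puts the second projection in `R_*`. The opfibration property holds because composition
with a span with invertible left leg changes only right legs (`isGroupoidOpfibrationCell`).

All computations are made on generalized elements. An element of the vertex `(comp p q).B` is a
point of `q.B` with a function from the fibre of `q.n` over it to `p.B`; an element of `(comp p
q).A` is such a function, an argument, and a point of `p.A` over the value. A morphism of
polynomials acts forwards on the `B`s and backwards on the fibres. With computation rules for `ev`,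
`app` and `mkA`, and with the extensionality principles `compB_ext` and `compA_ext`, the associator
becomes currying and the bicategory laws for polynomials become equalities of tuples.

The laws for spans of spans are not proved by pasting bipullbacks. The chosen vertex of a composite
span is isomorphic to the vertex of the composite polynomial (`isoB`), and these isomorphisms,
collected in `mu` and `iota`, commute with horizontal composition (`phi_hcomp`), associators
(`phi_associator`) and units (`phi_leftUnitor`, `phi_rightUnitor`). This yields a contravariant
comparison from spans to polynomials which is bijective on 2-cells, along which every law is
reflected (`Transport.isLawful`). The required pseudofunctor goes the other way; its values are a
section of this comparison up to isomorphism (`polySec`), so its coherence is again checked among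
polynomials, and its local equivalence follows from the bijection on 2-cells. -/

namespace SpanPoly

namespace Poly

variable {E : Type u} [Category.{v} E] [HasPullbacks E] {L R : MorphismProperty E}
  {X Y Z W : E}

/-! ### Morphisms of polynomials acting on generalized elements. -/

section CellElements

variable {p q s : Poly L R X Y}

/-- The action of a morphism of polynomials `p ⟶ q` on generalized elements: for `b` in `p.B` and
`z` in the fibre of `q.A` over the image of `b`, an element of the fibre of `p.A` over `b`. -/
noncomputable def NormalCell.app (c : NormalCell p q) {T : E} (b : T ⟶ p.B) (z : T ⟶ q.A)
    (h : b ≫ c.g = z ≫ q.n) : T ⟶ p.A :=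
  pullback.lift b z h ≫ c.ℓ

namespace NormalCell

@[simp]
theorem app_n (c : NormalCell p q) {T : E} (b : T ⟶ p.B) (z : T ⟶ q.A)
    (h : b ≫ c.g = z ≫ q.n) : c.app b z h ≫ p.n = b := by
  rw [app, Category.assoc, c.ℓ_n, pullback.lift_fst]

@[simp]
theorem app_r (c : NormalCell p q) {T : E} (b : T ⟶ p.B) (z : T ⟶ q.A)
    (h : b ≫ c.g = z ≫ q.n) : c.app b z h ≫ p.r = z ≫ q.r := by
  rw [app, Category.assoc, c.ℓ_r, pullback.lift_snd_assoc]

@[simp]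
theorem comp_app (c : NormalCell p q) {T T' : E} (σ : T' ⟶ T) (b : T ⟶ p.B) (z : T ⟶ q.A)
    (h : b ≫ c.g = z ≫ q.n) : σ ≫ c.app b z h =
      c.app (σ ≫ b) (σ ≫ z) (by rw [Category.assoc, h, Category.assoc]) := by
  rw [app, app, ← Category.assoc]
  congr 1
  apply pullback.hom_ext
  · simp only [Category.assoc, pullback.lift_fst]
  · simp only [Category.assoc, pullback.lift_snd]

theorem ℓ_eq_app (c : NormalCell p q) :
    c.ℓ = c.app (pullback.fst _ _) (pullback.snd _ _) pullback.condition := by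
  rw [app]
  convert (Category.id_comp _).symm
  ext <;> simp

/-- A Yoneda argument: the identity of `p.B` detects `g`, and the two projections of the chosen
pullback detect `ℓ`. Allowing all stages is harmless and lets laws be verified by computing with
elements. -/
theorem ext_elements {c c' : NormalCell p q}
    (hg : ∀ {T : E} (b : T ⟶ p.B), b ≫ c.g = b ≫ c'.g)
    (happ : ∀ {T : E} (b : T ⟶ p.B) (z : T ⟶ q.A) (h : b ≫ c.g = z ≫ q.n)
      (h' : b ≫ c'.g = z ≫ q.n), c.app b z h = c'.app b z h') : c = c' := by
  have hg' : c.g = c'.g := by simpa using hg (𝟙 _)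
  obtain ⟨g, ℓ, h₁, h₂, h₃⟩ := c
  obtain ⟨g', ℓ', h₁', h₂', h₃'⟩ := c'
  obtain rfl : g = g' := hg'
  have := happ (pullback.fst g q.n) (pullback.snd g q.n) pullback.condition pullback.condition
  rw [← ℓ_eq_app, ← ℓ_eq_app] at this
  obtain rfl : ℓ = ℓ' := this
  rfl

@[simp]
theorem id_g {T : E} (b : T ⟶ p.B) : b ≫ (NormalCell.id p).g = b := Category.comp_id _

@[simp]
theorem id_app {T : E} (b : T ⟶ p.B) (z : T ⟶ p.A) (h : b ≫ (NormalCell.id p).g = z ≫ p.n) :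
    (NormalCell.id p).app b z h = z := pullback.lift_snd _ _ _

@[simp]
theorem vcomp_g (c : NormalCell p q) (d : NormalCell q s) {T : E} (b : T ⟶ p.B) :
    b ≫ (c.vcomp d).g = (b ≫ c.g) ≫ d.g := (Category.assoc _ _ _).symm

-- On fibres the composite is contravariant: an element of `s.A` is carried back by `d` and then by
-- `c`.
@[simp]
theorem vcomp_app (c : NormalCell p q) (d : NormalCell q s) {T : E} (b : T ⟶ p.B) (z : T ⟶ s.A)
    (h : b ≫ (c.vcomp d).g = z ≫ s.n) :
    (c.vcomp d).app b z h =
      c.app b (d.app (b ≫ c.g) z ((vcomp_g c d b).symm.trans h)) (by rw [app_n]) := by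
  have h' : b ≫ c.g ≫ d.g = z ≫ s.n := h
  change pullback.lift b z h' ≫ pullback.lift (pullback.fst _ _) (pullback.lift
    (pullback.fst _ _ ≫ c.g) (pullback.snd _ _) _ ≫ d.ℓ) _ ≫ c.ℓ = _
  rw [← Category.assoc]
  refine congrArg (· ≫ c.ℓ) ?_
  apply pullback.hom_ext
  · simp only [Category.assoc, pullback.lift_fst]
  · simp only [Category.assoc, pullback.lift_snd]
    rw [← Category.assoc, app]
    congr 1
    apply pullback.hom_ext
    · simp only [Category.assoc, pullback.lift_fst, pullback.lift_fst_assoc]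
    · simp only [Category.assoc, pullback.lift_snd, pullback.lift_snd_assoc]

end NormalCell

end CellElements

variable [hL : IsProtocalibration L] [hR : IsProtocalibration R] [hLR : IsCompatible L R]

/-! ### Generalized elements of a composite polynomial. -/

section CompElements

variable (p : Poly L R X Y) (q : Poly L R Y Z)

/-- The projection `A' ⟶ q.A` of a composite polynomial. -/
noncomputable def compC : (comp p q).A ⟶ q.A := compA₁ p q ≫ compP₂ p q

variable {p q}

/-- Evaluation of a generalized element of `(comp p q).B` at an element of `q.A`. -/
noncomputable def ev {T : E} (f : T ⟶ (comp p q).B) (c : T ⟶ q.A)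
    (h : f ≫ compD p q = c ≫ q.n) : T ⟶ p.B :=
  (compP_isPullback p q).lift f c h ≫ compEv p q

theorem lift_compEv {T : E} (f : T ⟶ (comp p q).B) (c : T ⟶ q.A)
    (h : f ≫ compD p q = c ≫ q.n) :
    (compP_isPullback p q).lift f c h ≫ compEv p q = ev f c h := rfl

@[simp]
theorem ev_t {T : E} (f : T ⟶ (comp p q).B) (c : T ⟶ q.A) (h : f ≫ compD p q = c ≫ q.n) :
    ev f c h ≫ p.t = c ≫ q.r := by
  rw [ev, Category.assoc, compEv_t, IsPullback.lift_snd_assoc]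

@[simp]
theorem comp_ev {T T' : E} (σ : T' ⟶ T) (f : T ⟶ (comp p q).B) (c : T ⟶ q.A)
    (h : f ≫ compD p q = c ≫ q.n) : σ ≫ ev f c h =
      ev (σ ≫ f) (σ ≫ c) (by rw [Category.assoc, h, Category.assoc]) := by
  rw [ev, ev, ← Category.assoc]
  congr 1
  apply (compP_isPullback p q).hom_ext <;> simp

@[simp]
theorem comp_t_elem {T : E} (f : T ⟶ (comp p q).B) : f ≫ (comp p q).t = (f ≫ compD p q) ≫ q.t := by
  rw [comp_t, Category.assoc]

theorem liftB_D_elem {Q T : E} (σ : T ⟶ Q) (y : Q ⟶ q.B) (x : pullback y q.n ⟶ p.B)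
    (hx : x ≫ p.t = pullback.snd y q.n ≫ q.r) : (σ ≫ liftB y x hx) ≫ compD p q = σ ≫ y := by
  rw [Category.assoc, liftB_D]

/-- The computation rule of `Π` at an arbitrary stage: `liftB_ev` applied to the pair of `σ ≫ liftB
y x hx` and `c`. -/
theorem ev_liftB {Q T : E} (σ : T ⟶ Q) (y : Q ⟶ q.B) (x : pullback y q.n ⟶ p.B)
    (hx : x ≫ p.t = pullback.snd y q.n ≫ q.r) (c : T ⟶ q.A)
    (h : (σ ≫ liftB y x hx) ≫ compD p q = c ≫ q.n) :
    ev (σ ≫ liftB y x hx) c h =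
      pullback.lift σ c ((liftB_D_elem σ y x hx).symm.trans h) ≫ x := by
  have hc : (compP_isPullback p q).lift (σ ≫ liftB y x hx) c h ≫ compP₂ p q = c :=
    (compP_isPullback p q).lift_snd _ _ _
  rw [ev, liftB_ev y x hx σ _ ((compP_isPullback p q).lift_fst _ _ _)
    (by rw [hc, ← h, liftB_D_elem])]
  congr 1
  apply pullback.hom_ext
  · rw [pullback.lift_fst, pullback.lift_fst]
  · rw [pullback.lift_snd, pullback.lift_snd, hc]

/-- Transposition along `Δ_u ⊣ Π_u` is injective, and the transpose of a morphism into `Π_u a` is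
its pullback along `u` followed by the counit; `he` says that the two transposes agree. -/
theorem homEquiv_left_injective {A S U : E} (a : A ⟶ S) (u : S ⟶ U) (hu : powerful E u) {Q : E}
    {f f' : Q ⟶ piObj a u hu} (h : f ≫ piMap a u hu = f' ≫ piMap a u hu)
    (he : pullback.lift (pullback.fst (f ≫ piMap a u hu) u ≫ f) (pullback.snd _ u)
        (by rw [Category.assoc, pullback.condition]) ≫ piEval a u hu =
      pullback.lift (pullback.fst (f ≫ piMap a u hu) u ≫ f') (pullback.snd _ u)
        (by rw [Category.assoc, ← h, pullback.condition]) ≫ piEval a u hu) : f = f' := by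
  have : (Over.pullback u).IsLeftAdjoint := hu
  let F : Over.mk (f ≫ piMap a u hu) ⟶ piOver a u hu := Over.homMk f rfl
  let F' : Over.mk (f ≫ piMap a u hu) ⟶ piOver a u hu := Over.homMk f' h.symm
  have key : F = F' := by
    apply ((Adjunction.ofIsLeftAdjoint (Over.pullback u)).homEquiv (Over.mk (f ≫ piMap a u hu))
      (Over.mk a)).symm.injective
    apply Over.OverMorphism.ext
    refine Eq.trans ?_ (he.trans ?_)
    · exact congrArg CommaMorphism.left
        ((Adjunction.ofIsLeftAdjoint (Over.pullback u)).homEquiv_counit (g := F))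
    · exact (congrArg CommaMorphism.left
        ((Adjunction.ofIsLeftAdjoint (Over.pullback u)).homEquiv_counit (g := F'))).symm
  exact congrArg CommaMorphism.left key

/-- Function extensionality for the vertex `Π_{q.n} F`: an element is a point of `q.B` with a
function on the fibre of `q.n` over it. -/
theorem compB_ext {T : E} {f f' : T ⟶ (comp p q).B} (hD : f ≫ compD p q = f' ≫ compD p q)
    (hev : ∀ {T' : E} (σ : T' ⟶ T) (c : T' ⟶ q.A) (h : (σ ≫ f) ≫ compD p q = c ≫ q.n)
      (h' : (σ ≫ f') ≫ compD p q = c ≫ q.n), ev (σ ≫ f) c h = ev (σ ≫ f') c h') : f = f' := by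
  refine homEquiv_left_injective (pullback.snd p.t q.r) q.n (hLR.le_powerful _ q.n_mem) hD ?_
  have h₁ : (pullback.fst (f ≫ compD p q) q.n ≫ f) ≫ compD p q = pullback.snd _ _ ≫ q.n := by
    rw [Category.assoc, pullback.condition]
  have h₂ : (pullback.fst (f ≫ compD p q) q.n ≫ f') ≫ compD p q = pullback.snd _ _ ≫ q.n := by
    rw [Category.assoc, ← hD, pullback.condition]
  -- Comparing values at the generic argument, the projections of the pullback of `q.n`, is enough.
  have h := hev (pullback.fst (f ≫ compD p q) q.n) (pullback.snd _ _) h₁ h₂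
  apply pullback.hom_ext
  · rw [Category.assoc, Category.assoc]
    rw [ev, ev] at h
    refine Eq.trans ?_ (h.trans ?_)
    · exact congrArg (· ≫ compEv p q) ((compP_isPullback p q).hom_ext
        ((pullback.lift_fst _ _ _).trans ((compP_isPullback p q).lift_fst _ _ _).symm)
        ((pullback.lift_snd _ _ _).trans ((compP_isPullback p q).lift_snd _ _ _).symm))
    · exact congrArg (· ≫ compEv p q) ((compP_isPullback p q).hom_ext
        (((compP_isPullback p q).lift_fst _ _ _).trans (pullback.lift_fst _ _ _).symm)
        (((compP_isPullback p q).lift_snd _ _ _).trans (pullback.lift_snd _ _ _).symm))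
  · rw [Category.assoc, Category.assoc, piEval_comp, pullback.lift_snd, pullback.lift_snd]

@[simp]
theorem compA_n_D {T : E} (z : T ⟶ (comp p q).A) :
    (z ≫ (comp p q).n) ≫ compD p q = (z ≫ compC p q) ≫ q.n := by
  rw [comp_n, compC, Category.assoc, Category.assoc, Category.assoc, Category.assoc,
    (compP_isPullback p q).w]

-- This is the pullback square defining `(comp p q).A`, read on elements: an element is a function,
-- an argument, and a point of `p.A` lying over the value of the function at that argument.
@[simp]
theorem ev_compA {T : E} (z : T ⟶ (comp p q).A)
    (h : (z ≫ (comp p q).n) ≫ compD p q = (z ≫ compC p q) ≫ q.n) :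
    ev (z ≫ (comp p q).n) (z ≫ compC p q) h = (z ≫ compA₂ p q) ≫ p.n := by
  rw [Category.assoc z, ← (compA_isPullback p q).w, ev, ← Category.assoc z]
  congr 1
  apply (compP_isPullback p q).hom_ext
  · rw [IsPullback.lift_fst, comp_n, Category.assoc]
  · rw [IsPullback.lift_snd, compC, Category.assoc]

@[simp]
theorem compA_r {T : E} (z : T ⟶ (comp p q).A) :
    z ≫ (comp p q).r = (z ≫ compA₂ p q) ≫ p.r := by
  rw [comp_r, Category.assoc]

/-- A generalized element of `(comp p q).A` from its components. -/
noncomputable def mkA {T : E} (f : T ⟶ (comp p q).B) (c : T ⟶ q.A) (a : T ⟶ p.A)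
    (h : f ≫ compD p q = c ≫ q.n) (h' : ev f c h = a ≫ p.n) : T ⟶ (comp p q).A :=
  (compA_isPullback p q).lift ((compP_isPullback p q).lift f c h) a ((lift_compEv f c h).trans h')

section

variable {T : E} (f : T ⟶ (comp p q).B) (c : T ⟶ q.A) (a : T ⟶ p.A)
    (h : f ≫ compD p q = c ≫ q.n) (h' : ev f c h = a ≫ p.n)

@[simp]
theorem mkA_n : mkA f c a h h' ≫ (comp p q).n = f := by
  rw [mkA, comp_n, IsPullback.lift_fst_assoc, IsPullback.lift_fst]

@[simp]
theorem mkA_compC : mkA f c a h h' ≫ compC p q = c := by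
  rw [mkA, compC, IsPullback.lift_fst_assoc, IsPullback.lift_snd]

@[simp]
theorem mkA_compA₂ : mkA f c a h h' ≫ compA₂ p q = a := by
  rw [mkA, IsPullback.lift_snd]

theorem mkA_compA₁ : mkA f c a h h' ≫ compA₁ p q = (compP_isPullback p q).lift f c h := by
  rw [mkA, IsPullback.lift_fst]

end

theorem compA_ext {T : E} {z z' : T ⟶ (comp p q).A}
    (h₁ : z ≫ (comp p q).n = z' ≫ (comp p q).n) (h₂ : z ≫ compC p q = z' ≫ compC p q)
    (h₃ : z ≫ compA₂ p q = z' ≫ compA₂ p q) : z = z' := by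
  apply (compA_isPullback p q).hom_ext _ h₃
  apply (compP_isPullback p q).hom_ext
  · simpa [comp_n] using h₁
  · simpa [compC] using h₂

@[simp]
theorem comp_mkA {T T' : E} (σ : T' ⟶ T) (f : T ⟶ (comp p q).B) (c : T ⟶ q.A) (a : T ⟶ p.A)
    (h : f ≫ compD p q = c ≫ q.n) (h' : ev f c h = a ≫ p.n) :
    σ ≫ mkA f c a h h' = mkA (σ ≫ f) (σ ≫ c) (σ ≫ a)
      (by rw [Category.assoc, h, Category.assoc]) (by rw [← comp_ev σ f c h, h', Category.assoc]) := by
  apply compA_ext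
  · rw [Category.assoc, mkA_n, mkA_n]
  · rw [Category.assoc, mkA_compC, mkA_compC]
  · rw [Category.assoc, mkA_compA₂, mkA_compA₂]

end CompElements

/-! ### Horizontal composition of morphisms of polynomials on elements. -/

namespace NormalCell

section

variable {p p' : Poly L R X Y} {q q' : Poly L R Y Z} (c : NormalCell p p') (d : NormalCell q q')

@[simp]
theorem hcomp_g_D {T : E} (b : T ⟶ (comp p q).B) :
    (b ≫ (hcomp c d).g) ≫ compD p' q' = (b ≫ compD p q) ≫ d.g := by
  rw [Category.assoc, Category.assoc]
  exact congrArg (b ≫ ·) (liftB_D _ _ _)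

theorem lift_hcompK {T : E} (b : T ⟶ (comp p q).B) (z : T ⟶ q'.A)
    (h : b ≫ compD p q ≫ d.g = z ≫ q'.n) :
    pullback.lift b z h ≫ hcompK d = (compP_isPullback p q).lift b
      (d.app (b ≫ compD p q) z ((Category.assoc _ _ _).trans h)) (by rw [app_n]) := by
  apply (compP_isPullback p q).hom_ext
  · rw [IsPullback.lift_fst, Category.assoc, hcompK_fst, pullback.lift_fst]
  · rw [IsPullback.lift_snd, Category.assoc, hcompK, IsPullback.lift_snd, app, ← Category.assoc]
    congr 1
    apply pullback.hom_ext
    · simp only [Category.assoc, pullback.lift_fst, pullback.lift_fst_assoc]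
    · simp only [Category.assoc, pullback.lift_snd, pullback.lift_snd_assoc]

theorem hcompK_elem {T : E} (b : T ⟶ (comp p q).B) (z : T ⟶ q'.A)
    (h : b ≫ compD p q ≫ d.g = z ≫ q'.n) :
    pullback.lift b z h ≫ hcompK d ≫ compEv p q =
      ev b (d.app (b ≫ compD p q) z ((Category.assoc _ _ _).trans h)) (by rw [app_n]) := by
  rw [← Category.assoc, lift_hcompK, lift_compEv]

-- Functions are conjugated: the argument is carried back along `d`, the function is applied, and
-- the value is pushed forward along `c.g`.
@[simp]
theorem hcomp_g_ev {T : E} (b : T ⟶ (comp p q).B) (z : T ⟶ q'.A)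
    (h : (b ≫ (hcomp c d).g) ≫ compD p' q' = z ≫ q'.n) :
    ev (b ≫ (hcomp c d).g) z h =
      ev b (d.app (b ≫ compD p q) z ((hcomp_g_D c d b).symm.trans h)) (by rw [app_n]) ≫ c.g := by
  refine (ev_liftB b _ _ _ z h).trans ?_
  rw [← Category.assoc, ← Category.assoc, Category.assoc _ (hcompK d), hcompK_elem]

theorem hcomp_app_aux {T : E} (b : T ⟶ (comp p q).B) (z : T ⟶ (comp p' q').A)
    (h : b ≫ (hcomp c d).g = z ≫ (comp p' q').n) :
    (b ≫ compD p q) ≫ d.g = (z ≫ compC p' q') ≫ q'.n := by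
  rw [← hcomp_g_D c d, h, compA_n_D]

theorem hcomp_app_aux' {T : E} (b : T ⟶ (comp p q).B) (z : T ⟶ (comp p' q').A)
    (h : b ≫ (hcomp c d).g = z ≫ (comp p' q').n) :
    ev b (d.app (b ≫ compD p q) (z ≫ compC p' q') (hcomp_app_aux c d b z h)) (by rw [app_n]) ≫
      c.g = (z ≫ compA₂ p' q') ≫ p'.n := by
  rw [← ev_compA z (compA_n_D z), ← hcomp_g_ev c d b _ (by rw [h, compA_n_D])]
  congr 1

theorem hcomp_ℓ_aux : pullback.fst (hcomp c d).g (comp p' q').n ≫ compD p q ≫ d.g =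
    ((pullback.snd (hcomp c d).g (comp p' q').n ≫ compA₁ p' q') ≫ compP₂ p' q') ≫ q'.n := by
  rw [Category.assoc _ (compA₁ p' q')]
  exact (Category.assoc _ _ _).symm.trans (hcomp_app_aux c d _ _ pullback.condition)

theorem hcomp_ℓ_compA₁ : (hcomp c d).ℓ ≫ compA₁ p q =
    pullback.lift _ _ (hcomp_ℓ_aux c d) ≫ hcompK d :=
  IsPullback.lift_fst _ _ _ _

theorem hcomp_ℓ_compA₂ : (hcomp c d).ℓ ≫ compA₂ p q = c.app
    (ev (pullback.fst _ _) (d.app (pullback.fst _ _ ≫ compD p q) (pullback.snd _ _ ≫ compC p' q')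
      (hcomp_app_aux c d _ _ pullback.condition)) (by rw [app_n]))
    (pullback.snd _ _ ≫ compA₂ p' q') (hcomp_app_aux' c d _ _ pullback.condition) := by
  refine (IsPullback.lift_snd _ _ _ _).trans (congrArg (· ≫ c.ℓ) (pullback.hom_ext
    ((pullback.lift_fst _ _ _).trans (Eq.trans ?_ (pullback.lift_fst _ _ _).symm))
    ((pullback.lift_snd _ _ _).trans (pullback.lift_snd _ _ _).symm)))
  refine (Category.assoc _ _ _).trans ((hcompK_elem d _ _ (hcomp_ℓ_aux c d)).trans ?_)
  congr 2
  rw [compC, Category.assoc]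

theorem lift_hcomp_ℓ_aux {T : E} (b : T ⟶ (comp p q).B) (z : T ⟶ (comp p' q').A)
    (h : b ≫ (hcomp c d).g = z ≫ (comp p' q').n) :
    pullback.lift b z h ≫ pullback.lift _ _ (hcomp_ℓ_aux c d) = pullback.lift b (z ≫ compC p' q')
      ((Category.assoc _ _ _).symm.trans (hcomp_app_aux c d b z h)) := by
  apply pullback.hom_ext
  · simp only [Category.assoc, pullback.lift_fst, pullback.lift_fst_assoc]
  · simp only [Category.assoc, pullback.lift_snd, pullback.lift_snd_assoc, compC]

-- The triple is computed componentwise: `d` carries back the argument, and `c` carries back the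
-- point of `p'.A` over the value of `b` at that new argument.
@[simp]
theorem hcomp_app {T : E} (b : T ⟶ (comp p q).B) (z : T ⟶ (comp p' q').A)
    (h : b ≫ (hcomp c d).g = z ≫ (comp p' q').n) :
    (hcomp c d).app b z h =
      mkA b (d.app (b ≫ compD p q) (z ≫ compC p' q') (hcomp_app_aux c d b z h))
        (c.app (ev b (d.app (b ≫ compD p q) (z ≫ compC p' q') (hcomp_app_aux c d b z h))
          (by rw [app_n])) (z ≫ compA₂ p' q') (hcomp_app_aux' c d b z h))
        (by simp only [app_n]) (by simp only [app_n]) := by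
  have h₁ : (hcomp c d).app b z h ≫ compA₁ p q = (compP_isPullback p q).lift b
      (d.app (b ≫ compD p q) (z ≫ compC p' q') (hcomp_app_aux c d b z h)) (by rw [app_n]) := by
    rw [app, Category.assoc, hcomp_ℓ_compA₁, ← Category.assoc, lift_hcomp_ℓ_aux, lift_hcompK]
  apply compA_ext
  · rw [app_n, mkA_n]
  · rw [mkA_compC, compC, ← Category.assoc, h₁, IsPullback.lift_snd]
  · rw [mkA_compA₂, app, Category.assoc]
    rw [hcomp_ℓ_compA₂, comp_app]
    congr 1
    · rw [comp_ev]
      congr 1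
      · rw [pullback.lift_fst]
      · rw [comp_app]
        congr 1
        · rw [pullback.lift_fst_assoc]
        · rw [pullback.lift_snd_assoc]
    · rw [pullback.lift_snd_assoc]

end

end NormalCell

end Poly

end SpanPoly

/-! ### Unit and associativity constraints of polynomials on elements. -/

namespace SpanPoly

namespace Poly

variable {E : Type u} [Category.{v} E] [HasPullbacks E] {L R : MorphismProperty E}
  {X Y Z W : E} [hL : IsProtocalibration L] [hR : IsProtocalibration R]

section IdElements

/-- A generalized element of `X`, as an element of `(id L R X).A`. -/
def idA (L R : MorphismProperty E) [IsProtocalibration L] [IsProtocalibration R] {T : E}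
    (x : T ⟶ X) : T ⟶ (id L R X).A := x

/-- A generalized element of `X`, as an element of `(id L R X).B`. -/
def idB (L R : MorphismProperty E) [IsProtocalibration L] [IsProtocalibration R] {T : E}
    (x : T ⟶ X) : T ⟶ (id L R X).B := x

variable {T T' : E}

@[simp] theorem idA_n (x : T ⟶ X) : idA L R x ≫ (id L R X).n = idB L R x := Category.comp_id _
@[simp] theorem idA_r (x : T ⟶ X) : idA L R x ≫ (id L R X).r = x := Category.comp_id _
@[simp] theorem idB_t (x : T ⟶ X) : idB L R x ≫ (id L R X).t = x := Category.comp_id _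
@[simp] theorem comp_idA (σ : T' ⟶ T) (x : T ⟶ X) : σ ≫ idA L R x = idA L R (σ ≫ x) := rfl
@[simp] theorem idA_eta (z : T ⟶ (id L R X).A) : idA L R (z ≫ (id L R X).r) = z :=
  Category.comp_id _
@[simp] theorem idB_eta (z : T ⟶ (id L R X).B) : idB L R (z ≫ (id L R X).t) = z :=
  Category.comp_id _
theorem id_n_t (z : T ⟶ (id L R X).A) :
    (z ≫ (id L R X).n) ≫ (id L R X).t = z ≫ (id L R X).r :=
  congrArg (· ≫ (id L R X).t) (Category.comp_id z)
theorem id_n_eq (z : T ⟶ (id L R X).A) : z ≫ (id L R X).n = idB L R (z ≫ (id L R X).r) := by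
  rw [← id_n_t, idB_eta]

end IdElements

variable [hLR : IsCompatible L R]

theorem lift_compP {p : Poly L R X Y} {q : Poly L R Y Z} {T T' : E} (σ : T' ⟶ T)
    (f : T ⟶ (comp p q).B) (c : T ⟶ q.A)
    (h : f ≫ compD p q = c ≫ q.n) : σ ≫ (compP_isPullback p q).lift f c h =
      (compP_isPullback p q).lift (σ ≫ f) (σ ≫ c) (by rw [Category.assoc, h, Category.assoc]) := by
  apply (compP_isPullback p q).hom_ext
  · rw [IsPullback.lift_fst, Category.assoc, IsPullback.lift_fst]
  · rw [IsPullback.lift_snd, Category.assoc, IsPullback.lift_snd]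

/-- `compP` is the chosen pullback under another name. The constraints unfold to `pullback.lift`,
while the rules for `ev` are phrased with the lift of `compP_isPullback`; this passes between the
two. -/
theorem pullback_lift_eq {p : Poly L R X Y} {q : Poly L R Y Z} {T : E}
    (f : T ⟶ (comp p q).B) (c : T ⟶ q.A) (h : f ≫ compD p q = c ≫ q.n) :
    pullback.lift f c h = (compP_isPullback p q).lift f c h :=
  (compP_isPullback p q).hom_ext
    ((pullback.lift_fst _ _ _).trans ((compP_isPullback p q).lift_fst _ _ _).symm)
    ((pullback.lift_snd _ _ _).trans ((compP_isPullback p q).lift_snd _ _ _).symm)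

section Unitors

variable (p : Poly L R X Y)

@[simp]
theorem leftUnitor_g {T : E} (b : T ⟶ (comp (id L R X) p).B) :
    b ≫ (leftUnitor p).g = b ≫ compD _ _ := rfl

theorem leftUnitor_ℓ_A₂ : (leftUnitor p).ℓ ≫ compA₂ (id L R X) p =
    idA L R (compEv (id L R X) p ≫ (id L R X).t) :=
  ((compA_isPullback (id L R X) p).lift_snd _ _ _).trans (Category.comp_id _).symm

theorem leftUnitor_ℓ_A₁ : (leftUnitor p).ℓ ≫ compA₁ (id L R X) p = 𝟙 _ :=
  (compA_isPullback (id L R X) p).lift_fst _ _ _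

-- The last component is forced: all legs of the identity polynomial are identities, so the value of
-- `b` at `z` is determined by `ev_t`.
@[simp]
theorem leftUnitor_app {T : E} (b : T ⟶ (comp (id L R X) p).B) (z : T ⟶ p.A)
    (h : b ≫ (leftUnitor p).g = z ≫ p.n) :
    (leftUnitor p).app b z h = mkA b z (idA L R (z ≫ p.r)) ((leftUnitor_g p b).symm.trans h) (by
      rw [idA_n, ← ev_t b z ((leftUnitor_g p b).symm.trans h), idB_eta]) := by
  have h' : b ≫ compD (id L R X) p = z ≫ p.n := h
  apply compA_ext
  · rw [NormalCell.app_n, mkA_n]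
  · rw [mkA_compC, NormalCell.app, compC, Category.assoc, ← Category.assoc _ (compA₁ _ _),
      leftUnitor_ℓ_A₁]
    exact (congrArg (pullback.lift b z h ≫ ·) (Category.id_comp _)).trans (pullback.lift_snd _ _ _)
  · rw [mkA_compA₂, NormalCell.app, Category.assoc, leftUnitor_ℓ_A₂, ← ev_t b z h',
      ← lift_compEv, ← pullback_lift_eq b z h']
    exact (comp_idA _ _).trans (congrArg (idA L R) (Category.assoc _ _ _).symm)

/-- The fibre of an identity over a point has exactly one element, which `idA` names here. The right
unit constraint is evaluation at this element. -/
theorem rightUnitor_aux {T : E} (b : T ⟶ (comp p (id L R Y)).B) :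
    b ≫ compD p (id L R Y) =
      idA L R ((b ≫ compD p (id L R Y)) ≫ (id L R Y).t) ≫ (id L R Y).n := by
  rw [idA_n, idB_eta]

theorem comp_rightUnitor_section {T : E} (b : T ⟶ (comp p (id L R Y)).B)
    (h : 𝟙 _ ≫ compD p (id L R Y) = compD p (id L R Y) ≫ (id L R Y).n) :
    b ≫ (compP_isPullback p (id L R Y)).lift (𝟙 _) (compD p (id L R Y)) h =
      (compP_isPullback p (id L R Y)).lift b _ (rightUnitor_aux p b) := by
  refine (lift_compP b (𝟙 _) _ _).trans ((compP_isPullback p (id L R Y)).hom_ext ?_ ?_)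
  · exact (IsPullback.lift_fst _ _ _ _).trans ((Category.comp_id _).trans
      (IsPullback.lift_fst _ _ _ _).symm)
  · exact (IsPullback.lift_snd _ _ _ _).trans ((Category.comp_id _).symm.trans
      (IsPullback.lift_snd _ _ _ _).symm)

@[simp]
theorem rightUnitor_g {T : E} (b : T ⟶ (comp p (id L R Y)).B) :
    b ≫ (rightUnitor p).g = ev b _ (rightUnitor_aux p b) :=
  (Category.assoc _ _ _).symm.trans (congrArg (· ≫ compEv p (id L R Y))
    (comp_rightUnitor_section p b _))

@[simp]
theorem rightUnitor_app {T : E} (b : T ⟶ (comp p (id L R Y)).B) (z : T ⟶ p.A)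
    (h : b ≫ (rightUnitor p).g = z ≫ p.n) :
    (rightUnitor p).app b z h = mkA b _ z (rightUnitor_aux p b)
      ((rightUnitor_g p b).symm.trans h) := by
  apply compA_ext
  · rw [NormalCell.app_n, mkA_n]
  · rw [mkA_compC, NormalCell.app, compC, Category.assoc, ← Category.assoc _ (compA₁ _ _)]
    refine (congrArg (fun t => pullback.lift b z h ≫ t ≫ compP₂ _ _)
      (IsPullback.lift_fst _ _ _ _)).trans ?_
    refine (congrArg (pullback.lift b z h ≫ ·) ((Category.assoc _ _ _).trans
      (congrArg (_ ≫ ·) (IsPullback.lift_snd _ _ _ _)))).trans ?_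
    exact ((Category.assoc _ _ _).symm.trans (congrArg (· ≫ compD _ _)
      (pullback.lift_fst _ _ _))).trans (Category.comp_id _).symm
  · rw [mkA_compA₂, NormalCell.app, Category.assoc]
    exact (congrArg (pullback.lift b z h ≫ ·) (IsPullback.lift_snd _ _ _ _)).trans
      (pullback.lift_snd _ _ _)

/-- The underlying morphism of the inverse of the left unit constraint. -/
noncomputable def leftUnitorInvG : p.B ⟶ (comp (id L R X) p).B :=
  liftB (𝟙 p.B) (idB L R (pullback.snd _ _ ≫ p.r)) (idB_t _)

@[simp]
theorem leftUnitorInvG_D {T : E} (b : T ⟶ p.B) : (b ≫ leftUnitorInvG p) ≫ compD _ _ = b :=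
  (liftB_D_elem b _ _ _).trans (Category.comp_id _)

/-- The inverse of the left unit constraint. -/
noncomputable def leftUnitorInv : NormalCell p (comp (id L R X) p) where
  g := leftUnitorInvG p
  ℓ := pullback.snd _ _ ≫ compC _ _
  ℓ_n := by rw [← compA_n_D, ← pullback.condition, leftUnitorInvG_D]
  ℓ_r := by rw [compA_r, ← id_n_t, ← ev_compA _ (compA_n_D _), ev_t]
  g_t := by
    have h := leftUnitorInvG_D p (𝟙 _)
    rw [Category.id_comp] at h
    rw [comp_t_elem, h, Category.id_comp]

@[simp]
theorem leftUnitorInv_g_D {T : E} (b : T ⟶ p.B) : (b ≫ (leftUnitorInv p).g) ≫ compD _ _ = b :=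
  leftUnitorInvG_D p b

@[simp]
theorem leftUnitorInv_app {T : E} (b : T ⟶ p.B) (z : T ⟶ (comp (id L R X) p).A)
    (h : b ≫ (leftUnitorInv p).g = z ≫ (comp (id L R X) p).n) :
    (leftUnitorInv p).app b z h = z ≫ compC _ _ :=
  pullback.lift_snd_assoc _ _ _ _

/-- The underlying morphism of the inverse of the right unit constraint. -/
noncomputable def rightUnitorInvG : p.B ⟶ (comp p (id L R Y)).B :=
  liftB (idB L R p.t) (pullback.fst _ _)
    (by rw [← id_n_t, ← pullback.condition, Category.assoc, idB_t])

theorem rightUnitorInvG_D {T : E} (b : T ⟶ p.B) :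
    (b ≫ rightUnitorInvG p) ≫ compD _ _ = idB L R (b ≫ p.t) :=
  liftB_D_elem b _ _ _

theorem rightUnitorInvG_ev {T : E} (b : T ⟶ p.B) (c : T ⟶ (id L R Y).A)
    (h : (b ≫ rightUnitorInvG p) ≫ compD _ _ = c ≫ (id L R Y).n) :
    ev (b ≫ rightUnitorInvG p) c h = b :=
  (ev_liftB b _ _ _ c h).trans (pullback.lift_fst _ _ _)

/-- The inverse of the right unit constraint. -/
noncomputable def rightUnitorInv : NormalCell p (comp p (id L R Y)) where
  g := rightUnitorInvG p
  ℓ := pullback.snd _ _ ≫ compA₂ _ _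
  ℓ_n := by
    rw [← ev_compA _ (compA_n_D _)]
    simp only [← pullback.condition]
    rw [rightUnitorInvG_ev]
  ℓ_r := by rw [compA_r]
  g_t := by
    have h := rightUnitorInvG_D p (𝟙 _)
    rw [Category.id_comp, Category.id_comp] at h
    rw [comp_t_elem, h, idB_t]

@[simp]
theorem rightUnitorInv_g_D {T : E} (b : T ⟶ p.B) :
    (b ≫ (rightUnitorInv p).g) ≫ compD _ _ = idB L R (b ≫ p.t) :=
  rightUnitorInvG_D p b

@[simp]
theorem rightUnitorInv_g_ev {T : E} (b : T ⟶ p.B) (c : T ⟶ (id L R Y).A)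
    (h : (b ≫ (rightUnitorInv p).g) ≫ compD _ _ = c ≫ (id L R Y).n) :
    ev (b ≫ (rightUnitorInv p).g) c h = b :=
  rightUnitorInvG_ev p b c h

@[simp]
theorem rightUnitorInv_app {T : E} (b : T ⟶ p.B) (z : T ⟶ (comp p (id L R Y)).A)
    (h : b ≫ (rightUnitorInv p).g = z ≫ (comp p (id L R Y)).n) :
    (rightUnitorInv p).app b z h = z ≫ compA₂ _ _ :=
  pullback.lift_snd_assoc _ _ _ _

end Unitors

section Associator

variable (p : Poly L R X Y) (q : Poly L R Y Z) (s : Poly L R Z W)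

/-- The composite of the underlying morphism of the associator with `compD`. -/
noncomputable def associatorD : (comp (comp p q) s).B ⟶ (comp q s).B :=
  liftB (compD (comp p q) s)
    ((show pullback (compD (comp p q) s) s.n ⟶ (comp p q).B from compEv (comp p q) s) ≫ compD p q)
    ((Category.assoc _ _ _).trans (compEv_t (comp p q) s))

theorem associator_g_compD {T : E} (b : T ⟶ (comp (comp p q) s).B) :
    (b ≫ (associator p q s).g) ≫ compD p (comp q s) = b ≫ associatorD p q s :=
  liftB_D_elem b _ _ _

theorem associatorD_D {T : E} (b : T ⟶ (comp (comp p q) s).B) :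
    (b ≫ associatorD p q s) ≫ compD q s = b ≫ compD (comp p q) s :=
  liftB_D_elem b _ _ _

/-- A value of `b` is itself a function into `p.B` over a point of `q.B`; `associatorD` forgets the
function and keeps the point. -/
theorem associatorD_ev {T : E} (b : T ⟶ (comp (comp p q) s).B) (c : T ⟶ s.A)
    (h : (b ≫ associatorD p q s) ≫ compD q s = c ≫ s.n) :
    ev (b ≫ associatorD p q s) c h =
      ev b c ((associatorD_D p q s b).symm.trans h) ≫ compD p q := by
  have h' : b ≫ compD (comp p q) s = c ≫ s.n := (associatorD_D p q s b).symm.trans h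
  refine (ev_liftB b _ _ _ c h).trans ?_
  rw [← lift_compEv]
  refine Eq.trans ?_ (congrArg (fun t => (t ≫ compEv (comp p q) s) ≫ compD p q)
    (pullback_lift_eq b c h'))
  exact (Category.assoc _ _ _).symm

theorem associator_aux₁ {T : E} (b : T ⟶ (comp (comp p q) s).B) (z : T ⟶ (comp q s).A)
    (h : b ≫ associatorD p q s = z ≫ (comp q s).n) :
    b ≫ compD (comp p q) s = (z ≫ compC q s) ≫ s.n := by
  rw [← compA_n_D, ← h, associatorD_D]

theorem associator_aux₂ {T : E} (b : T ⟶ (comp (comp p q) s).B) (z : T ⟶ (comp q s).A)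
    (h : b ≫ associatorD p q s = z ≫ (comp q s).n) :
    ev b (z ≫ compC q s) (associator_aux₁ p q s b z h) ≫ compD p q = (z ≫ compA₂ q s) ≫ q.n := by
  rw [← associatorD_ev p q s b _ (by rw [h, compA_n_D]), ← ev_compA z (compA_n_D z)]
  congr 1

@[simp]
theorem associator_g_D {T : E} (b : T ⟶ (comp (comp p q) s).B) :
    ((b ≫ (associator p q s).g) ≫ compD p (comp q s)) ≫ compD q s = b ≫ compD (comp p q) s := by
  rw [associator_g_compD, associatorD_D]

@[simp]
theorem associator_g_D_ev {T : E} (b : T ⟶ (comp (comp p q) s).B) (c : T ⟶ s.A)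
    (h : ((b ≫ (associator p q s).g) ≫ compD p (comp q s)) ≫ compD q s = c ≫ s.n) :
    ev ((b ≫ (associator p q s).g) ≫ compD p (comp q s)) c h =
      ev b c ((associator_g_D p q s b).symm.trans h) ≫ compD p q := by
  simp only [associator_g_compD, associatorD_ev]

-- Uncurrying: the argument `z` of `comp q s` consists of an argument in `s.A` and one in `q.A`, and
-- `b` is evaluated at these in turn.
@[simp]
theorem associator_g_ev {T : E} (b : T ⟶ (comp (comp p q) s).B) (z : T ⟶ (comp q s).A)
    (h : (b ≫ (associator p q s).g) ≫ compD p (comp q s) = z ≫ (comp q s).n) :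
    ev (b ≫ (associator p q s).g) z h =
      ev (ev b (z ≫ compC q s)
          (associator_aux₁ p q s b z ((associator_g_compD p q s b).symm.trans h)))
        (z ≫ compA₂ q s)
        (associator_aux₂ p q s b z ((associator_g_compD p q s b).symm.trans h)) := by
  refine (ev_liftB b _ _ _ z h).trans ?_
  refine (Category.assoc _ _ _).symm.trans (congrArg (· ≫ compEv p q) ?_)
  refine (lift_compP _ _ _ _).trans ((compP_isPullback p q).hom_ext ?_ ?_)
  · rw [IsPullback.lift_fst, IsPullback.lift_fst, ← Category.assoc, ← lift_compEv]
    refine congrArg (· ≫ compEv (comp p q) s) ?_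
    refine (lift_compP _ _ _ _).trans ((compP_isPullback (comp p q) s).hom_ext ?_ ?_)
    · rw [IsPullback.lift_fst, IsPullback.lift_fst]
      exact pullback.lift_fst _ _ _
    · rw [IsPullback.lift_snd, IsPullback.lift_snd, compC]
      simp only [← Category.assoc]
      exact congrArg (fun t => (t ≫ compA₁ q s) ≫ compP₂ q s) (pullback.lift_snd _ _ _)
  · rw [IsPullback.lift_snd, IsPullback.lift_snd, ← Category.assoc]
    exact congrArg (· ≫ compA₂ q s) (pullback.lift_snd _ _ _)

theorem associator_aux₃ {T : E} (b : T ⟶ (comp (comp p q) s).B) (z : T ⟶ (comp p (comp q s)).A)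
    (h : b ≫ (associator p q s).g = z ≫ (comp p (comp q s)).n) :
    b ≫ associatorD p q s = (z ≫ compC p (comp q s)) ≫ (comp q s).n := by
  rw [← associator_g_compD, h, compA_n_D]

theorem associator_aux₄ {T : E} (b : T ⟶ (comp (comp p q) s).B) (z : T ⟶ (comp p (comp q s)).A)
    (h : b ≫ (associator p q s).g = z ≫ (comp p (comp q s)).n) :
    ev (ev b ((z ≫ compC p (comp q s)) ≫ compC q s)
        (associator_aux₁ p q s b _ (associator_aux₃ p q s b z h)))
      ((z ≫ compC p (comp q s)) ≫ compA₂ q s)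
      (associator_aux₂ p q s b _ (associator_aux₃ p q s b z h)) =
      (z ≫ compA₂ p (comp q s)) ≫ p.n := by
  rw [← associator_g_ev p q s b _ (by rw [h, compA_n_D]), ← ev_compA z (compA_n_D z)]
  congr 1

theorem associator_ℓ_compA₁ : (associator p q s).ℓ ≫ compA₁ (comp p q) s =
    (compP_isPullback (comp p q) s).lift _ _ (associator_aux₁ p q s _ _
      (associator_aux₃ p q s _ _ pullback.condition)) := by
  refine (IsPullback.lift_fst _ _ _ _).trans ((compP_isPullback (comp p q) s).hom_ext ?_ ?_)
  · refine (Category.assoc _ _ _).trans ((congrArg (_ ≫ ·) (IsPullback.lift_fst _ _ _ _)).trans ?_)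
    exact (pullback.lift_fst _ _ _).trans (IsPullback.lift_fst _ _ _ _).symm
  · refine (Category.assoc _ _ _).trans ((congrArg (_ ≫ ·) (IsPullback.lift_snd _ _ _ _)).trans ?_)
    refine Eq.trans ?_ (IsPullback.lift_snd _ _ _ _).symm
    refine Eq.trans ?_ (congrArg (_ ≫ ·) (compC.eq_1 q s)).symm
    have key : ∀ {A B C D F : E} (f₁ : A ⟶ B) (f₂ : B ⟶ C) (f₃ : C ⟶ D) (f₄ : D ⟶ F),
        f₁ ≫ (f₂ ≫ f₃) ≫ f₄ = ((f₁ ≫ f₂) ≫ f₃) ≫ f₄ := by simp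
    have key' : ∀ {A B C D F G : E} (f₁ : A ⟶ B) (f₂ : B ⟶ C) (f₃ : C ⟶ D) (f₄ : D ⟶ F)
        (f₅ : F ⟶ G), (((f₁ ≫ f₂) ≫ f₃) ≫ f₄) ≫ f₅ = (f₁ ≫ f₂ ≫ f₃) ≫ f₄ ≫ f₅ := by simp
    refine (key _ _ _ _).trans ?_
    refine (congrArg (fun t => (t ≫ compA₁ q s) ≫ compP₂ q s) (pullback.lift_snd _ _ _)).trans ?_
    exact key' _ _ _ _ _

theorem associator_ℓ_compA₂ : (associator p q s).ℓ ≫ compA₂ (comp p q) s =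
    mkA _ _ _ (associator_aux₂ p q s _ _ (associator_aux₃ p q s _ _ pullback.condition))
      (associator_aux₄ p q s _ _ pullback.condition) := by
  refine (IsPullback.lift_snd _ _ _ _).trans ((compA_isPullback p q).hom_ext ?_ ?_)
  · refine Eq.trans ?_ (mkA_compA₁ _ _ _ _ _).symm
    refine (IsPullback.lift_fst _ _ _ _).trans ((compP_isPullback p q).hom_ext ?_ ?_)
    · refine Eq.trans ?_ (Eq.trans (congrArg (· ≫ compEv (comp p q) s)
        (associator_ℓ_compA₁ p q s)) (IsPullback.lift_fst _ _ _ _).symm)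
      refine (Category.assoc _ _ _).trans ((congrArg (_ ≫ ·)
        (IsPullback.lift_fst _ _ _ _)).trans ?_)
      refine (Category.assoc _ _ _).symm.trans (congrArg (· ≫ compEv (comp p q) s) ?_)
      exact (IsPullback.lift_fst _ _ _ _).symm
    · refine Eq.trans ?_ (IsPullback.lift_snd _ _ _ _).symm
      refine (Category.assoc _ _ _).trans ((congrArg (_ ≫ ·)
        (IsPullback.lift_snd _ _ _ _)).trans ?_)
      refine (Category.assoc _ _ _).symm.trans (congrArg (· ≫ compA₂ q s) ?_)
      exact (pullback.lift_snd _ _ _).trans (Category.assoc _ _ _)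
  · exact (IsPullback.lift_snd _ _ _ _).trans (mkA_compA₂ _ _ _ _ _).symm

-- Tuples are only regrouped: the arguments in `s.A` and `q.A` and the point of `p.A` stay the same.
@[simp]
theorem associator_app {T : E} (b : T ⟶ (comp (comp p q) s).B) (z : T ⟶ (comp p (comp q s)).A)
    (h : b ≫ (associator p q s).g = z ≫ (comp p (comp q s)).n) :
    (associator p q s).app b z h =
      mkA b ((z ≫ compC p (comp q s)) ≫ compC q s)
        (mkA (ev b ((z ≫ compC p (comp q s)) ≫ compC q s)
            (associator_aux₁ p q s b _ (associator_aux₃ p q s b z h)))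
          ((z ≫ compC p (comp q s)) ≫ compA₂ q s) (z ≫ compA₂ p (comp q s))
          (associator_aux₂ p q s b _ (associator_aux₃ p q s b z h))
          (associator_aux₄ p q s b z h))
        (associator_aux₁ p q s b _ (associator_aux₃ p q s b z h)) (by rw [mkA_n]) := by
  apply compA_ext
  · rw [NormalCell.app_n, mkA_n]
  · rw [mkA_compC, NormalCell.app, compC.eq_1 (comp p q) s, Category.assoc,
      ← Category.assoc _ (compA₁ _ _), associator_ℓ_compA₁, IsPullback.lift_snd]
    simp only [← Category.assoc, pullback.lift_snd]
  · rw [mkA_compA₂, NormalCell.app, Category.assoc, associator_ℓ_compA₂]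
    simp only [comp_mkA, comp_ev, ← Category.assoc, pullback.lift_snd, pullback.lift_fst]

end Associator

end Poly

end SpanPoly

/-! ### The bicategory laws for morphisms of polynomials. -/

namespace SpanPoly

namespace Poly

variable {E : Type u} [Category.{v} E] [HasPullbacks E] {L R : MorphismProperty E}
  {X Y Z W V : E}

namespace NormalCell

theorem id_vcomp {p q : Poly L R X Y} (c : NormalCell p q) : (NormalCell.id p).vcomp c = c := by
  -- Bracketing to the left presents every composite as an element to which morphisms are applied
  -- one at a time, the form in which the rules on elements are stated.
  apply ext_elements <;> intros <;> simp [← Category.assoc]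

theorem vcomp_id {p q : Poly L R X Y} (c : NormalCell p q) : c.vcomp (NormalCell.id q) = c := by
  apply ext_elements <;> intros <;> simp [← Category.assoc]

theorem vcomp_assoc {p q s t : Poly L R X Y} (c : NormalCell p q) (d : NormalCell q s)
    (e : NormalCell s t) : (c.vcomp d).vcomp e = c.vcomp (d.vcomp e) := by
  apply ext_elements <;> intros <;> simp [← Category.assoc]

variable [hL : IsProtocalibration L] [hR : IsProtocalibration R] [hLR : IsCompatible L R]

/-- Combines `ext_elements` with `compB_ext`. As the hypotheses hold at all stages, the change of
stage in `compB_ext` is absorbed into `b`. -/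
theorem ext_comp {s : Poly L R X Z} {p : Poly L R X Y} {q : Poly L R Y Z}
    {c c' : NormalCell s (comp p q)}
    (hD : ∀ {T : E} (b : T ⟶ s.B), (b ≫ c.g) ≫ compD p q = (b ≫ c'.g) ≫ compD p q)
    (hev : ∀ {T : E} (b : T ⟶ s.B) (z : T ⟶ q.A) (h : (b ≫ c.g) ≫ compD p q = z ≫ q.n)
      (h' : (b ≫ c'.g) ≫ compD p q = z ≫ q.n), ev (b ≫ c.g) z h = ev (b ≫ c'.g) z h')
    (happ : ∀ {T : E} (b : T ⟶ s.B) (z : T ⟶ (comp p q).A) (h : b ≫ c.g = z ≫ (comp p q).n)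
      (h' : b ≫ c'.g = z ≫ (comp p q).n), c.app b z h = c'.app b z h') : c = c' := by
  refine ext_elements (fun b => compB_ext (hD b) fun σ z h h' => ?_) happ
  rw [← Category.assoc] at h h'
  simpa only [← Category.assoc] using hev (σ ≫ b) z h h'

theorem id_hcomp_id (p : Poly L R X Y) (q : Poly L R Y Z) :
    hcomp (NormalCell.id p) (NormalCell.id q) = NormalCell.id (comp p q) := by
  apply ext_comp
  · intros; simp [← Category.assoc]
  · intros; simp [← Category.assoc]
  · intro T b z h h'
    -- As the identity acts trivially, `h'` expresses `b` through the components of `z`.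
    rw [id_g] at h'
    apply compA_ext <;> simp [← Category.assoc, h']

theorem vcomp_hcomp_vcomp {p p' p'' : Poly L R X Y} {q q' q'' : Poly L R Y Z}
    (c : NormalCell p p') (c' : NormalCell p' p'') (d : NormalCell q q') (d' : NormalCell q' q'') :
    hcomp (c.vcomp c') (d.vcomp d') = (hcomp c d).vcomp (hcomp c' d') := by
  apply ext_comp
  · intros; simp [← Category.assoc]
  · intros; simp [← Category.assoc]
  · intros; apply compA_ext <;> simp [← Category.assoc]


/-- Naturality in the three variables at once; identities in two of them give the separate
naturality laws. -/
theorem associator_naturality {p p' : Poly L R X Y} {q q' : Poly L R Y Z} {s s' : Poly L R Z W}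
    (c : NormalCell p p') (d : NormalCell q q') (e : NormalCell s s') :
    (hcomp (hcomp c d) e).vcomp (associator p' q' s') =
      (associator p q s).vcomp (hcomp c (hcomp d e)) := by
  apply ext_comp
  · intro T b
    apply compB_ext
    · simp [← Category.assoc]
    · intros; simp [← Category.assoc]
  · intros; simp [← Category.assoc]
  · intro T b z h h'
    apply compA_ext
    · simp [← Category.assoc]
    · simp [← Category.assoc]
    · apply compA_ext <;> simp [← Category.assoc]

@[simp]
theorem ev_compD_t {p : Poly L R X Y} {q : Poly L R Y Z} {s : Poly L R Z W} {T : E}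
    (b : T ⟶ (comp (comp p q) s).B) (z : T ⟶ s.A) (h : b ≫ compD _ _ = z ≫ s.n) :
    (ev b z h ≫ compD p q) ≫ q.t = z ≫ s.r := by
  rw [← comp_t_elem, ev_t]

@[simp]
theorem ev_id_left {p : Poly L R X Y} {T : E} (b : T ⟶ (comp (Poly.id L R X) p).B) (z : T ⟶ p.A)
    (h : b ≫ compD _ _ = z ≫ p.n) : ev b z h = idB L R (z ≫ p.r) := by
  rw [← ev_t b z h, idB_eta]

/-- The middle leg of the identity polynomial is an identity, so the point of its domain coincides
with the value of the function, which `ev_id_left` computes. -/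
theorem compA₂_id_left {p : Poly L R X Y} {T : E} (z : T ⟶ (comp (Poly.id L R X) p).A) :
    z ≫ compA₂ _ _ = idA L R ((z ≫ compC _ _) ≫ p.r) := by
  have h := ev_compA z (compA_n_D z)
  rw [ev_id_left, id_n_eq] at h
  simpa [-Category.assoc] using congrArg (fun t => idA L R (t ≫ (Poly.id L R X).t)) h.symm

/-- Uniqueness of the argument over a point of the identity polynomial, needed to compare an
arbitrary argument with the one used by the right unit constraint. -/
theorem eq_idA_of_compD {p : Poly L R X Y} {T : E} (b : T ⟶ (comp p (Poly.id L R Y)).B)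
    (z : T ⟶ (Poly.id L R Y).A) (h : b ≫ compD _ _ = z ≫ (Poly.id L R Y).n) :
    z = idA L R ((b ≫ compD _ _) ≫ (Poly.id L R Y).t) := by
  rw [h, id_n_t, idA_eta]

theorem leftUnitor_naturality {p q : Poly L R X Y} (c : NormalCell p q) :
    (hcomp (NormalCell.id (Poly.id L R X)) c).vcomp (leftUnitor q) = (leftUnitor p).vcomp c := by
  apply ext_elements
  · intros; simp [← Category.assoc]
  · intros; apply compA_ext <;> simp [← Category.assoc]

theorem rightUnitor_naturality {p q : Poly L R X Y} (c : NormalCell p q) :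
    (hcomp c (NormalCell.id (Poly.id L R Y))).vcomp (rightUnitor q) = (rightUnitor p).vcomp c := by
  apply ext_elements
  · intros; simp [← Category.assoc]
  · intros; apply compA_ext <;> simp [← Category.assoc]

/-- Both composites only regroup arguments. Extensionality is applied at each level of the nested
functions and tuples, after which corresponding components coincide. -/
theorem pentagon (p : Poly L R X Y) (q : Poly L R Y Z) (s : Poly L R Z W) (t : Poly L R W V) :
    (hcomp (associator p q s) (NormalCell.id t)).vcomp ((associator p (comp q s) t).vcomp
      (hcomp (NormalCell.id p) (associator q s t))) =
    (associator (comp p q) s t).vcomp (associator p q (comp s t)) := by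
  apply ext_comp
  · intro T b
    apply compB_ext
    · apply compB_ext
      · simp [← Category.assoc]
      · intros; simp [← Category.assoc]
    · intros; simp [← Category.assoc]
  · intros; simp [← Category.assoc]
  · intro T b z h h'
    apply compA_ext
    · simp [← Category.assoc]
    · simp [← Category.assoc]
    · apply compA_ext
      · simp [← Category.assoc]
      · simp [← Category.assoc]
      · apply compA_ext <;> simp [← Category.assoc]

theorem triangle (p : Poly L R X Y) (q : Poly L R Y Z) :
    (associator p (Poly.id L R Y) q).vcomp (hcomp (NormalCell.id p) (leftUnitor q)) =
      hcomp (rightUnitor p) (NormalCell.id q) := by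
  apply ext_comp
  · intros; simp [← Category.assoc]
  · intros; simp [← Category.assoc]
  · intro T b z h h'
    apply compA_ext
    · simp [← Category.assoc]
    · simp [← Category.assoc]
    · apply compA_ext <;> simp [← Category.assoc]

theorem leftUnitor_vcomp_inv (p : Poly L R X Y) :
    (leftUnitor p).vcomp (leftUnitorInv p) = NormalCell.id _ := by
  apply ext_comp
  · intros; simp [← Category.assoc]
  · intros; simp [← Category.assoc]
  · intro T b z h h'
    rw [id_g] at h'
    apply compA_ext <;> simp [← Category.assoc, h', compA₂_id_left]

theorem leftUnitorInv_vcomp (p : Poly L R X Y) :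
    (leftUnitorInv p).vcomp (leftUnitor p) = NormalCell.id _ := by
  apply ext_elements <;> intros <;> simp [← Category.assoc]

theorem rightUnitor_vcomp_inv (p : Poly L R X Y) :
    (rightUnitor p).vcomp (rightUnitorInv p) = NormalCell.id _ := by
  apply ext_comp
  · intros; simp [← Category.assoc]
  · intro T b z h h'
    rw [id_g] at h'
    simp [← Category.assoc, ← eq_idA_of_compD b z h']
  · intro T b z h h'
    rw [id_g] at h'
    apply compA_ext <;> simp [← Category.assoc, h', id_n_t]

theorem rightUnitorInv_vcomp (p : Poly L R X Y) :
    (rightUnitorInv p).vcomp (rightUnitor p) = NormalCell.id _ := by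
  apply ext_elements <;> intros <;> simp [← Category.assoc]

section AssociatorInverse

variable (p : Poly L R X Y) (q : Poly L R Y Z) (s : Poly L R Z W)

/-- Side conditions for currying: an argument `c`, and at a later stage an `a` in the fibre over the
value at `c`, form an argument of `comp q s`. The second part quantifies over proofs of the first
because `ev` carries such a proof. -/
theorem associatorInv_aux {T T' : E} (b : T ⟶ (comp p (comp q s)).B) (c : T ⟶ s.A)
    (h : b ≫ compD p (comp q s) ≫ compD q s = c ≫ s.n) (σ : T' ⟶ T) (a : T' ⟶ q.A)
    (h' : σ ≫ ev (b ≫ compD p (comp q s)) c ((Category.assoc _ _ _).trans h) = a ≫ q.n) :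
    ((σ ≫ b) ≫ compD p (comp q s)) ≫ compD q s = (σ ≫ c) ≫ s.n ∧
    ∀ h'', ev ((σ ≫ b) ≫ compD p (comp q s)) (σ ≫ c) h'' = a ≫ q.n := by
  refine ⟨by simp only [Category.assoc, h], fun h'' => ?_⟩
  simpa [← Category.assoc] using h'

/-- The evaluation defining the inverse of the associator. -/
noncomputable def associatorInvEv :
    pullback (compD p (comp q s) ≫ compD q s) s.n ⟶ (comp p q).B :=
  liftB (ev (pullback.fst _ _ ≫ compD p (comp q s)) (pullback.snd _ _)
      ((Category.assoc _ _ _).trans pullback.condition))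
    (ev (pullback.fst _ _ ≫ pullback.fst _ _)
      (mkA ((pullback.fst _ _ ≫ pullback.fst _ _) ≫ compD p (comp q s))
        (pullback.fst _ _ ≫ pullback.snd _ _) (pullback.snd _ _)
        (associatorInv_aux p q s _ _ pullback.condition _ _ pullback.condition).1
        ((associatorInv_aux p q s _ _ pullback.condition _ _ pullback.condition).2 _))
      (mkA_n _ _ _ _ _).symm)
    (by rw [ev_t, compA_r, mkA_compA₂])

theorem associatorInvEv_D {T : E} (b : T ⟶ (comp p (comp q s)).B) (c : T ⟶ s.A)
    (h : b ≫ compD p (comp q s) ≫ compD q s = c ≫ s.n) :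
    (pullback.lift b c h ≫ associatorInvEv p q s) ≫ compD p q =
      ev (b ≫ compD p (comp q s)) c ((Category.assoc _ _ _).trans h) := by
  refine (liftB_D_elem _ _ _ _).trans ?_
  rw [comp_ev]
  congr 1
  · rw [pullback.lift_fst_assoc]
  · rw [pullback.lift_snd]

theorem associatorInvEv_ev {T : E} (b : T ⟶ (comp p (comp q s)).B) (c : T ⟶ s.A)
    (h : b ≫ compD p (comp q s) ≫ compD q s = c ≫ s.n) (a : T ⟶ q.A)
    (h' : (pullback.lift b c h ≫ associatorInvEv p q s) ≫ compD p q = a ≫ q.n) :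
    ev (pullback.lift b c h ≫ associatorInvEv p q s) a h' =
      ev b (mkA (b ≫ compD p (comp q s)) c a ((Category.assoc _ _ _).trans h)
        ((associatorInvEv_D p q s b c h).symm.trans h')) (mkA_n _ _ _ _ _).symm := by
  refine (ev_liftB _ _ _ _ _ _).trans ?_
  simp only [comp_ev, comp_mkA, ← Category.assoc, pullback.lift_fst, pullback.lift_snd]

/-- The underlying morphism of the inverse of the associator. -/
noncomputable def associatorInvG : (comp p (comp q s)).B ⟶ (comp (comp p q) s).B :=
  liftB (p := comp p q) (compD p (comp q s) ≫ compD q s) (associatorInvEv p q s) (by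
    have h := associatorInvEv_D p q s (pullback.fst _ _) (pullback.snd _ _) pullback.condition
    -- The projections pair to the identity, so `h` describes `associatorInvEv` itself.
    rw [show pullback.lift _ _ pullback.condition = 𝟙 _ from
      pullback.hom_ext (by simp) (by simp), Category.id_comp] at h
    rw [comp_t_elem, h, ev_t])

theorem associatorInvG_D {T : E} (b : T ⟶ (comp p (comp q s)).B) :
    (b ≫ associatorInvG p q s) ≫ compD (comp p q) s = (b ≫ compD p (comp q s)) ≫ compD q s :=
  (liftB_D_elem _ _ _ _).trans (Category.assoc _ _ _).symm

theorem associatorInvG_ev {T : E} (b : T ⟶ (comp p (comp q s)).B) (c : T ⟶ s.A)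
    (h : (b ≫ associatorInvG p q s) ≫ compD (comp p q) s = c ≫ s.n) :
    ev (b ≫ associatorInvG p q s) c h =
      pullback.lift b c ((Category.assoc _ _ _).symm.trans
        ((associatorInvG_D p q s b).symm.trans h)) ≫ associatorInvEv p q s :=
  ev_liftB _ _ _ _ _ _

theorem associatorInvG_ev_D {T : E} (b : T ⟶ (comp p (comp q s)).B) (c : T ⟶ s.A)
    (h : (b ≫ associatorInvG p q s) ≫ compD (comp p q) s = c ≫ s.n) :
    ev (b ≫ associatorInvG p q s) c h ≫ compD p q =
      ev (b ≫ compD p (comp q s)) c ((associatorInvG_D p q s b).symm.trans h) := by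
  rw [associatorInvG_ev, associatorInvEv_D]

/-- Currying: evaluation at `c` and then at `a` is evaluation of `b` at the pair of `c` and `a`.
With `associatorInvG_ev_D` it determines the inverse associator on vertices. -/
theorem associatorInvG_ev_ev {T : E} (b : T ⟶ (comp p (comp q s)).B) (c : T ⟶ s.A)
    (h : (b ≫ associatorInvG p q s) ≫ compD (comp p q) s = c ≫ s.n) (a : T ⟶ q.A)
    (h' : ev (b ≫ associatorInvG p q s) c h ≫ compD p q = a ≫ q.n) :
    ev (ev (b ≫ associatorInvG p q s) c h) a h' =
      ev b (mkA (b ≫ compD p (comp q s)) c a ((associatorInvG_D p q s b).symm.trans h)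
        ((associatorInvG_ev_D p q s b c h).symm.trans h')) (mkA_n _ _ _ _ _).symm := by
  simp only [associatorInvG_ev]
  exact associatorInvEv_ev p q s b c _ a _

theorem associatorInv_aux₁ {T : E} (b : T ⟶ (comp p (comp q s)).B)
    (z : T ⟶ (comp (comp p q) s).A) (h : b ≫ associatorInvG p q s = z ≫ (comp (comp p q) s).n) :
    (b ≫ compD p (comp q s)) ≫ compD q s = (z ≫ compC (comp p q) s) ≫ s.n := by
  rw [← associatorInvG_D, h, compA_n_D]

theorem associatorInv_aux₂ {T : E} (b : T ⟶ (comp p (comp q s)).B)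
    (z : T ⟶ (comp (comp p q) s).A) (h : b ≫ associatorInvG p q s = z ≫ (comp (comp p q) s).n) :
    ev (b ≫ compD p (comp q s)) (z ≫ compC (comp p q) s) (associatorInv_aux₁ p q s b z h) =
      ((z ≫ compA₂ (comp p q) s) ≫ compC p q) ≫ q.n := by
  rw [← compA_n_D, ← ev_compA _ (compA_n_D _),
    ← associatorInvG_ev_D p q s b _ (by rw [h, compA_n_D])]
  congr 2

theorem associatorInv_aux₃ {T : E} (b : T ⟶ (comp p (comp q s)).B)
    (z : T ⟶ (comp (comp p q) s).A) (h : b ≫ associatorInvG p q s = z ≫ (comp (comp p q) s).n) :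
    ev b (mkA (b ≫ compD p (comp q s)) (z ≫ compC (comp p q) s)
        ((z ≫ compA₂ (comp p q) s) ≫ compC p q) (associatorInv_aux₁ p q s b z h)
        (associatorInv_aux₂ p q s b z h)) (mkA_n _ _ _ _ _).symm =
      ((z ≫ compA₂ (comp p q) s) ≫ compA₂ p q) ≫ p.n := by
  have h₁ : (b ≫ associatorInvG p q s) ≫ compD (comp p q) s = (z ≫ compC (comp p q) s) ≫ s.n := by
    rw [h, compA_n_D]
  have h₂ : ev (b ≫ associatorInvG p q s) (z ≫ compC (comp p q) s) h₁ =
      (z ≫ compA₂ (comp p q) s) ≫ (comp p q).n := by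
    rw [← ev_compA _ (compA_n_D _)]
    congr 1
  rw [← ev_compA _ (compA_n_D _), ← associatorInvG_ev_ev p q s b _ h₁ _ (by rw [h₂, compA_n_D])]
  congr 1

/-- The inverse of the associator. -/
noncomputable def associatorInv : NormalCell (comp p (comp q s)) (comp (comp p q) s) where
  g := associatorInvG p q s
  ℓ := mkA _ _ _ (mkA_n _ _ _ _ _).symm (associatorInv_aux₃ p q s _ _ pullback.condition)
  ℓ_n := mkA_n _ _ _ _ _
  ℓ_r := by rw [compA_r, mkA_compA₂, compA_r, compA_r]
  g_t := by
    have h := associatorInvG_D p q s (𝟙 _)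
    rw [Category.id_comp, Category.id_comp] at h
    rw [comp_t_elem, h, comp_t p, comp_t q, Category.assoc]

@[simp]
theorem associatorInv_g_D {T : E} (b : T ⟶ (comp p (comp q s)).B) :
    (b ≫ (associatorInv p q s).g) ≫ compD (comp p q) s = (b ≫ compD p (comp q s)) ≫ compD q s :=
  associatorInvG_D p q s b

@[simp]
theorem associatorInv_g_ev_D {T : E} (b : T ⟶ (comp p (comp q s)).B) (c : T ⟶ s.A)
    (h : (b ≫ (associatorInv p q s).g) ≫ compD (comp p q) s = c ≫ s.n) :
    ev (b ≫ (associatorInv p q s).g) c h ≫ compD p q =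
      ev (b ≫ compD p (comp q s)) c ((associatorInvG_D p q s b).symm.trans h) :=
  associatorInvG_ev_D p q s b c h

@[simp]
theorem associatorInv_g_ev_ev {T : E} (b : T ⟶ (comp p (comp q s)).B) (c : T ⟶ s.A)
    (h : (b ≫ (associatorInv p q s).g) ≫ compD (comp p q) s = c ≫ s.n) (a : T ⟶ q.A)
    (h' : ev (b ≫ (associatorInv p q s).g) c h ≫ compD p q = a ≫ q.n) :
    ev (ev (b ≫ (associatorInv p q s).g) c h) a h' =
      ev b (mkA (b ≫ compD p (comp q s)) c a ((associatorInvG_D p q s b).symm.trans h)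
        ((associatorInvG_ev_D p q s b c h).symm.trans h')) (mkA_n _ _ _ _ _).symm :=
  associatorInvG_ev_ev p q s b c h a h'

@[simp]
theorem associatorInv_app {T : E} (b : T ⟶ (comp p (comp q s)).B)
    (z : T ⟶ (comp (comp p q) s).A)
    (h : b ≫ (associatorInv p q s).g = z ≫ (comp (comp p q) s).n) :
    (associatorInv p q s).app b z h =
      mkA b (mkA (b ≫ compD p (comp q s)) (z ≫ compC (comp p q) s)
        ((z ≫ compA₂ (comp p q) s) ≫ compC p q) (associatorInv_aux₁ p q s b z h)
        (associatorInv_aux₂ p q s b z h)) ((z ≫ compA₂ (comp p q) s) ≫ compA₂ p q)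
        (mkA_n _ _ _ _ _).symm (associatorInv_aux₃ p q s b z h) := by
  have h' : b ≫ associatorInvG p q s = z ≫ (comp (comp p q) s).n := h
  change pullback.lift b z h' ≫ mkA _ _ _ (mkA_n _ _ _ _ _).symm
    (associatorInv_aux₃ p q s _ _ pullback.condition) = _
  simp only [comp_mkA, ← Category.assoc, pullback.lift_fst, pullback.lift_snd]

theorem associator_vcomp_inv :
    (associator p q s).vcomp (associatorInv p q s) = NormalCell.id _ := by
  apply ext_comp
  · intros; simp [← Category.assoc]
  · intros
    apply compB_ext
    · simp [← Category.assoc]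
    · intros; simp [← Category.assoc]
  · intro T b z h h'
    rw [id_g] at h'
    apply compA_ext
    · simp [← Category.assoc, h']
    · simp [← Category.assoc]
    · apply compA_ext <;> simp [← Category.assoc, h']

theorem associatorInv_vcomp :
    (associatorInv p q s).vcomp (associator p q s) = NormalCell.id _ := by
  apply ext_comp
  · intro T b
    apply compB_ext
    · simp [← Category.assoc]
    · intros; simp [← Category.assoc]
  · intro T b z h h'
    simp [← Category.assoc]
    congr 1
    apply compA_ext <;> simp [← Category.assoc]
    simpa using h'
  · intro T b z h h'
    rw [id_g] at h'
    apply compA_ext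
    · simp [← Category.assoc, h']
    · apply compA_ext <;> simp [← Category.assoc, h']
    · simp [← Category.assoc]

end AssociatorInverse

end NormalCell

end Poly

end SpanPoly

/-! ### Polynomials form a bicategory. -/

namespace SpanPoly

section

variable {E : Type u} [Category.{v} E] [HasPullbacks E] {L R : MorphismProperty E}
  [hL : IsProtocalibration L] [hR : IsProtocalibration R] [hLR : IsCompatible L R]

namespace Ply

/-- The polynomial underlying a 1-cell. -/
abbrev poly {X Y : Ply L R} (p : X ⟶ Y) : Poly L R X.as Y.as := p

/-- The 2-cell of polynomials given by a normal cell. -/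
noncomputable def cell {X Y : Ply L R} {p q : X ⟶ Y}
    (c : Poly.NormalCell (poly p) (poly q)) : p ⟶ q :=
  Poly.NormalCell.toCell c

variable {X Y Z : Ply L R}

/-- An isomorphism class contains exactly one diagram on the chosen pullback, so laws for 2-cells
reduce to equations of normal cells. -/
theorem exists_cell {p q : X ⟶ Y} (η : p ⟶ q) : ∃ c : Poly.NormalCell (poly p) (poly q), η = cell c :=
  ⟨Poly.Cell.normal η, (Poly.Cell.toCell_normal η).symm⟩

theorem cell_injective {p q : X ⟶ Y} : Function.Injective (cell (p := p) (q := q)) :=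
  fun c d h => by
    rw [← Poly.NormalCell.normal_toCell c, ← Poly.NormalCell.normal_toCell d]
    exact congrArg Poly.Cell.normal h

theorem id_eq_cell (p : X ⟶ Y) : 𝟙 p = cell (Poly.NormalCell.id (poly p)) := rfl

theorem comp_cell {p q s : X ⟶ Y} (c : Poly.NormalCell (poly p) (poly q))
    (d : Poly.NormalCell (poly q) (poly s)) : (cell c : p ⟶ q) ≫ (cell d : q ⟶ s) = cell (c.vcomp d) := by
  change Poly.NormalCell.toCell (Poly.NormalCell.vcomp (Poly.Cell.normal (Poly.NormalCell.toCell c))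
    (Poly.Cell.normal (Poly.NormalCell.toCell d))) = _
  rw [Poly.NormalCell.normal_toCell, Poly.NormalCell.normal_toCell]
  rfl

theorem whiskerLeft_cell (p : X ⟶ Y) {q q' : Y ⟶ Z} (d : Poly.NormalCell (poly q) (poly q')) :
    BicategoryStruct.whiskerLeft p (cell d : q ⟶ q') =
      cell (p := p ≫ q) (q := p ≫ q')
        (Poly.NormalCell.hcomp (Poly.NormalCell.id (poly p)) d) := by
  change Poly.NormalCell.toCell (Poly.NormalCell.hcomp _
    (Poly.Cell.normal (Poly.NormalCell.toCell d))) = _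
  rw [Poly.NormalCell.normal_toCell]
  rfl

theorem whiskerRight_cell {p p' : X ⟶ Y} (c : Poly.NormalCell (poly p) (poly p')) (q : Y ⟶ Z) :
    BicategoryStruct.whiskerRight (cell c : p ⟶ p') q =
      cell (p := p ≫ q) (q := p' ≫ q)
        (Poly.NormalCell.hcomp c (Poly.NormalCell.id (poly q))) := by
  change Poly.NormalCell.toCell (Poly.NormalCell.hcomp
    (Poly.Cell.normal (Poly.NormalCell.toCell c)) _) = _
  rw [Poly.NormalCell.normal_toCell]
  rfl

theorem associator_eq {W : Ply L R} (p : W ⟶ X) (q : X ⟶ Y) (s : Y ⟶ Z) :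
    BicategoryStruct.associator p q s = cell (p := (p ≫ q) ≫ s) (q := p ≫ q ≫ s)
      (Poly.associator (poly p) (poly q) (poly s)) := rfl

theorem leftUnitor_eq (p : X ⟶ Y) :
    BicategoryStruct.leftUnitor p = cell (p := 𝟙 X ≫ p) (q := p) (Poly.leftUnitor (poly p)) := rfl

theorem rightUnitor_eq (p : X ⟶ Y) :
    BicategoryStruct.rightUnitor p = cell (p := p ≫ 𝟙 Y) (q := p) (Poly.rightUnitor (poly p)) := rfl

end Ply

open SpanPoly.Ply SpanPoly.Poly in
instance : BicategoryStruct.IsLawful (Ply L R) where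
  id_comp η := by
    obtain ⟨c, rfl⟩ := exists_cell η
    rw [id_eq_cell, comp_cell, NormalCell.id_vcomp]
  comp_id η := by
    obtain ⟨c, rfl⟩ := exists_cell η
    rw [id_eq_cell, comp_cell, NormalCell.vcomp_id]
  assoc η θ ζ := by
    obtain ⟨c, rfl⟩ := exists_cell η
    obtain ⟨d, rfl⟩ := exists_cell θ
    obtain ⟨e, rfl⟩ := exists_cell ζ
    simp only [comp_cell, NormalCell.vcomp_assoc]
  whiskerLeft_id f g := by
    rw [id_eq_cell, whiskerLeft_cell, NormalCell.id_hcomp_id]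
    rfl
  whiskerLeft_comp f _ _ _ η θ := by
    obtain ⟨c, rfl⟩ := exists_cell η
    obtain ⟨d, rfl⟩ := exists_cell θ
    simp only [comp_cell, whiskerLeft_cell, ← NormalCell.vcomp_hcomp_vcomp, NormalCell.id_vcomp]
  id_whiskerRight f g := by
    rw [id_eq_cell, whiskerRight_cell, NormalCell.id_hcomp_id]
    rfl
  comp_whiskerRight η θ i := by
    obtain ⟨c, rfl⟩ := exists_cell η
    obtain ⟨d, rfl⟩ := exists_cell θ
    simp only [comp_cell, whiskerRight_cell, ← NormalCell.vcomp_hcomp_vcomp, NormalCell.id_vcomp]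
  whisker_exchange η θ := by
    obtain ⟨c, rfl⟩ := exists_cell η
    obtain ⟨d, rfl⟩ := exists_cell θ
    simp only [comp_cell, whiskerRight_cell, whiskerLeft_cell, ← NormalCell.vcomp_hcomp_vcomp,
      NormalCell.id_vcomp, NormalCell.vcomp_id]
  associator_invertible f g h := by
    refine ⟨cell (NormalCell.associatorInv _ _ _), ?_, ?_⟩
    · rw [associator_eq, comp_cell, NormalCell.associator_vcomp_inv]
      rfl
    · rw [associator_eq, comp_cell, NormalCell.associatorInv_vcomp]
      rfl
  leftUnitor_invertible f := by
    refine ⟨cell (leftUnitorInv _), ?_, ?_⟩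
    · rw [leftUnitor_eq, comp_cell, NormalCell.leftUnitor_vcomp_inv]
      rfl
    · rw [leftUnitor_eq, comp_cell, NormalCell.leftUnitorInv_vcomp]
      rfl
  rightUnitor_invertible f := by
    refine ⟨cell (rightUnitorInv _), ?_, ?_⟩
    · rw [rightUnitor_eq, comp_cell, NormalCell.rightUnitor_vcomp_inv]
      rfl
    · rw [rightUnitor_eq, comp_cell, NormalCell.rightUnitorInv_vcomp]
      rfl
  associator_naturality_left η g h := by
    obtain ⟨c, rfl⟩ := exists_cell η
    simp only [comp_cell, whiskerRight_cell, whiskerLeft_cell, associator_eq,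
      NormalCell.associator_naturality, NormalCell.id_hcomp_id]
    rfl
  associator_naturality_middle f _ _ η h := by
    obtain ⟨c, rfl⟩ := exists_cell η
    simp only [comp_cell, whiskerRight_cell, whiskerLeft_cell, associator_eq,
      NormalCell.associator_naturality]
  associator_naturality_right f g _ _ η := by
    obtain ⟨c, rfl⟩ := exists_cell η
    simp only [whiskerLeft_cell, associator_eq]
    refine (comp_cell _ _).trans (Eq.trans (congrArg cell ?_) (comp_cell _ _).symm)
    -- The identity of a composite 1-cell is rewritten as a horizontal composite of identities, to
    -- fit the three-variable naturality.
    rw [← NormalCell.associator_naturality, NormalCell.id_hcomp_id]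
    rfl
  leftUnitor_naturality η := by
    obtain ⟨c, rfl⟩ := exists_cell η
    simp only [whiskerLeft_cell, leftUnitor_eq]
    exact (comp_cell _ _).trans (Eq.trans (congrArg cell (NormalCell.leftUnitor_naturality c))
      (comp_cell _ _).symm)
  rightUnitor_naturality η := by
    obtain ⟨c, rfl⟩ := exists_cell η
    simp only [whiskerRight_cell, rightUnitor_eq]
    exact (comp_cell _ _).trans (Eq.trans (congrArg cell (NormalCell.rightUnitor_naturality c))
      (comp_cell _ _).symm)
  pentagon f g h i := by
    simp only [associator_eq, whiskerLeft_cell, whiskerRight_cell]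
    refine (congrArg (_ ≫ ·) (comp_cell _ _)).trans ((comp_cell _ _).trans
      (Eq.trans (congrArg cell (NormalCell.pentagon _ _ _ _)) (comp_cell _ _).symm))
  triangle f g := by
    simp only [associator_eq, leftUnitor_eq, rightUnitor_eq, whiskerLeft_cell, whiskerRight_cell]
    exact (comp_cell _ _).trans (congrArg cell (NormalCell.triangle _ _))

end

end SpanPoly

/-! ### Spans in `E` on generalized elements. -/

namespace SpanPoly

namespace LSpn

variable {E : Type u} [Category.{v} E] [HasPullbacks E] {L : MorphismProperty E}
  [hL : IsProtocalibration L]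

variable {U V W X Y Z : LSpn L}

/-- The object of `E` underlying an object of `LSpn L`. -/
abbrev ob (X : LSpn L) : E := X.as.as

/-- The apex of a span. -/
def ap (f : X ⟶ Y) : E := Span.apex (show Span L ⊤ X.as.as Y.as.as from f.as)

/-- The left leg of a span. -/
def l (f : X ⟶ Y) : ap f ⟶ ob X := Span.l (show Span L ⊤ X.as.as Y.as.as from f.as)

/-- The right leg of a span. -/
def r (f : X ⟶ Y) : ap f ⟶ ob Y := Span.r (show Span L ⊤ X.as.as Y.as.as from f.as)

theorem l_mem (f : X ⟶ Y) : L (l f) := Span.wl (show Span L ⊤ X.as.as Y.as.as from f.as)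

/-- The 1-cell given by a span. -/
def mk (X Y : LSpn L) {A : E} (a : A ⟶ ob X) (b : A ⟶ ob Y) (ha : L a) : X ⟶ Y :=
  Co.Hom.mk (show Span L ⊤ X.as.as Y.as.as from ⟨A, a, b, ha, trivial⟩)

section Mk

variable {A : E} (a : A ⟶ ob X) (b : A ⟶ ob Y) (ha : L a)

/-- The identification of the apex of `mk`. -/
def inn : A ⟶ ap (mk X Y a b ha) := 𝟙 A

/-- The identification of the apex of `mk`. -/
def out : ap (mk X Y a b ha) ⟶ A := 𝟙 A

variable {T : E} (x : T ⟶ A) (z : T ⟶ ap (mk X Y a b ha))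

@[simp] theorem inn_out : (x ≫ inn a b ha) ≫ out a b ha = x :=
  (Category.comp_id _).trans (Category.comp_id _)
@[simp] theorem out_inn : (z ≫ out a b ha) ≫ inn a b ha = z :=
  (Category.comp_id _).trans (Category.comp_id _)
@[simp] theorem inn_l : (x ≫ inn a b ha) ≫ l (mk X Y a b ha) = x ≫ a :=
  congrArg (· ≫ a) (Category.comp_id x)
@[simp] theorem inn_r : (x ≫ inn a b ha) ≫ r (mk X Y a b ha) = x ≫ b :=
  congrArg (· ≫ b) (Category.comp_id x)
@[simp] theorem out_l : (z ≫ out a b ha) ≫ a = z ≫ l (mk X Y a b ha) :=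
  congrArg (· ≫ a) (Category.comp_id z)

end Mk

section TwoCells

variable {f g h : X ⟶ Y} {T : E}

/-- The morphism of apexes underlying a 2-cell. -/
def m (η : f ⟶ g) : ap g ⟶ ap f := Span.Hom.hom (Co.Hom₂.as η)

@[simp] theorem m_l (η : f ⟶ g) (z : T ⟶ ap g) : (z ≫ m η) ≫ l f = z ≫ l g :=
  (Category.assoc _ _ _).trans (congrArg (z ≫ ·) (Span.Hom.hom_l (Co.Hom₂.as η)))

@[simp] theorem m_r (η : f ⟶ g) (z : T ⟶ ap g) : (z ≫ m η) ≫ r f = z ≫ r g :=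
  (Category.assoc _ _ _).trans (congrArg (z ≫ ·) (Span.Hom.hom_r (Co.Hom₂.as η)))

@[simp] theorem m_id (z : T ⟶ ap f) : z ≫ m (𝟙 f) = z := Category.comp_id _

-- The order is reversed because a 2-cell of `LSpn L` is a morphism of spans in the opposite
-- direction, so that `m` goes from the apex of the target to that of the source.
@[simp] theorem m_comp (η : f ⟶ g) (θ : g ⟶ h) (z : T ⟶ ap h) :
    z ≫ m (η ≫ θ) = (z ≫ m θ) ≫ m η := (Category.assoc _ _ _).symm

@[simp] theorem m_hom_inv (e : f ≅ g) (z : T ⟶ ap f) : (z ≫ m e.inv) ≫ m e.hom = z := by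
  rw [← m_comp, e.hom_inv_id, m_id]

@[simp] theorem m_inv_hom (e : f ≅ g) (z : T ⟶ ap g) : (z ≫ m e.hom) ≫ m e.inv = z := by
  rw [← m_comp, e.inv_hom_id, m_id]

theorem m_injective {η θ : f ⟶ g} (h : m η = m θ) : η = θ := by
  obtain ⟨η⟩ := η
  obtain ⟨θ⟩ := θ
  exact congrArg Co.Hom₂.mk (Span.hom_ext h)

theorem cell_ext {η θ : f ⟶ g} (h : ∀ {T : E} (z : T ⟶ ap g), z ≫ m η = z ≫ m θ) : η = θ :=
  m_injective (by simpa using h (𝟙 _))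

/-- The 2-cell given by a morphism of apexes. -/
def cell (k : ap g ⟶ ap f) (hl : k ≫ l f = l g) (hr : k ≫ r f = r g) : f ⟶ g :=
  Co.Hom₂.mk (Span.Hom.mk (S₁ := (show Span L ⊤ X.as.as Y.as.as from g.as))
    (S₂ := (show Span L ⊤ X.as.as Y.as.as from f.as)) k hl hr)

@[simp] theorem m_cell (k : ap g ⟶ ap f) (hl : k ≫ l f = l g) (hr : k ≫ r f = r g) :
    m (cell k hl hr) = k := rfl

/-- The invertible 2-cell given by an isomorphism of apexes. -/
def isoCell (k : ap g ⟶ ap f) (k' : ap f ⟶ ap g) (h₁ : k ≫ k' = 𝟙 _) (h₂ : k' ≫ k = 𝟙 _)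
    (hl : k ≫ l f = l g) (hr : k ≫ r f = r g) : f ≅ g where
  hom := cell k hl hr
  inv := cell k' (by rw [← hl, ← Category.assoc, h₂, Category.id_comp])
    (by rw [← hr, ← Category.assoc, h₂, Category.id_comp])
  hom_inv_id := m_injective h₂
  inv_hom_id := m_injective h₁

end TwoCells

section Composition

variable {T T' : E} (f : X ⟶ Y) (g : Y ⟶ Z)

/-- The first projection of a composite span. -/
noncomputable def p₁ : ap (f ≫ g) ⟶ ap f := spanFst (L := L) f.as g.as

/-- The second projection of a composite span. -/
noncomputable def p₂ : ap (f ≫ g) ⟶ ap g := spanSnd (L := L) f.as g.as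

variable {f g}

@[simp] theorem comp_l (z : T ⟶ ap (f ≫ g)) : z ≫ l (f ≫ g) = (z ≫ p₁ f g) ≫ l f :=
  (Category.assoc _ _ _).symm

@[simp] theorem comp_r (z : T ⟶ ap (f ≫ g)) : z ≫ r (f ≫ g) = (z ≫ p₂ f g) ≫ r g :=
  (Category.assoc _ _ _).symm

theorem p_condition (z : T ⟶ ap (f ≫ g)) : (z ≫ p₁ f g) ≫ r f = (z ≫ p₂ f g) ≫ l g :=
  (Category.assoc _ _ _).trans ((congrArg (z ≫ ·) (spanCond (L := L) f.as g.as)).trans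
    (Category.assoc _ _ _).symm)

theorem ap_ext {z z' : T ⟶ ap (f ≫ g)} (h₁ : z ≫ p₁ f g = z' ≫ p₁ f g)
    (h₂ : z ≫ p₂ f g = z' ≫ p₂ f g) : z = z' := spanHomExt h₁ h₂

/-- A generalized element of the apex of a composite span from its components. -/
noncomputable def pr (a : T ⟶ ap f) (b : T ⟶ ap g) (h : a ≫ r f = b ≫ l g) : T ⟶ ap (f ≫ g) :=
  spanLift (L := L) f.as g.as a b h

variable (a : T ⟶ ap f) (b : T ⟶ ap g) (h : a ≫ r f = b ≫ l g)

@[simp] theorem pr_p₁ : pr a b h ≫ p₁ f g = a := spanLift_fst _ _ _ _ _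

@[simp] theorem pr_p₂ : pr a b h ≫ p₂ f g = b := spanLift_snd _ _ _ _ _

@[simp] theorem comp_pr (σ : T' ⟶ T) : σ ≫ pr a b h =
    pr (σ ≫ a) (σ ≫ b) (by rw [Category.assoc, h, Category.assoc]) := by
  apply ap_ext <;> simp

@[simp] theorem pr_eta (z : T ⟶ ap (f ≫ g)) (h : (z ≫ p₁ f g) ≫ r f = (z ≫ p₂ f g) ≫ l g) :
    pr (z ≫ p₁ f g) (z ≫ p₂ f g) h = z := by
  apply ap_ext <;> simp

end Composition

section Whiskering

variable {T : E}

@[simp] theorem whiskerRight_p₁ {f f' : X ⟶ Y} (η : f ⟶ f') (g : Y ⟶ Z) (z : T ⟶ ap (f' ≫ g)) :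
    (z ≫ m (η ▷ g)) ≫ p₁ f g = (z ≫ p₁ f' g) ≫ m η :=
  (Category.assoc _ _ _).trans ((congrArg (z ≫ ·) (spanLift_fst (L := L) _ _ _ _ _)).trans
    (Category.assoc _ _ _).symm)

@[simp] theorem whiskerRight_p₂ {f f' : X ⟶ Y} (η : f ⟶ f') (g : Y ⟶ Z) (z : T ⟶ ap (f' ≫ g)) :
    (z ≫ m (η ▷ g)) ≫ p₂ f g = z ≫ p₂ f' g :=
  (Category.assoc _ _ _).trans (congrArg (z ≫ ·) (spanLift_snd (L := L) _ _ _ _ _))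

@[simp] theorem whiskerLeft_p₁ (f : X ⟶ Y) {g g' : Y ⟶ Z} (η : g ⟶ g') (z : T ⟶ ap (f ≫ g')) :
    (z ≫ m (f ◁ η)) ≫ p₁ f g = z ≫ p₁ f g' :=
  (Category.assoc _ _ _).trans (congrArg (z ≫ ·) (spanLift_fst (L := L) _ _ _ _ _))

@[simp] theorem whiskerLeft_p₂ (f : X ⟶ Y) {g g' : Y ⟶ Z} (η : g ⟶ g') (z : T ⟶ ap (f ≫ g')) :
    (z ≫ m (f ◁ η)) ≫ p₂ f g = (z ≫ p₂ f g') ≫ m η :=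
  (Category.assoc _ _ _).trans ((congrArg (z ≫ ·) (spanLift_snd (L := L) _ _ _ _ _)).trans
    (Category.assoc _ _ _).symm)

variable (f : W ⟶ X) (g : X ⟶ Y) (h : Y ⟶ Z)

theorem associator_hom_eq (z : T ⟶ ap (f ≫ g ≫ h)) : z ≫ m (α_ f g h).hom =
    pr (pr (z ≫ p₁ _ _) ((z ≫ p₂ _ _) ≫ p₁ _ _) (by rw [p_condition, comp_l]))
      ((z ≫ p₂ _ _) ≫ p₂ _ _) (by rw [comp_r, pr_p₂, p_condition]) := by
  apply ap_ext
  · rw [pr_p₁]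
    refine (Category.assoc _ _ _).trans
      ((congrArg (z ≫ ·) (spanLift_fst (L := L) _ _ _ _ _)).trans ?_)
    apply ap_ext
    · rw [pr_p₁]
      exact (Category.assoc _ _ _).trans (congrArg (z ≫ ·) (spanLift_fst (L := L) _ _ _ _ _))
    · rw [pr_p₂]
      exact (Category.assoc _ _ _).trans ((congrArg (z ≫ ·)
        (spanLift_snd (L := L) _ _ _ _ _)).trans (Category.assoc _ _ _).symm)
  · rw [pr_p₂]
    exact (Category.assoc _ _ _).trans ((congrArg (z ≫ ·)
      (spanLift_snd (L := L) _ _ _ _ _)).trans (Category.assoc _ _ _).symm)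

/-- By `associator_hom_eq`, `z` is the image of its regrouped triple under the other direction,
which then cancels. -/
theorem associator_inv_eq (z : T ⟶ ap ((f ≫ g) ≫ h)) : z ≫ m (α_ f g h).inv =
    pr ((z ≫ p₁ _ _) ≫ p₁ _ _)
      (pr ((z ≫ p₁ _ _) ≫ p₂ _ _) (z ≫ p₂ _ _) (by rw [← p_condition, comp_r]))
      (by rw [comp_l, pr_p₁, p_condition]) := by
  have h' : z = pr (pr ((z ≫ p₁ _ _) ≫ p₁ _ _) ((z ≫ p₁ _ _) ≫ p₂ _ _) (p_condition _))
      (z ≫ p₂ _ _) (by rw [pr_eta, p_condition]) := by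
    apply ap_ext <;> simp [-Category.assoc]
  have h'' := associator_hom_eq f g h (pr ((z ≫ p₁ _ _) ≫ p₁ _ _)
      (pr ((z ≫ p₁ _ _) ≫ p₂ _ _) (z ≫ p₂ _ _) (by rw [← p_condition, comp_r]))
      (by rw [comp_l, pr_p₁, p_condition]))
  simp only [pr_p₁, pr_p₂] at h''
  exact (congrArg (· ≫ m (α_ f g h).inv) (h'.trans h''.symm)).trans (m_inv_hom (α_ f g h) _)

@[simp] theorem associator_hom_p₁_p₁ (z : T ⟶ ap (f ≫ g ≫ h)) :
    ((z ≫ m (α_ f g h).hom) ≫ p₁ _ _) ≫ p₁ _ _ = z ≫ p₁ _ _ := by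
  simp [associator_hom_eq, -Category.assoc]

@[simp] theorem associator_hom_p₁_p₂ (z : T ⟶ ap (f ≫ g ≫ h)) :
    ((z ≫ m (α_ f g h).hom) ≫ p₁ _ _) ≫ p₂ _ _ = (z ≫ p₂ _ _) ≫ p₁ _ _ := by
  simp [associator_hom_eq, -Category.assoc]

@[simp] theorem associator_hom_p₂ (z : T ⟶ ap (f ≫ g ≫ h)) :
    (z ≫ m (α_ f g h).hom) ≫ p₂ _ _ = (z ≫ p₂ _ _) ≫ p₂ _ _ := by
  simp [associator_hom_eq, -Category.assoc]

@[simp] theorem associator_inv_p₁ (z : T ⟶ ap ((f ≫ g) ≫ h)) :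
    (z ≫ m (α_ f g h).inv) ≫ p₁ _ _ = (z ≫ p₁ _ _) ≫ p₁ _ _ := by
  simp [associator_inv_eq, -Category.assoc]

@[simp] theorem associator_inv_p₂_p₁ (z : T ⟶ ap ((f ≫ g) ≫ h)) :
    ((z ≫ m (α_ f g h).inv) ≫ p₂ _ _) ≫ p₁ _ _ = (z ≫ p₁ _ _) ≫ p₂ _ _ := by
  simp [associator_inv_eq, -Category.assoc]

@[simp] theorem associator_inv_p₂_p₂ (z : T ⟶ ap ((f ≫ g) ≫ h)) :
    ((z ≫ m (α_ f g h).inv) ≫ p₂ _ _) ≫ p₂ _ _ = z ≫ p₂ _ _ := by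
  simp [associator_inv_eq, -Category.assoc]

theorem id_l_eq_r (z : T ⟶ ap (𝟙 X)) : z ≫ r (𝟙 X) = z ≫ l (𝟙 X) := rfl

@[simp] theorem leftUnitor_inv (f : X ⟶ Y) (z : T ⟶ ap (𝟙 X ≫ f)) :
    z ≫ m (λ_ f).inv = z ≫ p₂ _ _ := rfl

end Whiskering

/-! ### Spans with invertible left leg as morphisms of `E`. -/

section InvertibleLeg

variable {T T' : E}

instance (X : LSpn L) : IsIso (l (𝟙 X)) := inferInstanceAs (IsIso (𝟙 (ob X)))

instance isIso_l_comp (f : X ⟶ Y) (g : Y ⟶ Z) [IsIso (l f)] [IsIso (l g)] : IsIso (l (f ≫ g)) :=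
  inferInstanceAs (IsIso (pullback.fst (r f) (l g) ≫ l f))

variable (f : X ⟶ Y) [IsIso (l f)]

/-- The generalized element of the apex of a span with invertible left leg over an element. -/
noncomputable def el (x : T ⟶ ob X) : T ⟶ ap f := x ≫ inv (l f)

/-- The morphism corresponding to a span with invertible left leg. -/
noncomputable def tr : ob X ⟶ ob Y := inv (l f) ≫ r f

variable {f}

@[simp] theorem el_l (x : T ⟶ ob X) : el f x ≫ l f = x := by simp [el]

@[simp] theorem el_r (x : T ⟶ ob X) : el f x ≫ r f = x ≫ tr f := by simp [el, tr]

@[simp] theorem comp_el (σ : T' ⟶ T) (x : T ⟶ ob X) : σ ≫ el f x = el f (σ ≫ x) := by simp [el]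

@[simp] theorem el_eta (z : T ⟶ ap f) : el f (z ≫ l f) = z := by simp [el]

theorem r_eq_tr (z : T ⟶ ap f) : z ≫ r f = (z ≫ l f) ≫ tr f := by
  rw [← el_r, el_eta]

theorem el_ext {z z' : T ⟶ ap f} (h : z ≫ l f = z' ≫ l f) : z = z' := by
  rw [← el_eta z, h, el_eta]

@[simp] theorem el_m {g : X ⟶ Y} [IsIso (l g)] (η : f ⟶ g) (x : T ⟶ ob X) :
    el g x ≫ m η = el f x := el_ext (by simp [-Category.assoc])

@[simp] theorem el_p₁ (g : Y ⟶ Z) [IsIso (l g)] (x : T ⟶ ob X) :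
    el (f ≫ g) x ≫ p₁ f g = el f x := el_ext (by rw [← comp_l, el_l, el_l])

@[simp] theorem el_p₂ (g : Y ⟶ Z) [IsIso (l g)] (x : T ⟶ ob X) :
    el (f ≫ g) x ≫ p₂ f g = el g (x ≫ tr f) :=
  el_ext (by rw [← p_condition, el_p₁, el_r, el_l])

@[simp] theorem tr_id (x : T ⟶ ob X) : x ≫ tr (𝟙 X) = x := by
  rw [← el_r (f := 𝟙 X), id_l_eq_r, el_l]

@[simp] theorem tr_comp (g : Y ⟶ Z) [IsIso (l g)] (x : T ⟶ ob X) :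
    x ≫ tr (f ≫ g) = (x ≫ tr f) ≫ tr g := by
  rw [← el_r (f := f ≫ g), comp_r, el_p₂, el_r]

/-- An element of either apex is determined by its left leg. Hence `η` takes the element over `x` to
the element over `x`, and it preserves right legs. Invertibility of `η` is not assumed. -/
theorem tr_eq_of_hom {g : X ⟶ Y} [IsIso (l g)] (η : f ⟶ g) : tr f = tr g := by
  have h := m_r η (el g (𝟙 _))
  rw [el_m, el_r, el_r, Category.id_comp, Category.id_comp] at h
  exact h

theorem isIso_l_of_iso {g : X ⟶ Y} (e : f ≅ g) : IsIso (l g) := by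
  have h₁ : m e.hom ≫ m e.inv = 𝟙 _ := by simpa using m_inv_hom e (𝟙 _)
  have h₂ : m e.inv ≫ m e.hom = 𝟙 _ := by simpa using m_hom_inv e (𝟙 _)
  have : IsIso (m e.hom) := ⟨_, h₁, h₂⟩
  have h := m_l e.hom (𝟙 _)
  rw [Category.id_comp, Category.id_comp] at h
  rw [← h]
  infer_instance

end InvertibleLeg

end LSpn

end SpanPoly

namespace SpanPoly

namespace LSpn

variable {E : Type u} [Category.{v} E] [HasPullbacks E] {L : MorphismProperty E}
  [hL : IsProtocalibration L]

variable {U V W X Y Z : LSpn L}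

/-! ### Composition with a span with invertible left leg. -/

section Up

variable {T T' : E} (f : X ⟶ Y) (g : Y ⟶ Z) [IsIso (l g)]

/-- The generalized element of the apex of `f ≫ g` over a generalized element of the apex of `f`,
when `g` has an invertible left leg. -/
noncomputable def up (z : T ⟶ ap f) : T ⟶ ap (f ≫ g) := pr z (el g (z ≫ r f)) (el_l _).symm

variable {f g}

@[simp] theorem up_p₁ (z : T ⟶ ap f) : up f g z ≫ p₁ f g = z := pr_p₁ _ _ _

@[simp] theorem up_p₂ (z : T ⟶ ap f) : up f g z ≫ p₂ f g = el g (z ≫ r f) := pr_p₂ _ _ _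

/-- The second component is determined by its left leg, which equals the right leg of the first
component. -/
theorem ap_ext_p₁ {z z' : T ⟶ ap (f ≫ g)} (h : z ≫ p₁ f g = z' ≫ p₁ f g) : z = z' :=
  ap_ext h (el_ext (by rw [← p_condition, ← p_condition, h]))

@[simp] theorem up_eta (z : T ⟶ ap (f ≫ g)) : up f g (z ≫ p₁ f g) = z :=
  ap_ext_p₁ (up_p₁ _)

@[simp] theorem comp_up (σ : T' ⟶ T) (z : T ⟶ ap f) : σ ≫ up f g z = up f g (σ ≫ z) :=
  ap_ext_p₁ (by rw [up_p₁, Category.assoc, up_p₁])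

theorem p_condition_tr (z : T ⟶ ap (f ≫ g)) :
    ((z ≫ p₁ f g) ≫ r f) ≫ tr g = (z ≫ p₂ f g) ≫ r g := by
  rw [p_condition, ← r_eq_tr]

/-- The first projection is invertible, with inverse `up`, and the left leg of `f ≫ g` factors as
this projection followed by `l f`. -/
theorem isIso_l_of_isIso_l_comp [IsIso (l (f ≫ g))] : IsIso (l f) := by
  have h : IsIso (p₁ f g) := ⟨up f g (𝟙 _), by rw [comp_up, Category.comp_id,
    ← Category.id_comp (p₁ f g), up_eta], up_p₁ _⟩
  have h' : p₁ f g ≫ l f = l (f ≫ g) := by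
    rw [← Category.id_comp (p₁ f g), ← comp_l, Category.id_comp]
  have : IsIso (p₁ f g ≫ l f) := h' ▸ inferInstance
  exact IsIso.of_isIso_comp_left (p₁ f g) (l f)

end Up

/-- The 1-cell with identity left leg given by a morphism. -/
def st (x : ob X ⟶ ob Y) : X ⟶ Y := mk X Y (𝟙 _) x (IsProtocalibration.iso_mem _)

instance (x : ob X ⟶ ob Y) : IsIso (l (st x : X ⟶ Y)) := inferInstanceAs (IsIso (𝟙 (ob X)))

@[simp] theorem tr_st {T : E} (x : ob X ⟶ ob Y) (t : T ⟶ ob X) :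
    t ≫ tr (st x : X ⟶ Y) = t ≫ x := by
  have h : tr (st x : X ⟶ Y) = inv (𝟙 (ob X)) ≫ x := rfl
  rw [h, IsIso.inv_id, Category.id_comp]

/-- The 2-cell between 1-cells with invertible left legs and equal right legs. -/
noncomputable def trCell {f g : X ⟶ Y} [IsIso (l f)] [IsIso (l g)] (h : tr f = tr g) : f ≅ g :=
  isoCell (el f (l g)) (el g (l f)) (el_ext (by simp)) (el_ext (by simp)) (by simp)
    (by
      rw [el_r, h]
      simpa [-Category.assoc] using (r_eq_tr (𝟙 (ap g))).symm)

/-! ### Spans with invertible left leg are groupoid opfibrations. -/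

section Opfibration

variable (p : Y ⟶ Z) [IsIso (l p)]

/-- Composition with `p` keeps apexes and left legs and follows right legs by `tr p`. A 2-cell `z ≫
p ⟶ k ≫ p` is thus a morphism of apexes that respects right legs only after `tr p`; the
factorization through `κ` supplies the stronger compatibility, making every `κ` opcartesian. -/
theorem isGroupoidOpfibrationCell : IsGroupoidOpfibrationCell p := by
  refine fun U => ⟨?_, ?_⟩
  · intro x z k κ a b hb
    change U ⟶ Y at x z k
    change z ≫ p ⟶ k ≫ p at b
    have hb' : κ ▷ p ≫ b = a ▷ p := hb
    have key {T : E} (w : T ⟶ ap k) : ((up k p w ≫ m b) ≫ p₁ z p) ≫ m κ = w ≫ m a := by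
      rw [← whiskerRight_p₁, ← m_comp, hb', whiskerRight_p₁, up_p₁]
    let n : ap k ⟶ ap z := (up k p (𝟙 _) ≫ m b) ≫ p₁ z p
    have hn {T : E} (w : T ⟶ ap k) : w ≫ n = (up k p w ≫ m b) ≫ p₁ z p := by
      simp only [n, ← Category.assoc, comp_up, Category.comp_id]
    let c : z ⟶ k := cell n
      (by rw [← comp_l, m_l, comp_l, up_p₁, Category.id_comp])
      -- The right leg of `z` may be read after applying `κ`, where `n` becomes `a`, which respects
      -- right legs.
      (by rw [← m_r κ, key, m_r, Category.id_comp])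
    have hc {T : E} (w : T ⟶ ap k) : w ≫ m c = (up k p w ≫ m b) ≫ p₁ z p := hn w
    refine ⟨c, ⟨?_, ?_⟩, ?_⟩
    · change c ▷ p = b
      apply cell_ext
      intro T w
      apply ap_ext_p₁
      rw [whiskerRight_p₁, hc, up_eta]
    · apply cell_ext
      intro T w
      rw [m_comp, hc, key]
    -- The first projection recovers `c'` from `c' ▷ p`, so the image alone determines the lift.
    · rintro c' ⟨h₁, -⟩
      have h₁' : c' ▷ p = b := h₁
      apply cell_ext
      intro T w
      rw [hc, ← h₁', whiskerRight_p₁, up_p₁]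
  · intro x b φ
    change U ⟶ Y at x
    change U ⟶ Z at b
    change x ≫ p ⟶ b at φ
    -- The lift keeps the apex and left leg of `b`; its right leg is that of `x`, reached through
    -- `φ`.
    let z : U ⟶ Y := mk U Y (l b) ((m φ ≫ p₁ x p) ≫ r x) (l_mem b)
    let o : ap z ⟶ ap b := out _ _ _
    let i : ap b ⟶ ap z := inn _ _ _
    have oi {T : E} (w : T ⟶ ap z) : (w ≫ o) ≫ i = w := out_inn _ _ _ _
    have io {T : E} (w : T ⟶ ap b) : (w ≫ i) ≫ o = w := inn_out _ _ _ _
    have il {T : E} (w : T ⟶ ap b) : (w ≫ i) ≫ l z = w ≫ l b := inn_l _ _ _ _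
    have ir {T : E} (w : T ⟶ ap b) : (w ≫ i) ≫ r z = ((w ≫ m φ) ≫ p₁ x p) ≫ r x :=
      (inn_r _ _ _ _).trans (by simp only [Category.assoc])
    let κ : x ⟶ z := cell ((o ≫ m φ) ≫ p₁ x p)
      (by rw [← comp_l, m_l, ← il, ← Category.id_comp o, oi, Category.id_comp])
      (by rw [← ir, ← Category.id_comp o, oi, Category.id_comp])
    have hκ {T : E} (w : T ⟶ ap z) : w ≫ m κ = ((w ≫ o) ≫ m φ) ≫ p₁ x p := by
      simp only [κ, m_cell, Category.assoc]
    let e : z ≫ p ≅ b := isoCell (up z p i) (p₁ z p ≫ o)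
      (by rw [← Category.assoc, up_p₁, ← Category.id_comp i, io])
      (by
        apply ap_ext_p₁
        
        rw [Category.assoc, up_p₁, Category.id_comp]
        simpa using oi (p₁ z p))
      (by rw [comp_l, up_p₁, ← Category.id_comp i, il, Category.id_comp])
      (by
        rw [comp_r, up_p₂, el_r, ← Category.id_comp i, ir, Category.id_comp, ← el_r (f := p),
          ← up_p₂ (f := x), up_eta, ← comp_r, ← Category.id_comp (m φ), m_r, Category.id_comp])
    refine ⟨z, κ, e, ?_⟩
    change κ ▷ p ≫ e.hom = φ
    apply cell_ext
    intro T w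
    apply ap_ext_p₁
    have he : w ≫ m e.hom = up z p (w ≫ i) := comp_up _ _
    rw [m_comp, whiskerRight_p₁, he, up_p₁, hκ, io]

end Opfibration

/-! ### Equivalences in the bicategory of spans. -/

section Equivalence

theorem isIso_r_of_iso {f g : X ⟶ Y} (e : f ≅ g) [IsIso (r f)] : IsIso (r g) := by
  have h₁ : m e.hom ≫ m e.inv = 𝟙 _ := by simpa using m_inv_hom e (𝟙 _)
  have h₂ : m e.inv ≫ m e.hom = 𝟙 _ := by simpa using m_hom_inv e (𝟙 _)
  have : IsIso (m e.hom) := ⟨_, h₁, h₂⟩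
  have h := m_r e.hom (𝟙 _)
  rw [Category.id_comp, Category.id_comp] at h
  rw [← h]
  infer_instance

instance (X : LSpn L) : IsIso (r (𝟙 X)) := inferInstanceAs (IsIso (𝟙 (ob X)))

theorem isIso_of_isIso_comp_of_section {A B C : E} (f : A ⟶ B) (g : B ⟶ C) [IsIso (f ≫ g)]
    (s : B ⟶ A) (h : s ≫ f = 𝟙 _) : IsIso g := by
  have : IsSplitEpi f := ⟨⟨s, h⟩⟩
  have : Mono f := mono_of_mono f g
  have : IsIso f := isIso_of_mono_of_isSplitEpi f
  exact IsIso.of_isIso_comp_left f g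

/-- The unit and counit make a projection followed by a leg invertible, as a leg of an identity span
is. The projection in question has a section: the relevant leg of `e.inv` is a split epimorphism by
the other composite, so an element of the apex of `e.hom` can be completed to an element of the
composite span. -/
theorem isIso_legs_of_equivalence (e : X ≌ Y) : IsIso (l e.hom) ∧ IsIso (r e.hom) := by
  have h₁ : IsIso (l (e.hom ≫ e.inv)) := isIso_l_of_iso e.unit
  have h₂ : IsIso (r (e.hom ≫ e.inv)) := isIso_r_of_iso e.unit
  have h₃ : IsIso (l (e.inv ≫ e.hom)) := isIso_l_of_iso e.counit.symm
  have h₄ : IsIso (r (e.inv ≫ e.hom)) := isIso_r_of_iso e.counit.symm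
  have h₁' : IsIso (p₁ e.hom e.inv ≫ l e.hom) := h₁
  have h₂' : IsIso (p₂ e.hom e.inv ≫ r e.inv) := h₂
  have h₃' : IsIso (p₁ e.inv e.hom ≫ l e.inv) := h₃
  have h₄' : IsIso (p₂ e.inv e.hom ≫ r e.hom) := h₄
  refine ⟨isIso_of_isIso_comp_of_section (p₁ e.hom e.inv) _
    (pr (𝟙 _) (r e.hom ≫ inv (p₁ e.inv e.hom ≫ l e.inv) ≫ p₁ e.inv e.hom) ?_) (pr_p₁ _ _ _),
    isIso_of_isIso_comp_of_section (p₂ e.inv e.hom) _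
    (pr (l e.hom ≫ inv (p₂ e.hom e.inv ≫ r e.inv) ≫ p₂ e.hom e.inv) (𝟙 _) ?_) (pr_p₂ _ _ _)⟩
  · simp only [Category.assoc, IsIso.inv_hom_id, Category.id_comp, Category.comp_id]
  · simp only [Category.assoc, IsIso.inv_hom_id, Category.id_comp, Category.comp_id]

end Equivalence

/-! ### Bipullbacks along spans with invertible left leg. -/

section Bipullback

variable {f : U ⟶ W} {g : V ⟶ W} [IsIso (l f)] (c : IsoSquare f g) [IsIso (l c.snd)]

section

variable {T T' : E}

/-- Evaluation of a generalized element of the vertex of a square at an element of the fibre of `g`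
over its projection. -/
noncomputable def ev (x : T ⟶ ob c.pt) (z : T ⟶ ap g) (h : x ≫ tr c.snd = z ≫ l g) :
    T ⟶ ap c.fst :=
  (pr (el c.snd x) z ((el_r x).trans h) ≫ m c.iso.hom) ≫ p₁ c.fst f

/-- The argument of an evaluation. -/
noncomputable def arg (w : T ⟶ ap c.fst) : T ⟶ ap g :=
  (up c.fst f w ≫ m c.iso.inv) ≫ p₂ c.snd g

variable {c}

@[simp] theorem ev_l (x : T ⟶ ob c.pt) (z : T ⟶ ap g) (h : x ≫ tr c.snd = z ≫ l g) :
    ev c x z h ≫ l c.fst = x := by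
  rw [ev, ← comp_l, m_l, comp_l, pr_p₁, el_l]

theorem ev_r_tr (x : T ⟶ ob c.pt) (z : T ⟶ ap g) (h : x ≫ tr c.snd = z ≫ l g) :
    (ev c x z h ≫ r c.fst) ≫ tr f = z ≫ r g := by
  rw [ev, p_condition, ← r_eq_tr, ← comp_r, m_r, comp_r, pr_p₂]

@[simp] theorem comp_ev (σ : T' ⟶ T) (x : T ⟶ ob c.pt) (z : T ⟶ ap g)
    (h : x ≫ tr c.snd = z ≫ l g) : σ ≫ ev c x z h =
      ev c (σ ≫ x) (σ ≫ z) (by rw [Category.assoc, h, Category.assoc]) := by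
  simp [ev, ← Category.assoc]

theorem l_tr_eq_arg_l (w : T ⟶ ap c.fst) : (w ≫ l c.fst) ≫ tr c.snd = arg c w ≫ l g := by
  have h : w ≫ l c.fst = ((up c.fst f w ≫ m c.iso.inv) ≫ p₁ c.snd g) ≫ l c.snd := by
    rw [← comp_l, m_l, comp_l, up_p₁]
  rw [arg, ← p_condition, r_eq_tr, h]

@[simp] theorem comp_arg (σ : T' ⟶ T) (w : T ⟶ ap c.fst) : σ ≫ arg c w = arg c (σ ≫ w) := by
  simp [arg, ← Category.assoc]

-- With `arg_ev`, this identifies elements of the apex of `c.fst` with pairs of an element of the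
-- vertex and an argument in the fibre of `g`. It is the isomorphism `c.iso`, with the invertible
-- left legs of `f` and `c.snd` cancelled.
@[simp] theorem ev_arg (w : T ⟶ ap c.fst) (h : (w ≫ l c.fst) ≫ tr c.snd = arg c w ≫ l g) :
    ev c (w ≫ l c.fst) (arg c w) h = w := by
  have h' : pr (el c.snd (w ≫ l c.fst)) (arg c w) ((el_r _).trans h) =
      up c.fst f w ≫ m c.iso.inv := by
    apply ap_ext
    · apply el_ext
      rw [pr_p₁, el_l, ← comp_l, m_l, comp_l, up_p₁]
    · rw [pr_p₂, arg]
  rw [ev, h', m_hom_inv, up_p₁]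

@[simp] theorem arg_ev (x : T ⟶ ob c.pt) (z : T ⟶ ap g) (h : x ≫ tr c.snd = z ≫ l g) :
    arg c (ev c x z h) = z := by
  rw [arg, ev, up_eta, m_inv_hom, pr_p₂]

end

/-- Generalized elements of the vertex of the square correspond to elements of the target of the
second projection with a family of elements of the domain of `f` indexed by the fibre of `g`. -/
structure IsRepresenting : Prop where
  elem_ext : ∀ {T : E} {x x' : T ⟶ ob c.pt}, x ≫ tr c.snd = x' ≫ tr c.snd →
    (∀ {T' : E} (σ : T' ⟶ T) (z : T' ⟶ ap g) (h : (σ ≫ x) ≫ tr c.snd = z ≫ l g)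
      (h' : (σ ≫ x') ≫ tr c.snd = z ≫ l g),
      ev c (σ ≫ x) z h ≫ r c.fst = ev c (σ ≫ x') z h' ≫ r c.fst) → x = x'
  exists_elem : ∀ {T : E} (y : T ⟶ ob V) (u : pullback y (l g) ⟶ ob U),
    u ≫ tr f = pullback.snd _ _ ≫ r g → ∃ x : T ⟶ ob c.pt, x ≫ tr c.snd = y ∧
      ∀ {T' : E} (σ : T' ⟶ T) (z : T' ⟶ ap g) (h : (σ ≫ x) ≫ tr c.snd = z ≫ l g)
        (h' : σ ≫ y = z ≫ l g), ev c (σ ≫ x) z h ≫ r c.fst = pullback.lift σ z h' ≫ u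

variable {c}

/-- The pasted 2-cell in the definition of a bipullback keeps the element of the apex of `h` and
replaces the argument by the value at it. By `ap_ext_p₁` nothing is lost in the first projection. -/
theorem square_elem {h : X ⟶ c.pt} {T : E} (z : T ⟶ ap ((h ≫ c.snd) ≫ g))
    (hz : (((z ≫ p₁ _ _) ≫ p₁ _ _) ≫ r h) ≫ tr c.snd = (z ≫ p₂ _ _) ≫ l g)
    (hz' : ((z ≫ p₁ _ _) ≫ p₁ _ _) ≫ r h =
      ev c (((z ≫ p₁ _ _) ≫ p₁ _ _) ≫ r h) (z ≫ p₂ _ _) hz ≫ l c.fst) :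
    (z ≫ m ((α_ h c.fst f).hom ≫ h ◁ c.iso.hom ≫ (α_ h c.snd g).inv)) ≫ p₁ _ _ =
      pr ((z ≫ p₁ _ _) ≫ p₁ _ _)
        (ev c (((z ≫ p₁ _ _) ≫ p₁ _ _) ≫ r h) (z ≫ p₂ _ _) hz) hz' := by
  apply ap_ext
  · simp [-Category.assoc]
  · rw [pr_p₂, m_comp, m_comp, associator_hom_p₁_p₂, whiskerLeft_p₂, ev]
    congr 2
    apply ap_ext
    · apply el_ext
      rw [pr_p₁, el_l, associator_inv_p₂_p₁, ← p_condition]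
    · rw [pr_p₂, associator_inv_p₂_p₂]

/-- Given `a`, `b` and `δ`, the apex of `a` is identified by `δ` with that of `b ≫ g`, so the right
leg of `a` is a family in `U` indexed by the fibre of `g` and defines a morphism from the apex of
`b` to the vertex. For 2-cells, `β` already determines the morphism of apexes, and `α` shows that it
respects the right legs into the vertex. -/
theorem IsRepresenting.isBipullback (hc : IsRepresenting c) : IsBipullback c := by
  constructor
  · intro X a b δ
    -- The family classified by the cone: a pair is sent through `δ` to the apex of `a`, whose right
    -- leg is then read.
    let u : pullback (r b) (l g) ⟶ ob U :=
      (((pr (pullback.fst _ _) (pullback.snd _ _) pullback.condition : _ ⟶ ap (b ≫ g)) ≫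
        m δ.hom) ≫ p₁ a f) ≫ r a
    have hu : u ≫ tr f = pullback.snd _ _ ≫ r g := by
      simp only [u]
      rw [p_condition, ← r_eq_tr, ← comp_r, m_r, comp_r, pr_p₂]
    obtain ⟨x, hx, hxu⟩ := hc.exists_elem (r b) u hu
    let h : X ⟶ c.pt := LSpn.mk X c.pt (l b) x (l_mem b)
    let i : ap b ⟶ ap h := inn _ _ _
    let o : ap h ⟶ ap b := out _ _ _
    have io {T : E} (z : T ⟶ ap b) : (z ≫ i) ≫ o = z := inn_out _ _ _ _
    have oi {T : E} (z : T ⟶ ap h) : (z ≫ o) ≫ i = z := out_inn _ _ _ _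
    have il {T : E} (z : T ⟶ ap b) : (z ≫ i) ≫ l h = z ≫ l b := inn_l _ _ _ _
    have ir {T : E} (z : T ⟶ ap b) : (z ≫ i) ≫ r h = z ≫ x := inn_r _ _ _ _
    have hr {T : E} (z : T ⟶ ap h) : z ≫ r h = (z ≫ o) ≫ x := by rw [← ir, oi]
    have key {T : E} (w : T ⟶ ap (b ≫ g)) (hw : ((w ≫ p₁ b g) ≫ x) ≫ tr c.snd =
        (w ≫ p₂ b g) ≫ l g) :
        ev c ((w ≫ p₁ b g) ≫ x) (w ≫ p₂ b g) hw ≫ r c.fst =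
          ((w ≫ m δ.hom) ≫ p₁ a f) ≫ r a := by
      rw [hxu (w ≫ p₁ b g) (w ≫ p₂ b g) hw (p_condition w)]
      simp only [u, ← Category.assoc]
      rw [comp_pr]
      congr 4
      apply ap_ext
      · rw [pr_p₁, pullback.lift_fst]
      · rw [pr_p₂, pullback.lift_snd]
    have hw {T : E} (w : T ⟶ ap (b ≫ g)) : ((w ≫ p₁ b g) ≫ x) ≫ tr c.snd =
        (w ≫ p₂ b g) ≫ l g := by
      rw [Category.assoc, hx, p_condition]
    let β : h ≫ c.snd ≅ b := isoCell (up h c.snd i) (p₁ _ _ ≫ o)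
      (by rw [← Category.assoc, up_p₁, ← Category.id_comp i, io])
      (ap_ext_p₁ (by
        rw [Category.assoc, up_p₁, Category.id_comp]
        simpa using oi (p₁ _ _)))
      (by rw [comp_l, up_p₁, ← Category.id_comp i, il, Category.id_comp])
      (by rw [comp_r, up_p₂, el_r, ← Category.id_comp i, ir, Category.id_comp, hx])
    let ω : ap a ⟶ ap (b ≫ g) := up a f (𝟙 _) ≫ m δ.inv
    have hω {T : E} (w : T ⟶ ap a) : w ≫ ω = up a f w ≫ m δ.inv := by
      simp only [ω, ← Category.assoc, comp_up, Category.comp_id]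
    -- Both apexes consist of pairs of an element of the apex of `b` and an argument in that of `g`;
    -- `ζ` and its inverse `ξ` pass through `b ≫ g`.
    let ζ : ap a ⟶ ap (h ≫ c.fst) := pr ((ω ≫ p₁ b g) ≫ i)
      (ev c ((ω ≫ p₁ b g) ≫ x) (ω ≫ p₂ b g) (hw ω)) (by rw [ev_l, ir])
    have hζ₁ {T : E} (w : T ⟶ ap a) : (w ≫ ζ) ≫ p₁ _ _ = ((w ≫ ω) ≫ p₁ b g) ≫ i := by
      rw [Category.assoc, pr_p₁]
      simp only [Category.assoc]
    have hζ₂ {T : E} (w : T ⟶ ap a) : (w ≫ ζ) ≫ p₂ _ _ =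
        ev c (((w ≫ ω) ≫ p₁ b g) ≫ x) ((w ≫ ω) ≫ p₂ b g) (hw _) := by
      rw [Category.assoc, pr_p₂, comp_ev]
      simp only [Category.assoc]
    have hξ {T : E} (v : T ⟶ ap (h ≫ c.fst)) :
        ((v ≫ p₁ _ _) ≫ o) ≫ r b = arg c (v ≫ p₂ _ _) ≫ l g := by
      rw [← l_tr_eq_arg_l, ← p_condition, hr, Category.assoc _ x, hx]
    let ξ : ap (h ≫ c.fst) ⟶ ap a :=
      (pr ((𝟙 _ ≫ p₁ _ _) ≫ o) (arg c (𝟙 _ ≫ p₂ _ _)) (hξ (𝟙 _)) ≫ m δ.hom) ≫ p₁ a f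
    have hξ' {T : E} (v : T ⟶ ap (h ≫ c.fst)) : v ≫ ξ =
        (pr ((v ≫ p₁ _ _) ≫ o) (arg c (v ≫ p₂ _ _)) (hξ v) ≫ m δ.hom) ≫ p₁ a f := by
      simp only [ξ, ← Category.assoc, comp_pr, comp_arg, Category.comp_id]
    have ζξ {T : E} (w : T ⟶ ap a) : (w ≫ ζ) ≫ ξ = w := by
      have h' : pr (((w ≫ ζ) ≫ p₁ _ _) ≫ o) (arg c ((w ≫ ζ) ≫ p₂ _ _)) (hξ (w ≫ ζ)) = w ≫ ω := by
        apply ap_ext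
        · rw [pr_p₁, hζ₁, io]
        · rw [pr_p₂, hζ₂, arg_ev]
      rw [hξ', h', hω, m_hom_inv, up_p₁]
    have hξω {T : E} (v : T ⟶ ap (h ≫ c.fst)) : (v ≫ ξ) ≫ ω =
        pr ((v ≫ p₁ _ _) ≫ o) (arg c (v ≫ p₂ _ _)) (hξ v) := by
      rw [hω, hξ', up_eta, m_inv_hom]
    have ξζ {T : E} (v : T ⟶ ap (h ≫ c.fst)) : (v ≫ ξ) ≫ ζ = v := by
      apply ap_ext
      · rw [hζ₁, hξω, pr_p₁, oi]
      · rw [hζ₂]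
        simp only [hξω, pr_p₁, pr_p₂, ← hr, p_condition, ev_arg]
    let α : h ≫ c.fst ≅ a := isoCell ζ ξ (by rw [← ζξ (𝟙 _), Category.id_comp])
        (by rw [← ξζ (𝟙 _), Category.id_comp])
      (by
        rw [comp_l, ← Category.id_comp ζ, hζ₁, il, ← comp_l, Category.id_comp,
          ← Category.id_comp ω, hω, m_l, comp_l, up_p₁, Category.id_comp])
      (by
        rw [comp_r, ← Category.id_comp ζ, hζ₂, key, hω, m_hom_inv, up_p₁, Category.id_comp])
    refine ⟨h, α, β, ?_⟩
    apply cell_ext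
    intro T w
    apply ap_ext_p₁
    have hβ {T : E} (w : T ⟶ ap b) : (w ≫ m β.hom) ≫ p₁ _ _ = w ≫ i := by
      rw [Category.assoc]
      exact congrArg (w ≫ ·) (up_p₁ _)
    have hα {T : E} (w : T ⟶ ap a) : w ≫ m α.hom = w ≫ ζ := rfl
    rw [m_comp, whiskerRight_p₁, hα]
    have hs := square_elem (c := c) (w ≫ m (β.hom ▷ g))
      (by rw [whiskerRight_p₁, hβ, ir, whiskerRight_p₂, hw]) (by rw [ev_l])
    rw [m_comp, m_comp] at hs
    simp only [m_comp]
    rw [hs]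
    apply ap_ext
    · rw [hζ₁, hω, up_eta, m_inv_hom, pr_p₁, whiskerRight_p₁, hβ]
    · rw [hζ₂, pr_p₂]
      simp only [hω, up_eta, m_inv_hom, whiskerRight_p₁, whiskerRight_p₂, hβ, ir]
  · intro X h k α β hαβ
    -- The equation `hαβ` on elements: `α` sends `w` with its value at `z` to the image of `w` under
    -- `β` with the value of that image at `z`.
    have sq {T : E} (w : T ⟶ ap k) (z : T ⟶ ap g) (hz : (w ≫ r k) ≫ tr c.snd = z ≫ l g)
        (hz' : (((up k c.snd w ≫ m β) ≫ p₁ h c.snd) ≫ r h) ≫ tr c.snd = z ≫ l g) :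
        (pr w (ev c (w ≫ r k) z hz) (by rw [ev_l]) : _ ⟶ ap (k ≫ c.fst)) ≫ m α =
          pr ((up k c.snd w ≫ m β) ≫ p₁ h c.snd)
            (ev c (((up k c.snd w ≫ m β) ≫ p₁ h c.snd) ≫ r h) z hz') (by rw [ev_l]) := by
      let y : T ⟶ ap ((k ≫ c.snd) ≫ g) := pr (up k c.snd w) z
        (by rw [comp_r, up_p₂, el_r, hz])
      have hy₁ : y ≫ p₁ _ _ = up k c.snd w := pr_p₁ _ _ _
      have hy₂ : y ≫ p₂ _ _ = z := pr_p₂ _ _ _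
      have h₁ := congrArg (fun t => (y ≫ m t) ≫ p₁ _ _) hαβ
      have h₂ := square_elem y (by simp only [hy₁, hy₂, up_p₁]; exact hz) (by rw [ev_l])
      have h₃ := square_elem (y ≫ m (β ▷ g))
        (by simp only [hy₁, hy₂, whiskerRight_p₁, whiskerRight_p₂]; exact hz') (by rw [ev_l])
      simp only [m_comp] at h₁ h₂ h₃
      rw [whiskerRight_p₁, h₂, h₃] at h₁
      simp only [hy₁, hy₂, up_p₁, whiskerRight_p₁, whiskerRight_p₂] at h₁
      exact h₁
    let n : ap k ⟶ ap h := (up k c.snd (𝟙 _) ≫ m β) ≫ p₁ h c.snd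
    have hn {T : E} (w : T ⟶ ap k) : w ≫ n = (up k c.snd w ≫ m β) ≫ p₁ h c.snd := by
      simp only [n, ← Category.assoc, comp_up, Category.comp_id]
    have hD {T : E} (w : T ⟶ ap k) : ((w ≫ n) ≫ r h) ≫ tr c.snd = (w ≫ r k) ≫ tr c.snd := by
      rw [hn, p_condition, ← r_eq_tr, ← comp_r, m_r, comp_r, up_p₂, el_r]
    simp only [← hn] at sq
    -- As `α` preserves right legs, `sq` makes the values of the two elements of the vertex agree,
    -- and representability makes the elements equal.
    have hr : n ≫ r h = r k := by
      apply hc.elem_ext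
      · simpa using hD (𝟙 _)
      · intro T σ z hz hz'
        have hz'' : ((σ ≫ n) ≫ r h) ≫ tr c.snd = z ≫ l g := by simpa using hz
        have h₁ := congrArg (· ≫ r (h ≫ c.fst)) (sq σ z hz' hz'')
        simp only [m_r] at h₁
        simp only [comp_r, pr_p₂] at h₁
        simp only [← Category.assoc]
        exact h₁.symm
    let χ : h ⟶ k := cell n (by rw [← Category.id_comp n, hn, ← comp_l, m_l, comp_l, up_p₁,
      Category.id_comp]) hr
    have hχ {T : E} (w : T ⟶ ap k) : w ≫ m χ = (up k c.snd w ≫ m β) ≫ p₁ h c.snd := hn w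
    refine ⟨χ, ⟨?_, ?_⟩, ?_⟩
    · apply cell_ext
      intro T v
      have hz : ((v ≫ p₁ _ _) ≫ r k) ≫ tr c.snd = arg c (v ≫ p₂ _ _) ≫ l g := by
        rw [p_condition, l_tr_eq_arg_l]
      have h₁ := sq (v ≫ p₁ _ _) (arg c (v ≫ p₂ _ _)) hz ((hD _).trans hz)
      simp only [Category.assoc _ n (r h), hr, p_condition, ev_arg, pr_eta] at h₁
      rw [h₁]
      apply ap_ext
      · rw [whiskerRight_p₁, pr_p₁]
        rfl
      · rw [whiskerRight_p₂, pr_p₂]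
    · apply cell_ext
      intro T v
      apply ap_ext_p₁
      rw [whiskerRight_p₁, hχ, up_eta]
    · rintro χ' ⟨-, h₁⟩
      apply cell_ext
      intro T w
      rw [hχ, ← h₁, whiskerRight_p₁, up_p₁]

/-- The generalized elements of the vertex of a bipullback. -/
theorem isRepresenting_of_isBipullback (hc : IsBipullback c) : IsRepresenting c := by
  constructor
  · intro T x x' hD hev
    -- The stage becomes an object of the bicategory, so that generalized elements are 1-cells with
    -- identity left leg.
    let Q : LSpn L := Co.mk (LeftSpan.mk T)
    let h : Q ⟶ c.pt := st (X := Q) x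
    let k : Q ⟶ c.pt := st (X := Q) x'
    have hh {S : E} (w : S ⟶ ap h) : w ≫ r h = (w ≫ l h) ≫ x := by rw [r_eq_tr, tr_st]
    have hk {S : E} (w : S ⟶ ap k) : w ≫ r k = (w ≫ l k) ≫ x' := by rw [r_eq_tr, tr_st]
    have htr : tr (h ≫ c.snd) = tr (k ≫ c.snd) := by
      rw [← Category.id_comp (tr (h ≫ c.snd)), ← Category.id_comp (tr (k ≫ c.snd)),
        tr_comp, tr_comp, tr_st, tr_st, Category.id_comp, Category.id_comp, hD]
    have hw {S : E} (w : S ⟶ ap (k ≫ c.fst)) :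
        (((w ≫ p₁ _ _) ≫ l k) ≫ x) ≫ tr c.snd = arg c (w ≫ p₂ _ _) ≫ l g := by
      rw [Category.assoc _ x, hD, ← Category.assoc, ← hk, p_condition, l_tr_eq_arg_l]
    -- Replaces `x'` by `x` and keeps the argument. It respects right legs because the two elements
    -- have the same values.
    let n : ap (k ≫ c.fst) ⟶ ap (h ≫ c.fst) :=
      pr (el h ((𝟙 _ ≫ p₁ _ _) ≫ l k)) (ev c _ _ (hw (𝟙 _))) (by rw [el_r, ev_l, tr_st])
    have hn {S : E} (w : S ⟶ ap (k ≫ c.fst)) : w ≫ n =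
        pr (el h ((w ≫ p₁ _ _) ≫ l k)) (ev c _ _ (hw w)) (by rw [el_r, ev_l, tr_st]) := by
      simp only [n, comp_pr, comp_el, comp_ev, comp_arg, ← Category.assoc, Category.comp_id]
    have hnr : n ≫ r (h ≫ c.fst) = r (k ≫ c.fst) := by
      have h₁ := hev ((𝟙 _ ≫ p₁ k c.fst) ≫ l k) (arg c (𝟙 _ ≫ p₂ k c.fst)) (hw (𝟙 _))
        (by rw [← hk, p_condition, l_tr_eq_arg_l])
      rw [comp_r, pr_p₂, h₁]
      simp only [← hk, p_condition, ev_arg]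
      rw [← comp_r, Category.id_comp]
    let α : h ≫ c.fst ⟶ k ≫ c.fst := cell n
      (by rw [comp_l, pr_p₁, el_l, ← comp_l, Category.id_comp]) hnr
    have hα {S : E} (w : S ⟶ ap (k ≫ c.fst)) : w ≫ m α =
        pr (el h ((w ≫ p₁ _ _) ≫ l k)) (ev c _ _ (hw w)) (by rw [el_r, ev_l, tr_st]) := hn w
    obtain ⟨χ, -⟩ := hc.existsUnique_cell h k α (trCell htr).hom (by
      apply cell_ext
      intro S w
      apply ap_ext_p₁
      have hβ : ((w ≫ m ((trCell htr).hom ▷ g)) ≫ p₁ _ _) ≫ p₁ _ _ =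
          el h (((w ≫ p₁ _ _) ≫ p₁ _ _) ≫ l k) := by
        apply el_ext
        rw [el_l, whiskerRight_p₁, ← comp_l, m_l, comp_l]
      have hD' : (((w ≫ p₁ _ _) ≫ p₁ _ _) ≫ r k) ≫ tr c.snd = (w ≫ p₂ _ _) ≫ l g := by
        rw [p_condition, ← r_eq_tr, ← comp_r, p_condition]
      have hD'' : (el h (((w ≫ p₁ _ _) ≫ p₁ _ _) ≫ l k) ≫ r h) ≫ tr c.snd =
          (w ≫ p₂ _ _) ≫ l g := by
        rw [← hD', hh, el_l, Category.assoc _ x, hD, hk, Category.assoc _ x']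
      have h₁ := square_elem w hD' (by rw [ev_l])
      have h₂ := square_elem (w ≫ m ((trCell htr).hom ▷ g))
        (by simp only [hβ, whiskerRight_p₂, hD'']) (by rw [ev_l])
      rw [m_comp, whiskerRight_p₁, h₁, hα]
      simp only [m_comp] at h₂ ⊢
      rw [h₂]
      apply ap_ext
      · simp only [pr_p₁, hβ]
      · simp only [pr_p₁, pr_p₂, arg_ev, hβ, whiskerRight_p₂, hh, el_l])
    -- The existence of a 2-cell between 1-cells with invertible left legs already forces `x = x'`.
    have := tr_eq_of_hom χ
    rw [← Category.id_comp x, ← Category.id_comp x', ← tr_st (X := Q) x, ← tr_st (X := Q) x']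
    exact congrArg (𝟙 _ ≫ ·) this
  · intro T y u hu
    let Q : LSpn L := Co.mk (LeftSpan.mk T)
    let b : Q ⟶ V := st (X := Q) y
    have hb {S : E} (w : S ⟶ ap b) : w ≫ r b = (w ≫ l b) ≫ y := by rw [r_eq_tr, tr_st]
    -- The family `u` is itself the right leg of a 1-cell to `U`; its left leg is a pullback of `l
    -- g`, hence in `L`.
    let a : Q ⟶ U := LSpn.mk Q U (pullback.fst y (l g)) u
      (hL.pullback_mem (IsPullback.of_hasPullback y (l g)).flip (l_mem g))
    let i : pullback y (l g) ⟶ ap a := inn _ _ _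
    let o : ap a ⟶ pullback y (l g) := out _ _ _
    have io {S : E} (z : S ⟶ pullback y (l g)) : (z ≫ i) ≫ o = z := inn_out _ _ _ _
    have oi {S : E} (z : S ⟶ ap a) : (z ≫ o) ≫ i = z := out_inn _ _ _ _
    have il {S : E} (z : S ⟶ pullback y (l g)) : (z ≫ i) ≫ l a = z ≫ pullback.fst _ _ :=
      inn_l _ _ _ _
    have ir {S : E} (z : S ⟶ pullback y (l g)) : (z ≫ i) ≫ r a = z ≫ u := inn_r _ _ _ _
    have hw {S : E} (w : S ⟶ ap (b ≫ g)) : ((w ≫ p₁ _ _) ≫ l b) ≫ y = (w ≫ p₂ _ _) ≫ l g := by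
      rw [← hb, p_condition]
    let d : ap (b ≫ g) ⟶ ap (a ≫ f) :=
      up a f (pullback.lift ((𝟙 _ ≫ p₁ _ _) ≫ l b) (𝟙 _ ≫ p₂ _ _) (hw (𝟙 _)) ≫ i)
    have hd {S : E} (w : S ⟶ ap (b ≫ g)) : w ≫ d =
        up a f (pullback.lift ((w ≫ p₁ _ _) ≫ l b) (w ≫ p₂ _ _) (hw w) ≫ i) := by
      simp only [d, comp_up, ← Category.assoc]
      congr 2
      apply pullback.hom_ext <;>
        simp only [Category.assoc, pullback.lift_fst, pullback.lift_snd, Category.id_comp]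
    have he {S : E} (v : S ⟶ ap (a ≫ f)) :
        el b (((v ≫ p₁ _ _) ≫ o) ≫ pullback.fst _ _) ≫ r b =
          (((v ≫ p₁ _ _) ≫ o) ≫ pullback.snd _ _) ≫ l g := by
      rw [hb, el_l, Category.assoc _ (pullback.fst _ _), Category.assoc _ (pullback.snd _ _),
        pullback.condition]
    let e : ap (a ≫ f) ⟶ ap (b ≫ g) := pr _ _ (he (𝟙 _))
    have he' {S : E} (v : S ⟶ ap (a ≫ f)) : v ≫ e = pr _ _ (he v) := by
      simp only [e, comp_pr, comp_el, ← Category.assoc, Category.comp_id]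
    have de {S : E} (w : S ⟶ ap (b ≫ g)) : (w ≫ d) ≫ e = w := by
      rw [he']
      apply ap_ext
      · apply el_ext
        simp only [pr_p₁, el_l, hd, up_p₁, io, pullback.lift_fst]
      · simp only [pr_p₂, hd, up_p₁, io, pullback.lift_snd]
    have ed {S : E} (v : S ⟶ ap (a ≫ f)) : (v ≫ e) ≫ d = v := by
      rw [hd]
      apply ap_ext_p₁
      rw [up_p₁, ← oi (v ≫ p₁ _ _)]
      refine congrArg (· ≫ i) ?_
      apply pullback.hom_ext
      · simp only [he', pr_p₁, el_l, pullback.lift_fst, oi]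
      · simp only [he', pr_p₂, pullback.lift_snd, oi]
    have hdr {S : E} (w : S ⟶ ap (b ≫ g)) : (w ≫ d) ≫ r (a ≫ f) = w ≫ r (b ≫ g) := by
      rw [comp_r, ← p_condition_tr, hd, up_p₁, ir, Category.assoc, hu, pullback.lift_snd_assoc,
        comp_r]
    let δ : a ≫ f ≅ b ≫ g := isoCell d e (by simpa using de (𝟙 _)) (by simpa using ed (𝟙 _))
      (by
        rw [comp_l, ← Category.id_comp d, hd, up_p₁, il, pullback.lift_fst, ← comp_l,
          Category.id_comp])
      (by rw [← Category.id_comp d, hdr, Category.id_comp])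
    obtain ⟨h, α, β, hαβ⟩ := hc.exists_lift a b δ
    -- Since `b` has identity left leg, the 1-cell `h` has invertible left leg and so comes from a
    -- morphism of `E`, the element sought.
    have : IsIso (l (h ≫ c.snd)) := isIso_l_of_iso β.symm
    have : IsIso (l h) := isIso_l_of_isIso_l_comp (g := c.snd)
    have hy : tr h ≫ tr c.snd = y := by
      have h₁ := tr_eq_of_hom β.hom
      have h₂ := tr_comp (f := h) c.snd (𝟙 (ob Q))
      rw [h₁, tr_st, Category.id_comp, Category.id_comp] at h₂
      exact h₂.symm
    refine ⟨tr h, hy, ?_⟩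
    intro S σ z hz hz'
    let w : S ⟶ ap (b ≫ g) := pr (el b σ) z (by rw [hb, el_l, hz'])
    have hw₁ : w ≫ p₁ _ _ = el b σ := pr_p₁ _ _ _
    have hw₂ : w ≫ p₂ _ _ = z := pr_p₂ _ _ _
    have h₁ := congrArg (fun t => (w ≫ m t) ≫ p₁ _ _) hαβ
    have hr : (((w ≫ m (β.hom ▷ g)) ≫ p₁ _ _) ≫ p₁ _ _) ≫ r h = σ ≫ tr h := by
      rw [r_eq_tr, whiskerRight_p₁, ← comp_l, m_l, hw₁, el_l]
    have h₂ := square_elem (w ≫ m (β.hom ▷ g)) (by simp only [hr, whiskerRight_p₂, hw₂, hz])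
      (by rw [ev_l])
    simp only [m_comp] at h₁ h₂
    rw [h₂, whiskerRight_p₁] at h₁
    have h₃ := congrArg (· ≫ r (h ≫ c.fst)) h₁
    have hδ : w ≫ m δ.hom = w ≫ d := rfl
    simp only [m_r] at h₃
    simp only [comp_r, pr_p₂, hr, whiskerRight_p₂, hw₂, hδ, hd, up_p₁, ir, hw₁, el_l] at h₃
    exact h₃.symm

end Bipullback

end LSpn

end SpanPoly

/-! ### The class `R_*` is a protocalibration. -/

namespace SpanPoly

namespace LSpn

variable {E : Type u} [Category.{v} E] [HasPullbacks E] {L : MorphismProperty E}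
  [hL : IsProtocalibration L]

variable {U V W X Y Z : LSpn L}

section LowerStar

variable {R : MorphismProperty E} [hR : IsProtocalibration R]

theorem lowerStar_iff (f : X ⟶ Y) : lowerStar L R f ↔ IsIso (l f) ∧ R (r f) := Iff.rfl

/-- `r f` and `tr f` differ by the isomorphism `l f`, and `R` contains isomorphisms and is closed
under composition. -/
theorem lowerStar_iff_tr (f : X ⟶ Y) [IsIso (l f)] : lowerStar L R f ↔ R (tr f) := by
  rw [lowerStar_iff]
  refine ⟨fun h => hR.comp_mem _ _ (hR.iso_mem _) h.2, fun h => ⟨inferInstance, ?_⟩⟩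
  have h' : r f = l f ≫ tr f := by simp [tr]
  rw [h']
  exact hR.comp_mem _ _ (hR.iso_mem _) h

variable [hLR : IsCompatible L R]

section

variable (f : U ⟶ W) [IsIso (l f)] (hf : R (tr f)) (g : V ⟶ W)

/-- The polynomial given by a 1-cell of `LSpn L` with invertible left leg. -/
noncomputable abbrev starPoly : Poly L R (ob U) (ob W) :=
  ⟨ob U, ob U, 𝟙 _, 𝟙 _, tr f, hL.iso_mem _, hf⟩

variable (R) in
/-- The polynomial given by a 1-cell of `LSpn L`, in the opposite direction. -/
abbrev spanPoly : Poly L R (ob W) (ob V) :=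
  ⟨ap g, ob V, r g, l g, 𝟙 _, l_mem g, hR.iso_mem _⟩

/-- The polynomial whose middle leg gives the vertex of the bipullback of `f` along `g`. -/
noncomputable abbrev pullPoly : Poly L R (ob U) (ob V) := Poly.comp (starPoly f hf) (spanPoly R g)

/-- The vertex of the bipullback of `f` along `g`. -/
noncomputable abbrev pullPt : LSpn L := Co.mk (LeftSpan.mk (pullPoly f hf g).B)

/-- The first projection of the bipullback of `f` along `g`. -/
noncomputable def pullFst : pullPt f hf g ⟶ U :=
  mk (pullPt f hf g) U (Poly.compP₁ (starPoly f hf) (spanPoly R g))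
    (Poly.compEv (starPoly f hf) (spanPoly R g))
    (hL.pullback_mem (Poly.compP_isPullback _ _).flip (l_mem g))

/-- The second projection of the bipullback of `f` along `g`. -/
noncomputable def pullSnd : pullPt f hf g ⟶ V :=
  st (X := pullPt f hf g) (Poly.compD (starPoly f hf) (spanPoly R g))

instance : IsIso (l (pullSnd f hf g)) := inferInstanceAs (IsIso (l (st _)))

variable {f hf g}

section

variable {T T' : E}

theorem tr_pullSnd (x : T ⟶ ob (pullPt f hf g)) :
    x ≫ tr (pullSnd f hf g) = x ≫ Poly.compD (starPoly f hf) (spanPoly R g) := tr_st _ _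

/-- The element of the first projection with given components. -/
noncomputable def pullElem (x : T ⟶ ob (pullPt f hf g)) (z : T ⟶ ap g)
    (h : x ≫ tr (pullSnd f hf g) = z ≫ l g) : T ⟶ ap (pullFst f hf g) :=
  (Poly.compP_isPullback (starPoly f hf) (spanPoly R g)).lift x z ((tr_pullSnd x).symm.trans h) ≫
    inn _ _ _

/-- The second component of an element of the first projection. -/
noncomputable def pullArg : ap (pullFst f hf g) ⟶ ap g :=
  out _ _ _ ≫ Poly.compP₂ (starPoly f hf) (spanPoly R g)

theorem pullElem_l (x : T ⟶ ob (pullPt f hf g)) (z : T ⟶ ap g)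
    (h : x ≫ tr (pullSnd f hf g) = z ≫ l g) : pullElem x z h ≫ l (pullFst f hf g) = x :=
  (inn_l _ _ _ _).trans (IsPullback.lift_fst _ _ _ _)

theorem pullElem_arg (x : T ⟶ ob (pullPt f hf g)) (z : T ⟶ ap g)
    (h : x ≫ tr (pullSnd f hf g) = z ≫ l g) : pullElem x z h ≫ pullArg = z :=
  ((Category.assoc _ _ _).symm.trans (congrArg (· ≫ Poly.compP₂ _ _) (inn_out _ _ _ _))).trans
    (IsPullback.lift_snd _ _ _ _)

theorem pullElem_r (x : T ⟶ ob (pullPt f hf g)) (z : T ⟶ ap g)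
    (h : x ≫ tr (pullSnd f hf g) = z ≫ l g) : pullElem x z h ≫ r (pullFst f hf g) =
      Poly.ev (p := starPoly f hf) (q := spanPoly R g) x z ((tr_pullSnd x).symm.trans h) :=
  inn_r _ _ _ _

theorem pullFst_ext {w w' : T ⟶ ap (pullFst f hf g)}
    (h : w ≫ l (pullFst f hf g) = w' ≫ l (pullFst f hf g)) (h' : w ≫ pullArg = w' ≫ pullArg) :
    w = w' := by
  have h₁ : w ≫ out _ _ _ = w' ≫ out _ _ _ :=
    (Poly.compP_isPullback (starPoly f hf) (spanPoly R g)).hom_ext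
      ((out_l _ _ _ _).trans (h.trans (out_l _ _ _ _).symm))
      ((Category.assoc _ _ _).trans (h'.trans (Category.assoc _ _ _).symm))
  exact (out_inn _ _ _ _).symm.trans ((congrArg (· ≫ inn _ _ _) h₁).trans (out_inn _ _ _ _))

theorem pullFst_l_tr (w : T ⟶ ap (pullFst f hf g)) :
    (w ≫ l (pullFst f hf g)) ≫ tr (pullSnd f hf g) = (w ≫ pullArg) ≫ l g := (tr_pullSnd _).trans
    ((congrArg (· ≫ Poly.compD _ _) (out_l _ _ _ _).symm).trans ((Category.assoc _ _ _).trans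
      ((congrArg ((w ≫ out _ _ _) ≫ ·)
        (Poly.compP_isPullback (starPoly f hf) (spanPoly R g)).w).trans
          ((Category.assoc _ _ _).symm.trans (congrArg (· ≫ l g) (Category.assoc _ _ _))))))

theorem pullElem_eta (w : T ⟶ ap (pullFst f hf g)) :
    pullElem (w ≫ l (pullFst f hf g)) (w ≫ pullArg) (pullFst_l_tr w) = w :=
  pullFst_ext (pullElem_l _ _ _) (pullElem_arg _ _ _)

theorem comp_pullElem (σ : T' ⟶ T) (x : T ⟶ ob (pullPt f hf g)) (z : T ⟶ ap g)
    (h : x ≫ tr (pullSnd f hf g) = z ≫ l g) : σ ≫ pullElem x z h =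
      pullElem (σ ≫ x) (σ ≫ z) (by rw [Category.assoc, h, Category.assoc]) :=
  pullFst_ext (by rw [Category.assoc, pullElem_l, pullElem_l])
    (by rw [Category.assoc, pullElem_arg, pullElem_arg])

theorem pullFst_r_tr (w : T ⟶ ap (pullFst f hf g)) :
    (w ≫ r (pullFst f hf g)) ≫ tr f = (w ≫ pullArg) ≫ r g := by
  rw [← pullElem_eta w, pullElem_r, pullElem_arg]
  exact Poly.ev_t _ _ _

theorem snd_l_tr (w : T ⟶ ap (pullSnd f hf g ≫ g)) :
    ((w ≫ p₁ _ _) ≫ l (pullSnd f hf g)) ≫ tr (pullSnd f hf g) = (w ≫ p₂ _ _) ≫ l g := by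
  rw [← r_eq_tr, p_condition]

variable (f hf g)

/-- The isomorphism filling the bipullback square of `f` along `g`. -/
noncomputable def pullIso : pullFst f hf g ≫ f ≅ pullSnd f hf g ≫ g :=
  isoCell (up _ f (pullElem _ _ (snd_l_tr (𝟙 _))))
    (pr (el (pullSnd f hf g) ((𝟙 _ ≫ p₁ (pullFst f hf g) f) ≫ l (pullFst f hf g)))
      ((𝟙 _ ≫ p₁ (pullFst f hf g) f) ≫ pullArg) (by rw [el_r, pullFst_l_tr]))
    (by
      apply ap_ext
      · apply el_ext
        simp only [comp_pr, pr_p₁, comp_el, el_l, ← Category.assoc, Category.comp_id, up_p₁,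
          pullElem_l]
      · simp only [comp_pr, pr_p₂, ← Category.assoc, Category.comp_id, up_p₁, pullElem_arg])
    (by
      apply ap_ext_p₁
      apply pullFst_ext
      · simp only [comp_up, up_p₁, comp_pullElem, pullElem_l, ← Category.assoc, Category.comp_id,
          pr_p₁, el_l]
      · simp only [comp_up, up_p₁, comp_pullElem, pullElem_arg, ← Category.assoc,
          Category.comp_id, pr_p₂])
    (by rw [comp_l, up_p₁, pullElem_l, ← comp_l, Category.id_comp])
    (by
      rw [comp_r, ← p_condition_tr, up_p₁, pullFst_r_tr, pullElem_arg, ← comp_r,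
        Category.id_comp])

/-- The bipullback square of `f` along `g`. -/
noncomputable def pullSquare : IsoSquare f g := ⟨_, pullFst f hf g, pullSnd f hf g, pullIso f hf g⟩

instance : IsIso (l (pullSquare f hf g).snd) := inferInstanceAs (IsIso (l (pullSnd f hf g)))

theorem ev_pullSquare (x : T ⟶ ob (pullPt f hf g)) (z : T ⟶ ap g)
    (h : x ≫ tr (pullSnd f hf g) = z ≫ l g) :
    ev (pullSquare f hf g) x z h = pullElem x z h := by
  have h₁ : (pr (el (pullSnd f hf g) x) z ((el_r x).trans h) : _ ⟶ ap (pullSnd f hf g ≫ g)) ≫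
      m (pullIso f hf g).hom = up _ f (pullElem x z h) := by
    refine (comp_up _ _).trans (congrArg (up _ f) ?_)
    rw [comp_pullElem]
    simp only [← Category.assoc, Category.comp_id, pr_p₁, pr_p₂, el_l]
  exact (congrArg (· ≫ p₁ _ _) h₁).trans (up_p₁ _)

theorem ev_pullSquare_r (x : T ⟶ ob (pullPt f hf g)) (z : T ⟶ ap g)
    (h : x ≫ tr (pullSnd f hf g) = z ≫ l g) :
    ev (pullSquare f hf g) x z h ≫ r (pullSquare f hf g).fst =
      Poly.ev (p := starPoly f hf) (q := spanPoly R g) x z ((tr_pullSnd x).symm.trans h) :=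
  (congrArg (· ≫ r (pullFst f hf g)) (ev_pullSquare f hf g x z h)).trans (pullElem_r x z h)

/-- The vertex is `Π` along `l g` of the pullback of `f` along `r g`. Once evaluation in the square
is identified with `Poly.ev`, the two conditions are the uniqueness and existence parts of its
universal property. -/
theorem isRepresenting_pullSquare : IsRepresenting (pullSquare f hf g) := by
  constructor
  · intro T x x' hD hev
    have hD' := (tr_pullSnd (f := f) (hf := hf) (g := g) x).symm.trans
      (hD.trans (tr_pullSnd (f := f) (hf := hf) (g := g) x'))
    refine Poly.compB_ext (p := starPoly f hf) (q := spanPoly R g) hD' ?_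
    intro T' σ z h h'
    have h₁ := hev σ z ((tr_pullSnd (f := f) (hf := hf) (g := g) _).trans h)
      ((tr_pullSnd (f := f) (hf := hf) (g := g) _).trans h')
    exact (ev_pullSquare_r f hf g _ _ _).symm.trans (h₁.trans (ev_pullSquare_r f hf g _ _ _))
  · intro T y u hu
    refine ⟨Poly.liftB (p := starPoly f hf) (q := spanPoly R g) y u hu,
      (tr_pullSnd _).trans (Poly.liftB_D _ _ _), ?_⟩
    intro T' σ z h h'
    exact (ev_pullSquare_r f hf g _ _ _).trans (Poly.ev_liftB _ _ _ _ _ _)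

/-- The morphism in question is the right leg of the composite polynomial `pullPoly`, which is in
`R` because `Π` along `L` preserves `R`. -/
theorem lowerStar_pullSnd : lowerStar L R (pullSnd f hf g) := by
  rw [lowerStar_iff_tr]
  have h := (pullPoly f hf g).t_mem
  have h' : tr (pullSnd f hf g) = (pullPoly f hf g).t :=
    (Category.id_comp _).symm.trans ((tr_pullSnd (𝟙 _)).trans
      ((Category.id_comp _).trans (Category.comp_id _).symm))
  rw [h']
  exact h

end

end

instance isBiProtocalibration_lowerStar : IsBiProtocalibration (lowerStar L R) where
  equivalence_mem e := by
    obtain ⟨h₁, h₂⟩ := isIso_legs_of_equivalence e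
    exact ⟨h₁, hR.iso_mem (r e.hom)⟩
  iso_mem {U V f g} e hf := by
    have : IsIso (l f) := hf.1
    have : IsIso (l g) := isIso_l_of_iso e
    rw [lowerStar_iff_tr] at hf ⊢
    rwa [← tr_eq_of_hom e.hom]
  comp_mem f g hf hg := by
    have : IsIso (l f) := hf.1
    have : IsIso (l g) := hg.1
    rw [lowerStar_iff_tr] at hf hg ⊢
    have h : tr (f ≫ g) = tr f ≫ tr g := by
      rw [← Category.id_comp (tr (f ≫ g)), tr_comp, Category.id_comp]
    rw [h]
    exact hR.comp_mem _ _ hf hg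
  exists_bipullback f g hf := by
    have : IsIso (l f) := hf.1
    rw [lowerStar_iff_tr] at hf
    exact ⟨pullSquare f hf g, (isRepresenting_pullSquare f hf g).isBipullback,
      lowerStar_pullSnd f hf g⟩
  opfibration f hf := by
    have : IsIso (l f) := hf.1
    exact isGroupoidOpfibrationCell f

end LowerStar

end LSpn

end SpanPoly

/-! ### Diagrams of `R_*`-spans as morphisms of polynomials. -/

namespace SpanPoly

namespace LSpn

variable {E : Type u} [Category.{v} E] [HasPullbacks E] {L R : MorphismProperty E}
  [hL : IsProtocalibration L] [hR : IsProtocalibration R]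

variable {U V W X Y Z : LSpn L}

theorem tr_comp_eq (f : X ⟶ Y) [IsIso (l f)] (g : Y ⟶ Z) [IsIso (l g)] :
    tr (f ≫ g) = tr f ≫ tr g := by
  rw [← Category.id_comp (tr (f ≫ g)), tr_comp, Category.id_comp]

/-- The underlying morphism goes into the apex of `f`, where elements are determined by their left
legs. Hence conditions on the left 2-cell of a diagram are automatic. -/
theorem cell_eq {f g : X ⟶ Y} [IsIso (l f)] (η θ : f ⟶ g) : η = θ := by
  apply cell_ext
  intro T z
  apply el_ext
  rw [m_l, m_l]

instance (S : BiSpan (lowerStar L R) U V) : IsIso (l S.left) := S.left_mem.1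

/-- `a.left` identifies `a.mid ≫ S'.left` with `S.left`, and both left legs of spans are in `R_*`.
-/
instance {S S' : BiSpan (lowerStar L R) U V} (a : BiSpan.Diagram S S') : IsIso (l a.mid) :=
  have : IsIso (l (a.mid ≫ S'.left)) := isIso_l_of_iso a.left.symm
  isIso_l_of_isIso_l_comp (g := S'.left)

/-- The polynomial corresponding to a span of spans. -/
noncomputable abbrev toPoly (S : BiSpan (lowerStar L R) U V) : Poly L R (ob V) (ob U) where
  A := ap S.right
  B := ob S.apex
  r := r S.right
  n := l S.right
  t := tr S.left
  n_mem := l_mem _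
  t_mem := (lowerStar_iff_tr _).1 S.left_mem

section Phi

variable {S S' S'' : BiSpan (lowerStar L R) U V} {T : E}

theorem mid_cond (a : BiSpan.Diagram S S') (b : T ⟶ ob S.apex) (z : T ⟶ ap S'.right)
    (h : b ≫ tr a.mid = z ≫ l S'.right) : el a.mid b ≫ r a.mid = z ≫ l S'.right := by
  rw [el_r, h]

/-- The action of a diagram of spans on generalized elements. -/
noncomputable def act (a : BiSpan.Diagram S S') (b : T ⟶ ob S.apex) (z : T ⟶ ap S'.right)
    (h : b ≫ tr a.mid = z ≫ l S'.right) : T ⟶ ap S.right :=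
  pr (el a.mid b) z (mid_cond a b z h) ≫ m a.right

/-- The morphism of polynomials corresponding to a diagram of spans. -/
noncomputable def phi (a : BiSpan.Diagram S S') : Poly.NormalCell (toPoly S) (toPoly S') where
  g := tr a.mid
  ℓ := act a (pullback.fst _ _) (pullback.snd _ _) pullback.condition
  ℓ_n := by
    rw [act, m_l, comp_l, pr_p₁, el_l]
  ℓ_r := by
    rw [act, m_r, comp_r, pr_p₂]
  g_t := by
    rw [← tr_comp_eq]
    exact tr_eq_of_hom a.left.hom

theorem phi_g (a : BiSpan.Diagram S S') : (phi a).g = tr a.mid := rfl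

theorem phi_app (a : BiSpan.Diagram S S') (b : T ⟶ ob S.apex) (z : T ⟶ ap S'.right)
    (h : b ≫ tr a.mid = z ≫ l S'.right) : (phi a).app b z h = act a b z h := by
  refine (Category.assoc _ _ _).symm.trans (congrArg (· ≫ m a.right) ?_)
  apply ap_ext
  · rw [pr_p₁]
    refine (Category.assoc _ _ _).trans ((congrArg (_ ≫ ·) (pr_p₁ _ _ _)).trans ?_)
    exact (comp_el _ _).trans (congrArg (el a.mid) (pullback.lift_fst _ _ _))
  · rw [pr_p₂]
    refine (Category.assoc _ _ _).trans ((congrArg (_ ≫ ·) (pr_p₂ _ _ _)).trans ?_)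
    exact pullback.lift_snd _ _ _

theorem phi_ext {a : BiSpan.Diagram S S'} {c : Poly.NormalCell (toPoly S) (toPoly S')}
    (hg : tr a.mid = c.g) (h : ∀ {T : E} (b : T ⟶ ob S.apex) (z : T ⟶ ap S'.right)
      (h : b ≫ tr a.mid = z ≫ l S'.right) (h' : b ≫ c.g = z ≫ l S'.right),
        act a b z h = c.app b z h') : phi a = c := by
  apply Poly.NormalCell.ext_elements
  · intro T b
    rw [phi_g, hg]
  · intro T b z h₁ h₂
    exact (phi_app a b z h₁).trans (h b z h₁ h₂)

/-- The 1-cells are isomorphic exactly when they have the same `tr`; compatibility on the left is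
then automatic, and compatibility on the right says that the actions on fibres agree. -/
theorem phi_eq_iff (a b : BiSpan.Diagram S S') : phi a = phi b ↔ a ≈ b := by
  constructor
  · intro h
    have hg : tr a.mid = tr b.mid := congrArg Poly.NormalCell.g h
    refine ⟨trCell hg, cell_eq _ _, ?_⟩
    apply cell_ext
    intro T z
    have hz : ((z ≫ p₁ _ _) ≫ l b.mid) ≫ tr b.mid = (z ≫ p₂ _ _) ≫ l S'.right := by
      rw [← r_eq_tr, p_condition]
    have hz' : ((z ≫ p₁ _ _) ≫ l b.mid) ≫ tr a.mid = (z ≫ p₂ _ _) ≫ l S'.right := by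
      rw [hg, hz]
    have h₁ : (phi a).app _ _ hz' = (phi b).app _ _ hz := by simp only [h]
    rw [phi_app, phi_app] at h₁
    have h₂ : z = pr (el b.mid ((z ≫ p₁ _ _) ≫ l b.mid)) (z ≫ p₂ _ _) (mid_cond b _ _ hz) := by
      apply ap_ext
      · rw [pr_p₁, el_eta]
      · rw [pr_p₂]
    have h₃ : z ≫ m ((trCell hg).hom ▷ S'.right) =
        pr (el a.mid ((z ≫ p₁ _ _) ≫ l b.mid)) (z ≫ p₂ _ _) (mid_cond a _ _ hz') := by
      apply ap_ext
      · apply el_ext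
        rw [pr_p₁, whiskerRight_p₁, m_l, el_l]
      · rw [pr_p₂, whiskerRight_p₂]
    rw [m_comp, h₃]
    exact h₁.trans (congrArg (· ≫ m b.right) h₂.symm)
  · rintro ⟨χ, -, h⟩
    have hg : tr a.mid = tr b.mid := tr_eq_of_hom χ.hom
    apply phi_ext hg
    intro T x z h₁ h₂
    refine Eq.trans ?_ (phi_app b x z h₂).symm
    simp only [act, ← h, m_comp]
    congr 1
    apply ap_ext
    · rw [pr_p₁, whiskerRight_p₁, pr_p₁, el_m]
    · rw [pr_p₂, whiskerRight_p₂, pr_p₂]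

variable (S S') in
/-- The 2-cells of spans of spans correspond to the morphisms of polynomials. -/
noncomputable def Phi : BiSpan.Cell S S' → Poly.NormalCell (toPoly S) (toPoly S') :=
  Quotient.lift phi fun a b h => (phi_eq_iff a b).2 h

theorem phi_out (a : BiSpan.Cell S S') : phi (Quotient.out a) = Phi S S' a :=
  congrArg (Phi S S') (Quotient.out_eq a)

theorem Phi_injective : Function.Injective (Phi S S') := by
  rintro ⟨a⟩ ⟨b⟩ h
  exact Quotient.sound ((phi_eq_iff a b).1 h)

/-- A morphism of polynomials is realized by the 1-cell with identity left leg and right leg `c.g`,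
with its own action on fibres as the 2-cell. -/
theorem Phi_surjective : Function.Surjective (Phi S S') := by
  intro c
  have hz {T : E} (z : T ⟶ ap (st c.g ≫ S'.right)) :
      ((z ≫ p₁ _ _) ≫ l (st c.g : S.apex ⟶ S'.apex)) ≫ c.g = (z ≫ p₂ _ _) ≫ l S'.right := by
    rw [← p_condition, r_eq_tr, tr_st]
  let a : BiSpan.Diagram S S' :=
    { mid := st c.g
      left := trCell (by
        rw [tr_comp_eq, ← Category.id_comp (tr (st c.g)), tr_st, Category.id_comp]
        exact c.g_t)
      right := cell (c.app _ _ (hz (𝟙 _)))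
        ((c.app_n _ _ _).trans (by rw [← comp_l, Category.id_comp]))
        ((c.app_r _ _ _).trans (by rw [← comp_r, Category.id_comp])) }
  refine ⟨Quotient.mk _ a, phi_ext ?_ ?_⟩
  · change tr (st c.g) = c.g
    rw [← Category.id_comp (tr (st c.g)), tr_st, Category.id_comp]
  · intro T b z h h'
    refine (c.comp_app _ _ _ _).trans ?_
    have h₁ : pr (el a.mid b) z (mid_cond a b z h) ≫ (𝟙 _ ≫ p₁ a.mid S'.right) ≫ l a.mid = b := by
      rw [Category.id_comp, ← Category.assoc, pr_p₁, el_l]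
    have h₂ : pr (el a.mid b) z (mid_cond a b z h) ≫ 𝟙 _ ≫ p₂ a.mid S'.right = z := by
      rw [Category.id_comp, pr_p₂]
    simp only [a] at h₁ h₂ ⊢
    congr 1

theorem Phi_id : Phi S S (BiSpan.Cell.id S) = Poly.NormalCell.id (toPoly S) := by
  refine phi_ext ?_ ?_
  · exact (Category.id_comp _).symm.trans (tr_id _)
  · intro T b z h h'
    rw [Poly.NormalCell.id_app, act, leftUnitor_inv, pr_p₂]

theorem phi_vcomp (a : BiSpan.Diagram S S') (b : BiSpan.Diagram S' S'') :
    phi (a.vcomp b) = (phi a).vcomp (phi b) := by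
  refine phi_ext (tr_comp_eq _ _) ?_
  intro T x z h h'
  rw [Poly.NormalCell.vcomp_app]
  have h₁ : (x ≫ tr a.mid) ≫ tr b.mid = z ≫ l S''.right := (tr_comp _ _).symm.trans h
  refine Eq.trans ?_ (phi_app a x _ (Poly.NormalCell.app_n (phi b) _ _ h₁).symm).symm
  have h₂ := phi_app b (x ≫ tr a.mid) z h₁
  have h₃ : (x ≫ tr a.mid) = act b (x ≫ tr a.mid) z h₁ ≫ l S'.right := by
    rw [act, m_l, comp_l, pr_p₁, el_l]
  have h₄ : act (a.vcomp b) x z h = act a x (act b (x ≫ tr a.mid) z h₁) h₃ := by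
    simp only [act, BiSpan.Diagram.vcomp, m_comp]
    congr 1
    apply ap_ext
    · rw [whiskerLeft_p₁, associator_inv_p₁, pr_p₁, pr_p₁, el_p₁]
    · rw [whiskerLeft_p₂, pr_p₂]
      congr 1
      apply ap_ext
      · rw [associator_inv_p₂_p₁, pr_p₁, pr_p₁, el_p₂]
      · rw [associator_inv_p₂_p₂, pr_p₂, pr_p₂]
  rw [h₄]
  congr 1
  exact h₂.symm

theorem Phi_vcomp (a : BiSpan.Cell S S') (b : BiSpan.Cell S' S'') :
    Phi S S'' (a.vcomp b) = (Phi S S' a).vcomp (Phi S' S'' b) := by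
  obtain ⟨a⟩ := a
  obtain ⟨b⟩ := b
  exact phi_vcomp a b

end Phi

end LSpn

/-! ### Invertible morphisms of polynomials. -/

namespace Poly

variable {E : Type u} [Category.{v} E] [HasPullbacks E] {L R : MorphismProperty E} {X Y : E}
  {p q : Poly L R X Y}

/-- The morphism of polynomials given by isomorphisms of the vertices. -/
noncomputable def NormalCell.ofIso (β : p.B ≅ q.B) (α : p.A ≅ q.A) (hn : α.hom ≫ q.n = p.n ≫ β.hom)
    (hr : α.hom ≫ q.r = p.r) (ht : β.hom ≫ q.t = p.t) : NormalCell p q where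
  g := β.hom
  ℓ := pullback.snd _ _ ≫ α.inv
  ℓ_n := by
    rw [← cancel_mono β.hom, Category.assoc, Category.assoc, ← hn, Iso.inv_hom_id_assoc,
      pullback.condition]
  ℓ_r := by rw [Category.assoc, ← hr, Iso.inv_hom_id_assoc]
  g_t := ht

section

variable (β : p.B ≅ q.B) (α : p.A ≅ q.A) (hn : α.hom ≫ q.n = p.n ≫ β.hom)
    (hr : α.hom ≫ q.r = p.r) (ht : β.hom ≫ q.t = p.t)

theorem NormalCell.ofIso_g : (ofIso β α hn hr ht).g = β.hom := rfl

theorem NormalCell.ofIso_app {T : E} (b : T ⟶ p.B) (z : T ⟶ q.A)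
    (h : b ≫ (ofIso β α hn hr ht).g = z ≫ q.n) : (ofIso β α hn hr ht).app b z h = z ≫ α.inv := by
  exact pullback.lift_snd_assoc _ _ _ _

theorem NormalCell.exists_ofIso_inv : ∃ c : NormalCell q p,
    (ofIso β α hn hr ht).vcomp c = NormalCell.id p ∧
      c.vcomp (ofIso β α hn hr ht) = NormalCell.id q := by
  refine ⟨ofIso β.symm α.symm ?_ ?_ ?_, ?_, ?_⟩
  · rw [Iso.symm_hom, Iso.inv_comp_eq, ← Category.assoc, hn, Category.assoc, Iso.symm_hom,
      Iso.hom_inv_id, Category.comp_id]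
  · rw [Iso.symm_hom, Iso.inv_comp_eq, hr]
  · rw [Iso.symm_hom, Iso.inv_comp_eq, ht]
  · apply ext_elements
    · intro T b
      simp [ofIso_g]
    · intro T b z h h'
      simp [ofIso_app]
  · apply ext_elements
    · intro T b
      simp [ofIso_g]
    · intro T b z h h'
      simp [ofIso_app]

end

end Poly

end SpanPoly

/-! ### The vertex of a composite span and the vertex of a composite polynomial. -/

namespace SpanPoly

namespace LSpn

variable {E : Type u} [Category.{v} E] [HasPullbacks E] {L R : MorphismProperty E}
  [hL : IsProtocalibration L] [hR : IsProtocalibration R] [hLR : IsCompatible L R]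

variable {U V W X : LSpn L}

section Vertex

open BiSpan (vertex proj₁ proj₂ square bipullback lift liftProj₁ liftProj₂ lift_square)

variable {S : BiSpan (lowerStar L R) U V} {T : BiSpan (lowerStar L R) V W} {Q Q' : E}

instance : IsIso (l (bipullback S T).snd) := (BiSpan.bipullback_mem S T).1

instance : IsIso (l (proj₁ S T)) := (BiSpan.bipullback_mem S T).1

/-- Evaluation of a generalized element of the vertex of a composite span. -/
noncomputable def evV (x : Q ⟶ ob (vertex S T)) (z : Q ⟶ ap S.right)
    (h : x ≫ tr (proj₁ S T) = z ≫ l S.right) : Q ⟶ ap (proj₂ S T) := ev (bipullback S T) x z h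

/-- The argument of an evaluation. -/
noncomputable def argV (w : Q ⟶ ap (proj₂ S T)) : Q ⟶ ap S.right := arg (bipullback S T) w

theorem evV_eq (x : Q ⟶ ob (vertex S T)) (z : Q ⟶ ap S.right)
    (h : x ≫ tr (proj₁ S T) = z ≫ l S.right) : evV x z h =
      (pr (el (proj₁ S T) x) z ((el_r x).trans h) ≫ m (square S T).hom) ≫ p₁ _ _ := rfl

@[simp] theorem evV_l (x : Q ⟶ ob (vertex S T)) (z : Q ⟶ ap S.right)
    (h : x ≫ tr (proj₁ S T) = z ≫ l S.right) : evV x z h ≫ l (proj₂ S T) = x := ev_l x z h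

theorem evV_r_tr (x : Q ⟶ ob (vertex S T)) (z : Q ⟶ ap S.right)
    (h : x ≫ tr (proj₁ S T) = z ≫ l S.right) :
    (evV x z h ≫ r (proj₂ S T)) ≫ tr T.left = z ≫ r S.right := ev_r_tr x z h

@[simp] theorem comp_evV (σ : Q' ⟶ Q) (x : Q ⟶ ob (vertex S T)) (z : Q ⟶ ap S.right)
    (h : x ≫ tr (proj₁ S T) = z ≫ l S.right) : σ ≫ evV x z h =
      evV (σ ≫ x) (σ ≫ z) (by rw [Category.assoc, h, Category.assoc]) := comp_ev σ x z h

theorem proj₂_l_tr (w : Q ⟶ ap (proj₂ S T)) :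
    (w ≫ l (proj₂ S T)) ≫ tr (proj₁ S T) = argV w ≫ l S.right := l_tr_eq_arg_l w

@[simp] theorem comp_argV (σ : Q' ⟶ Q) (w : Q ⟶ ap (proj₂ S T)) : σ ≫ argV w = argV (σ ≫ w) :=
  comp_arg σ w

@[simp] theorem evV_argV (w : Q ⟶ ap (proj₂ S T))
    (h : (w ≫ l (proj₂ S T)) ≫ tr (proj₁ S T) = argV w ≫ l S.right) :
    evV (w ≫ l (proj₂ S T)) (argV w) h = w := ev_arg w h

@[simp] theorem argV_evV (x : Q ⟶ ob (vertex S T)) (z : Q ⟶ ap S.right)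
    (h : x ≫ tr (proj₁ S T) = z ≫ l S.right) : argV (evV x z h) = z := arg_ev x z h

theorem proj₂_ext {w w' : Q ⟶ ap (proj₂ S T)} (h : w ≫ l (proj₂ S T) = w' ≫ l (proj₂ S T))
    (h' : argV w = argV w') : w = w' := by
  rw [← evV_argV w (proj₂_l_tr w), ← evV_argV w' (proj₂_l_tr w')]
  simp only [h, h']

theorem evV_congr {x x' : Q ⟶ ob (vertex S T)} {z z' : Q ⟶ ap S.right} (hx : x = x')
    (hz : z = z') (h : x ≫ tr (proj₁ S T) = z ≫ l S.right) :
    evV x z h = evV x' z' (by rw [← hx, ← hz, h]) := by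
  subst hx hz
  rfl

/-- The vertex belongs to a bipullback about which only the universal property is known, so its
elements are reached through representability. This is the analogue of `compB_ext`. -/
theorem vertex_ext {x x' : Q ⟶ ob (vertex S T)}
    (hD : x ≫ tr (proj₁ S T) = x' ≫ tr (proj₁ S T))
    (hev : ∀ {Q' : E} (σ : Q' ⟶ Q) (z : Q' ⟶ ap S.right)
      (h : (σ ≫ x) ≫ tr (proj₁ S T) = z ≫ l S.right)
      (h' : (σ ≫ x') ≫ tr (proj₁ S T) = z ≫ l S.right),
      evV (σ ≫ x) z h ≫ r (proj₂ S T) = evV (σ ≫ x') z h' ≫ r (proj₂ S T)) : x = x' :=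
  (isRepresenting_of_isBipullback (BiSpan.bipullback_isBipullback S T)).elem_ext hD hev

theorem exists_vertex_elem (y : Q ⟶ ob S.apex) (u : pullback y (l S.right) ⟶ ob T.apex)
    (hu : u ≫ tr T.left = pullback.snd _ _ ≫ r S.right) :
    ∃ x : Q ⟶ ob (vertex S T), x ≫ tr (proj₁ S T) = y ∧
      ∀ {Q' : E} (σ : Q' ⟶ Q) (z : Q' ⟶ ap S.right)
        (h : (σ ≫ x) ≫ tr (proj₁ S T) = z ≫ l S.right) (h' : σ ≫ y = z ≫ l S.right),
        evV (σ ≫ x) z h ≫ r (proj₂ S T) = pullback.lift σ z h' ≫ u :=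
  (isRepresenting_of_isBipullback (BiSpan.bipullback_isBipullback S T)).exists_elem y u hu

theorem square_elemV {h : X ⟶ vertex S T} (z : Q ⟶ ap ((h ≫ proj₁ S T) ≫ S.right))
    (hz : (((z ≫ p₁ _ _) ≫ p₁ _ _) ≫ r h) ≫ tr (proj₁ S T) = (z ≫ p₂ _ _) ≫ l S.right) :
    (z ≫ m ((α_ h (proj₂ S T) T.left).hom ≫ h ◁ (square S T).hom ≫
        (α_ h (proj₁ S T) S.right).inv)) ≫ p₁ _ _ =
      pr ((z ≫ p₁ _ _) ≫ p₁ _ _)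
        (evV (((z ≫ p₁ _ _) ≫ p₁ _ _) ≫ r h) (z ≫ p₂ _ _) hz) (by rw [evV_l]) :=
  square_elem (c := bipullback S T) z hz (ev_l _ _ _).symm

section Lift

variable {b : X ⟶ T.apex} {a : X ⟶ S.apex} {δ : b ≫ T.left ≅ a ≫ S.right}

/-- The element of the apex of `a` corresponding to an element of the apex of `lift`. -/
noncomputable def liftFst (ξ : Q ⟶ ap (lift S T b a δ)) : Q ⟶ ap a :=
  up _ (proj₁ S T) ξ ≫ m (liftProj₁ S T b a δ).inv

@[simp] theorem liftFst_l (ξ : Q ⟶ ap (lift S T b a δ)) :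
    liftFst ξ ≫ l a = ξ ≫ l (lift S T b a δ) := by
  rw [liftFst, m_l, comp_l, up_p₁]

theorem lift_r_tr (ξ : Q ⟶ ap (lift S T b a δ)) :
    (ξ ≫ r (lift S T b a δ)) ≫ tr (proj₁ S T) = liftFst ξ ≫ r a := by
  rw [liftFst, m_r, comp_r, up_p₂, el_r]

/-- `lift_square` on elements: the value at `z` of the element of the vertex given by `lift` is
obtained by sending the corresponding pair through `δ`. -/
theorem evV_lift (ξ : Q ⟶ ap (lift S T b a δ)) (z : Q ⟶ ap S.right)
    (h : (ξ ≫ r (lift S T b a δ)) ≫ tr (proj₁ S T) = z ≫ l S.right) :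
    ((pr (liftFst ξ) z ((lift_r_tr ξ).symm.trans h) ≫ m δ.hom) ≫ p₁ _ _) ≫
      m (liftProj₂ S T b a δ).hom = pr ξ (evV (ξ ≫ r (lift S T b a δ)) z h) (by rw [evV_l]) := by
  let w : Q ⟶ ap (a ≫ S.right) := pr (liftFst ξ) z ((lift_r_tr ξ).symm.trans h)
  have hw₁ : w ≫ p₁ _ _ = liftFst ξ := pr_p₁ _ _ _
  have hw₂ : w ≫ p₂ _ _ = z := pr_p₂ _ _ _
  have h₁ := congrArg (fun t => (w ≫ m t) ≫ p₁ _ _) (lift_square S T b a δ)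
  have hr : ((w ≫ m ((liftProj₁ S T b a δ).hom ▷ S.right)) ≫ p₁ _ _) ≫ p₁ _ _ = ξ := by
    rw [whiskerRight_p₁, hw₁, liftFst, m_hom_inv, up_p₁]
  have h₂ := square_elemV (w ≫ m ((liftProj₁ S T b a δ).hom ▷ S.right))
    (by simp only [whiskerRight_p₂, hw₂, hr, h])
  simp only [m_comp] at h₁ h₂
  rw [whiskerRight_p₁, h₂] at h₁
  simp only [whiskerRight_p₂, hw₂, hr] at h₁
  exact h₁

end Lift

section Mu

variable (S T)

theorem mu_cond : (evV (pullback.fst (tr (proj₁ S T)) (l S.right)) (pullback.snd _ _)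
    pullback.condition ≫ r (proj₂ S T)) ≫ tr T.left =
      pullback.snd (tr (proj₁ S T)) (l S.right) ≫ r S.right := evV_r_tr _ _ _

/-- The vertex of a composite span as the vertex of a composite polynomial. -/
noncomputable def muB : ob (vertex S T) ⟶ (Poly.comp (toPoly T) (toPoly S)).B :=
  Poly.liftB (p := toPoly T) (q := toPoly S) (tr (proj₁ S T)) _ (mu_cond S T)

variable {S T}

theorem muB_D (x : Q ⟶ ob (vertex S T)) :
    (x ≫ muB S T) ≫ Poly.compD (toPoly T) (toPoly S) = x ≫ tr (proj₁ S T) :=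
  Poly.liftB_D_elem _ _ _ _

theorem muB_cond {x : Q ⟶ ob (vertex S T)} {z : Q ⟶ ap S.right}
    (h : (x ≫ muB S T) ≫ Poly.compD (toPoly T) (toPoly S) = z ≫ l S.right) :
    x ≫ tr (proj₁ S T) = z ≫ l S.right := (muB_D x).symm.trans h

theorem muB_ev (x : Q ⟶ ob (vertex S T)) (z : Q ⟶ ap S.right)
    (h : (x ≫ muB S T) ≫ Poly.compD (toPoly T) (toPoly S) = z ≫ l S.right) :
    Poly.ev (p := toPoly T) (q := toPoly S) (x ≫ muB S T) z h =
      evV x z (muB_cond h) ≫ r (proj₂ S T) := by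
  refine (Poly.ev_liftB _ _ _ _ _ h).trans ((Category.assoc _ _ _).symm.trans
    (congrArg (· ≫ r (proj₂ S T)) ((comp_evV _ _ _ _).trans ?_)))
  congr 1
  · exact pullback.lift_fst _ _ _
  · exact pullback.lift_snd _ _ _

/-- Both objects classify an element of `S.apex` with a compatible family in `T.apex` indexed by the
fibre of `S.right`. The inverse classifies the evaluation of the composite polynomial, and both
round trips hold by extensionality. -/
theorem exists_muB_inv : ∃ β : (Poly.comp (toPoly T) (toPoly S)).B ⟶ ob (vertex S T),
    muB S T ≫ β = 𝟙 _ ∧ β ≫ muB S T = 𝟙 _ := by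
  obtain ⟨β, hβ, hβ'⟩ := exists_vertex_elem (S := S) (T := T)
    (Poly.compD (toPoly T) (toPoly S)) (Poly.ev (p := toPoly T) (q := toPoly S)
      (pullback.fst _ _) (pullback.snd _ _) pullback.condition) (Poly.ev_t _ _ _)
  have hβ'' {Q : E} (σ : Q ⟶ (Poly.comp (toPoly T) (toPoly S)).B) (z : Q ⟶ ap S.right)
      (h : (σ ≫ β) ≫ tr (proj₁ S T) = z ≫ l S.right)
      (h' : σ ≫ Poly.compD (toPoly T) (toPoly S) = z ≫ l S.right) :
      evV (σ ≫ β) z h ≫ r (proj₂ S T) = Poly.ev (p := toPoly T) (q := toPoly S) σ z h' := by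
    refine (hβ' σ z h h').trans ((Poly.comp_ev _ _ _ _).trans ?_)
    congr 1
    · exact pullback.lift_fst _ _ _
    · exact pullback.lift_snd _ _ _
  have h₂ : β ≫ muB S T = 𝟙 _ := by
    apply Poly.compB_ext
    · rw [muB_D, hβ, Category.id_comp]
    · intro Q σ z h h'
      simp only [← Category.assoc, Category.comp_id] at h h' ⊢
      exact (muB_ev _ _ _).trans (hβ'' _ _ _ _)
  refine ⟨β, ?_, h₂⟩
  apply vertex_ext
  · rw [Category.assoc, hβ, Category.id_comp]
    exact (congrArg (· ≫ _) (Category.id_comp _).symm).trans ((muB_D _).trans (Category.id_comp _))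
  · intro Q σ z h h'
    simp only [← Category.assoc, Category.comp_id] at h h' ⊢
    have h₀ : (σ ≫ muB S T) ≫ Poly.compD (toPoly T) (toPoly S) = z ≫ l S.right :=
      (muB_D _).trans h'
    exact (hβ'' _ _ _ h₀).trans (muB_ev _ _ _)

variable (S T)

/-- The vertices of a composite span and of a composite polynomial are isomorphic. -/
noncomputable def isoB : ob (vertex S T) ≅ (Poly.comp (toPoly T) (toPoly S)).B where
  hom := muB S T
  inv := exists_muB_inv.choose
  hom_inv_id := exists_muB_inv.choose_spec.1
  inv_hom_id := exists_muB_inv.choose_spec.2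

variable {S T}

theorem isoB_inv_tr (b : Q ⟶ (Poly.comp (toPoly T) (toPoly S)).B) :
    (b ≫ (isoB S T).inv) ≫ tr (proj₁ S T) = b ≫ Poly.compD (toPoly T) (toPoly S) := by
  rw [← muB_D, Category.assoc b]
  exact congrArg (fun t => (b ≫ t) ≫ _) (isoB S T).inv_hom_id |>.trans
    (congrArg (· ≫ _) (Category.comp_id b))

theorem isoB_inv_ev (b : Q ⟶ (Poly.comp (toPoly T) (toPoly S)).B) (z : Q ⟶ ap S.right)
    (h : (b ≫ (isoB S T).inv) ≫ tr (proj₁ S T) = z ≫ l S.right) :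
    evV (b ≫ (isoB S T).inv) z h ≫ r (proj₂ S T) =
      Poly.ev (p := toPoly T) (q := toPoly S) b z ((isoB_inv_tr b).symm.trans h) := by
  have h₁ : (b ≫ (isoB S T).inv) ≫ muB S T = b := by
    rw [Category.assoc]
    exact (congrArg (b ≫ ·) (isoB S T).inv_hom_id).trans (Category.comp_id b)
  refine (muB_ev _ _ ((muB_D _).trans h)).symm.trans ?_
  simp only [h₁]

/-- The element of the apex of the right leg of a composite span with given components. -/
noncomputable def mkV (x : Q ⟶ ob (vertex S T)) (z : Q ⟶ ap S.right) (y : Q ⟶ ap T.right)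
    (h : x ≫ tr (proj₁ S T) = z ≫ l S.right) (h' : evV x z h ≫ r (proj₂ S T) = y ≫ l T.right) :
    Q ⟶ ap (proj₂ S T ≫ T.right) :=
  pr (evV x z h) y h'

variable (w : Q ⟶ ap (proj₂ S T ≫ T.right))

/-- The component in the first span of an element of the right leg of a composite span. -/
noncomputable def argS : Q ⟶ ap S.right :=
  argV (w ≫ p₁ _ _)

/-- The component in the second span of an element of the right leg of a composite span. -/
noncomputable def argT : Q ⟶ ap T.right :=
  w ≫ p₂ _ _

/-- The component in the vertex of an element of the right leg of a composite span. -/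
noncomputable def argB : Q ⟶ ob (vertex S T) := (w ≫ p₁ _ _) ≫ l (proj₂ S T)

variable {w}

/-- An element here is an element of the vertex, an argument in the apex of `S.right`, and an
element of the apex of `T.right` over the value, just as for `Poly.compA_ext`. -/
theorem compR_ext {w' : Q ⟶ ap (proj₂ S T ≫ T.right)}
    (h : argB w = argB w')
    (h₁ : argS w = argS w') (h₂ : argT w = argT w') : w = w' := by
  exact ap_ext (f := proj₂ S T) (g := T.right) (proj₂_ext h h₁) h₂

theorem compR_l_tr :
    argB w ≫ tr (proj₁ S T) = argS w ≫ l S.right := by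
  rw [argB, proj₂_l_tr, argS]

theorem evV_argS (h : argB w ≫ tr (proj₁ S T) = argS w ≫ l S.right) :
    evV (argB w) (argS w) h =
      w ≫ p₁ _ _ :=
  evV_argV _ _

theorem evV_argS_r
    (h : argB w ≫ tr (proj₁ S T) = argS w ≫ l S.right) :
    evV (argB w) (argS w) h ≫ r (proj₂ S T) = argT w ≫ l T.right :=
  (congrArg (· ≫ r (proj₂ S T)) (evV_argS h)).trans (p_condition _)

theorem comp_argS (σ : Q' ⟶ Q) : σ ≫ argS w = argS (σ ≫ w) := by
  rw [argS, comp_argV, argS, ← Category.assoc]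

theorem comp_argB (σ : Q' ⟶ Q) : σ ≫ argB w = argB (σ ≫ w) := by
  simp only [argB, Category.assoc]

theorem comp_argT (σ : Q' ⟶ Q) : σ ≫ argT w = argT (σ ≫ w) :=
  (Category.assoc _ _ _).symm

section

variable (x : Q ⟶ ob (vertex S T)) (z : Q ⟶ ap S.right) (y : Q ⟶ ap T.right)
    (h : x ≫ tr (proj₁ S T) = z ≫ l S.right) (h' : evV x z h ≫ r (proj₂ S T) = y ≫ l T.right)

theorem argB_mkV : argB (mkV x z y h h') = x :=
  (congrArg (· ≫ l (proj₂ S T)) (pr_p₁ _ _ _)).trans (evV_l _ _ _)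

theorem argS_mkV : argS (mkV x z y h h') = z :=
  (congrArg argV (pr_p₁ _ _ _)).trans (argV_evV _ _ _)

theorem argT_mkV : argT (mkV x z y h h') = y := pr_p₂ _ _ _

end

theorem toA_cond (w : Q ⟶ ap (proj₂ S T ≫ T.right)) :
    (argB w ≫ muB S T) ≫ Poly.compD (toPoly T) (toPoly S) =
      argS w ≫ l S.right := (muB_D _).trans compR_l_tr

theorem toA_cond' (w : Q ⟶ ap (proj₂ S T ≫ T.right)) :
    Poly.ev (p := toPoly T) (q := toPoly S) (argB w ≫ muB S T) (argS w)
      (toA_cond w) = argT w ≫ l T.right := (muB_ev _ _ _).trans (evV_argS_r _)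

theorem ofA_cond (z : Q ⟶ (Poly.comp (toPoly T) (toPoly S)).A) :
    ((z ≫ (Poly.comp (toPoly T) (toPoly S)).n) ≫ (isoB S T).inv) ≫ tr (proj₁ S T) =
      (z ≫ Poly.compC (toPoly T) (toPoly S)) ≫ l S.right :=
  (isoB_inv_tr _).trans (Poly.compA_n_D z)

theorem ofA_cond' (z : Q ⟶ (Poly.comp (toPoly T) (toPoly S)).A) :
    evV ((z ≫ (Poly.comp (toPoly T) (toPoly S)).n) ≫ (isoB S T).inv)
      (z ≫ Poly.compC (toPoly T) (toPoly S)) (ofA_cond z) ≫ r (proj₂ S T) =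
        (z ≫ Poly.compA₂ (toPoly T) (toPoly S)) ≫ l T.right :=
  (isoB_inv_ev _ _ _).trans (Poly.ev_compA z _)

variable (S T)

/-- The morphism from the apex of the right leg of a composite span to the domain of the middle leg
of a composite polynomial. -/
noncomputable def toA :
    ap (proj₂ S T ≫ T.right) ⟶ (Poly.comp (toPoly T) (toPoly S)).A :=
  Poly.mkA (p := toPoly T) (q := toPoly S) _ _ _ (toA_cond (𝟙 _)) (toA_cond' (𝟙 _))

/-- The inverse of `toA`. -/
noncomputable def ofA :
    (Poly.comp (toPoly T) (toPoly S)).A ⟶ ap (proj₂ S T ≫ T.right) :=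
  mkV _ _ _ (ofA_cond (𝟙 _)) (ofA_cond' (𝟙 _))

variable {S T}

theorem toA_n : (w ≫ toA S T) ≫ (Poly.comp (toPoly T) (toPoly S)).n =
    argB w ≫ muB S T := by
  rw [Category.assoc]
  refine (congrArg (w ≫ ·) (Poly.mkA_n _ _ _ _ _)).trans ?_
  rw [← Category.assoc, comp_argB, Category.comp_id]

theorem toA_compC : (w ≫ toA S T) ≫ Poly.compC (toPoly T) (toPoly S) = argS w := by
  rw [Category.assoc]
  refine (congrArg (w ≫ ·) (Poly.mkA_compC _ _ _ _ _)).trans ?_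
  rw [comp_argS, Category.comp_id]

theorem toA_compA₂ : (w ≫ toA S T) ≫ Poly.compA₂ (toPoly T) (toPoly S) = argT w := by
  rw [Category.assoc]
  refine (congrArg (w ≫ ·) (Poly.mkA_compA₂ _ _ _ _ _)).trans ?_
  rw [comp_argT, Category.comp_id]

section

variable (z : Q ⟶ (Poly.comp (toPoly T) (toPoly S)).A)

theorem argB_ofA : argB (z ≫ ofA S T) =
    (z ≫ (Poly.comp (toPoly T) (toPoly S)).n) ≫ (isoB S T).inv := by
  rw [← comp_argB, ofA, argB_mkV, Category.id_comp, Category.assoc]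

theorem argS_ofA : argS (z ≫ ofA S T) = z ≫ Poly.compC (toPoly T) (toPoly S) := by
  rw [← comp_argS, ofA, argS_mkV, Category.id_comp]

theorem argT_ofA : argT (z ≫ ofA S T) = z ≫ Poly.compA₂ (toPoly T) (toPoly S) := by
  rw [← comp_argT, ofA, argT_mkV, Category.id_comp]

end

variable (S T)

/-- The domains of the middle legs of a composite span and a composite polynomial are
isomorphic. -/
noncomputable def isoA :
    ap (proj₂ S T ≫ T.right) ≅ (Poly.comp (toPoly T) (toPoly S)).A where
  hom := toA S T
  inv := ofA S T
  hom_inv_id := by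
    apply compR_ext
    · rw [argB_ofA, ← Category.id_comp (toA S T), toA_n, Category.assoc]
      exact congrArg (argB (𝟙 _) ≫ ·) (isoB S T).hom_inv_id |>.trans (Category.comp_id _)
    · rw [argS_ofA, ← Category.id_comp (toA S T), toA_compC]
    · rw [argT_ofA, ← Category.id_comp (toA S T), toA_compA₂]
  inv_hom_id := by
    apply Poly.compA_ext
    · rw [toA_n, ← Category.id_comp (ofA S T), argB_ofA, Category.assoc]
      refine (Category.assoc _ _ _).symm.trans ?_
      rw [Category.assoc]
      exact congrArg ((𝟙 _ ≫ (Poly.comp (toPoly T) (toPoly S)).n) ≫ ·)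
        (isoB S T).inv_hom_id |>.trans (Category.comp_id _)
    · rw [toA_compC, ← Category.id_comp (ofA S T), argS_ofA]
    · rw [toA_compA₂, ← Category.id_comp (ofA S T), argT_ofA]

/-- The comparison of the composition of spans with that of polynomials. -/
noncomputable def mu :
    Poly.NormalCell (toPoly (BiSpan.comp S T)) (Poly.comp (toPoly T) (toPoly S)) :=
  Poly.NormalCell.ofIso (p := toPoly (BiSpan.comp S T)) (isoB S T) (isoA S T)
    (by
      have h := toA_n (S := S) (T := T) (w := 𝟙 _)
      rw [Category.id_comp] at h
      refine h.trans (congrArg (· ≫ muB S T) ?_)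
      exact (comp_l (𝟙 _)).symm.trans (Category.id_comp _))
    (by
      have h := Poly.compA_r (p := toPoly T) (q := toPoly S) (toA S T)
      refine h.trans ?_
      rw [← Category.id_comp (toA S T), toA_compA₂]
      exact (comp_r (𝟙 _)).symm.trans (Category.id_comp _))
    (by
      have h := Poly.comp_t_elem (p := toPoly T) (q := toPoly S) (𝟙 _ ≫ muB S T)
      rw [muB_D, Category.id_comp] at h
      refine h.trans (Eq.trans ?_ (tr_comp_eq (proj₁ S T) S.left).symm)
      rw [Category.id_comp])

theorem mu_app (x : Q ⟶ ob (vertex S T)) (z : Q ⟶ (Poly.comp (toPoly T) (toPoly S)).A)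
    (h : x ≫ (mu S T).g = z ≫ (Poly.comp (toPoly T) (toPoly S)).n) :
    (mu S T).app x z h = z ≫ ofA S T := Poly.NormalCell.ofIso_app _ _ _ _ _ _ _ _

end Mu

end Vertex

end LSpn

end SpanPoly

/-! ### Horizontal composition of spans and of polynomials. -/

namespace SpanPoly

namespace LSpn

variable {E : Type u} [Category.{v} E] [HasPullbacks E] {L R : MorphismProperty E}
  [hL : IsProtocalibration L] [hR : IsProtocalibration R] [hLR : IsCompatible L R]

variable {U V W X : LSpn L}

open BiSpan (vertex proj₁ proj₂ square bipullback lift liftProj₁ liftProj₂ lift_square)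

section Lift

variable {S : BiSpan (lowerStar L R) U V} {T : BiSpan (lowerStar L R) V W} {Q Q' : E}

variable {b : X ⟶ T.apex} {a : X ⟶ S.apex} {δ : b ≫ T.left ≅ a ≫ S.right}

instance isIso_l_lift [IsIso (l a)] : IsIso (l (lift S T b a δ)) :=
  have : IsIso (l (lift S T b a δ ≫ proj₁ S T)) := isIso_l_of_iso (liftProj₁ S T b a δ).symm
  isIso_l_of_isIso_l_comp (g := proj₁ S T)

variable [IsIso (l a)]

theorem liftFst_el (x : Q ⟶ ob X) : liftFst (el (lift S T b a δ) x) = el a x :=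
  el_ext (by rw [liftFst_l, el_l, el_l])

theorem tr_lift (x : Q ⟶ ob X) : (x ≫ tr (lift S T b a δ)) ≫ tr (proj₁ S T) = x ≫ tr a := by
  rw [← el_r (f := lift S T b a δ), lift_r_tr, liftFst_el, el_r]

theorem evV_tr_lift (x : Q ⟶ ob X) (z : Q ⟶ ap S.right)
    (h : (x ≫ tr (lift S T b a δ)) ≫ tr (proj₁ S T) = z ≫ l S.right) :
    ((pr (el a x) z ((el_r x).trans ((tr_lift x).symm.trans h)) ≫ m δ.hom) ≫ p₁ _ _) ≫
      m (liftProj₂ S T b a δ).hom = pr (el (lift S T b a δ) x)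
        (evV (x ≫ tr (lift S T b a δ)) z h) (by rw [evV_l, el_r]) := by
  have h₁ := evV_lift (el (lift S T b a δ) x) z (by rw [el_r, h])
  simp only [liftFst_el, el_r] at h₁
  exact h₁

end Lift

section HorizontalComposition

variable {S S' : BiSpan (lowerStar L R) U V} {T T' : BiSpan (lowerStar L R) V W} {Q : E}
  (a : BiSpan.Diagram S S') (b : BiSpan.Diagram T T')
  {k : vertex S T ⟶ T'.apex} (κ : proj₂ S T ≫ b.mid ⟶ k)
  (e : k ≫ T'.left ≅ (proj₁ S T ≫ a.mid) ≫ S'.right)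

theorem act_l (x : Q ⟶ ob S.apex) (z : Q ⟶ ap S'.right) (h : x ≫ tr a.mid = z ≫ l S'.right) :
    act a x z h ≫ l S.right = x := by
  rw [act, m_l, comp_l, pr_p₁, el_l]

section

variable (x : Q ⟶ ob (vertex S T)) (z : Q ⟶ ap S'.right)
  (h : (x ≫ tr (proj₁ S T)) ≫ tr a.mid = z ≫ l S'.right)

/-- The element of the apex of `k` lying over an element of the vertex and an element of the right
leg of `S'`. -/
noncomputable def opElem : Q ⟶ ap k :=
  ((pr (el (proj₁ S T ≫ a.mid) x) z (by rw [el_r, tr_comp, h]) :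
    Q ⟶ ap ((proj₁ S T ≫ a.mid) ≫ S'.right)) ≫ m e.hom) ≫ p₁ _ _

/-- The equation for `κ` applied to the pair of `x` and `z`: its right side carries `z` back along
`a` and evaluates `x` there. -/
theorem opElem_p₁ (he : κ ▷ T'.left ≫ e.hom =
    (α_ _ _ _).hom ≫ proj₂ S T ◁ b.left.hom ≫ (square S T).hom ≫
      proj₁ S T ◁ a.right ≫ (α_ _ _ _).inv) :
    (opElem a e x z h ≫ m κ) ≫ p₁ _ _ =
    evV x (act a (x ≫ tr (proj₁ S T)) z h) (act_l _ _ _ _).symm := by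
  let w : Q ⟶ ap ((proj₁ S T ≫ a.mid) ≫ S'.right) :=
    pr (el (proj₁ S T ≫ a.mid) x) z (by rw [el_r, tr_comp, h])
  have h₁ := congrArg (fun t => ((w ≫ m t) ≫ p₁ _ _) ≫ p₁ _ _) he
  simp only [m_comp] at h₁
  rw [whiskerRight_p₁, associator_hom_p₁_p₁, whiskerLeft_p₁] at h₁
  refine h₁.trans ?_
  rw [evV_eq]
  congr 2
  apply ap_ext
  · rw [whiskerLeft_p₁, associator_inv_p₁, pr_p₁, pr_p₁, el_p₁]
  · rw [whiskerLeft_p₂, pr_p₂, act]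
    congr 1
    apply ap_ext
    · rw [associator_inv_p₂_p₁, pr_p₁, pr_p₁, el_p₂]
    · rw [associator_inv_p₂_p₂, pr_p₂, pr_p₂]

theorem opElem_p₂ (he : κ ▷ T'.left ≫ e.hom =
    (α_ _ _ _).hom ≫ proj₂ S T ◁ b.left.hom ≫ (square S T).hom ≫
      proj₁ S T ◁ a.right ≫ (α_ _ _ _).inv) :
    (opElem a e x z h ≫ m κ) ≫ p₂ _ _ = el b.mid
    (evV x (act a (x ≫ tr (proj₁ S T)) z h) (act_l _ _ _ _).symm ≫ r (proj₂ S T)) := by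
  apply el_ext
  rw [el_l, ← p_condition, opElem_p₁ a b κ e x z h he]

/-- The right leg of `k` is forced by the lifting equation, whichever lift was chosen. -/
theorem opElem_r (he : κ ▷ T'.left ≫ e.hom =
    (α_ _ _ _).hom ≫ proj₂ S T ◁ b.left.hom ≫ (square S T).hom ≫
      proj₁ S T ◁ a.right ≫ (α_ _ _ _).inv) :
    opElem a e x z h ≫ r k =
    (evV x (act a (x ≫ tr (proj₁ S T)) z h) (act_l _ _ _ _).symm ≫ r (proj₂ S T)) ≫ tr b.mid := by
  rw [← m_r κ, comp_r, opElem_p₂ a b κ e x z h he, el_r]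

end

variable (x : Q ⟶ ob (vertex S T))

theorem lift_tr_proj₁ : (x ≫ tr (lift S' T' k (proj₁ S T ≫ a.mid) e)) ≫ tr (proj₁ S' T') =
    (x ≫ tr (proj₁ S T)) ≫ tr a.mid := by
  rw [tr_lift, tr_comp]

theorem opElem_liftProj₂ (z : Q ⟶ ap S'.right)
    (h : (x ≫ tr (lift S' T' k (proj₁ S T ≫ a.mid) e)) ≫ tr (proj₁ S' T') = z ≫ l S'.right) :
    opElem a e x z ((lift_tr_proj₁ a e x).symm.trans h) ≫
      m (liftProj₂ S' T' k (proj₁ S T ≫ a.mid) e).hom =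
        pr (el (lift S' T' k (proj₁ S T ≫ a.mid) e) x)
          (evV (x ≫ tr (lift S' T' k (proj₁ S T ≫ a.mid) e)) z h) (by rw [evV_l, el_r]) :=
  evV_tr_lift x z h

/-- The counterpart for spans of `Poly.NormalCell.hcomp_g_ev`. The second projection of the induced
1-cell is compared with `k`, whose right leg is known. -/
theorem evV_hcomp_r (he : κ ▷ T'.left ≫ e.hom =
    (α_ _ _ _).hom ≫ proj₂ S T ◁ b.left.hom ≫ (square S T).hom ≫
      proj₁ S T ◁ a.right ≫ (α_ _ _ _).inv) (z : Q ⟶ ap S'.right)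
    (h : (x ≫ tr (lift S' T' k (proj₁ S T ≫ a.mid) e)) ≫ tr (proj₁ S' T') = z ≫ l S'.right) :
    evV (x ≫ tr (lift S' T' k (proj₁ S T ≫ a.mid) e)) z h ≫ r (proj₂ S' T') =
      (evV x (act a (x ≫ tr (proj₁ S T)) z ((lift_tr_proj₁ a e x).symm.trans h))
        (act_l _ _ _ _).symm ≫ r (proj₂ S T)) ≫ tr b.mid := by
  have h₁ := congrArg (· ≫ r _) (opElem_liftProj₂ a e x z h)
  rw [m_r, comp_r, pr_p₂] at h₁
  rw [← h₁, opElem_r a b κ e x z _ he]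

theorem lift_argB_cond {ζ : Q ⟶ ap (proj₂ S' T' ≫ T'.right)}
    (h : x ≫ tr (lift S' T' k (proj₁ S T ≫ a.mid) e) = argB ζ) :
    (x ≫ tr (proj₁ S T)) ≫ tr a.mid = argS ζ ≫ l S'.right := by
  rw [← lift_tr_proj₁ a e, h, compR_l_tr]

theorem lift_el_cond {ζ : Q ⟶ ap (proj₂ S' T' ≫ T'.right)}
    (h : x ≫ tr (lift S' T' k (proj₁ S T ≫ a.mid) e) = argB ζ) :
    el (lift S' T' k (proj₁ S T ≫ a.mid) e) x ≫ r _ = ζ ≫ l (proj₂ S' T' ≫ T'.right) := by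
  rw [el_r, h, comp_l, argB]

theorem act_argT_cond (he : κ ▷ T'.left ≫ e.hom =
    (α_ _ _ _).hom ≫ proj₂ S T ◁ b.left.hom ≫ (square S T).hom ≫
      proj₁ S T ◁ a.right ≫ (α_ _ _ _).inv) {ζ : Q ⟶ ap (proj₂ S' T' ≫ T'.right)}
    (h : x ≫ tr (lift S' T' k (proj₁ S T ≫ a.mid) e) = argB ζ) :
    (evV x (act a (x ≫ tr (proj₁ S T)) (argS ζ) (lift_argB_cond a e x h))
      (act_l _ _ _ _).symm ≫ r (proj₂ S T)) ≫ tr b.mid = argT ζ ≫ l T'.right := by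
  have h' : (x ≫ tr (lift S' T' k (proj₁ S T ≫ a.mid) e)) ≫ tr (proj₁ S' T') =
      argS ζ ≫ l S'.right := by rw [h, compR_l_tr]
  rw [← evV_hcomp_r a b κ e x he (argS ζ) h', ← evV_argS_r compR_l_tr]
  simp only [h]

theorem hcomp_mid_p₁ {ζ : Q ⟶ ap (proj₂ S' T' ≫ T'.right)}
    (h : x ≫ tr (lift S' T' k (proj₁ S T ≫ a.mid) e) = argB ζ) :
    (pr (el (lift S' T' k (proj₁ S T ≫ a.mid) e) x) ζ (lift_el_cond a e x h) ≫
      m (α_ _ (proj₂ S' T') T'.right).hom) ≫ p₁ _ _ =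
        opElem a e x (argS ζ) (lift_argB_cond a e x h) ≫
          m (liftProj₂ S' T' k (proj₁ S T ≫ a.mid) e).hom := by
  have h' : (x ≫ tr (lift S' T' k (proj₁ S T ≫ a.mid) e)) ≫ tr (proj₁ S' T') =
      argS ζ ≫ l S'.right := by rw [h, compR_l_tr]
  rw [opElem_liftProj₂ a e x (argS ζ) h']
  apply ap_ext
  · rw [associator_hom_p₁_p₁, pr_p₁, pr_p₁]
  · rw [associator_hom_p₁_p₂, pr_p₂, pr_p₂, ← evV_argS compR_l_tr]
    simp only [h]

/-- The 2-cell on the right of a horizontal composite of diagrams. -/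
noncomputable def hcompRight : proj₂ S T ≫ T.right ⟶
    lift S' T' k (proj₁ S T ≫ a.mid) e ≫ proj₂ S' T' ≫ T'.right :=
  proj₂ S T ◁ b.right ≫ (α_ _ _ _).inv ≫
      (κ ≫ (liftProj₂ S' T' k _ e).inv) ▷ T'.right ≫ (α_ _ _ _).hom

theorem hcompRight_p₁ (he : κ ▷ T'.left ≫ e.hom =
    (α_ _ _ _).hom ≫ proj₂ S T ◁ b.left.hom ≫ (square S T).hom ≫
      proj₁ S T ◁ a.right ≫ (α_ _ _ _).inv) {ζ : Q ⟶ ap (proj₂ S' T' ≫ T'.right)}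
    (h : x ≫ tr (lift S' T' k (proj₁ S T ≫ a.mid) e) = argB ζ) :
    (pr (el (lift S' T' k (proj₁ S T ≫ a.mid) e) x) ζ (lift_el_cond a e x h) ≫
      m (hcompRight a b κ e)) ≫ p₁ _ _ =
        evV x (act a (x ≫ tr (proj₁ S T)) (argS ζ) (lift_argB_cond a e x h))
          (act_l _ _ _ _).symm := by
  simp only [hcompRight, m_comp]
  rw [whiskerLeft_p₁, associator_inv_p₁, whiskerRight_p₁, hcomp_mid_p₁ a e x h, m_comp, m_inv_hom,
    opElem_p₁ a b κ e x _ _ he]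

theorem hcompRight_p₂ (he : κ ▷ T'.left ≫ e.hom =
    (α_ _ _ _).hom ≫ proj₂ S T ◁ b.left.hom ≫ (square S T).hom ≫
      proj₁ S T ◁ a.right ≫ (α_ _ _ _).inv) {ζ : Q ⟶ ap (proj₂ S' T' ≫ T'.right)}
    (h : x ≫ tr (lift S' T' k (proj₁ S T ≫ a.mid) e) = argB ζ) :
    (pr (el (lift S' T' k (proj₁ S T ≫ a.mid) e) x) ζ (lift_el_cond a e x h) ≫
      m (hcompRight a b κ e)) ≫ p₂ _ _ = act b _ (argT ζ) (act_argT_cond a b κ e x he h) := by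
  simp only [hcompRight, m_comp]
  rw [whiskerLeft_p₂, act]
  congr 1
  apply ap_ext
  · rw [associator_inv_p₂_p₁, whiskerRight_p₁, hcomp_mid_p₁ a e x h, m_comp, m_inv_hom,
      opElem_p₂ a b κ e x _ _ he, pr_p₁]
  · rw [associator_inv_p₂_p₂, whiskerRight_p₂, associator_hom_p₂, pr_p₂, pr_p₂, argT]

/-- Both sides are functions into `T'.apex`: their underlying points agree by `lift_tr_proj₁`, and
their values are given by the matching rules `evV_hcomp_r` and `Poly.NormalCell.hcomp_g_ev`. -/
theorem hcomp_muB (he : κ ▷ T'.left ≫ e.hom =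
    (α_ _ _ _).hom ≫ proj₂ S T ◁ b.left.hom ≫ (square S T).hom ≫
      proj₁ S T ◁ a.right ≫ (α_ _ _ _).inv) :
    (x ≫ tr (lift S' T' k (proj₁ S T ≫ a.mid) e)) ≫ muB S' T' =
      (x ≫ muB S T) ≫ (Poly.NormalCell.hcomp (phi b) (phi a)).g := by
  apply Poly.compB_ext
  · rw [muB_D, Poly.NormalCell.hcomp_g_D, muB_D, lift_tr_proj₁]
    rfl
  · intro Q' σ z h h'
    simp only [← Category.assoc] at h h' ⊢
    have h₁ : ((σ ≫ x) ≫ tr (proj₁ S T)) ≫ tr a.mid = z ≫ l S'.right :=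
      (lift_tr_proj₁ a e _).symm.trans (muB_cond h)
    refine (muB_ev _ _ h).trans ((evV_hcomp_r a b κ e (σ ≫ x) he z _).trans ?_)
    refine Eq.trans ?_ (Poly.NormalCell.hcomp_g_ev (phi b) (phi a) ((σ ≫ x) ≫ muB S T) z h').symm
    refine congrArg (· ≫ tr b.mid) ?_
    refine (muB_ev (S := S) (T := T) _ _ ?_).symm.trans ?_
    · rw [muB_D, act_l]
    · congr 1
      refine (phi_app a _ _ h₁).symm.trans ?_
      simp only [← muB_D]

section

theorem argB_hcompRight (he : κ ▷ T'.left ≫ e.hom =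
    (α_ _ _ _).hom ≫ proj₂ S T ◁ b.left.hom ≫ (square S T).hom ≫
      proj₁ S T ◁ a.right ≫ (α_ _ _ _).inv) {ζ : Q ⟶ ap (proj₂ S' T' ≫ T'.right)}
    (h : x ≫ tr (lift S' T' k (proj₁ S T ≫ a.mid) e) = argB ζ) : argB (S := S) (T := T)
    (pr (el (lift S' T' k (proj₁ S T ≫ a.mid) e) x) ζ (lift_el_cond a e x h) ≫
      m (hcompRight a b κ e)) = x := by
  rw [argB, hcompRight_p₁ a b κ e x he h, evV_l]

theorem argS_hcompRight (he : κ ▷ T'.left ≫ e.hom =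
    (α_ _ _ _).hom ≫ proj₂ S T ◁ b.left.hom ≫ (square S T).hom ≫
      proj₁ S T ◁ a.right ≫ (α_ _ _ _).inv) {ζ : Q ⟶ ap (proj₂ S' T' ≫ T'.right)}
    (h : x ≫ tr (lift S' T' k (proj₁ S T ≫ a.mid) e) = argB ζ) : argS (S := S) (T := T)
    (pr (el (lift S' T' k (proj₁ S T ≫ a.mid) e) x) ζ (lift_el_cond a e x h) ≫
      m (hcompRight a b κ e)) =
        act a (x ≫ tr (proj₁ S T)) (argS ζ) (lift_argB_cond a e x h) := by
  rw [argS, hcompRight_p₁ a b κ e x he h, argV_evV]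

theorem argT_hcompRight (he : κ ▷ T'.left ≫ e.hom =
    (α_ _ _ _).hom ≫ proj₂ S T ◁ b.left.hom ≫ (square S T).hom ≫
      proj₁ S T ◁ a.right ≫ (α_ _ _ _).inv) {ζ : Q ⟶ ap (proj₂ S' T' ≫ T'.right)}
    (h : x ≫ tr (lift S' T' k (proj₁ S T ≫ a.mid) e) = argB ζ) : argT (S := S) (T := T)
    (pr (el (lift S' T' k (proj₁ S T ≫ a.mid) e) x) ζ (lift_el_cond a e x h) ≫
      m (hcompRight a b κ e)) = act b _ (argT ζ) (act_argT_cond a b κ e x he h) :=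
  hcompRight_p₂ a b κ e x he h

end

theorem act_congr (a : BiSpan.Diagram S S') {x x' : Q ⟶ ob S.apex} {z z' : Q ⟶ ap S'.right}
    (hx : x = x') (hz : z = z') (h : x ≫ tr a.mid = z ≫ l S'.right) :
    act a x z h = act a x' z' (by rw [← hx, ← hz, h]) := by
  subst hx hz
  rfl

theorem muB_isoB_inv : (x ≫ muB S T) ≫ (isoB S T).inv = x :=
  (Category.assoc _ _ _).trans
    ((congrArg (x ≫ ·) (isoB S T).hom_inv_id).trans (Category.comp_id x))

/-- Stated for every `k`, `κ` and `e` satisfying the lifting equation, the only property used of the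
choice made in horizontal composition. The right side involves no choice of lift, so the class of
the composite is independent of it. -/
theorem phi_hcomp_aux (he : κ ▷ T'.left ≫ e.hom =
    (α_ _ _ _).hom ≫ proj₂ S T ◁ b.left.hom ≫ (square S T).hom ≫
      proj₁ S T ◁ a.right ≫ (α_ _ _ _).inv)
    (d : BiSpan.Diagram (BiSpan.comp S T) (BiSpan.comp S' T'))
    (δ : lift S' T' k (proj₁ S T ≫ a.mid) e ≫ proj₁ S' T' ≫ S'.left ≅ proj₁ S T ≫ S.left)
    (hd : d = ⟨lift S' T' k (proj₁ S T ≫ a.mid) e, δ, hcompRight a b κ e⟩) :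
    (phi d).vcomp (mu S' T') =
      (mu S T).vcomp (Poly.NormalCell.hcomp (phi b) (phi a)) := by
  subst hd
  apply Poly.NormalCell.ext_elements
  · intro Q x
    rw [Poly.NormalCell.vcomp_g, Poly.NormalCell.vcomp_g]
    exact hcomp_muB a b κ e x he
  · intro Q (x : Q ⟶ ob (vertex S T)) z h h'
    refine (Poly.NormalCell.vcomp_app _ _ x z h).trans
      (Eq.trans ?_ (Poly.NormalCell.vcomp_app (mu S T) (.hcomp (phi b) (phi a)) x z h').symm)
    have hx : x ≫ tr (lift S' T' k (proj₁ S T ≫ a.mid) e) = argB (z ≫ ofA S' T') := by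
      rw [argB_ofA]
      refine (muB_isoB_inv _).symm.trans (congrArg (· ≫ (isoB S' T').inv) ?_)
      exact (Category.assoc _ _ _).trans h
    have hD : (x ≫ muB S T) ≫ Poly.compD (toPoly T) (toPoly S) = x ≫ tr (proj₁ S T) := muB_D x
    refine Eq.trans ?_ (mu_app S T x _ _).symm
    refine (phi_app _ _ _ _).trans ?_
    refine (act_congr _ rfl (mu_app S' T' _ _ _) _).trans ?_
    have h₁ : (x ≫ muB S T) ≫ (Poly.NormalCell.hcomp (phi b) (phi a)).g =
        z ≫ (Poly.comp (toPoly T') (toPoly S')).n :=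
      (hcomp_muB a b κ e x he).symm.trans ((Category.assoc _ _ _).trans h)
    have hS : (phi a).app ((x ≫ muB S T) ≫ Poly.compD (toPoly T) (toPoly S))
        (z ≫ Poly.compC (toPoly T') (toPoly S'))
          (Poly.NormalCell.hcomp_app_aux (phi b) (phi a) _ z h₁) =
        act a (x ≫ tr (proj₁ S T)) (argS (z ≫ ofA S' T')) (lift_argB_cond a e x hx) :=
      (phi_app a _ _ _).trans (act_congr a hD (argS_ofA z).symm _)
    refine Eq.trans ?_ (congrArg (· ≫ ofA S T)
      (Poly.NormalCell.hcomp_app (phi b) (phi a) (x ≫ muB S T) z h₁).symm)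
    apply compR_ext
    · refine (argB_hcompRight a b κ e x he hx).trans ?_
      rw [argB_ofA, Poly.mkA_n, muB_isoB_inv]
    · refine (argS_hcompRight a b κ e x he hx).trans ?_
      exact hS.symm.trans ((argS_ofA _).trans (Poly.mkA_compC _ _ _ _ _)).symm
    · refine (argT_hcompRight a b κ e x he hx).trans ?_
      refine Eq.trans ?_ ((argT_ofA _).trans (Poly.mkA_compA₂ _ _ _ _ _)).symm
      refine Eq.trans ?_ (phi_app b _ _ _).symm
      refine act_congr b ?_ (argT_ofA z) _
      refine Eq.trans ?_ (muB_ev _ _ _).symm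
      exact congrArg (· ≫ r (proj₂ S T)) (evV_congr rfl hS.symm _)

theorem phi_hcomp : (phi (a.hcomp b)).vcomp (mu S' T') =
    (mu S T).vcomp (Poly.NormalCell.hcomp (phi b) (phi a)) :=
  phi_hcomp_aux a b _ _ (BiSpan.exists_opcartesian a b).choose_spec.choose_spec.choose_spec _ _ rfl

end HorizontalComposition

end LSpn

end SpanPoly

/-! ### Reassociation of three composable spans on elements. -/

namespace SpanPoly

namespace LSpn

variable {E : Type u} [Category.{v} E] [HasPullbacks E] {L R : MorphismProperty E}
  [hL : IsProtocalibration L] [hR : IsProtocalibration R] [hLR : IsCompatible L R]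

variable {U V W Z P : LSpn L}

open BiSpan (vertex proj₁ proj₂ square bipullback lift liftProj₁ liftProj₂ lift_square)

section Pasting

variable {M N O : LSpn L} {mid : P ⟶ M} {f : M ⟶ N} {g : N ⟶ O} {k : O ⟶ Z} {h : P ⟶ N}
  {q : P ⟶ O} (e₁ : h ≫ g ≅ q) (e₂ : mid ≫ f ≅ h) {Q : E}

variable (k) in
/-- The 2-cell obtained by pasting two invertible 2-cells. -/
noncomputable def pasteRight : q ≫ k ⟶ mid ≫ f ≫ g ≫ k :=
  e₁.inv ▷ k ≫ (α_ _ _ _).hom ≫ e₂.inv ▷ (g ≫ k) ≫ (α_ _ _ _).hom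

/-- The pasted 2-cell uses the inverses of `e₁` and `e₂`, which have no explicit formula; it
suffices to exhibit `ξ` and `w` whose images under the forward 2-cells are the components of `u`. -/
theorem pasteRight_p₁ (u : Q ⟶ ap (mid ≫ f ≫ g ≫ k)) (ξ : Q ⟶ ap h) (w : Q ⟶ ap q)
    (h₁ : (u ≫ p₁ _ _) ≫ r mid = ((u ≫ p₂ _ _) ≫ p₁ _ _) ≫ l f)
    (hξ : ξ ≫ m e₂.hom = pr (u ≫ p₁ _ _) ((u ≫ p₂ _ _) ≫ p₁ _ _) h₁)
    (h₂ : ξ ≫ r h = (((u ≫ p₂ _ _) ≫ p₂ _ _) ≫ p₁ _ _) ≫ l g)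
    (hw : w ≫ m e₁.hom = pr ξ (((u ≫ p₂ _ _) ≫ p₂ _ _) ≫ p₁ _ _) h₂) :
    (u ≫ m (pasteRight k e₁ e₂)) ≫ p₁ _ _ = w := by
  have h₃ : (u ≫ m (α_ mid f (g ≫ k)).hom) ≫ p₁ _ _ = ξ ≫ m e₂.hom := by
    rw [hξ]
    apply ap_ext
    · rw [associator_hom_p₁_p₁, pr_p₁]
    · rw [associator_hom_p₁_p₂, pr_p₂]
  simp only [pasteRight, m_comp]
  rw [whiskerRight_p₁, ← m_inv_hom e₁ w, hw]
  congr 1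
  apply ap_ext
  · rw [associator_hom_p₁_p₁, whiskerRight_p₁, h₃, m_inv_hom, pr_p₁]
  · rw [associator_hom_p₁_p₂, whiskerRight_p₂, associator_hom_p₂, pr_p₂]

theorem pasteRight_p₂ (u : Q ⟶ ap (mid ≫ f ≫ g ≫ k)) :
    (u ≫ m (pasteRight k e₁ e₂)) ≫ p₂ _ _ = ((u ≫ p₂ _ _) ≫ p₂ _ _) ≫ p₂ _ _ := by
  simp only [pasteRight, m_comp]
  rw [whiskerRight_p₂, associator_hom_p₂, whiskerRight_p₂, associator_hom_p₂]

end Pasting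

section Reassociation

variable {S : BiSpan (lowerStar L R) U V} {T : BiSpan (lowerStar L R) V W}
  {Y : BiSpan (lowerStar L R) W Z} {Q : E}
  (q₁ : P ⟶ vertex S T) [IsIso (l q₁)] (q₂ : P ⟶ Y.apex)
  (σ : q₂ ≫ Y.left ≅ q₁ ≫ proj₂ S T ≫ T.right)

/-- The 1-cell to the composite of the second and third of three composable spans. -/
noncomputable abbrev liftRight : P ⟶ vertex T Y :=
  lift T Y q₂ (q₁ ≫ proj₂ S T) (σ ≪≫ (α_ _ _ _).symm)

/-- The second projection of `liftRight`. -/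
noncomputable abbrev liftRightProj₂ : liftRight q₁ q₂ σ ≫ proj₂ T Y ≅ q₂ :=
  liftProj₂ T Y q₂ (q₁ ≫ proj₂ S T) (σ ≪≫ (α_ _ _ _).symm)

/-- The isomorphism by which `liftRight` induces a 1-cell to the reassociated composite. -/
noncomputable def liftRightIso :
    liftRight q₁ q₂ σ ≫ proj₁ T Y ≫ T.left ≅ (q₁ ≫ proj₁ S T) ≫ S.right :=
  (α_ _ _ _).symm ≪≫
    whiskerRightIso (liftProj₁ T Y q₂ (q₁ ≫ proj₂ S T) (σ ≪≫ (α_ _ _ _).symm)) T.left ≪≫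
      α_ _ _ _ ≪≫ whiskerLeftIso q₁ (square S T) ≪≫ (α_ _ _ _).symm

/-- Evaluation along an isomorphism `q₂ ≫ Y.left ≅ q₁ ≫ f`. -/
noncomputable def evIso {f : vertex S T ⟶ W} (σ : q₂ ≫ Y.left ≅ q₁ ≫ f) (x : Q ⟶ ob P)
    (ω : Q ⟶ ap f) (h : x ≫ tr q₁ = ω ≫ l f) : Q ⟶ ap q₂ :=
  (pr (el q₁ x) ω ((el_r x).trans h) ≫ m σ.hom) ≫ p₁ _ _

theorem evIso_congr {f : vertex S T ⟶ W} (σ : q₂ ≫ Y.left ≅ q₁ ≫ f) {x x' : Q ⟶ ob P}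
    {ω ω' : Q ⟶ ap f} (hx : x = x') (hω : ω = ω') (h : x ≫ tr q₁ = ω ≫ l f) :
    evIso q₁ q₂ σ x ω h = evIso q₁ q₂ σ x' ω' (by rw [← hx, ← hω, h]) := by
  subst hx hω
  rfl

variable (x : Q ⟶ ob P) (z : Q ⟶ ap S.right) (h : (x ≫ tr q₁) ≫ tr (proj₁ S T) = z ≫ l S.right)

/-- The element of the apex of `liftRight` over an element of the source and an argument. -/
noncomputable def rightElem : Q ⟶ ap (liftRight q₁ q₂ σ) :=
  (pr (el (q₁ ≫ proj₁ S T) x) z (by rw [el_r, tr_comp, h]) ≫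
    m (liftRightIso q₁ q₂ σ).hom) ≫ p₁ _ _

/-- `liftRightIso` ends with the square of `S` and `T`, which produces the value at `z`, and begins
with the first projection isomorphism of the lift, which `liftFst` undoes. -/
theorem liftFst_rightElem : liftFst (rightElem q₁ q₂ σ x z h) =
    pr (el q₁ x) (evV (x ≫ tr q₁) z h) (by rw [el_r, evV_l]) := by
  let w : Q ⟶ ap ((q₁ ≫ proj₂ S T) ≫ T.left) :=
    pr (el (q₁ ≫ proj₁ S T) x) z (by rw [el_r, tr_comp, h]) ≫
      m ((α_ _ _ _).hom ≫ q₁ ◁ (square S T).hom ≫ (α_ _ _ _).inv)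
  have hw : w ≫ p₁ _ _ = pr (el q₁ x) (evV (x ≫ tr q₁) z h) (by rw [el_r, evV_l]) := by
    simp only [w, m_comp]
    apply ap_ext
    · rw [associator_hom_p₁_p₁, whiskerLeft_p₁, associator_inv_p₁, pr_p₁, pr_p₁, el_p₁]
    · rw [associator_hom_p₁_p₂, whiskerLeft_p₂, pr_p₂, evV_eq]
      congr 2
      apply ap_ext
      · rw [associator_inv_p₂_p₁, pr_p₁, pr_p₁, el_p₂]
      · rw [associator_inv_p₂_p₂, pr_p₂, pr_p₂]
  have hξ : rightElem q₁ q₂ σ x z h =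
      ((w ≫ p₁ _ _) ≫ m (liftProj₁ T Y q₂ (q₁ ≫ proj₂ S T) (σ ≪≫ (α_ _ _ _).symm)).hom) ≫
        p₁ _ _ := by
    have hθ : (liftRightIso q₁ q₂ σ).hom = (α_ _ _ _).inv ≫
        (liftProj₁ T Y q₂ (q₁ ≫ proj₂ S T) (σ ≪≫ (α_ _ _ _).symm)).hom ▷ T.left ≫
          ((α_ _ _ _).hom ≫ q₁ ◁ (square S T).hom ≫ (α_ _ _ _).inv) := rfl
    rw [rightElem, hθ, m_comp, m_comp, ← whiskerRight_p₁]
    exact associator_inv_p₁ _ _ _ _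
  rw [hξ]
  refine (congrArg (· ≫ m (liftProj₁ T Y q₂ (q₁ ≫ proj₂ S T) (σ ≪≫ (α_ _ _ _).symm)).inv)
    (up_eta _)).trans ?_
  rw [m_inv_hom, hw]

theorem rightElem_r_tr : (rightElem q₁ q₂ σ x z h ≫ r (liftRight q₁ q₂ σ)) ≫ tr (proj₁ T Y) =
    evV (x ≫ tr q₁) z h ≫ r (proj₂ S T) := by
  refine (lift_r_tr _).trans ?_
  rw [liftFst_rightElem, comp_r, pr_p₂]

theorem evIso_rightElem (t : Q ⟶ ap T.right)
    (h' : evV (x ≫ tr q₁) z h ≫ r (proj₂ S T) = t ≫ l T.right) :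
    evIso q₁ q₂ σ x (pr (evV (x ≫ tr q₁) z h) t h') (by rw [comp_l, pr_p₁, evV_l]) ≫
      m (liftRightProj₂ q₁ q₂ σ).hom = pr (rightElem q₁ q₂ σ x z h)
        (evV (rightElem q₁ q₂ σ x z h ≫ r (liftRight q₁ q₂ σ)) t
          ((rightElem_r_tr q₁ q₂ σ x z h).trans h')) (by rw [evV_l]) := by
  refine Eq.trans ?_ (evV_lift (rightElem q₁ q₂ σ x z h) t
    ((rightElem_r_tr q₁ q₂ σ x z h).trans h'))
  simp only [evIso, Iso.trans_hom, m_comp, liftFst_rightElem]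
  congr 4
  apply ap_ext
  · exact (pr_p₁ _ _ _).trans (by rw [Iso.symm_hom, associator_inv_p₁, pr_p₁, pr_p₁])
  · rw [pr_p₂]
    apply ap_ext
    · rw [pr_p₁, Iso.symm_hom, associator_inv_p₂_p₁, pr_p₁, pr_p₂]
    · rw [pr_p₂, Iso.symm_hom, associator_inv_p₂_p₂, pr_p₂]

/-- The 1-cell to the reassociated composite of three spans. -/
noncomputable def liftAll : P ⟶ vertex S (BiSpan.comp T Y) :=
  lift S (BiSpan.comp T Y) (liftRight q₁ q₂ σ) (q₁ ≫ proj₁ S T) (liftRightIso q₁ q₂ σ)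

instance : IsIso (l (liftAll q₁ q₂ σ)) :=
  isIso_l_lift (S := S) (T := BiSpan.comp T Y) (b := liftRight q₁ q₂ σ) (a := q₁ ≫ proj₁ S T)
    (δ := liftRightIso q₁ q₂ σ)

/-- The second projection of `liftAll`. -/
noncomputable def liftAllProj₂ : liftAll q₁ q₂ σ ≫ proj₂ S (BiSpan.comp T Y) ≅ liftRight q₁ q₂ σ :=
  liftProj₂ S (BiSpan.comp T Y) (liftRight q₁ q₂ σ) (q₁ ≫ proj₁ S T) (liftRightIso q₁ q₂ σ)

theorem liftAll_tr : (x ≫ tr (liftAll q₁ q₂ σ)) ≫ tr (proj₁ S (BiSpan.comp T Y)) =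
    (x ≫ tr q₁) ≫ tr (proj₁ S T) :=
  (tr_lift (S := S) (T := BiSpan.comp T Y) (b := liftRight q₁ q₂ σ) (a := q₁ ≫ proj₁ S T)
    (δ := liftRightIso q₁ q₂ σ) x).trans (tr_comp _ x)

theorem rightElem_proj₂ : rightElem q₁ q₂ σ x z h ≫ m (liftAllProj₂ q₁ q₂ σ).hom =
    pr (el (liftAll q₁ q₂ σ) x) (evV (x ≫ tr (liftAll q₁ q₂ σ)) z
      ((liftAll_tr q₁ q₂ σ x).trans h)) (by rw [evV_l, el_r]) :=
  evV_tr_lift (S := S) (T := BiSpan.comp T Y) (b := liftRight q₁ q₂ σ) (a := q₁ ≫ proj₁ S T)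
    (δ := liftRightIso q₁ q₂ σ) x z _

/-- The value of an element of the reassociated composite. -/
noncomputable def evAll : Q ⟶ ob (vertex T Y) :=
  evV (x ≫ tr (liftAll q₁ q₂ σ)) z ((liftAll_tr q₁ q₂ σ x).trans h) ≫
      r (proj₂ S (BiSpan.comp T Y))

theorem rightElem_r : rightElem q₁ q₂ σ x z h ≫ r (liftRight q₁ q₂ σ) =
    evAll q₁ q₂ σ x z h := by
  refine (m_r (liftAllProj₂ q₁ q₂ σ).hom _).symm.trans ?_
  refine (congrArg (· ≫ r _) (rightElem_proj₂ q₁ q₂ σ x z h)).trans ?_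
  exact (comp_r _).trans (congrArg (· ≫ r _) (pr_p₂ _ _ _))

theorem evAll_tr : evAll q₁ q₂ σ x z h ≫ tr (proj₁ T Y) =
    evV (x ≫ tr q₁) z h ≫ r (proj₂ S T) := by
  rw [← rightElem_r, rightElem_r_tr]

/-- Currying for spans: evaluation at `z` and then at `t` is evaluation along `σ` at the single
element of the apex of `proj₂ S T ≫ T.right` made of both. This matches `Poly.associator_g_ev`. -/
theorem evV_evAll (t : Q ⟶ ap T.right)
    (h' : evV (x ≫ tr q₁) z h ≫ r (proj₂ S T) = t ≫ l T.right) :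
    evV (evAll q₁ q₂ σ x z h) t ((evAll_tr q₁ q₂ σ x z h).trans h') ≫ r (proj₂ T Y) =
      evIso q₁ q₂ σ x (pr (evV (x ≫ tr q₁) z h) t h') (by rw [comp_l, pr_p₁, evV_l]) ≫ r q₂ := by
  rw [← m_r (liftRightProj₂ q₁ q₂ σ).hom, evIso_rightElem, comp_r, pr_p₂]
  exact congrArg (· ≫ r (proj₂ T Y)) (evV_congr (rightElem_r q₁ q₂ σ x z h).symm rfl _)

/-- The 2-cell on the right of the reassociation. -/
noncomputable def reassocRight : q₂ ≫ Y.right ⟶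
    liftAll q₁ q₂ σ ≫ proj₂ S (BiSpan.comp T Y) ≫ proj₂ T Y ≫ Y.right :=
  pasteRight Y.right (liftRightProj₂ q₁ q₂ σ) (liftAllProj₂ q₁ q₂ σ)

/-- The components in the last two spans of an element of the right leg of a composite of three. -/
noncomputable def argTY (ζ : Q ⟶ ap (proj₂ S (BiSpan.comp T Y) ≫ (BiSpan.comp T Y).right)) :
    Q ⟶ ap (proj₂ T Y ≫ Y.right) := argT ζ

theorem argS_cond {ζ : Q ⟶ ap (proj₂ S (BiSpan.comp T Y) ≫ (BiSpan.comp T Y).right)}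
    (hx : x ≫ tr (liftAll q₁ q₂ σ) = argB ζ) :
    (x ≫ tr q₁) ≫ tr (proj₁ S T) = argS ζ ≫ l S.right := by
  refine (liftAll_tr q₁ q₂ σ x).symm.trans ?_
  exact (congrArg (· ≫ tr _) hx).trans compR_l_tr

theorem evAll_argS {ζ : Q ⟶ ap (proj₂ S (BiSpan.comp T Y) ≫ (BiSpan.comp T Y).right)}
    (hx : x ≫ tr (liftAll q₁ q₂ σ) = argB ζ) :
    evAll q₁ q₂ σ x (argS ζ) (argS_cond q₁ q₂ σ x hx) = argB (argTY ζ) := by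
  refine (congrArg (· ≫ r (proj₂ S (BiSpan.comp T Y))) (evV_congr hx rfl _)).trans ?_
  exact (evV_argS_r compR_l_tr).trans (comp_l (f := proj₂ T Y) (g := Y.right) (argTY ζ))

theorem argS_argTY_cond {ζ : Q ⟶ ap (proj₂ S (BiSpan.comp T Y) ≫ (BiSpan.comp T Y).right)}
    (hx : x ≫ tr (liftAll q₁ q₂ σ) = argB ζ) :
    evV (x ≫ tr q₁) (argS ζ) (argS_cond q₁ q₂ σ x hx) ≫ r (proj₂ S T) =
      argS (argTY ζ) ≫ l T.right := by
  rw [← evAll_tr q₁ q₂ σ, evAll_argS q₁ q₂ σ x hx, compR_l_tr]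

theorem reassocRight_cond {ζ : Q ⟶ ap (proj₂ S (BiSpan.comp T Y) ≫ (BiSpan.comp T Y).right)}
    (hx : x ≫ tr (liftAll q₁ q₂ σ) = argB ζ) : el (liftAll q₁ q₂ σ) x ≫ r (liftAll q₁ q₂ σ) =
      ζ ≫ l (proj₂ S (BiSpan.comp T Y) ≫ (BiSpan.comp T Y).right) :=
  (el_r x).trans (hx.trans (comp_l ζ).symm)

theorem reassocRight_p₁ {ζ : Q ⟶ ap (proj₂ S (BiSpan.comp T Y) ≫ (BiSpan.comp T Y).right)}
    (hx : x ≫ tr (liftAll q₁ q₂ σ) = argB ζ) :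
    (pr (el (liftAll q₁ q₂ σ) x) ζ (reassocRight_cond q₁ q₂ σ x hx) ≫
      m (reassocRight q₁ q₂ σ)) ≫ p₁ _ _ =
    evIso q₁ q₂ σ x (pr (evV (x ≫ tr q₁) (argS ζ) (argS_cond q₁ q₂ σ x hx)) (argS (argTY ζ))
      (argS_argTY_cond q₁ q₂ σ x hx)) (by rw [comp_l, pr_p₁, evV_l]) := by
  have h₁ : (pr (el (liftAll q₁ q₂ σ) x) ζ (reassocRight_cond q₁ q₂ σ x hx) ≫ p₁ _ _) =
      el (liftAll q₁ q₂ σ) x := pr_p₁ _ _ _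
  have h₂ : (pr (el (liftAll q₁ q₂ σ) x) ζ (reassocRight_cond q₁ q₂ σ x hx) ≫ p₂ _ _) = ζ :=
    pr_p₂ _ _ _
  have h₃ : argTY ζ ≫ p₁ _ _ = evV (rightElem q₁ q₂ σ x (argS ζ) (argS_cond q₁ q₂ σ x hx) ≫
      r (liftRight q₁ q₂ σ)) (argS (argTY ζ)) ((rightElem_r_tr q₁ q₂ σ x _ _).trans
        (argS_argTY_cond q₁ q₂ σ x hx)) := by
    refine (evV_argS (w := argTY ζ) compR_l_tr).symm.trans (evV_congr ?_ rfl _)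
    rw [rightElem_r, evAll_argS q₁ q₂ σ x hx]
  have h₄ : ζ ≫ p₁ _ _ = evV (x ≫ tr (liftAll q₁ q₂ σ)) (argS ζ)
      ((liftAll_tr q₁ q₂ σ x).trans (argS_cond q₁ q₂ σ x hx)) :=
    (evV_argS compR_l_tr).symm.trans (evV_congr hx.symm rfl _)
  have h₅ : (ζ ≫ p₂ _ _) ≫ p₁ _ _ = argTY ζ ≫ p₁ _ _ := rfl
  refine pasteRight_p₁ (k := Y.right) (liftRightProj₂ q₁ q₂ σ) (liftAllProj₂ q₁ q₂ σ)
    (pr (el (liftAll q₁ q₂ σ) x) ζ (reassocRight_cond q₁ q₂ σ x hx))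
    (rightElem q₁ q₂ σ x (argS ζ) (argS_cond q₁ q₂ σ x hx)) _ ?_ ?_ ?_ ?_
  · exact (p_condition _).trans (comp_l _)
  · refine (rightElem_proj₂ q₁ q₂ σ x _ _).trans (ap_ext ?_ ?_)
    · exact (pr_p₁ _ _ _).trans (h₁.symm.trans (pr_p₁ _ _ _).symm)
    · exact (pr_p₂ _ _ _).trans (h₄.symm.trans ((congrArg (· ≫ p₁ _ _) h₂).symm.trans
        (pr_p₂ _ _ _).symm))
  · refine (evV_l _ _ ((rightElem_r_tr q₁ q₂ σ x _ _).trans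
        (argS_argTY_cond q₁ q₂ σ x hx))).symm.trans (congrArg (· ≫ l (proj₂ T Y)) ?_)
    exact h₃.symm.trans (congrArg (fun t => (t ≫ p₂ _ _) ≫ p₁ _ _) h₂).symm
  · refine (evIso_rightElem q₁ q₂ σ x _ _ _ _).trans (ap_ext ?_ ?_)
    · exact (pr_p₁ _ _ _).trans (pr_p₁ _ _ _).symm
    · refine (pr_p₂ _ _ _).trans (Eq.trans ?_ (pr_p₂ _ _ _).symm)
      exact h₃.symm.trans (congrArg (fun t => (t ≫ p₂ _ _) ≫ p₁ _ _) h₂).symm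

theorem reassocRight_p₂ {ζ : Q ⟶ ap (proj₂ S (BiSpan.comp T Y) ≫ (BiSpan.comp T Y).right)}
    (hx : x ≫ tr (liftAll q₁ q₂ σ) = argB ζ) :
    (pr (el (liftAll q₁ q₂ σ) x) ζ (reassocRight_cond q₁ q₂ σ x hx) ≫
      m (reassocRight q₁ q₂ σ)) ≫ p₂ _ _ = argT (argTY ζ) := by
  refine (pasteRight_p₂ (k := Y.right) (liftRightProj₂ q₁ q₂ σ) (liftAllProj₂ q₁ q₂ σ) _).trans ?_
  exact congrArg (fun t => (t ≫ p₂ _ _) ≫ p₂ _ _) (pr_p₂ _ _ _)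

end Reassociation

end LSpn

end SpanPoly

/-! ### The associators of spans and of polynomials agree. -/

namespace SpanPoly

theorem Poly.ev_congr {E : Type u} [Category.{v} E] [HasPullbacks E] {L R : MorphismProperty E}
    [hL : IsProtocalibration L] [hR : IsProtocalibration R] [hLR : IsCompatible L R] {X Y Z T : E}
    {p : Poly L R X Y} {q : Poly L R Y Z} {f f' : T ⟶ (comp p q).B} {c c' : T ⟶ q.A} (hf : f = f')
    (hc : c = c') (h : f ≫ compD p q = c ≫ q.n) :
    ev f c h = ev f' c' (by rw [← hf, ← hc, h]) := by
  subst hf hc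
  rfl

namespace LSpn

variable {E : Type u} [Category.{v} E] [HasPullbacks E] {L R : MorphismProperty E}
  [hL : IsProtocalibration L] [hR : IsProtocalibration R] [hLR : IsCompatible L R]

variable {U V W Z : LSpn L}

open BiSpan (vertex proj₁ proj₂ square bipullback lift liftProj₁ liftProj₂ lift_square)

section Associator

variable (S : BiSpan (lowerStar L R) U V) (T : BiSpan (lowerStar L R) V W)
  (Y : BiSpan (lowerStar L R) W Z) {Q : E}

/-- The projection from a left-bracketed composite of three spans to the composite of the first
two. -/
noncomputable def outer₁ : vertex (BiSpan.comp S T) Y ⟶ vertex S T := proj₁ (BiSpan.comp S T) Y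

/-- The projection from a left-bracketed composite of three spans to the third. -/
noncomputable def outer₂ : vertex (BiSpan.comp S T) Y ⟶ Y.apex := proj₂ (BiSpan.comp S T) Y

/-- The bipullback square of a left-bracketed composite of three spans. -/
noncomputable def outerSquare : outer₂ S T Y ≫ Y.left ≅ outer₁ S T Y ≫ proj₂ S T ≫ T.right :=
  square (BiSpan.comp S T) Y

instance : IsIso (l (outer₁ S T Y)) := inferInstanceAs (IsIso (l (proj₁ (BiSpan.comp S T) Y)))

/-- The 1-cell underlying the associator. -/
noncomputable abbrev assocMid : vertex (BiSpan.comp S T) Y ⟶ vertex S (BiSpan.comp T Y) :=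
  liftAll (outer₁ S T Y) (outer₂ S T Y) (outerSquare S T Y)

variable (x : Q ⟶ ob (vertex (BiSpan.comp S T) Y))

/-- The composite of the comparison isomorphisms for the right-bracketed composite. -/
noncomputable abbrev muRight : Poly.NormalCell (Poly.comp (toPoly (BiSpan.comp T Y)) (toPoly S))
    (Poly.comp (Poly.comp (toPoly Y) (toPoly T)) (toPoly S)) :=
  Poly.NormalCell.hcomp (mu T Y) (Poly.NormalCell.id (toPoly S))

/-- The composite of the comparison isomorphisms for the left-bracketed composite. -/
noncomputable abbrev muLeft : Poly.NormalCell (Poly.comp (toPoly Y) (toPoly (BiSpan.comp S T)))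
    (Poly.comp (toPoly Y) (Poly.comp (toPoly T) (toPoly S))) :=
  Poly.NormalCell.hcomp (Poly.NormalCell.id (toPoly Y)) (mu S T)

theorem muRight_D : (((x ≫ tr (assocMid S T Y)) ≫ muB S (BiSpan.comp T Y)) ≫ (muRight S T Y).g) ≫
    Poly.compD (Poly.comp (toPoly Y) (toPoly T)) (toPoly S) =
      (x ≫ tr (outer₁ S T Y)) ≫ tr (proj₁ S T) := by
  refine (Poly.NormalCell.hcomp_g_D _ _ _).trans ((Poly.NormalCell.id_g _).trans ?_)
  exact (muB_D _).trans (liftAll_tr _ _ _ _)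

theorem muRight_ev (z : Q ⟶ ap S.right)
    (h : (((x ≫ tr (assocMid S T Y)) ≫ muB S (BiSpan.comp T Y)) ≫ (muRight S T Y).g) ≫
      Poly.compD (Poly.comp (toPoly Y) (toPoly T)) (toPoly S) = z ≫ l S.right) :
    Poly.ev (p := Poly.comp (toPoly Y) (toPoly T)) (q := toPoly S)
      (((x ≫ tr (assocMid S T Y)) ≫ muB S (BiSpan.comp T Y)) ≫ (muRight S T Y).g) z h =
    evAll (outer₁ S T Y) (outer₂ S T Y) (outerSquare S T Y) x z
      ((muRight_D S T Y x).symm.trans h) ≫ muB T Y := by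
  refine (Poly.NormalCell.hcomp_g_ev (mu T Y) (.id (toPoly S)) _ z h).trans ?_
  refine congrArg (· ≫ muB T Y) ?_
  simp only [Poly.NormalCell.id_app]
  exact muB_ev _ _ _

theorem muLeft_D : ((x ≫ muB (BiSpan.comp S T) Y) ≫ (muLeft S T Y).g) ≫
    Poly.compD (toPoly Y) (Poly.comp (toPoly T) (toPoly S)) =
      (x ≫ tr (outer₁ S T Y)) ≫ muB S T := by
  refine (Poly.NormalCell.hcomp_g_D _ _ _).trans ?_
  exact congrArg (· ≫ muB S T) (muB_D x)

theorem ofA_l_eq (z : Q ⟶ (Poly.comp (toPoly T) (toPoly S)).A) {y : Q ⟶ ob (vertex S T)}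
    (h : y ≫ muB S T = z ≫ (Poly.comp (toPoly T) (toPoly S)).n) :
    argB (z ≫ ofA S T) = y := by
  rw [argB_ofA, ← h, muB_isoB_inv]

theorem muLeft_ev (z : Q ⟶ (Poly.comp (toPoly T) (toPoly S)).A)
    (h : ((x ≫ muB (BiSpan.comp S T) Y) ≫ (muLeft S T Y).g) ≫
      Poly.compD (toPoly Y) (Poly.comp (toPoly T) (toPoly S)) =
        z ≫ (Poly.comp (toPoly T) (toPoly S)).n) :
    Poly.ev (p := toPoly Y) (q := Poly.comp (toPoly T) (toPoly S))
      ((x ≫ muB (BiSpan.comp S T) Y) ≫ (muLeft S T Y).g) z h =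
    evIso (outer₁ S T Y) (outer₂ S T Y) (outerSquare S T Y) x (z ≫ ofA S T)
      ((ofA_l_eq S T z ((muLeft_D S T Y x).symm.trans h)).symm.trans (comp_l _).symm) ≫
        r (outer₂ S T Y) := by
  refine (Poly.NormalCell.hcomp_g_ev (.id (toPoly Y)) (mu S T) _ z h).trans ?_
  refine (Poly.NormalCell.id_g _).trans ?_
  refine (muB_ev (S := BiSpan.comp S T) (T := Y) x _ _).trans ?_
  refine congrArg (· ≫ r (proj₂ (BiSpan.comp S T) Y)) ?_
  exact evV_congr (S := BiSpan.comp S T) (T := Y) rfl (mu_app S T _ _ _) _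

/-- Extensionality reduces the claim to the point of `S.apex`, the function into `T.apex`, and the
function into `Y.apex` of two arguments; for the last, both sides are evaluation along
`outerSquare`. -/
theorem associator_muB :
    (((x ≫ tr (assocMid S T Y)) ≫ muB S (BiSpan.comp T Y)) ≫ (muRight S T Y).g) ≫
      (Poly.associator (toPoly Y) (toPoly T) (toPoly S)).g =
    (x ≫ muB (BiSpan.comp S T) Y) ≫ (muLeft S T Y).g := by
  apply Poly.compB_ext
  · apply Poly.compB_ext
    · refine (Poly.associator_g_D _ _ _ _).trans ((muRight_D S T Y x).trans ?_)
      refine Eq.trans ?_ (congrArg (· ≫ Poly.compD (toPoly T) (toPoly S))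
        (muLeft_D S T Y x)).symm
      exact (muB_D _).symm
    · intro Q' τ z h h'
      have ha : τ ≫ ((((x ≫ tr (assocMid S T Y)) ≫ muB S (BiSpan.comp T Y)) ≫
          (muRight S T Y).g) ≫ (Poly.associator (toPoly Y) (toPoly T) (toPoly S)).g) ≫
            Poly.compD (toPoly Y) (Poly.comp (toPoly T) (toPoly S)) =
          (((((τ ≫ x) ≫ tr (assocMid S T Y)) ≫ muB S (BiSpan.comp T Y)) ≫
            (muRight S T Y).g) ≫ (Poly.associator (toPoly Y) (toPoly T) (toPoly S)).g) ≫
              Poly.compD (toPoly Y) (Poly.comp (toPoly T) (toPoly S)) := by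
        simp only [Category.assoc]
      have hb : τ ≫ ((x ≫ muB (BiSpan.comp S T) Y) ≫ (muLeft S T Y).g) ≫
          Poly.compD (toPoly Y) (Poly.comp (toPoly T) (toPoly S)) =
            ((τ ≫ x) ≫ tr (outer₁ S T Y)) ≫ muB S T := by
        rw [← muLeft_D]
        simp only [Category.assoc]
      refine (Poly.ev_congr ha rfl h).trans ((Poly.associator_g_D_ev _ _ _ _ _ _).trans ?_)
      refine (congrArg (· ≫ Poly.compD (toPoly Y) (toPoly T)) (muRight_ev S T Y _ z _)).trans ?_
      refine (muB_D _).trans ((evAll_tr _ _ _ _ _ _).trans ?_)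
      exact ((Poly.ev_congr hb rfl h').trans (muB_ev _ _ _)).symm
  · intro Q' τ z h h'
    have ha : τ ≫ (((x ≫ tr (assocMid S T Y)) ≫ muB S (BiSpan.comp T Y)) ≫
          (muRight S T Y).g) ≫ (Poly.associator (toPoly Y) (toPoly T) (toPoly S)).g =
          ((((τ ≫ x) ≫ tr (assocMid S T Y)) ≫ muB S (BiSpan.comp T Y)) ≫
            (muRight S T Y).g) ≫ (Poly.associator (toPoly Y) (toPoly T) (toPoly S)).g := by
        simp only [Category.assoc]
    have hb : τ ≫ (x ≫ muB (BiSpan.comp S T) Y) ≫ (muLeft S T Y).g =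
          ((τ ≫ x) ≫ muB (BiSpan.comp S T) Y) ≫ (muLeft S T Y).g := by
        simp only [Category.assoc]
    have h₀ : (((τ ≫ x) ≫ muB (BiSpan.comp S T) Y) ≫ (muLeft S T Y).g) ≫
        Poly.compD (toPoly Y) (Poly.comp (toPoly T) (toPoly S)) =
          z ≫ (Poly.comp (toPoly T) (toPoly S)).n := (congrArg (· ≫ _) hb).symm.trans h'
    have hB : argB (z ≫ ofA S T) = (τ ≫ x) ≫ tr (outer₁ S T Y) :=
      ofA_l_eq S T z ((muLeft_D S T Y _).symm.trans h₀)
    have hS : ((τ ≫ x) ≫ tr (outer₁ S T Y)) ≫ tr (proj₁ S T) =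
        (z ≫ Poly.compC (toPoly T) (toPoly S)) ≫ l S.right := by
      rw [← hB, compR_l_tr, argS_ofA]
    have hT : evV ((τ ≫ x) ≫ tr (outer₁ S T Y)) (z ≫ Poly.compC (toPoly T) (toPoly S)) hS ≫
        r (proj₂ S T) = (z ≫ Poly.compA₂ (toPoly T) (toPoly S)) ≫ l T.right := by
      refine (congrArg (· ≫ r (proj₂ S T)) (evV_congr hB.symm (argS_ofA z).symm hS)).trans ?_
      rw [evV_argS_r, argT_ofA]
    -- The two-part argument, rebuilt from the components of `z`, is the element corresponding to
    -- `z` under `isoA`.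
    have hω : pr (evV ((τ ≫ x) ≫ tr (outer₁ S T Y)) (z ≫ Poly.compC (toPoly T) (toPoly S)) hS)
        (z ≫ Poly.compA₂ (toPoly T) (toPoly S)) hT = z ≫ ofA S T := by
      apply compR_ext
      · exact (argB_mkV _ _ _ _ _).trans hB.symm
      · exact (argS_mkV _ _ _ _ _).trans (argS_ofA z).symm
      · exact (argT_mkV _ _ _ _ _).trans (argT_ofA z).symm
    refine (Poly.ev_congr ha rfl h).trans ((Poly.associator_g_ev _ _ _ _ _ _).trans ?_)
    refine (Poly.ev_congr (muRight_ev S T Y _ _ _) rfl _).trans ((muB_ev _ _ _).trans ?_)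
    refine (evV_evAll _ _ _ _ _ hS _ hT).trans ?_
    refine Eq.trans ?_ ((Poly.ev_congr hb rfl h').trans (muLeft_ev S T Y _ z h₀)).symm
    exact congrArg (· ≫ r (outer₂ S T Y)) (evIso_congr _ _ _ rfl hω _)

section

variable {S T Y}
  (y : Q ⟶ (Poly.comp (toPoly (BiSpan.comp T Y)) (toPoly S)).B)
  (z : Q ⟶ (Poly.comp (toPoly Y) (Poly.comp (toPoly T) (toPoly S))).A)
  (h : y ≫ ((muRight S T Y).vcomp (Poly.associator (toPoly Y) (toPoly T) (toPoly S))).g =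
    z ≫ (Poly.comp (toPoly Y) (Poly.comp (toPoly T) (toPoly S))).n)

theorem muRight_associator_app_compC :
    ((muRight S T Y).vcomp (Poly.associator (toPoly Y) (toPoly T) (toPoly S))).app y z h ≫
      Poly.compC (toPoly (BiSpan.comp T Y)) (toPoly S) =
    (z ≫ Poly.compC (toPoly Y) (Poly.comp (toPoly T) (toPoly S))) ≫
      Poly.compC (toPoly T) (toPoly S) := by
  rw [Poly.NormalCell.vcomp_app, Poly.NormalCell.hcomp_app, Poly.mkA_compC,
    Poly.NormalCell.id_app, Poly.associator_app, Poly.mkA_compC]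

/-- Only the components of `w` matter later, so its explicit form is hidden by the existential. -/
theorem muRight_associator_app_compA₂ :
    ∃ w : Q ⟶ (Poly.comp (toPoly Y) (toPoly T)).A,
    ((muRight S T Y).vcomp (Poly.associator (toPoly Y) (toPoly T) (toPoly S))).app y z h ≫
      Poly.compA₂ (toPoly (BiSpan.comp T Y)) (toPoly S) = w ≫ ofA T Y ∧
    w ≫ Poly.compC _ _ =
      (z ≫ Poly.compC (toPoly Y) (Poly.comp (toPoly T) (toPoly S))) ≫
        Poly.compA₂ (toPoly T) (toPoly S) ∧
    w ≫ Poly.compA₂ _ _ =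
      z ≫ Poly.compA₂ (toPoly Y) (Poly.comp (toPoly T) (toPoly S)) := by
  rw [Poly.NormalCell.vcomp_app, Poly.NormalCell.hcomp_app, Poly.mkA_compA₂]
  refine ⟨_, mu_app T Y _ _ _, ?_, ?_⟩
  · rw [Poly.associator_app, Poly.mkA_compA₂, Poly.mkA_compC]
  · rw [Poly.associator_app, Poly.mkA_compA₂, Poly.mkA_compA₂]

end

theorem act_associatorDiagram {ζ : Q ⟶ ap (proj₂ S (BiSpan.comp T Y) ≫ (BiSpan.comp T Y).right)}
    (hx : x ≫ tr (assocMid S T Y) = argB ζ)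
    (h : (show Q ⟶ ob (BiSpan.comp (BiSpan.comp S T) Y).apex from x) ≫
      tr (BiSpan.associatorDiagram S T Y).mid =
        (show Q ⟶ ap (BiSpan.comp S (BiSpan.comp T Y)).right from ζ) ≫
          l (BiSpan.comp S (BiSpan.comp T Y)).right) :
    (act (BiSpan.associatorDiagram S T Y) x ζ h ≫ p₁ (outer₂ S T Y) Y.right =
      evIso (outer₁ S T Y) (outer₂ S T Y) (outerSquare S T Y) x
        (pr (evV (x ≫ tr (outer₁ S T Y)) (argS ζ) (argS_cond _ _ _ x hx)) (argS (argTY ζ))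
          (argS_argTY_cond _ _ _ x hx)) (by rw [comp_l, pr_p₁, evV_l])) ∧
      act (BiSpan.associatorDiagram S T Y) x ζ h ≫ p₂ (outer₂ S T Y) Y.right = argT (argTY ζ) :=
  ⟨reassocRight_p₁ (outer₁ S T Y) (outer₂ S T Y) (outerSquare S T Y) x hx,
    reassocRight_p₂ (outer₁ S T Y) (outer₂ S T Y) (outerSquare S T Y) x hx⟩

/-- Separates the computation in spans from that in polynomials: `V` and `t` enter only through
their components, which the polynomial rules supply. -/
theorem act_associatorDiagram_ofA
    (V : Q ⟶ (Poly.comp (toPoly (BiSpan.comp T Y)) (toPoly S)).A)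
    (hV : V ≫ (Poly.comp (toPoly (BiSpan.comp T Y)) (toPoly S)).n =
      (x ≫ tr (assocMid S T Y)) ≫ muB S (BiSpan.comp T Y))
    (w : Q ⟶ (Poly.comp (toPoly Y) (toPoly T)).A)
    (z : Q ⟶ (Poly.comp (toPoly Y) (Poly.comp (toPoly T) (toPoly S))).A)
    (hVC : V ≫ Poly.compC (toPoly (BiSpan.comp T Y)) (toPoly S) =
      (z ≫ Poly.compC (toPoly Y) (Poly.comp (toPoly T) (toPoly S))) ≫
        Poly.compC (toPoly T) (toPoly S))
    (hVA : V ≫ Poly.compA₂ (toPoly (BiSpan.comp T Y)) (toPoly S) = w ≫ ofA T Y)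
    (hwC : w ≫ Poly.compC _ _ =
      (z ≫ Poly.compC (toPoly Y) (Poly.comp (toPoly T) (toPoly S))) ≫
        Poly.compA₂ (toPoly T) (toPoly S))
    (hwA : w ≫ Poly.compA₂ _ _ =
      z ≫ Poly.compA₂ (toPoly Y) (Poly.comp (toPoly T) (toPoly S)))
    (t : Q ⟶ (Poly.comp (toPoly Y) (toPoly (BiSpan.comp S T))).A)
    (ht : t ≫ (Poly.comp (toPoly Y) (toPoly (BiSpan.comp S T))).n = x ≫ muB (BiSpan.comp S T) Y)
    (htC : t ≫ Poly.compC (toPoly Y) (toPoly (BiSpan.comp S T)) =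
      (z ≫ Poly.compC (toPoly Y) (Poly.comp (toPoly T) (toPoly S))) ≫ ofA S T)
    (htA : t ≫ Poly.compA₂ (toPoly Y) (toPoly (BiSpan.comp S T)) =
      z ≫ Poly.compA₂ (toPoly Y) (Poly.comp (toPoly T) (toPoly S)))
    (h : (show Q ⟶ ob (BiSpan.comp (BiSpan.comp S T) Y).apex from x) ≫
      tr (BiSpan.associatorDiagram S T Y).mid =
        (show Q ⟶ ap (BiSpan.comp S (BiSpan.comp T Y)).right from V ≫ ofA S (BiSpan.comp T Y)) ≫
          l (BiSpan.comp S (BiSpan.comp T Y)).right) :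
    act (BiSpan.associatorDiagram S T Y) x (V ≫ ofA S (BiSpan.comp T Y)) h =
      t ≫ ofA (BiSpan.comp S T) Y := by
  have hx : x ≫ tr (assocMid S T Y) = argB (V ≫ ofA S (BiSpan.comp T Y)) :=
    (ofA_l_eq S (BiSpan.comp T Y) V hV.symm).symm
  have hS : argS (V ≫ ofA S (BiSpan.comp T Y)) =
      (z ≫ Poly.compC (toPoly Y) (Poly.comp (toPoly T) (toPoly S))) ≫
        Poly.compC (toPoly T) (toPoly S) := (argS_ofA V).trans hVC
  have hTY : argTY (V ≫ ofA S (BiSpan.comp T Y)) = w ≫ ofA T Y := (argT_ofA V).trans hVA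
  obtain ⟨h₁, h₂⟩ := act_associatorDiagram S T Y x hx h
  have hB : argB (t ≫ ofA (BiSpan.comp S T) Y) = x := ofA_l_eq (BiSpan.comp S T) Y t ht.symm
  have hSt : argS (t ≫ ofA (BiSpan.comp S T) Y) =
    (z ≫ Poly.compC (toPoly Y) (Poly.comp (toPoly T) (toPoly S))) ≫ ofA S T :=
      (argS_ofA t).trans htC
  have hl := compR_l_tr (S := BiSpan.comp S T) (T := Y) (w := t ≫ ofA (BiSpan.comp S T) Y)
  have hl' : x ≫ tr (outer₁ S T Y) =
      argB ((z ≫ Poly.compC (toPoly Y) (Poly.comp (toPoly T) (toPoly S))) ≫ ofA S T) :=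
    (congrArg (· ≫ tr (outer₁ S T Y)) hB).symm.trans
      (hl.trans ((congrArg (· ≫ l (proj₂ S T ≫ T.right)) hSt).trans (comp_l _)))
  have h₃ : (t ≫ ofA (BiSpan.comp S T) Y) ≫ p₁ (outer₂ S T Y) Y.right =
      evIso (outer₁ S T Y) (outer₂ S T Y) (outerSquare S T Y) x
        ((z ≫ Poly.compC (toPoly Y) (Poly.comp (toPoly T) (toPoly S))) ≫ ofA S T)
          (hl'.trans (comp_l _).symm) :=
    (evV_argS (S := BiSpan.comp S T) (T := Y) hl).symm.trans
      (evV_congr (S := BiSpan.comp S T) (T := Y) hB hSt hl)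
  refine ap_ext (f := outer₂ S T Y) (g := Y.right) (h₁.trans (Eq.trans ?_ h₃.symm)) (h₂.trans ?_)
  · refine evIso_congr _ _ _ rfl ?_ _
    apply compR_ext
    · exact (argB_mkV _ _ _ _ _).trans hl'
    · exact (argS_mkV _ _ _ _ _).trans (hS.trans (argS_ofA _).symm)
    · refine (argT_mkV _ _ _ _ _).trans ?_
      rw [hTY, argS_ofA, hwC, argT_ofA]
  · rw [hTY, argT_ofA, hwA]
    exact ((argT_ofA t).trans htA).symm

/-- On vertices this is `associator_muB`. On fibres both sides keep the arguments for `S` and `T`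
and the point for `Y`, and differ only in their grouping. -/
theorem phi_associator :
    ((phi (BiSpan.associatorDiagram S T Y)).vcomp (mu S (BiSpan.comp T Y))).vcomp
      ((muRight S T Y).vcomp (Poly.associator (toPoly Y) (toPoly T) (toPoly S))) =
    (mu (BiSpan.comp S T) Y).vcomp (muLeft S T Y) := by
  apply Poly.NormalCell.ext_elements
  · intro Q x
    simp only [Poly.NormalCell.vcomp_g]
    exact associator_muB S T Y x
  · intro Q x z h h'
    have h₁ := (Poly.NormalCell.vcomp_app
      ((phi (BiSpan.associatorDiagram S T Y)).vcomp (mu S (BiSpan.comp T Y)))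
      ((muRight S T Y).vcomp (Poly.associator (toPoly Y) (toPoly T) (toPoly S))) x z h)
    refine h₁.trans ?_
    refine (Poly.NormalCell.vcomp_app (phi (BiSpan.associatorDiagram S T Y))
      (mu S (BiSpan.comp T Y)) x _ _).trans ?_
    refine (phi_app _ _ _ _).trans ?_
    refine (act_congr _ rfl (mu_app S (BiSpan.comp T Y) _ _ _) _).trans ?_
    have h₂ := Poly.NormalCell.vcomp_app (mu (BiSpan.comp S T) Y) (muLeft S T Y) x z h'
    refine Eq.trans ?_ h₂.symm
    refine Eq.trans ?_ (mu_app (BiSpan.comp S T) Y _ _ _).symm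
    obtain ⟨w, hw, hwC, hwA⟩ := muRight_associator_app_compA₂
      (x ≫ ((phi (BiSpan.associatorDiagram S T Y)).vcomp (mu S (BiSpan.comp T Y))).g) z
        ((Category.assoc _ _ _).trans h)
    refine act_associatorDiagram_ofA S T Y x _ ?_ w _
      (muRight_associator_app_compC _ z ((Category.assoc _ _ _).trans h)) hw hwC hwA _ ?_ ?_ ?_ _
    · exact (Poly.NormalCell.app_n _ _ _ _).trans (Category.assoc _ _ _).symm
    · exact Poly.NormalCell.app_n _ _ _ _
    · refine (congrArg (· ≫ Poly.compC (toPoly Y) (toPoly (BiSpan.comp S T)))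
        (Poly.NormalCell.hcomp_app _ _ _ _ _)).trans ?_
      exact (Poly.mkA_compC _ _ _ _ _).trans (mu_app S T _ _ _)
    · refine (congrArg (· ≫ Poly.compA₂ (toPoly Y) (toPoly (BiSpan.comp S T)))
        (Poly.NormalCell.hcomp_app _ _ _ _ _)).trans ?_
      exact (Poly.mkA_compA₂ _ _ _ _ _).trans (Poly.NormalCell.id_app _ _ _)

end Associator

end LSpn

end SpanPoly

/-! ### The unit constraints of spans and of polynomials agree. -/

namespace SpanPoly

namespace LSpn

variable {E : Type u} [Category.{v} E] [HasPullbacks E] {L R : MorphismProperty E}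
  [hL : IsProtocalibration L] [hR : IsProtocalibration R] [hLR : IsCompatible L R]

variable {U V W Z : LSpn L}

open BiSpan (vertex proj₁ proj₂ square bipullback lift liftProj₁ liftProj₂ lift_square)

section Extensionality

variable {S : BiSpan (lowerStar L R) U V} {T : BiSpan (lowerStar L R) V W} {Q : E}
  {w w' : Q ⟶ ap (proj₂ S T ≫ T.right)}

theorem compR_ext_of_isIso_left [IsIso (l S.right)] (h : argB w = argB w')
    (h' : argT w = argT w') : w = w' :=
  compR_ext h (el_ext (by rw [← compR_l_tr, h, compR_l_tr])) h'

theorem compR_ext_of_isIso_right [IsIso (l T.right)] (h : argB w = argB w')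
    (h' : argS w = argS w') : w = w' :=
  compR_ext h h' (el_ext (by
    rw [← evV_argS_r compR_l_tr, ← evV_argS_r compR_l_tr]
    exact congrArg (· ≫ r (proj₂ S T)) (evV_congr h h' _)))

theorem argB_ofA_eq (z : Q ⟶ (Poly.comp (toPoly T) (toPoly S)).A) {y : Q ⟶ ob (vertex S T)}
    (h : z ≫ (Poly.comp (toPoly T) (toPoly S)).n = y ≫ muB S T) :
    argB (z ≫ ofA S T) = y := ofA_l_eq S T z h.symm

end Extensionality

section Unitors

variable {Q : E}

instance (U : LSpn L) : IsIso (l (BiSpan.id (R := lowerStar L R) U).right) :=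
  inferInstanceAs (IsIso (l (𝟙 U)))

variable (L R) in
/-- The comparison of the identity span with the identity polynomial. -/
noncomputable def iota (U : LSpn L) :
    Poly.NormalCell (toPoly (BiSpan.id (R := lowerStar L R) U)) (Poly.id L R (ob U)) :=
  Poly.NormalCell.ofIso (p := toPoly (BiSpan.id (R := lowerStar L R) U)) (q := Poly.id L R (ob U))
    (Iso.refl (ob U)) (Iso.refl (ob U)) ((Category.id_comp _).trans (Category.comp_id _).symm)
      (Category.id_comp _) (by
      refine (Category.id_comp _).trans ?_
      exact (tr_id (𝟙 (ob U))).symm.trans (Category.id_comp _))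

variable (S : BiSpan (lowerStar L R) U V)

instance : IsIso (l (proj₂ (BiSpan.id U) S)) :=
  inferInstanceAs (IsIso (l (BiSpan.leftUnitorDiagram S).mid))

theorem leftUnitor_muB (x : Q ⟶ ob (vertex (BiSpan.id U) S)) :
    ((x ≫ muB (BiSpan.id U) S) ≫
      (Poly.NormalCell.hcomp (Poly.NormalCell.id (toPoly S)) (iota L R U)).g) ≫
        (Poly.rightUnitor (toPoly S)).g = x ≫ tr (proj₂ (BiSpan.id U) S) := by
  refine (Poly.rightUnitor_g _ _).trans ((Poly.NormalCell.hcomp_g_ev _ _ _ _ _).trans ?_)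
  refine (Poly.NormalCell.id_g _).trans ((muB_ev (S := BiSpan.id U) (T := S) _ _ _).trans ?_)
  rw [r_eq_tr, evV_l]

theorem rightUnitor_muB (x : Q ⟶ ob (vertex S (BiSpan.id V))) :
    ((x ≫ muB S (BiSpan.id V)) ≫
      (Poly.NormalCell.hcomp (iota L R V) (Poly.NormalCell.id (toPoly S))).g) ≫
        (Poly.leftUnitor (toPoly S)).g = x ≫ tr (proj₁ S (BiSpan.id V)) := by
  refine (Poly.leftUnitor_g _ _).trans ((Poly.NormalCell.hcomp_g_D _ _ _).trans ?_)
  exact (Poly.NormalCell.id_g _).trans (muB_D x)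

/-- The comparison reverses composition, so the left unit of spans corresponds to the right unit of
polynomials. The argument component is redundant since the right leg of the identity span has
invertible left leg. -/
theorem phi_leftUnitor : phi (BiSpan.leftUnitorDiagram S) = (mu (BiSpan.id U) S).vcomp
    ((Poly.NormalCell.hcomp (Poly.NormalCell.id (toPoly S)) (iota L R U)).vcomp
      (Poly.rightUnitor (toPoly S))) := by
  apply phi_ext
  · have h := leftUnitor_muB S (𝟙 _)
    simp only [Category.id_comp, Category.assoc] at h
    exact h.symm
  · intro Q x z h h'
    refine Eq.trans ?_ (Poly.NormalCell.vcomp_app (mu (BiSpan.id U) S)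
      ((Poly.NormalCell.hcomp (Poly.NormalCell.id (toPoly S)) (iota L R U)).vcomp
        (Poly.rightUnitor (toPoly S))) x z h').symm
    refine Eq.trans ?_ (mu_app (BiSpan.id U) S _ _ _).symm
    apply compR_ext_of_isIso_left (S := BiSpan.id U) (T := S)
    · refine Eq.trans ?_ (argB_ofA_eq (S := BiSpan.id U) (T := S) _
        (Poly.NormalCell.app_n _ _ _ _)).symm
      refine (congrArg (fun t => (t ≫ p₁ (proj₂ (BiSpan.id U) S) S.right) ≫
        l (proj₂ (BiSpan.id U) S)) (m_id _)).trans ?_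
      exact (congrArg (· ≫ l (proj₂ (BiSpan.id U) S)) (pr_p₁ _ _ _)).trans (el_l _)
    · refine Eq.trans ?_ (argT_ofA (S := BiSpan.id U) (T := S) _).symm
      refine (congrArg (· ≫ p₂ (proj₂ (BiSpan.id U) S) S.right) (m_id _)).trans
        ((pr_p₂ _ _ _).trans ?_)
      rw [Poly.NormalCell.vcomp_app, Poly.NormalCell.hcomp_app, Poly.mkA_compA₂,
        Poly.NormalCell.id_app, Poly.rightUnitor_app, Poly.mkA_compA₂]

theorem phi_rightUnitor : phi (BiSpan.rightUnitorDiagram S) = (mu S (BiSpan.id V)).vcomp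
    ((Poly.NormalCell.hcomp (iota L R V) (Poly.NormalCell.id (toPoly S))).vcomp
      (Poly.leftUnitor (toPoly S))) := by
  apply phi_ext
  · have h := rightUnitor_muB S (𝟙 _)
    simp only [Category.id_comp, Category.assoc] at h
    exact h.symm
  · intro Q x z h h'
    refine Eq.trans ?_ (Poly.NormalCell.vcomp_app (mu S (BiSpan.id V))
      ((Poly.NormalCell.hcomp (iota L R V) (Poly.NormalCell.id (toPoly S))).vcomp
        (Poly.leftUnitor (toPoly S))) x z h').symm
    refine Eq.trans ?_ (mu_app S (BiSpan.id V) _ _ _).symm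
    apply compR_ext_of_isIso_right (S := S) (T := BiSpan.id V)
    · refine Eq.trans ?_ (argB_ofA_eq (S := S) (T := BiSpan.id V) _
        (Poly.NormalCell.app_n _ _ _ _)).symm
      exact evV_l _ _ h
    · refine Eq.trans ?_ (argS_ofA (S := S) (T := BiSpan.id V) _).symm
      refine (argV_evV _ _ h).trans ?_
      rw [Poly.NormalCell.vcomp_app, Poly.NormalCell.hcomp_app, Poly.mkA_compC,
        Poly.NormalCell.id_app, Poly.leftUnitor_app, Poly.mkA_compC]

end Unitors

end LSpn

end SpanPoly

/-! ### Reflection of bicategory laws along a comparison bijective on 2-cells. -/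

namespace SpanPoly

/-- Data comparing a bicategory structure `B` contravariantly on 1-cells with a bicategory `C`,
bijectively on 2-cells. -/
structure Transport (B : Type*) [BicategoryStruct B] (C : Type*) [Bicategory C] where
  /-- the action on objects -/
  obj : B → C
  /-- the action on 1-cells -/
  map {X Y : B} (f : X ⟶ Y) : obj Y ⟶ obj X
  /-- the action on 2-cells -/
  map₂ {X Y : B} {f g : X ⟶ Y} (η : f ⟶ g) : map f ⟶ map g
  map₂_injective {X Y : B} {f g : X ⟶ Y} : Function.Injective (map₂ (f := f) (g := g))
  map₂_surjective {X Y : B} {f g : X ⟶ Y} : Function.Surjective (map₂ (f := f) (g := g))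
  map₂_id {X Y : B} (f : X ⟶ Y) : map₂ (𝟙 f) = 𝟙 (map f)
  map₂_comp {X Y : B} {f g h : X ⟶ Y} (η : f ⟶ g) (θ : g ⟶ h) :
    map₂ (η ≫ θ) = map₂ η ≫ map₂ θ
  /-- the comparison for composites -/
  mapComp {X Y Z : B} (f : X ⟶ Y) (g : Y ⟶ Z) : map (f ≫ g) ≅ map g ≫ map f
  /-- the comparison for identities -/
  mapId (X : B) : map (𝟙 X) ≅ 𝟙 (obj X)
  map₂_whiskerLeft {X Y Z : B} (f : X ⟶ Y) {g g' : Y ⟶ Z} (η : g ⟶ g') :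
    map₂ (BicategoryStruct.whiskerLeft f η) ≫ (mapComp f g').hom =
      (mapComp f g).hom ≫ map₂ η ▷ map f
  map₂_whiskerRight {X Y Z : B} {f f' : X ⟶ Y} (η : f ⟶ f') (g : Y ⟶ Z) :
    map₂ (BicategoryStruct.whiskerRight η g) ≫ (mapComp f' g).hom =
      (mapComp f g).hom ≫ map g ◁ map₂ η
  map₂_associator {X Y Z W : B} (f : X ⟶ Y) (g : Y ⟶ Z) (h : Z ⟶ W) :
    map₂ (BicategoryStruct.associator f g h) ≫ (mapComp f (g ≫ h)).hom ≫
      (mapComp g h).hom ▷ map f ≫ (α_ (map h) (map g) (map f)).hom =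
        (mapComp (f ≫ g) h).hom ≫ map h ◁ (mapComp f g).hom
  map₂_leftUnitor {X Y : B} (f : X ⟶ Y) :
    map₂ (BicategoryStruct.leftUnitor f) =
      (mapComp (𝟙 X) f).hom ≫ map f ◁ (mapId X).hom ≫ (ρ_ (map f)).hom
  map₂_rightUnitor {X Y : B} (f : X ⟶ Y) :
    map₂ (BicategoryStruct.rightUnitor f) =
      (mapComp f (𝟙 Y)).hom ≫ (mapId Y).hom ▷ map f ≫ (λ_ (map f)).hom

namespace Transport

variable {B : Type*} [BicategoryStruct B] {C : Type*} [Bicategory C] (F : Transport B C)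

variable {X Y Z W V : B}

theorem whiskerLeft_eq (f : X ⟶ Y) {g g' : Y ⟶ Z} (η : g ⟶ g') :
    F.map₂ (BicategoryStruct.whiskerLeft f η) =
      (F.mapComp f g).hom ≫ F.map₂ η ▷ F.map f ≫ (F.mapComp f g').inv := by
  rw [← Category.assoc, Iso.eq_comp_inv, F.map₂_whiskerLeft]

theorem whiskerRight_eq {f f' : X ⟶ Y} (η : f ⟶ f') (g : Y ⟶ Z) :
    F.map₂ (BicategoryStruct.whiskerRight η g) =
      (F.mapComp f g).hom ≫ F.map g ◁ F.map₂ η ≫ (F.mapComp f' g).inv := by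
  rw [← Category.assoc, Iso.eq_comp_inv, F.map₂_whiskerRight]

/-- The isomorphism corresponding to the associator. -/
def associatorIso (f : X ⟶ Y) (g : Y ⟶ Z) (h : Z ⟶ W) :
    F.map ((f ≫ g) ≫ h) ≅ F.map (f ≫ g ≫ h) :=
  F.mapComp (f ≫ g) h ≪≫ whiskerLeftIso (F.map h) (F.mapComp f g) ≪≫
    (α_ (F.map h) (F.map g) (F.map f)).symm ≪≫ whiskerRightIso (F.mapComp g h).symm (F.map f) ≪≫
      (F.mapComp f (g ≫ h)).symm

theorem associator_eq (f : X ⟶ Y) (g : Y ⟶ Z) (h : Z ⟶ W) :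
    F.map₂ (BicategoryStruct.associator f g h) =
      (F.mapComp (f ≫ g) h).hom ≫ F.map h ◁ (F.mapComp f g).hom ≫
        (α_ (F.map h) (F.map g) (F.map f)).inv ≫ (F.mapComp g h).inv ▷ F.map f ≫
          (F.mapComp f (g ≫ h)).inv := by
  have h₁ := F.map₂_associator f g h
  rw [← cancel_mono ((F.mapComp f (g ≫ h)).hom ≫
      (F.mapComp g h).hom ▷ F.map f ≫ (α_ (F.map h) (F.map g) (F.map f)).hom), h₁]
  simp

theorem exists_inverse {f g : X ⟶ Y} (η : f ⟶ g) (e : F.map f ≅ F.map g) (h : F.map₂ η = e.hom) :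
    ∃ ζ : g ⟶ f, η ≫ ζ = 𝟙 _ ∧ ζ ≫ η = 𝟙 _ := by
  obtain ⟨ζ, hζ⟩ := F.map₂_surjective e.inv
  refine ⟨ζ, F.map₂_injective ?_, F.map₂_injective ?_⟩
  · rw [F.map₂_comp, F.map₂_id, h, hζ, e.hom_inv_id]
  · rw [F.map₂_comp, F.map₂_id, h, hζ, e.inv_hom_id]

/-- Each law is an equation of 2-cells, and `F.map₂` is injective. The comparison isomorphisms
express the operations of `B` as conjugates of those of `C`, with the whiskerings exchanged and the
associator inverted, so every law becomes one of `C`. Inverses of the constraints exist by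
surjectivity. -/
theorem isLawful (F : Transport B C) : BicategoryStruct.IsLawful B where
  id_comp η := F.map₂_injective (by rw [F.map₂_comp, F.map₂_id, Category.id_comp])
  comp_id η := F.map₂_injective (by rw [F.map₂_comp, F.map₂_id, Category.comp_id])
  assoc η θ ζ := F.map₂_injective (by simp only [F.map₂_comp, Category.assoc])
  whiskerLeft_id f g := F.map₂_injective (by simp [F.whiskerLeft_eq, F.map₂_id])
  whiskerLeft_comp f _ _ _ η θ := F.map₂_injective (by simp [F.whiskerLeft_eq, F.map₂_comp])
  id_whiskerRight f g := F.map₂_injective (by simp [F.whiskerRight_eq, F.map₂_id])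
  comp_whiskerRight η θ i := F.map₂_injective (by simp [F.whiskerRight_eq, F.map₂_comp])
  whisker_exchange η θ := F.map₂_injective (by
    simp [F.whiskerRight_eq, F.whiskerLeft_eq, F.map₂_comp, whisker_exchange_assoc])
  associator_invertible f g h := F.exists_inverse _ (F.associatorIso f g h) (by
    rw [F.associator_eq]; rfl)
  leftUnitor_invertible f := F.exists_inverse _
    (F.mapComp _ f ≪≫ whiskerLeftIso (F.map f) (F.mapId _) ≪≫ ρ_ (F.map f))
    (by rw [F.map₂_leftUnitor]; rfl)
  rightUnitor_invertible f := F.exists_inverse _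
    (F.mapComp f _ ≪≫ whiskerRightIso (F.mapId _) (F.map f) ≪≫ λ_ (F.map f))
    (by rw [F.map₂_rightUnitor]; rfl)
  associator_naturality_left η g h := F.map₂_injective (by
    simp [F.whiskerRight_eq, F.associator_eq, F.map₂_comp, ← whisker_exchange_assoc])
  associator_naturality_middle f _ _ η h := F.map₂_injective (by
    simp [F.whiskerRight_eq, F.whiskerLeft_eq, F.associator_eq, F.map₂_comp])
  associator_naturality_right f g _ _ η := F.map₂_injective (by
    simp [F.whiskerLeft_eq, F.associator_eq, F.map₂_comp, ← whisker_exchange_assoc])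
  leftUnitor_naturality η := F.map₂_injective (by
    simp [F.whiskerLeft_eq, F.map₂_leftUnitor, F.map₂_comp, ← whisker_exchange_assoc])
  rightUnitor_naturality η := F.map₂_injective (by
    simp [F.whiskerRight_eq, F.map₂_rightUnitor, F.map₂_comp, whisker_exchange_assoc])
  pentagon f g h i := F.map₂_injective (by
    simp [F.whiskerRight_eq, F.whiskerLeft_eq, F.associator_eq, F.map₂_comp,
      ← whisker_exchange_assoc])
  triangle f g := F.map₂_injective (by
    simp [F.whiskerRight_eq, F.whiskerLeft_eq, F.associator_eq, F.map₂_rightUnitor,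
      F.map₂_leftUnitor, F.map₂_comp])

end Transport

end SpanPoly

/-! ### Spans of spans form a bicategory. -/

namespace SpanPoly

variable {E : Type u} [Category.{v} E] [HasPullbacks E] {L R : MorphismProperty E}
  [hL : IsProtocalibration L] [hR : IsProtocalibration R] [hLR : IsCompatible L R]

namespace Ply

variable {X Y Z W : Ply L R}

/-- The isomorphism of 1-cells given by an invertible normal cell. -/
noncomputable def isoOfCell {p q : X ⟶ Y} (c : Poly.NormalCell (poly p) (poly q))
    (h : ∃ d : Poly.NormalCell (poly q) (poly p), c.vcomp d = Poly.NormalCell.id (poly p) ∧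
      d.vcomp c = Poly.NormalCell.id (poly q)) : p ≅ q where
  hom := cell c
  inv := cell h.choose
  hom_inv_id := (comp_cell _ _).trans (congrArg Ply.cell h.choose_spec.1)
  inv_hom_id := (comp_cell _ _).trans (congrArg Ply.cell h.choose_spec.2)

theorem whiskerLeft_cell' (p : X ⟶ Y) {q q' : Y ⟶ Z} (d : Poly.NormalCell (poly q) (poly q')) :
    p ◁ (cell d : q ⟶ q') = cell (p := p ≫ q) (q := p ≫ q')
      (Poly.NormalCell.hcomp (Poly.NormalCell.id (poly p)) d) :=
  whiskerLeft_cell p d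

theorem whiskerRight_cell' {p p' : X ⟶ Y} (c : Poly.NormalCell (poly p) (poly p')) (q : Y ⟶ Z) :
    (cell c : p ⟶ p') ▷ q = cell (p := p ≫ q) (q := p' ≫ q)
      (Poly.NormalCell.hcomp c (Poly.NormalCell.id (poly q))) :=
  whiskerRight_cell c q

end Ply

namespace LSpn

open Ply (comp_cell)

variable {X Y Z W : Spn (lowerStar L R)}

/-- The polynomial corresponding to a 1-cell of `Spn (lowerStar L R)`. -/
noncomputable def ply (S : X ⟶ Y) : (Ply.mk (ob Y.as) : Ply L R) ⟶ Ply.mk (ob X.as) :=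
  toPoly (show BiSpan (lowerStar L R) X.as Y.as from S)

/-- The 2-cell of polynomials corresponding to a 2-cell of `Spn (lowerStar L R)`. -/
noncomputable def ply₂ {S S' : X ⟶ Y} (a : S ⟶ S') : ply S ⟶ ply S' :=
  Ply.cell (p := ply S) (q := ply S') (Phi _ _ a)

/-- Composition of spans corresponds to composition of polynomials. -/
noncomputable def plyComp (S : X ⟶ Y) (T : Y ⟶ Z) : ply (S ≫ T) ≅ ply T ≫ ply S :=
  Ply.isoOfCell (p := ply (S ≫ T)) (q := ply T ≫ ply S) (mu S T)
    (Poly.NormalCell.exists_ofIso_inv _ _ _ _ _)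

variable (X) in
/-- The identity span corresponds to the identity polynomial. -/
noncomputable def plyId : ply (𝟙 X) ≅ 𝟙 (Ply.mk (ob X.as) : Ply L R) :=
  Ply.isoOfCell (p := ply (𝟙 X)) (q := 𝟙 (Ply.mk (ob X.as) : Ply L R)) (iota L R X.as)
    (Poly.NormalCell.exists_ofIso_inv _ _ _ _ _)

/-- Horizontal composition of classes is defined on chosen representatives, to which `phi_hcomp`
applies directly. -/
theorem Phi_hcomp {U V W : LSpn L} {S S' : BiSpan (lowerStar L R) U V}
    {T T' : BiSpan (lowerStar L R) V W} (a : BiSpan.Cell S S') (b : BiSpan.Cell T T') :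
    (Phi _ _ (a.hcomp b)).vcomp (mu S' T') =
      (mu S T).vcomp (Poly.NormalCell.hcomp (Phi _ _ b) (Phi _ _ a)) := by
  rw [← phi_out a, ← phi_out b]
  exact phi_hcomp _ _

theorem ply₂_whiskerLeft (S : X ⟶ Y) {T T' : Y ⟶ Z} (b : T ⟶ T') :
    ply₂ (BicategoryStruct.whiskerLeft S b) ≫ (plyComp S T').hom =
      (plyComp S T).hom ≫ ply₂ b ▷ ply S := by
  refine (comp_cell _ _).trans ?_
  refine Eq.trans ?_ ((congrArg (_ ≫ ·) (Ply.whiskerRight_cell' _ _)).trans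
    (comp_cell _ _)).symm
  refine congrArg Ply.cell ((Phi_hcomp (BiSpan.Cell.id _) b).trans ?_)
  rw [Phi_id]
  rfl

theorem ply₂_whiskerRight {S S' : X ⟶ Y} (a : S ⟶ S') (T : Y ⟶ Z) :
    ply₂ (BicategoryStruct.whiskerRight a T) ≫ (plyComp S' T).hom =
      (plyComp S T).hom ≫ ply T ◁ ply₂ a := by
  refine (comp_cell _ _).trans ?_
  refine Eq.trans ?_ ((congrArg (_ ≫ ·) (Ply.whiskerLeft_cell' _ _)).trans
    (comp_cell _ _)).symm
  refine congrArg Ply.cell ((Phi_hcomp a (BiSpan.Cell.id _)).trans ?_)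
  rw [Phi_id]
  rfl

theorem ply₂_associator (S : X ⟶ Y) (T : Y ⟶ Z) (U : Z ⟶ W) :
    ply₂ (BicategoryStruct.associator S T U) ≫ (plyComp S (T ≫ U)).hom ≫
      (plyComp T U).hom ▷ ply S ≫ (α_ (ply U) (ply T) (ply S)).hom =
        (plyComp (S ≫ T) U).hom ≫ ply U ◁ (plyComp S T).hom := by
  have h₁ : ply₂ (BicategoryStruct.associator S T U) ≫ (plyComp S (T ≫ U)).hom =
      Ply.cell (p := ply ((S ≫ T) ≫ U)) (q := ply (T ≫ U) ≫ ply S)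
        ((phi (BiSpan.associatorDiagram S T U)).vcomp (mu S (BiSpan.comp T U))) :=
    comp_cell _ _
  have h₂ : (plyComp T U).hom ▷ ply S =
      Ply.cell (p := ply (T ≫ U) ≫ ply S) (q := (ply U ≫ ply T) ≫ ply S) (muRight S T U) :=
    Ply.whiskerRight_cell' _ _
  have h₃ : (plyComp T U).hom ▷ ply S ≫ (α_ (ply U) (ply T) (ply S)).hom =
      Ply.cell (p := ply (T ≫ U) ≫ ply S) (q := ply U ≫ ply T ≫ ply S)
        ((muRight S T U).vcomp (Poly.associator (toPoly U) (toPoly T) (toPoly S))) :=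
    (congrArg (· ≫ _) h₂).trans (comp_cell _ _)
  have h₄ : ply U ◁ (plyComp S T).hom =
      Ply.cell (p := ply U ≫ ply (S ≫ T)) (q := ply U ≫ ply T ≫ ply S) (muLeft S T U) :=
    Ply.whiskerLeft_cell' _ _
  rw [← Category.assoc, h₁, h₃, h₄]
  exact (comp_cell _ _).trans ((congrArg Ply.cell (phi_associator S T U)).trans
    (comp_cell _ _).symm)

theorem ply₂_leftUnitor (S : X ⟶ Y) :
    ply₂ (BicategoryStruct.leftUnitor S) =
      (plyComp (𝟙 X) S).hom ≫ ply S ◁ (plyId X).hom ≫ (ρ_ (ply S)).hom := by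
  have h₁ : ply S ◁ (plyId X).hom = Ply.cell (p := ply S ≫ ply (𝟙 X)) (q := ply S ≫ 𝟙 _)
      (Poly.NormalCell.hcomp (Poly.NormalCell.id (toPoly S)) (iota L R X.as)) :=
    Ply.whiskerLeft_cell' _ _
  have h₂ : ply S ◁ (plyId X).hom ≫ (ρ_ (ply S)).hom = Ply.cell (p := ply S ≫ ply (𝟙 X))
      (q := ply S) ((Poly.NormalCell.hcomp (Poly.NormalCell.id (toPoly S)) (iota L R X.as)).vcomp
        (Poly.rightUnitor (toPoly S))) :=
    (congrArg (· ≫ _) h₁).trans (comp_cell _ _)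
  rw [h₂]
  exact (congrArg Ply.cell (phi_leftUnitor S)).trans (comp_cell _ _).symm

theorem ply₂_rightUnitor (S : X ⟶ Y) :
    ply₂ (BicategoryStruct.rightUnitor S) =
      (plyComp S (𝟙 Y)).hom ≫ (plyId Y).hom ▷ ply S ≫ (λ_ (ply S)).hom := by
  have h₁ : (plyId Y).hom ▷ ply S = Ply.cell (p := ply (𝟙 Y) ≫ ply S) (q := 𝟙 _ ≫ ply S)
      (Poly.NormalCell.hcomp (iota L R Y.as) (Poly.NormalCell.id (toPoly S))) :=
    Ply.whiskerRight_cell' _ _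
  have h₂ : (plyId Y).hom ▷ ply S ≫ (λ_ (ply S)).hom = Ply.cell (p := ply (𝟙 Y) ≫ ply S)
      (q := ply S) ((Poly.NormalCell.hcomp (iota L R Y.as) (Poly.NormalCell.id (toPoly S))).vcomp
        (Poly.leftUnitor (toPoly S))) :=
    (congrArg (· ≫ _) h₁).trans (comp_cell _ _)
  rw [h₂]
  exact (congrArg Ply.cell (phi_rightUnitor S)).trans (comp_cell _ _).symm

variable (L R) in
/-- The comparison of the bicategory of spans with the bicategory of polynomials. -/
noncomputable def transport : Transport (Spn (lowerStar L R)) (Ply L R) where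
  obj X := Ply.mk (ob X.as)
  map S := ply S
  map₂ a := ply₂ a
  map₂_injective := fun h => Phi_injective (Ply.cell_injective h)
  map₂_surjective := fun η => by
    obtain ⟨c, rfl⟩ := Ply.exists_cell η
    obtain ⟨a, rfl⟩ := Phi_surjective c
    exact ⟨a, rfl⟩
  map₂_id S := congrArg Ply.cell Phi_id
  map₂_comp a b := (congrArg Ply.cell (Phi_vcomp a b)).trans (comp_cell _ _).symm
  mapComp S T := plyComp S T
  mapId X := plyId X
  map₂_whiskerLeft := ply₂_whiskerLeft
  map₂_whiskerRight := ply₂_whiskerRight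
  map₂_associator := ply₂_associator
  map₂_leftUnitor := ply₂_leftUnitor
  map₂_rightUnitor := ply₂_rightUnitor

instance : BicategoryStruct.IsLawful (Spn (lowerStar L R)) := (transport L R).isLawful

end LSpn

end SpanPoly

/-! ### Pseudofunctor laws for a section of the comparison. -/

namespace SpanPoly

namespace Transport

variable {B : Type*} [BicategoryStruct B] [BicategoryStruct.IsLawful B] {C : Type*} [Bicategory C]
  (F : Transport B C)

variable {X Y Z : B}

theorem map₂_whiskerLeft' (f : X ⟶ Y) {g g' : Y ⟶ Z} (η : g ⟶ g') :
    F.map₂ (f ◁ η) = (F.mapComp f g).hom ≫ F.map₂ η ▷ F.map f ≫ (F.mapComp f g').inv :=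
  F.whiskerLeft_eq f η

theorem map₂_whiskerRight' {f f' : X ⟶ Y} (η : f ⟶ f') (g : Y ⟶ Z) :
    F.map₂ (η ▷ g) = (F.mapComp f g).hom ≫ F.map g ◁ F.map₂ η ≫ (F.mapComp f' g).inv :=
  F.whiskerRight_eq η g

theorem map₂_associator_hom {W : B} (f : X ⟶ Y) (g : Y ⟶ Z) (h : Z ⟶ W) :
    F.map₂ (α_ f g h).hom = (F.mapComp (f ≫ g) h).hom ≫ F.map h ◁ (F.mapComp f g).hom ≫
        (α_ (F.map h) (F.map g) (F.map f)).inv ≫ (F.mapComp g h).inv ▷ F.map f ≫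
          (F.mapComp f (g ≫ h)).inv :=
  F.associator_eq f g h

theorem map₂_leftUnitor_hom (f : X ⟶ Y) : F.map₂ (λ_ f).hom =
    (F.mapComp (𝟙 X) f).hom ≫ F.map f ◁ (F.mapId X).hom ≫ (ρ_ (F.map f)).hom :=
  F.map₂_leftUnitor f

theorem map₂_rightUnitor_hom (f : X ⟶ Y) : F.map₂ (ρ_ f).hom =
    (F.mapComp f (𝟙 Y)).hom ≫ (F.mapId Y).hom ▷ F.map f ≫ (λ_ (F.map f)).hom :=
  F.map₂_rightUnitor f

/-- Isomorphisms of 1-cells are reflected. -/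
noncomputable def preimageIso {f g : X ⟶ Y} (e : F.map f ≅ F.map g) : f ≅ g where
  hom := (F.map₂_surjective e.hom).choose
  inv := (F.map₂_surjective e.inv).choose
  hom_inv_id := F.map₂_injective (by
    rw [F.map₂_comp, F.map₂_id, (F.map₂_surjective e.hom).choose_spec,
      (F.map₂_surjective e.inv).choose_spec, e.hom_inv_id])
  inv_hom_id := F.map₂_injective (by
    rw [F.map₂_comp, F.map₂_id, (F.map₂_surjective e.hom).choose_spec,
      (F.map₂_surjective e.inv).choose_spec, e.inv_hom_id])

theorem map₂_preimageIso_hom {f g : X ⟶ Y} (e : F.map f ≅ F.map g) :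
    F.map₂ (F.preimageIso e).hom = e.hom := (F.map₂_surjective e.hom).choose_spec

theorem map₂_preimageIso_inv {f g : X ⟶ Y} (e : F.map f ≅ F.map g) :
    F.map₂ (F.preimageIso e).inv = e.inv := (F.map₂_surjective e.inv).choose_spec

/-- A choice, on the objects `sec X`, of 1-cells of `B` corresponding to 1-cells of `C`. -/
structure Sec (O : Type*) where
  /-- the action on objects -/
  sec : O → B
  /-- the action on 1-cells -/
  map {X Y : O} (f : F.obj (sec X) ⟶ F.obj (sec Y)) : sec Y ⟶ sec X
  /-- the action on 2-cells -/
  map₂ {X Y : O} {f g : F.obj (sec X) ⟶ F.obj (sec Y)} (η : f ⟶ g) : map f ⟶ map g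
  /-- the chosen 1-cell corresponds to the given one -/
  unit {X Y : O} (f : F.obj (sec X) ⟶ F.obj (sec Y)) : F.map (map f) ≅ f
  map₂_unit {X Y : O} {f g : F.obj (sec X) ⟶ F.obj (sec Y)} (η : f ⟶ g) :
    F.map₂ (map₂ η) ≫ (unit g).hom = (unit f).hom ≫ η

namespace Sec

variable {F} {O : Type*} (s : F.Sec O) {X Y Z W : O}

/-- Applying the section and then `F` is conjugation by the unit. Since `F.map₂` is injective, the
functoriality and coherence of the section can all be verified in `C` from this formula. -/
theorem map₂_map₂ {f g : F.obj (s.sec X) ⟶ F.obj (s.sec Y)} (η : f ⟶ g) :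
    F.map₂ (s.map₂ η) = (s.unit f).hom ≫ η ≫ (s.unit g).inv := by
  rw [← Category.assoc, Iso.eq_comp_inv, s.map₂_unit]

theorem map₂_id (f : F.obj (s.sec X) ⟶ F.obj (s.sec Y)) : s.map₂ (𝟙 f) = 𝟙 _ :=
  F.map₂_injective (by rw [s.map₂_map₂, F.map₂_id, Category.id_comp, Iso.hom_inv_id])

theorem map₂_comp {f g h : F.obj (s.sec X) ⟶ F.obj (s.sec Y)} (η : f ⟶ g) (θ : g ⟶ h) :
    s.map₂ (η ≫ θ) = s.map₂ η ≫ s.map₂ θ :=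
  F.map₂_injective (by simp [s.map₂_map₂, F.map₂_comp])

theorem map₂_injective {f g : F.obj (s.sec X) ⟶ F.obj (s.sec Y)} :
    Function.Injective (s.map₂ (f := f) (g := g)) := fun η θ h => by
  have h' := congrArg F.map₂ h
  simpa [s.map₂_map₂] using h'

theorem map₂_surjective {f g : F.obj (s.sec X) ⟶ F.obj (s.sec Y)} :
    Function.Surjective (s.map₂ (f := f) (g := g)) := fun η =>
  ⟨(s.unit f).inv ≫ F.map₂ η ≫ (s.unit g).hom, F.map₂_injective (by simp [s.map₂_map₂])⟩

/-- Every 1-cell of `B` between the chosen objects is isomorphic to a chosen one. -/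
noncomputable def mapMapIso (f : s.sec Y ⟶ s.sec X) : s.map (F.map f) ≅ f :=
  F.preimageIso (s.unit (F.map f))

/-- The comparison for identities. -/
noncomputable def mapId (X : O) : s.map (𝟙 (F.obj (s.sec X))) ≅ 𝟙 (s.sec X) :=
  F.preimageIso (s.unit _ ≪≫ (F.mapId _).symm)

/-- The comparison for composites. -/
noncomputable def mapComp (f : F.obj (s.sec X) ⟶ F.obj (s.sec Y))
    (g : F.obj (s.sec Y) ⟶ F.obj (s.sec Z)) : s.map (f ≫ g) ≅ s.map g ≫ s.map f :=
  F.preimageIso (s.unit _ ≪≫ (whiskerRightIso (s.unit f).symm g ≪≫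
    whiskerLeftIso (F.map (s.map f)) (s.unit g).symm) ≪≫ (F.mapComp _ _).symm)

theorem map₂_mapId_hom (X : O) :
    F.map₂ (s.mapId X).hom = (s.unit _).hom ≫ (F.mapId _).inv := F.map₂_preimageIso_hom _

theorem map₂_mapComp_hom (f : F.obj (s.sec X) ⟶ F.obj (s.sec Y))
    (g : F.obj (s.sec Y) ⟶ F.obj (s.sec Z)) : F.map₂ (s.mapComp f g).hom =
      (s.unit _).hom ≫ ((s.unit f).inv ▷ g ≫ F.map (s.map f) ◁ (s.unit g).inv) ≫
        (F.mapComp _ _).inv := F.map₂_preimageIso_hom _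

theorem map₂_mapComp_inv (f : F.obj (s.sec X) ⟶ F.obj (s.sec Y))
    (g : F.obj (s.sec Y) ⟶ F.obj (s.sec Z)) : F.map₂ (s.mapComp f g).inv =
      ((F.mapComp _ _).hom ≫ F.map (s.map f) ◁ (s.unit g).hom ≫ (s.unit f).hom ▷ g) ≫
        (s.unit _).inv :=
  (F.map₂_preimageIso_inv _).trans (by simp)

theorem map₂_whiskerRight {f f' : F.obj (s.sec X) ⟶ F.obj (s.sec Y)} (η : f ⟶ f')
    (g : F.obj (s.sec Y) ⟶ F.obj (s.sec Z)) :
    s.map₂ (η ▷ g) = (s.mapComp f g).hom ≫ s.map g ◁ s.map₂ η ≫ (s.mapComp f' g).inv :=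
  F.map₂_injective (by
    simp [s.map₂_map₂, F.map₂_comp, F.map₂_whiskerLeft', map₂_mapComp_hom, map₂_mapComp_inv,
      whisker_exchange_assoc])

theorem map₂_whiskerLeft (f : F.obj (s.sec X) ⟶ F.obj (s.sec Y))
    {g g' : F.obj (s.sec Y) ⟶ F.obj (s.sec Z)} (η : g ⟶ g') :
    s.map₂ (f ◁ η) = (s.mapComp f g).hom ≫ s.map₂ η ▷ s.map f ≫ (s.mapComp f g').inv :=
  F.map₂_injective (by
    simp [s.map₂_map₂, F.map₂_comp, F.map₂_whiskerRight', map₂_mapComp_hom, map₂_mapComp_inv,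
      whisker_exchange_assoc])

theorem map₂_associator_inv (f : F.obj (s.sec W) ⟶ F.obj (s.sec X))
    (g : F.obj (s.sec X) ⟶ F.obj (s.sec Y)) (h : F.obj (s.sec Y) ⟶ F.obj (s.sec Z)) :
    s.map₂ (α_ f g h).inv = (s.mapComp f (g ≫ h)).hom ≫ (s.mapComp g h).hom ▷ s.map f ≫
      (α_ (s.map h) (s.map g) (s.map f)).hom ≫ s.map h ◁ (s.mapComp f g).inv ≫
        (s.mapComp (f ≫ g) h).inv :=
  F.map₂_injective (by
    simp [s.map₂_map₂, F.map₂_comp, F.map₂_whiskerRight', F.map₂_whiskerLeft',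
      F.map₂_associator_hom, map₂_mapComp_hom, map₂_mapComp_inv, whisker_exchange_assoc]
    -- What remains is to move the units of the three 1-cells past one another by interchange.
    rw [← associator_inv_naturality_left_assoc, Iso.inv_hom_id_assoc, whisker_exchange_assoc,
      whisker_exchange_assoc, ← whiskerLeft_comp_assoc _ (F.map (s.map g) ◁ (s.unit h).inv),
      whisker_exchange]
    simp)

theorem map₂_rightUnitor_hom (f : F.obj (s.sec X) ⟶ F.obj (s.sec Y)) :
    s.map₂ (ρ_ f).hom = (s.mapComp f (𝟙 _)).hom ≫ (s.mapId Y).hom ▷ s.map f ≫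
      (λ_ (s.map f)).hom :=
  F.map₂_injective (by
    simp [s.map₂_map₂, F.map₂_comp, F.map₂_whiskerRight', F.map₂_leftUnitor_hom,
      map₂_mapComp_hom, map₂_mapId_hom])

theorem map₂_leftUnitor_hom (f : F.obj (s.sec X) ⟶ F.obj (s.sec Y)) :
    s.map₂ (λ_ f).hom = (s.mapComp (𝟙 _) f).hom ≫ s.map f ◁ (s.mapId X).hom ≫
      (ρ_ (s.map f)).hom :=
  F.map₂_injective (by
    simp [s.map₂_map₂, F.map₂_comp, F.map₂_whiskerLeft', F.map₂_rightUnitor_hom,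
      map₂_mapComp_hom, map₂_mapId_hom, whisker_exchange_assoc])

end Sec

end Transport

end SpanPoly

/-! ### The comparison pseudofunctor and its local equivalence. -/

namespace SpanPoly

variable {E : Type u} [Category.{v} E] [HasPullbacks E] {L R : MorphismProperty E}
  [hL : IsProtocalibration L] [hR : IsProtocalibration R]

namespace LSpn

instance {B Y : E} (g : B ⟶ Y) : IsIso (l (starCell (L := L) g)) :=
  inferInstanceAs (IsIso (𝟙 B))

/-- `tr` contains the inverse of an identity, so the polynomial of the span of `p` equals `p` only
after an argument; `nu` bridges this gap. -/
theorem tr_starCell {B Y : E} (g : B ⟶ Y) : tr (starCell (L := L) g) = g :=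
  (IsIso.inv_comp_eq _).2 (Category.id_comp g).symm

theorem el_starCell {B Y T : E} (g : B ⟶ Y) (x : T ⟶ B) : el (starCell (L := L) g) x = x :=
  el_ext ((el_l _).trans (Category.comp_id x).symm)

section

variable {X Y : E}

/-- The comparison of a polynomial with the polynomial of its span. -/
noncomputable def nu (p : Poly L R X Y) : Poly.NormalCell (toPoly (polySpan p)) p :=
  Poly.NormalCell.ofIso (p := toPoly (polySpan p)) (Iso.refl p.B) (Iso.refl p.A)
    ((Category.id_comp _).trans (Category.comp_id _).symm) (Category.id_comp _)
    ((Category.id_comp _).trans (tr_starCell p.t).symm)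

/-- As `nu` is the identity on both vertices, this says that the span diagram of `c`, read back as a
morphism of polynomials, is `c`. -/
theorem phi_polyDiagram {p q : Poly L R X Y} (c : Poly.NormalCell p q) :
    (phi (polyDiagram c)).vcomp (nu q) = (nu p).vcomp c := by
  apply Poly.NormalCell.ext_elements
  · intro T b
    refine congrArg (b ≫ ·) ((Category.comp_id _).trans ?_)
    exact (tr_starCell c.g).trans (Category.id_comp _).symm
  · intro T b z h h'
    rw [Poly.NormalCell.vcomp_app, Poly.NormalCell.vcomp_app]
    refine (phi_app (polyDiagram c) b _ _).trans ?_
    refine Eq.trans ?_ ((Poly.NormalCell.ofIso_app _ _ _ _ _ _ _ _).trans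
      (Category.comp_id _)).symm
    refine congrArg (· ≫ c.ℓ) (pullback.hom_ext ?_ ?_)
    · refine (pr_p₁ (f := starCell c.g) (g := spanCell q.n q.r q.n_mem) _ _ _).trans ?_
      refine (el_starCell c.g b).trans ?_
      exact ((pullback.lift_fst _ _ _).trans (Category.comp_id b)).symm
    · refine (pr_p₂ (f := starCell c.g) (g := spanCell q.n q.r q.n_mem) _ _ _).trans ?_
      refine (Poly.NormalCell.ofIso_app _ _ _ _ _ _ _ _).trans ((Category.comp_id z).trans ?_)
      exact (pullback.lift_snd _ _ _).symm

end

variable [hLR : IsCompatible L R]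

variable (L R) in
/-- The choice of spans of spans given by polynomials. -/
noncomputable def polySec : (transport L R).Sec (Ply L R) where
  sec X := Spn.mk (Co.mk (LeftSpan.mk X.as))
  map {X Y} p := polySpan (X := X.as) (Y := Y.as) p
  map₂ {X Y p q} c := Quotient.mk _ (polyDiagram (X := X.as) (Y := Y.as) (Poly.Cell.normal c))
  unit {X Y} p := Ply.isoOfCell (X := X) (Y := Y) (p := toPoly (polySpan (X := X.as) (Y := Y.as) p))
    (q := p) (nu p) (Poly.NormalCell.exists_ofIso_inv _ _ _ _ _)
  map₂_unit {X Y p q} c := by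
    obtain ⟨c, rfl⟩ := Ply.exists_cell c
    refine (Ply.comp_cell (X := X) (Y := Y) (p := toPoly (polySpan (X := X.as) (Y := Y.as) p))
      _ _).trans (Eq.trans (congrArg Ply.cell ?_) (Ply.comp_cell _ _).symm)
    refine Eq.trans ?_ (phi_polyDiagram c)
    exact congrArg (fun d => (phi (polyDiagram d)).vcomp (nu _)) (Poly.NormalCell.normal_toCell c)

/-- The comparison pseudofunctor. -/
noncomputable def comparisonFunctor : Pseudofunctor (Ply L R)ᵒᵖ (Spn (lowerStar L R)) where
  toPrelaxFunctorStruct := comparison L R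
  map₂_id {X Y} p := (polySec L R).map₂_id (X := Y.unop) (Y := X.unop) p.unop
  map₂_comp {X Y _ _ _} c d :=
    (polySec L R).map₂_comp (X := Y.unop) (Y := X.unop) c.unop2 d.unop2
  mapId X := (polySec L R).mapId X.unop
  mapComp {X Y Z} p q :=
    (polySec L R).mapComp (X := Z.unop) (Y := Y.unop) (Z := X.unop) q.unop p.unop
  map₂_whisker_left {X Y Z} p _ _ c := (polySec L R).map₂_whiskerRight (X := Z.unop) (Y := Y.unop)
    (Z := X.unop) c.unop2 p.unop
  map₂_whisker_right {X Y Z _ _} c p := (polySec L R).map₂_whiskerLeft (X := Z.unop) (Y := Y.unop)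
    (Z := X.unop) p.unop c.unop2
  map₂_associator {X Y Z W} p q s := (polySec L R).map₂_associator_inv (W := W.unop) (X := Z.unop)
    (Y := Y.unop) (Z := X.unop) s.unop q.unop p.unop
  map₂_left_unitor {X Y} p :=
    (polySec L R).map₂_rightUnitor_hom (X := Y.unop) (Y := X.unop) p.unop
  map₂_right_unitor {X Y} p :=
    (polySec L R).map₂_leftUnitor_hom (X := Y.unop) (Y := X.unop) p.unop

/-- The section is bijective on 2-cells because `transport` is, and an `R_*`-span is isomorphic to
the span of its own polynomial. -/
instance (X Y : (Ply L R)ᵒᵖ) : ((comparisonFunctor (L := L) (R := R)).mapFunctor X Y).IsEquivalence where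
  faithful := ⟨fun h => by
    have h' := (polySec L R).map₂_injective (X := Y.unop) (Y := X.unop) h
    exact congrArg Bicategory.Opposite.op2 h'⟩
  full := ⟨fun {p q} a => by
    obtain ⟨c, hc⟩ := (polySec L R).map₂_surjective (X := Y.unop) (Y := X.unop)
      (f := p.unop) (g := q.unop) a
    exact ⟨Bicategory.Opposite.op2 c, hc⟩⟩
  essSurj := ⟨fun S => ⟨Quiver.Hom.op (show Y.unop ⟶ X.unop from ply S),
    ⟨(polySec L R).mapMapIso (X := Y.unop) (Y := X.unop) S⟩⟩⟩

end LSpn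

end SpanPoly

theorem theorem5p1 {E : Type u} [Category.{v} E] [HasPullbacks E] (L R : MorphismProperty E)
    [SpanPoly.IsProtocalibration L] [SpanPoly.IsProtocalibration R] [SpanPoly.IsCompatible L R] :
    ∃ (_ : SpanPoly.IsBiProtocalibration (SpanPoly.lowerStar L R))
      (_ : SpanPoly.BicategoryStruct.IsLawful (SpanPoly.Ply L R))
      (_ : SpanPoly.BicategoryStruct.IsLawful (SpanPoly.Spn (SpanPoly.lowerStar L R)))
      (F : Pseudofunctor (SpanPoly.Ply L R)ᵒᵖ (SpanPoly.Spn (SpanPoly.lowerStar L R))),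
      F.toPrelaxFunctorStruct = SpanPoly.comparison L R ∧
        ∀ X Y, (F.mapFunctor X Y).IsEquivalence :=
  ⟨SpanPoly.LSpn.isBiProtocalibration_lowerStar, inferInstance, inferInstance,
    -- The pseudofunctor is built on `comparison` itself, so the required equality is definitional.
    SpanPoly.LSpn.comparisonFunctor, rfl, inferInstance⟩
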